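/- **Setting.** Let $\Omega=\mathrm{BUC}(\mathbb R)$ carry the $\sigma$-algebra generated by the evaluations $V\mapsto V(x)$, let $(T_zV)(x)=V(x+z)$, and let $\mathbb P$ be a probability measure on $\Omega$ such that, for some $\bar m>0$, almost surely $\operatorname{ess\,sup}V=0$ and $\operatorname{ess\,sup}(-V)=\bar m$; $\mathbb P[T_yE]=\mathbb P[E]$ for all measurable $E$ and all $y$; and $\mathbb P[\bigcap_zT_zE]\in\{0,1\}$ for all measurable $E$. Assume that almost surely $V\in C^\infty(\mathbb R)$ and no level set of $V$ has a cluster point. Let $H:\mathbb R\to[0,\infty)$ be Lipschitz, with $\min H=H(0)=0$ and $H(p)\to\infty$ as $|p|\to\infty$. Assume that $H$ is strictly decreasing on $(-\infty,0]$ (no bumps on the negative side), and that there are $L\ge0$ and $p_1>p_2>\dots>p_{2L}>p_{2L+1}=0$ such that $H$ is strictly increasing on $[p_1,\infty)$ and on each $[p_{2k+1},p_{2k}]$, strictly decreasing on each $[p_{2k},p_{2k-1}]$ ($1\le k\le L$), and $H(p_1),\dots,H(p_{2L})$ are distinct and positive. Put $m_i=H(p_{2i-1})$, $M_i=H(p_{2i})$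 for $1\le i\le L$. Differential equations are understood in the viscosity sense. $(H,V)$ is *regularly homogenizable* with effective Hamiltonian $\overline H$ if for every $p\in\mathbb R$ and every $R>0$, almost surely $\max_{|y|\le R/\lambda}|\lambda v_\lambda(y,p)+\overline H(p)|\to0$ as $\lambda\to0^+$, where $v_\lambda(\cdot,p)$ is the unique bounded continuous solution of $\lambda v+H(p+v')+V=0$ on $\mathbb R$. **Theorem.** Suppose $\bar m\ge M_i-m_j$ for all $1\le i,j\le L$. Then $(H,V)$ is regularly homogenizable, and $\overline H:\mathbb R\to[0,\infty)$ is quasiconvex; it is nondecreasing on $[0,\infty)$ and nonincreasing on $(-\infty,0]$. If moreover $\bar m> M_i-m_j$ for all $1\le i,j\le L$, then the level sets (in particular the flat pieces) of $\overline H$ are given as follows. Let $\psi_1$ be the inverse of $H|_{[p_1,\infty)}$, $\psi_j$ the inverse of $H|_{[p_j,p_{j-1}]}$ ($2\le j\le 2L+1$), and $\Psi$ the inverse of $H|_{(-\infty,0]}$. For $\mu\ge0$ let $\mathcal A(H,V,\mu)$ be the set of $f\in L^\infty(\mathbb R)$ such that every Lipschitz $u$ with $u'=f$ solves $H(u')+V=\mu$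 on $\mathbb R$. Let $\mathcal P=\{\mu\ge0:\ \min_im_i-\bar m<\mu<\max_iM_i\}$ (empty if $L=0$). For $\mu\in\mathcal P$, call $f\in\mathcal A(H,V,\mu)$ *admissible* if $0\le f\le\max\{q\ge0:H(q)\le\mu+\bar m\}$ and, on each interval $I_i=(a_i,a_{i+1})$, $i\in\mathbb Z$, of the decomposition of $\mathbb R$ by the points $a$ with $\mu-V(a)\in\{m_j,M_j\}_j$ (where $a_i\to\pm\infty$ as $i\to\pm\infty$), one has $f=\psi_j(\mu-V)$ for some $j=j_i$; let $\underline f_\mu$ and $\overline f_\mu$ be the pointwise infimum and supremum of all admissible $f$. For $\mu\notin\mathcal P$ let $\underline f_\mu=\overline f_\mu$ be $\psi_{2L+1}(\mu-V)$ if $\mu\le m_i-\bar m$ for all $i$, and $\psi_1(\mu-V)$ otherwise. Then: 1. for every $\mu\ge0$, $\underline f_\mu$ and $\overline f_\mu$ are stationary, with integrable value at $0$, and almost surely belong to $\mathcal A(H,V,\mu)$ and, if $\mu\in\mathcal P$, are admissible; 2. with $q_0=\mathbb E[\underline f_0(0)]$: for $p\ge q_0$ and $\mu\ge0$, $\overline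 H(p)=\mu$ if and only if $\mathbb E[\underline f_\mu(0)]\le p\le\mathbb E[\overline f_\mu(0)]$; and for each $p\ge q_0$ there is a jointly measurable stationary $f$, with integrable value at $0$, that almost surely belongs to $\mathcal A(H,V,\overline H(p))$ and satisfies $\mathbb E[f(0)]=p$; 3. with $q_{-1}=\mathbb E[\Psi(-V(0))]$: $\overline H=0$ on $[q_{-1},q_0]$; 4. for every $\mu\ge0$, $\Psi(\mu-V(0))$ is integrable and almost surely $\Psi(\mu-V)\in\mathcal A(H,V,\mu)$; and for $p\le q_{-1}$ and $\mu\ge0$, $\overline H(p)=\mu$ if and only if $p=\mathbb E[\Psi(\mu-V(0))]$. -/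

import Mathlib

open Set Filter Topology MeasureTheory

noncomputable section

/-! ### The space of potentials and the law of the random potential -/

/-- Bounded uniformly continuous functions on the line. As a subtype of `ℝ → ℝ` it carries the
sigma-algebra generated by the evaluations `V ↦ V x`. -/
abbrev BUC : Type :=
  {V : ℝ → ℝ // UniformContinuous V ∧ ∃ C : ℝ, ∀ x, |V x| ≤ C}

/-- The translation `(T_z V)(x) = V (x + z)`. -/
def BUC.translate (z : ℝ) (V : BUC) : BUC :=
  ⟨fun x => V.1 (x + z),
    V.2.1.comp (uniformContinuous_id.add uniformContinuous_const),
    V.2.2.imp fun _ hC x => hC (x + z)⟩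

/-- The normalised, stationary and ergodic laws of potentials, with oscillation `mbar > 0`. -/
structure IsPotentialLaw (P : Measure BUC) (mbar : ℝ) : Prop where
  mbar_pos : 0 < mbar
  esssup_eq : ∀ᵐ V ∂P, essSup (fun x => V.1 x) volume = 0
  esssup_neg_eq : ∀ᵐ V ∂P, essSup (fun x => -V.1 x) volume = mbar
  stationary : ∀ E : Set BUC, MeasurableSet E → ∀ y : ℝ, P (BUC.translate y '' E) = P E
  ergodic : ∀ E : Set BUC, MeasurableSet E →
    P (⋂ z : ℝ, BUC.translate z '' E) = 0 ∨ P (⋂ z : ℝ, BUC.translate z '' E) = 1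

/-- A potential that is smooth and has no level set with a cluster point. -/
def HasDiscreteLevels (V : ℝ → ℝ) : Prop :=
  ContDiff ℝ (⊤ : ℕ∞) V ∧ ∀ c y : ℝ, ¬ AccPt y (𝓟 {x | V x = c})

/-! ### Viscosity solutions on the line -/

/-- `u` is a viscosity subsolution of `F (y, u, u') = 0`. -/
def IsViscositySubsolution (F : ℝ → ℝ → ℝ → ℝ) (u : ℝ → ℝ) : Prop :=
  ∀ φ : ℝ → ℝ, ContDiff ℝ 1 φ → ∀ y : ℝ, IsLocalMax (fun x => u x - φ x) y →
    F y (u y) (deriv φ y) ≤ 0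

/-- `u` is a viscosity supersolution of `F (y, u, u') = 0`. -/
def IsViscositySupersolution (F : ℝ → ℝ → ℝ → ℝ) (u : ℝ → ℝ) : Prop :=
  ∀ φ : ℝ → ℝ, ContDiff ℝ 1 φ → ∀ y : ℝ, IsLocalMin (fun x => u x - φ x) y →
    0 ≤ F y (u y) (deriv φ y)

/-- `u` is a continuous viscosity solution of `F (y, u, u') = 0`. -/
def IsViscositySolution (F : ℝ → ℝ → ℝ → ℝ) (u : ℝ → ℝ) : Prop :=
  Continuous u ∧ IsViscositySubsolution F u ∧ IsViscositySupersolution F u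

/-! ### Regular homogenization -/

/-- `v` is a bounded continuous viscosity solution of `lam v + H (q + v') + V = 0`. -/
def IsCellSolution (H V : ℝ → ℝ) (q lam : ℝ) (v : ℝ → ℝ) : Prop :=
  (∃ C : ℝ, ∀ y, |v y| ≤ C) ∧
    IsViscositySolution (fun y r s => lam * r + H (q + s) + V y) v

/-- `(H, V)` is regularly homogenizable at `q` with effective value `h`: the discounted cell
problems have a unique bounded solution `v_lam`, and for each `R > 0`, almost surely,
`max_{|y| ≤ R / lam} |lam v_lam (y) + h|` tends to zero as `lam → 0`. -/
structure IsRegularlyHomogenizableAt (P : Measure BUC) (mbar : ℝ) (H : ℝ → ℝ) (q h : ℝ) :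
    Prop where
  law : IsPotentialLaw P mbar
  continuous : Continuous H
  coercive : Tendsto H (cocompact ℝ) atTop
  wellposed : ∀ V : BUC, ∀ lam : ℝ, 0 < lam → ∃! v : ℝ → ℝ, IsCellSolution H V.1 q lam v
  limit : ∀ R : ℝ, 0 < R → ∀ᵐ V ∂P, ∀ ε : ℝ, 0 < ε → ∀ᶠ lam in 𝓝[>] (0 : ℝ),
    ∀ v : ℝ → ℝ, IsCellSolution H V.1 q lam v →
      ∀ y : ℝ, |y| ≤ R / lam → |lam * v y + h| ≤ ε

/-! ### The Hamiltonian -/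

/-- `H` is nonnegative, Lipschitz and coercive, with minimum value `H 0 = 0`. -/
structure IsNormalizedHamiltonian (H : ℝ → ℝ) : Prop where
  lipschitz : ∃ K, LipschitzWith K H
  nonneg : ∀ q, 0 ≤ H q
  zero : H 0 = 0
  coercive : Tendsto H (cocompact ℝ) atTop

/-- On `[0, ∞)` the Hamiltonian has exactly the `L` bumps delimited by
`p 1 > p 2 > ... > p (2 L + 1) = 0` (other values of `p` play no role): local minima at the odd
indices, local maxima at the even ones, with distinct positive values at `p 1, ..., p (2 L)`. -/
structure HasBumps (H : ℝ → ℝ) (L : ℕ) (p : ℕ → ℝ) : Prop where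
  decreasing : ∀ i, 1 ≤ i → i ≤ 2 * L → p (i + 1) < p i
  last : p (2 * L + 1) = 0
  mono_outer : StrictMonoOn H (Ici (p 1))
  mono_inner : ∀ k, 1 ≤ k → k ≤ L → StrictMonoOn H (Icc (p (2 * k + 1)) (p (2 * k)))
  anti_inner : ∀ k, 1 ≤ k → k ≤ L → StrictAntiOn H (Icc (p (2 * k)) (p (2 * k - 1)))
  values_pos : ∀ i, 1 ≤ i → i ≤ 2 * L → 0 < H (p i)
  values_distinct : InjOn (fun i => H (p i)) (Icc 1 (2 * L))

/-- The local minimum value `m_i = H (p_{2 i - 1})`. -/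
def minValue (H : ℝ → ℝ) (p : ℕ → ℝ) (i : ℕ) : ℝ := H (p (2 * i - 1))

/-- The local maximum value `M_i = H (p_{2 i})`. -/
def maxValue (H : ℝ → ℝ) (p : ℕ → ℝ) (i : ℕ) : ℝ := H (p (2 * i))

/-- The monotone branches on `[0, ∞)`: `[p_1, ∞)` for `j = 1` and `[p_j, p_{j - 1}]` for `j ≥ 2`. -/
def branch (p : ℕ → ℝ) (j : ℕ) : Set ℝ :=
  if j = 1 then Ici (p 1) else Icc (p j) (p (j - 1))

/-- The inverse `ψ_j` of `H` restricted to the `j`-th branch (meaningful on `H '' branch p j`). -/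
def branchInv (H : ℝ → ℝ) (p : ℕ → ℝ) (j : ℕ) (s : ℝ) : ℝ :=
  Function.invFunOn H (branch p j) s

/-- The inverse `Ψ` of `H` restricted to `(-∞, 0]` (meaningful on `[0, ∞)`). -/
def leftInv (H : ℝ → ℝ) (s : ℝ) : ℝ := Function.invFunOn H (Iic 0) s

/-! ### Admissible derivatives -/

/-- `f` belongs to `𝒜(H, V, μ)`: it is essentially bounded and every Lipschitz `u` with `u' = f`
solves `H (u') + V = μ` on the line in the viscosity sense. -/
def IsSolutionDerivative (H V : ℝ → ℝ) (μ : ℝ) (f : ℝ → ℝ) : Prop :=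
  MemLp f ⊤ volume ∧
    ∀ u : ℝ → ℝ, (∃ K, LipschitzWith K u) → (∀ᵐ y, HasDerivAt u (f y) y) →
      IsViscositySolution (fun y _ s => H s + V y - μ) u

/-- The set `{m_j, M_j : 1 ≤ j ≤ L}` of critical values. -/
def criticalValues (H : ℝ → ℝ) (p : ℕ → ℝ) (L : ℕ) : Set ℝ :=
  {c | ∃ j, 1 ≤ j ∧ j ≤ L ∧ (c = minValue H p j ∨ c = maxValue H p j)}

/-- The set `𝒫` of the levels `μ ≥ 0` with `min_i m_i - mbar < μ < max_i M_i` (empty if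
`L = 0`). -/
def bumpLevels (H : ℝ → ℝ) (p : ℕ → ℝ) (L : ℕ) (mbar : ℝ) : Set ℝ :=
  {μ | 0 ≤ μ ∧ (∃ i, 1 ≤ i ∧ i ≤ L ∧ minValue H p i - mbar < μ) ∧
    ∃ i, 1 ≤ i ∧ i ≤ L ∧ μ < maxValue H p i}

/-- The intervals `(a_i, a_{i + 1})`, `i ∈ ℤ`, are a `(V, μ)`-admissible decomposition. -/
structure IsAdmissibleDecomposition (H : ℝ → ℝ) (p : ℕ → ℝ) (L : ℕ) (V : ℝ → ℝ) (μ : ℝ)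
    (a : ℤ → ℝ) : Prop where
  strictMono : StrictMono a
  tendsto_top : Tendsto a atTop atTop
  tendsto_bot : Tendsto a atBot atBot
  endpoint : ∀ i, μ - V (a i) ∈ criticalValues H p L
  interior : ∀ i, ∀ y ∈ Ioo (a i) (a (i + 1)), μ - V y ∉ criticalValues H p L

/-- `f` is `(I_i, V, μ)`-admissible, where `I_i` is the `(V, μ)`-admissible decomposition (which
is unique up to a shift of the index). -/
def IsAdmissible (H : ℝ → ℝ) (p : ℕ → ℝ) (L : ℕ) (mbar : ℝ) (V : ℝ → ℝ) (μ : ℝ)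
    (f : ℝ → ℝ) : Prop :=
  IsSolutionDerivative H V μ f ∧
    (∀ y, 0 ≤ f y ∧ f y ≤ sSup {q | 0 ≤ q ∧ H q ≤ μ + mbar}) ∧
    ∃ a : ℤ → ℝ, IsAdmissibleDecomposition H p L V μ a ∧
      ∀ i, ∃ j, 1 ≤ j ∧ j ≤ 2 * L + 1 ∧ ∀ y ∈ Ioo (a i) (a (i + 1)),
        μ - V y ∈ H '' branch p j ∧ f y = branchInv H p j (μ - V y)

open Classical in
/-- The derivative `f_μ` for `μ ∉ 𝒫`: `ψ_{2 L + 1} (μ - V)` below `𝒫` and `ψ_1 (μ - V)` above. -/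
def outerDerivative (H : ℝ → ℝ) (p : ℕ → ℝ) (L : ℕ) (mbar μ : ℝ) (V : ℝ → ℝ) (y : ℝ) : ℝ :=
  if ∀ i, 1 ≤ i → i ≤ L → μ ≤ minValue H p i - mbar then
    branchInv H p (2 * L + 1) (μ - V y)
  else branchInv H p 1 (μ - V y)

open Classical in
/-- The greatest admissible derivative at level `μ`. -/
def upperDerivative (H : ℝ → ℝ) (p : ℕ → ℝ) (L : ℕ) (mbar μ : ℝ) (V : BUC) (y : ℝ) : ℝ :=
  if μ ∈ bumpLevels H p L mbar then
    sSup {t | ∃ f, IsAdmissible H p L mbar V.1 μ f ∧ t = f y}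
  else outerDerivative H p L mbar μ V.1 y

open Classical in
/-- The least admissible derivative at level `μ`. -/
def lowerDerivative (H : ℝ → ℝ) (p : ℕ → ℝ) (L : ℕ) (mbar μ : ℝ) (V : BUC) (y : ℝ) : ℝ :=
  if μ ∈ bumpLevels H p L mbar then
    sInf {t | ∃ f, IsAdmissible H p L mbar V.1 μ f ∧ t = f y}
  else outerDerivative H p L mbar μ V.1 y

/-- The random function `f` is stationary: `f (T_z V, y) = f (V, y + z)`. -/
def IsStationaryField (f : BUC → ℝ → ℝ) : Prop :=
  ∀ (z : ℝ) (V : BUC) (y : ℝ), f (BUC.translate z V) y = f V (y + z)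

/-- The almost sure property of a stationary random function of being, at level `μ`, an admissible
derivative: it lies in `𝒜(H, V, μ)` and, if `μ ∈ 𝒫`, is `(I_i, V, μ)`-admissible. The expectation
of its value at the origin is required to make sense. -/
def IsAdmissibleField (P : Measure BUC) (H : ℝ → ℝ) (p : ℕ → ℝ) (L : ℕ) (mbar μ : ℝ)
    (f : BUC → ℝ → ℝ) : Prop :=
  IsStationaryField f ∧ Integrable (fun V => f V 0) P ∧
    (∀ᵐ V ∂P, IsSolutionDerivative H V.1 μ (f V)) ∧
    (μ ∈ bumpLevels H p L mbar → ∀ᵐ V ∂P, IsAdmissible H p L mbar V.1 μ (f V))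

end

noncomputable section

/-! ### Pointwise viscosity inequalities -/

/-! In dimension one a corrector is the primitive of a stationary slope field. If almost surely `H
(w') + V = μ` has a subsolution and a supersolution that both grow like `q y` up to a sublinear
error, then subtracting `q y` and a small multiple of `√(1 + y²)` and comparing with the discounted
solution gives `lam * v → -μ` on `|y| ≤ R / lam` (`cell_lower_bound`, `cell_upper_bound`). The
effective value is unique, so a covering of the slope axis by correctors is at the same time a
description of the level sets.

For slopes to the right, the strict oscillation condition enters through one fact
(`exists_isRegularValue_Ioo`): the range of `μ - V` contains a level at which `H` has a single
nonnegative root. By ergodicity `V` returns to the corresponding value arbitrarily far in both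
directions, and near each such visit every nondecreasing solution has the same forced slope. This
yields comparison (`IsMonoSol.antitone_sub`): for ordered right-hand sides, doubling of variables
excludes local maxima of the difference of two nondecreasing solutions wherever the order is strict,
the remaining points are regular, and the difference decreases at recurrent points; hence it is
nonincreasing.

Solutions that follow one inverse branch of `H` between critical points are built from right to left
(`IsBumpRhs.exists_admDeriv`), and their pointwise supremum and infimum are again of this kind.
Comparing an arbitrary nondecreasing solution for `s = μ - V` with branchwise solutions for `t * s`
and letting `t → 1` shows that this supremum and infimum are extremal among all nondecreasing
solutions (`Oscillates.exists_admDeriv_comparison`). Extremality makes them measurable functionals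
of `V`, orders them across levels, and makes their means semicontinuous in `μ`; therefore the
intervals between the lower and the upper mean cover all slopes from `q₀` on
(`IsStrictSetting.exists_level_right`).

A slope strictly inside such an interval is reached by mixing: follow one extremal derivative for a
time `τ` after each visit of `V` to the regular level and the other one afterwards. The mean depends
continuously on `τ`. With the greatest derivative first the mixture is a supersolution, with the
least one first a subsolution, because the switch back has the harmless direction and the two
derivatives agree near a visit. Perron's method below the supersolution mixture gives an exact
stationary solution of the same slope, since it touches the mixture at every visit
(`IsStrictSetting.exists_exact_field`).

At level zero a similar mixture of `Ψ (-V)` with the least derivative gives subsolutions for the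
slopes between their means, and zigzags of steep slope give supersolutions of every slope at levels
slightly below zero. To the left `Ψ (μ - V)` is an exact corrector whose mean is continuous in `μ`.
Under the non-strict oscillation condition, `t * H` with `t < 1` satisfies the strict one, and the
discounted solutions for `H` and `t * H` differ by `O (1 - t)` uniformly, so homogenization and
monotonicity pass to the limit. -/

/-- Every `C¹` function touching `u` from above at `y` has a slope `q` there with `H q ≤ c`. -/
def SubAt (H : ℝ → ℝ) (c : ℝ) (u : ℝ → ℝ) (y : ℝ) : Prop :=
  ∀ φ : ℝ → ℝ, ContDiff ℝ 1 φ → IsLocalMax (fun x => u x - φ x) y → H (deriv φ y) ≤ c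

/-- Every `C¹` function touching `u` from below at `y` has a slope `q` there with `c ≤ H q`. -/
def SuperAt (H : ℝ → ℝ) (c : ℝ) (u : ℝ → ℝ) (y : ℝ) : Prop :=
  ∀ φ : ℝ → ℝ, ContDiff ℝ 1 φ → IsLocalMin (fun x => u x - φ x) y → c ≤ H (deriv φ y)

/-- Passing to `-u` exchanges the two notions, so facts about supersolutions follow from those about
subsolutions of `q ↦ -H (-q)`. -/
lemma superAt_iff_subAt_neg {H : ℝ → ℝ} {c : ℝ} {u : ℝ → ℝ} {y : ℝ} :
    SuperAt H c u y ↔ SubAt (fun q => -H (-q)) (-c) (fun x => -u x) y := by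
  constructor
  · intro h φ hφ hmax
    have := h (fun x => -φ x) hφ.neg (by
      have := hmax.neg
      refine this.congr (Eventually.of_forall fun x => ?_)
      simp; ring)
    rw [deriv.fun_neg] at this
    simpa using this
  · intro h φ hφ hmin
    have := h (fun x => -φ x) hφ.neg (by
      have := hmin.neg
      refine this.congr (Eventually.of_forall fun x => ?_)
      simp; ring)
    rw [deriv.fun_neg] at this
    simpa using this

lemma SubAt.mono {H : ℝ → ℝ} {c c' : ℝ} {u : ℝ → ℝ} {y : ℝ} (h : SubAt H c u y) (hc : c ≤ c') :
    SubAt H c' u y := fun φ hφ hm => (h φ hφ hm).trans hc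

lemma SuperAt.mono {H : ℝ → ℝ} {c c' : ℝ} {u : ℝ → ℝ} {y : ℝ} (h : SuperAt H c u y)
    (hc : c' ≤ c) : SuperAt H c' u y := fun φ hφ hm => hc.trans (h φ hφ hm)

lemma SubAt.imp {H H' : ℝ → ℝ} {c c' : ℝ} {u : ℝ → ℝ} {y : ℝ} (h : SubAt H c u y)
    (hc : ∀ q, H q ≤ c → H' q ≤ c') : SubAt H' c' u y := fun φ hφ hm => hc _ (h φ hφ hm)

lemma SuperAt.imp {H H' : ℝ → ℝ} {c c' : ℝ} {u : ℝ → ℝ} {y : ℝ} (h : SuperAt H c u y)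
    (hc : ∀ q, c ≤ H q → c' ≤ H' q) : SuperAt H' c' u y := fun φ hφ hm => hc _ (h φ hφ hm)

lemma SubAt.congr {H : ℝ → ℝ} {c k : ℝ} {u w : ℝ → ℝ} {y : ℝ} (h : SubAt H c w y)
    (hu : ∀ᶠ x in 𝓝 y, u x = w x + k) : SubAt H c u y := by
  intro φ hφ hm
  refine h φ hφ ?_
  have hy := hu.self_of_nhds
  filter_upwards [hm, hu] with x hx hux
  simp only [hux, hy] at hx
  linarith

lemma SuperAt.congr {H : ℝ → ℝ} {c k : ℝ} {u w : ℝ → ℝ} {y : ℝ} (h : SuperAt H c w y)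
    (hu : ∀ᶠ x in 𝓝 y, u x = w x + k) : SuperAt H c u y := by
  intro φ hφ hm
  refine h φ hφ ?_
  have hy := hu.self_of_nhds
  filter_upwards [hm, hu] with x hx hux
  simp only [hux, hy] at hx
  linarith

lemma SubAt.comp_add {H : ℝ → ℝ} {c z : ℝ} {u : ℝ → ℝ} {y : ℝ} (h : SubAt H c u (y + z)) :
    SubAt H c (fun x => u (x + z)) y := by
  intro φ hφ hm
  have := h (fun x => φ (x - z)) (hφ.comp (contDiff_id.sub contDiff_const)) (by
    have ht : Tendsto (fun x => x - z) (𝓝 (y + z)) (𝓝 y) := by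
      have : ContinuousAt (fun x : ℝ => x - z) (y + z) := by fun_prop
      simpa [ContinuousAt] using this
    filter_upwards [ht.eventually hm] with x hx
    simpa using hx)
  rw [deriv_comp_sub_const] at this
  simpa using this

lemma SuperAt.comp_add {H : ℝ → ℝ} {c z : ℝ} {u : ℝ → ℝ} {y : ℝ} (h : SuperAt H c u (y + z)) :
    SuperAt H c (fun x => u (x + z)) y := by
  rw [superAt_iff_subAt_neg] at h ⊢
  exact h.comp_add

lemma SubAt.add_smooth {H : ℝ → ℝ} {c : ℝ} {u ψ : ℝ → ℝ} {y : ℝ} (h : SubAt H c u y)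
    (hψ : ContDiff ℝ 1 ψ) : SubAt (fun q => H (q - deriv ψ y)) c (fun x => u x + ψ x) y := by
  intro φ hφ hm
  have := h (fun x => φ x - ψ x) (hφ.sub hψ)
    (hm.congr (Eventually.of_forall fun x => by ring))
  rwa [deriv_fun_sub (hφ.differentiable (by simp) _) (hψ.differentiable (by simp) _)] at this

lemma SuperAt.add_smooth {H : ℝ → ℝ} {c : ℝ} {u ψ : ℝ → ℝ} {y : ℝ} (h : SuperAt H c u y)
    (hψ : ContDiff ℝ 1 ψ) : SuperAt (fun q => H (q - deriv ψ y)) c (fun x => u x + ψ x) y := by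
  intro φ hφ hm
  have := h (fun x => φ x - ψ x) (hφ.sub hψ)
    (hm.congr (Eventually.of_forall fun x => by ring))
  rwa [deriv_fun_sub (hφ.differentiable (by simp) _) (hψ.differentiable (by simp) _)] at this

lemma subAt_of_differentiableAt {H : ℝ → ℝ} {c : ℝ} {u : ℝ → ℝ} {y : ℝ}
    (hu : DifferentiableAt ℝ u y) (h : H (deriv u y) ≤ c) : SubAt H c u y := by
  intro φ hφ hm
  have hd := hφ.differentiable (by simp) y
  have := hm.deriv_eq_zero
  rw [deriv_fun_sub hu hd] at this
  rwa [← sub_eq_zero.1 this]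

lemma superAt_of_differentiableAt {H : ℝ → ℝ} {c : ℝ} {u : ℝ → ℝ} {y : ℝ}
    (hu : DifferentiableAt ℝ u y) (h : c ≤ H (deriv u y)) : SuperAt H c u y := by
  intro φ hφ hm
  have hd := hφ.differentiable (by simp) y
  have := hm.deriv_eq_zero
  rw [deriv_fun_sub hu hd] at this
  rwa [← sub_eq_zero.1 this]

lemma isViscositySolution_iff {H V : ℝ → ℝ} {μ : ℝ} {u : ℝ → ℝ} :
    IsViscositySolution (fun y _ r => H r + V y - μ) u ↔
      Continuous u ∧ (∀ y, SubAt H (μ - V y) u y) ∧ ∀ y, SuperAt H (μ - V y) u y := by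
  unfold IsViscositySolution IsViscositySubsolution IsViscositySupersolution SubAt SuperAt
  refine and_congr_right fun _ => and_congr ⟨fun h y φ hφ hm => ?_, fun h φ hφ y hm => ?_⟩
    ⟨fun h y φ hφ hm => ?_, fun h φ hφ y hm => ?_⟩
  · linarith [h φ hφ y hm]
  · linarith [h y φ hφ hm]
  · linarith [h φ hφ y hm]
  · linarith [h y φ hφ hm]

lemma isCellSolution_iff {H V : ℝ → ℝ} {q lam : ℝ} {v : ℝ → ℝ} :
    IsCellSolution H V q lam v ↔ (∃ C : ℝ, ∀ y, |v y| ≤ C) ∧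
      Continuous v ∧ (∀ y, SubAt (fun r => H (q + r)) (-V y - lam * v y) v y) ∧
        ∀ y, SuperAt (fun r => H (q + r)) (-V y - lam * v y) v y := by
  unfold IsCellSolution IsViscositySolution IsViscositySubsolution IsViscositySupersolution
    SubAt SuperAt
  refine and_congr_right fun _ => and_congr_right fun _ =>
    and_congr ⟨fun h y φ hφ hm => ?_, fun h φ hφ y hm => ?_⟩
    ⟨fun h y φ hφ hm => ?_, fun h φ hφ y hm => ?_⟩
  · linarith [h φ hφ y hm]
  · linarith [h y φ hφ hm]
  · linarith [h φ hφ y hm]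
  · linarith [h y φ hφ hm]

/-! ### The doubling lemma -/

/-- Where a subsolution of `H (u') = s₁` minus a supersolution of `H (u') = s₂` has a local
maximum, `s₂ ≤ s₁`. -/
theorem le_of_isLocalMax_sub {H : ℝ → ℝ} {K : NNReal} (hH : LipschitzWith K H)
    {u₁ u₂ s₁ s₂ : ℝ → ℝ} (c₁ : Continuous u₁) (c₂ : Continuous u₂) (hs₁ : Continuous s₁)
    (hs₂ : Continuous s₂) {y₀ : ℝ} (h₁ : ∀ᶠ y in 𝓝 y₀, SubAt H (s₁ y) u₁ y)
    (h₂ : ∀ᶠ y in 𝓝 y₀, SuperAt H (s₂ y) u₂ y)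
    (hmax : IsLocalMax (fun x => u₁ x - u₂ x) y₀) : s₂ y₀ ≤ s₁ y₀ := by
  by_contra! hlt
  -- A quarter of the gap: one `η` each is lost to the oscillation of `s₁`, to that of `s₂` and to
  -- the Lipschitz error of `H`, which still leaves a contradiction.
  obtain ⟨η, hη, hη2⟩ : ∃ η : ℝ, 0 < η ∧ s₂ y₀ - s₁ y₀ = 4 * η :=
    ⟨(s₂ y₀ - s₁ y₀) / 4, by linarith, by ring⟩
  have e₁ : ∀ᶠ x in 𝓝 y₀, s₁ x < s₁ y₀ + η :=
    hs₁.continuousAt.eventually_lt continuousAt_const (by linarith)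
  have e₂ : ∀ᶠ x in 𝓝 y₀, s₂ y₀ - η < s₂ x :=
    continuousAt_const.eventually_lt hs₂.continuousAt (by linarith)
  obtain ⟨R, hR, hball⟩ := Metric.eventually_nhds_iff.1 (((e₁.and e₂).and hmax).and (h₁.and h₂))
  obtain ⟨r, hr, hrR, hrK⟩ : ∃ r : ℝ, 0 < r ∧ r < R ∧ K * (2 * r) ≤ η := by
    refine ⟨min (R / 2) (η / (2 * (K + 1))), by positivity,
      (min_le_left _ _).trans_lt (by linarith), ?_⟩
    have hK : (0 : ℝ) ≤ K := K.2
    calc (K : ℝ) * (2 * min (R / 2) (η / (2 * (K + 1))))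
        ≤ K * (2 * (η / (2 * (K + 1)))) := by gcongr; exact min_le_right _ _
      _ = K / (K + 1) * η := by field_simp
      _ ≤ 1 * η := by
          gcongr
          rw [div_le_one (by positivity)]; linarith
      _ = η := one_mul _
  have hin : ∀ x ∈ Icc (y₀ - r) (y₀ + r), dist x y₀ < R := fun x hx => by
    rw [Real.dist_eq, abs_lt]; constructor <;> linarith [hx.1, hx.2]
  have hcpt : IsCompact (Icc (y₀ - r) (y₀ + r)) := isCompact_Icc
  obtain ⟨δ, hδ, hδu⟩ := Metric.uniformContinuousOn_iff.1
    (hcpt.uniformContinuousOn_of_continuous c₂.continuousOn) (r ^ 2 / 4) (by positivity)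
  have hy₀ : y₀ ∈ Icc (y₀ - r) (y₀ + r) := ⟨by linarith, by linarith⟩
  obtain ⟨C₁, hC₁⟩ := hcpt.exists_bound_of_continuousOn c₁.continuousOn
  obtain ⟨C₂, hC₂⟩ := hcpt.exists_bound_of_continuousOn c₂.continuousOn
  obtain ⟨δ', hδ', hδδ, hδr⟩ : ∃ δ' : ℝ, 0 < δ' ∧ δ' ≤ δ ∧ δ' ≤ r / 2 :=
    ⟨min δ (r / 2), by positivity, min_le_left _ _, min_le_right _ _⟩
  -- So strong a penalty forces `|a - b| < δ'` at a maximum point of the doubled function, hence `u₂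
  -- a` and `u₂ b` within `r² / 4` of each other.
  obtain ⟨N, hN, hN2⟩ : ∃ N : ℝ, 0 < N ∧ 2 * (C₁ + C₂) < N * δ' ^ 2 := by
    have hC1 := (norm_nonneg _).trans (hC₁ y₀ hy₀)
    have hC2 := (norm_nonneg _).trans (hC₂ y₀ hy₀)
    refine ⟨(2 * (C₁ + C₂) + 1) / δ' ^ 2, by positivity, ?_⟩
    rw [div_mul_cancel₀ _ (by positivity)]; linarith
  -- The term `(x - y₀)²` localises, because the given maximum need not be strict. It separates the
  -- two test slopes by at most `2 r`, which costs at most `η` by the choice of `r`.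
  obtain ⟨⟨a, b⟩, ⟨ha, hb⟩, hab⟩ := (hcpt.prod hcpt).exists_isMaxOn
    ⟨(y₀, y₀), hy₀, hy₀⟩ (f := fun z : ℝ × ℝ =>
      u₁ z.1 - u₂ z.2 - (N * (z.1 - z.2) ^ 2 + (z.1 - y₀) ^ 2)) (by fun_prop)
  simp only at ha hb
  have hmx : ∀ x ∈ Icc (y₀ - r) (y₀ + r), ∀ y ∈ Icc (y₀ - r) (y₀ + r),
      u₁ x - u₂ y - (N * (x - y) ^ 2 + (x - y₀) ^ 2)
        ≤ u₁ a - u₂ b - (N * (a - b) ^ 2 + (a - y₀) ^ 2) := fun x hx y hy =>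
    hab (mk_mem_prod hx hy : (x, y) ∈ Icc (y₀ - r) (y₀ + r) ×ˢ Icc (y₀ - r) (y₀ + r))
  have h00 := hmx y₀ hy₀ y₀ hy₀
  have habs : |a - b| < δ' := by
    have b1 := abs_le.1 (hC₁ a ha)
    have b2 := abs_le.1 (hC₂ b hb)
    have b3 := abs_le.1 (hC₁ y₀ hy₀)
    have b4 := abs_le.1 (hC₂ y₀ hy₀)
    have : N * (a - b) ^ 2 < N * δ' ^ 2 := by nlinarith [sq_nonneg (a - y₀)]
    exact abs_lt_of_sq_lt_sq (lt_of_mul_lt_mul_left this hN.le) hδ'.le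
  have hu2 : |u₂ a - u₂ b| < r ^ 2 / 4 := hδu a ha b hb (by rw [Real.dist_eq]; linarith)
  have hloc : u₁ a - u₂ a ≤ u₁ y₀ - u₂ y₀ := (hball (hin a ha)).1.2
  have hay : |a - y₀| < r / 2 := by
    have h1 := (abs_lt.1 hu2).2
    have : (a - y₀) ^ 2 < (r / 2) ^ 2 := by nlinarith [sq_nonneg (a - b)]
    exact abs_lt_of_sq_lt_sq this (by positivity)
  have ha' := abs_lt.1 hay
  have hb' := abs_lt.1 habs
  have na : Icc (y₀ - r) (y₀ + r) ∈ 𝓝 a := Icc_mem_nhds (by linarith) (by linarith)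
  have nb : Icc (y₀ - r) (y₀ + r) ∈ 𝓝 b := Icc_mem_nhds (by linarith) (by linarith)
  have t₁ := (hball (hin a ha)).2.1 (fun x => N * (x - b) ^ 2 + (x - y₀) ^ 2) (by fun_prop) (by
    filter_upwards [na] with x hx
    have := hmx x hx b hb
    linarith)
  have t₂ := (hball (hin b hb)).2.2 (fun y => -(N * (a - y) ^ 2)) (by fun_prop) (by
    filter_upwards [nb] with y hy
    have := hmx a ha y hy
    linarith)
  have d₁ : deriv (fun x => N * (x - b) ^ 2 + (x - y₀) ^ 2) a
      = 2 * N * (a - b) + 2 * (a - y₀) := by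
    have : HasDerivAt (fun x => N * (x - b) ^ 2 + (x - y₀) ^ 2)
        (N * (2 * (a - b) ^ 1 * 1) + 2 * (a - y₀) ^ 1 * 1) a :=
      ((((hasDerivAt_id a).sub_const b).pow 2).const_mul N).add
        (((hasDerivAt_id a).sub_const y₀).pow 2)
    rw [this.deriv]; ring
  have d₂ : deriv (fun y => -(N * (a - y) ^ 2)) b = 2 * N * (a - b) := by
    have : HasDerivAt (fun y => -(N * (a - y) ^ 2)) (-(N * (2 * (a - b) ^ 1 * (-1)))) b :=
      ((((hasDerivAt_id b).const_sub a).pow 2).const_mul N).neg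
    rw [this.deriv]; ring
  rw [d₁] at t₁
  rw [d₂] at t₂
  have hLip := hH.dist_le_mul (2 * N * (a - b)) (2 * N * (a - b) + 2 * (a - y₀))
  rw [Real.dist_eq, Real.dist_eq] at hLip
  have h3 : |2 * N * (a - b) - (2 * N * (a - b) + 2 * (a - y₀))| ≤ 2 * r := by
    rw [abs_le]; constructor <;> linarith
  have h4 := (abs_le.1 (hLip.trans ((mul_le_mul_of_nonneg_left h3 K.2).trans hrK))).2
  have h5 := (hball (hin a ha)).1.1.1
  have h6 := (hball (hin b hb)).1.1.2
  linarith

/-! ### Stability -/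

/-- The approximants need only stay below `u + δ` nearby and come close to `u` at the single point
`y`. This covers locally uniform limits as well as suprema of families. -/
theorem subAt_of_approx {H : ℝ → ℝ} (hH : Continuous H) {u : ℝ → ℝ} {c y : ℝ}
    (h : ∀ η > 0, ∃ r > 0, ∀ δ > 0, ∃ w : ℝ → ℝ, Continuous w ∧
      (∀ x ∈ Icc (y - r) (y + r), w x ≤ u x + δ) ∧ u y - δ ≤ w y ∧
      ∀ x ∈ Icc (y - r) (y + r), SubAt H (c + η) w x) : SubAt H c u y := by
  intro φ hφ hm
  by_contra! hlt
  obtain ⟨η, hη, hη2⟩ : ∃ η : ℝ, 0 < η ∧ H (deriv φ y) - c = 2 * η :=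
    ⟨(H (deriv φ y) - c) / 2, by linarith, by ring⟩
  obtain ⟨r₀, hr₀, hw⟩ := h η hη
  have hdφ : Continuous (deriv φ) := hφ.continuous_deriv le_rfl
  have e₁ : ∀ᶠ x in 𝓝 y, c + η < H (deriv φ x + 2 * (x - y)) := by
    refine continuousAt_const.eventually_lt (g := fun x => H (deriv φ x + 2 * (x - y)))
      (by fun_prop) ?_
    simp; linarith
  obtain ⟨R, hR, hball⟩ := Metric.eventually_nhds_iff.1 (e₁.and hm)
  obtain ⟨r, hr, hrR, hrr⟩ : ∃ r : ℝ, 0 < r ∧ r < R ∧ r ≤ r₀ :=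
    ⟨min (R / 2) r₀, by positivity, (min_le_left _ _).trans_lt (by linarith), min_le_right _ _⟩
  -- A maximum point `a` of `w - φ - (x - y)²` satisfies `(a - y)² ≤ 2 δ`; with `δ = r² / 4` it
  -- stays in the interior.
  obtain ⟨w, hwc, hwu, hwy, hws⟩ := hw (r ^ 2 / 4) (by positivity)
  have hin : ∀ x ∈ Icc (y - r) (y + r), dist x y < R := fun x hx => by
    rw [Real.dist_eq, abs_lt]; constructor <;> linarith [hx.1, hx.2]
  have hin' : ∀ x ∈ Icc (y - r) (y + r), x ∈ Icc (y - r₀) (y + r₀) := fun x hx =>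
    ⟨by linarith [hx.1], by linarith [hx.2]⟩
  have hφc := hφ.continuous
  have hy : y ∈ Icc (y - r) (y + r) := ⟨by linarith, by linarith⟩
  obtain ⟨a, ha, hmx⟩ := (isCompact_Icc (a := y - r) (b := y + r)).exists_isMaxOn ⟨y, hy⟩
    (f := fun x => w x - (φ x + (x - y) ^ 2)) (by fun_prop)
  have h1 : w y - (φ y + (y - y) ^ 2) ≤ w a - (φ a + (a - y) ^ 2) := hmx hy
  have h2 := hwu a (hin' a ha)
  have h3 : u a - φ a ≤ u y - φ y := (hball (hin a ha)).2
  have h4 : |a - y| < r := by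
    refine abs_lt_of_sq_lt_sq ?_ hr.le
    nlinarith
  have h5 := abs_lt.1 h4
  have na : Icc (y - r) (y + r) ∈ 𝓝 a := Icc_mem_nhds (by linarith) (by linarith)
  have t := hws a (hin' a ha) (fun x => φ x + (x - y) ^ 2) (by fun_prop)
    (by filter_upwards [na] with x hx using hmx hx)
  have d : deriv (fun x => φ x + (x - y) ^ 2) a = deriv φ a + 2 * (a - y) := by
    have : HasDerivAt (fun x => φ x + (x - y) ^ 2) (deriv φ a + 2 * (a - y) ^ 1 * 1) a :=
      (hφ.differentiable (by simp) a).hasDerivAt.add (((hasDerivAt_id a).sub_const y).pow 2)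
    rw [this.deriv]; ring
  rw [d] at t
  linarith [(hball (hin a ha)).1]

/-- Locally uniform limits of subsolutions are subsolutions. -/
theorem subAt_of_tendsto {ι : Type*} {l : Filter ι} [NeBot l] {H : ℝ → ℝ} (hH : Continuous H)
    {u : ℝ → ℝ} {s : ℝ → ℝ} {w : ι → ℝ → ℝ} {t : ι → ℝ → ℝ} (hs : Continuous s)
    (hw : ∀ i, Continuous (w i)) (hsub : ∀ i y, SubAt H (t i y) (w i) y)
    (hwu : ∀ a b : ℝ, ∀ ε > 0, ∀ᶠ i in l, ∀ x ∈ Icc a b, |w i x - u x| ≤ ε)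
    (hts : ∀ a b : ℝ, ∀ ε > 0, ∀ᶠ i in l, ∀ x ∈ Icc a b, |t i x - s x| ≤ ε) (y : ℝ) :
    SubAt H (s y) u y := by
  refine subAt_of_approx hH fun η hη => ?_
  have e₁ : ∀ᶠ x in 𝓝 y, s x < s y + η / 2 :=
    hs.continuousAt.eventually_lt continuousAt_const (by linarith)
  obtain ⟨R, hR, hball⟩ := Metric.eventually_nhds_iff.1 e₁
  refine ⟨R / 2, by positivity, fun δ hδ => ?_⟩
  obtain ⟨i, h1, h2⟩ := ((hwu (y - R / 2) (y + R / 2) δ hδ).and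
    (hts (y - R / 2) (y + R / 2) (η / 2) (by positivity))).exists
  refine ⟨w i, hw i, fun x hx => ?_, ?_, fun x hx => (hsub i x).mono ?_⟩
  · linarith [(abs_le.1 (h1 x hx)).2]
  · linarith [(abs_le.1 (h1 y ⟨by linarith, by linarith⟩)).1]
  · have := (abs_le.1 (h2 x hx)).2
    have := hball (y := x) (by rw [Real.dist_eq, abs_lt]; constructor <;> linarith [hx.1, hx.2])
    linarith

theorem superAt_of_tendsto {ι : Type*} {l : Filter ι} [NeBot l] {H : ℝ → ℝ} (hH : Continuous H)
    {u : ℝ → ℝ} {s : ℝ → ℝ} {w : ι → ℝ → ℝ} {t : ι → ℝ → ℝ} (hs : Continuous s)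
    (hw : ∀ i, Continuous (w i)) (hsup : ∀ i y, SuperAt H (t i y) (w i) y)
    (hwu : ∀ a b : ℝ, ∀ ε > 0, ∀ᶠ i in l, ∀ x ∈ Icc a b, |w i x - u x| ≤ ε)
    (hts : ∀ a b : ℝ, ∀ ε > 0, ∀ᶠ i in l, ∀ x ∈ Icc a b, |t i x - s x| ≤ ε) (y : ℝ) :
    SuperAt H (s y) u y := by
  rw [superAt_iff_subAt_neg]
  refine subAt_of_tendsto (l := l) (s := fun y => -s y) (t := fun i y => -t i y)
    (w := fun i y => -w i y) (by fun_prop) (by fun_prop) (fun i => (hw i).neg)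
    (fun i y => superAt_iff_subAt_neg.1 (hsup i y)) (fun a b ε hε => ?_) (fun a b ε hε => ?_) y
  · filter_upwards [hwu a b ε hε] with i hi x hx
    rw [← abs_neg]; convert hi x hx using 2; ring
  · filter_upwards [hts a b ε hε] with i hi x hx
    rw [← abs_neg]; convert hi x hx using 2; ring

/-! ### Lipschitz bounds -/

/-- Touch `u` from above by a line of slope `ρ' > ρ` plus `ε exp (N (z - b))`. For large `N` the
barrier exceeds `u` at `c`, so the touching point is interior and its test slope is larger than `ρ`.
The interval must continue beyond `b` to leave room for the exponential. -/
lemma sub_le_mul_of_subAt {u : ℝ → ℝ} {a b c ρ : ℝ} (hu : ContinuousOn u (Icc a c)) (hab : a < b)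
    (hbc : b < c) (h : ∀ y ∈ Ioo a c, SubAt (fun q => q) ρ u y) : u b - u a ≤ ρ * (b - a) := by
  by_contra! hlt
  obtain ⟨ρ', hρ', hlt'⟩ : ∃ ρ' > ρ, ρ' * (b - a) < u b - u a := by
    obtain ⟨ρ', h1, h2⟩ := exists_between ((lt_div_iff₀ (sub_pos.2 hab)).2 hlt)
    exact ⟨ρ', h1, (lt_div_iff₀ (sub_pos.2 hab)).1 h2⟩
  obtain ⟨ε, hε, hε2⟩ := exists_between (sub_pos.2 hlt')
  obtain ⟨N, hN, hN0⟩ : ∃ N : ℝ, u c - u a - ρ' * (c - a) + ε < ε * Real.exp (N * (c - b)) ∧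
      0 < N := by
    have hlim : Tendsto (fun N : ℝ => ε * Real.exp (N * (c - b))) atTop atTop :=
      (Real.tendsto_exp_atTop.comp
        (tendsto_id.atTop_mul_const (sub_pos.2 hbc))).const_mul_atTop hε
    exact ((hlim.eventually_gt_atTop _).and (eventually_gt_atTop 0)).exists
  set ψ : ℝ → ℝ := fun z => ρ' * (z - a) + ε * Real.exp (N * (z - b)) with hψ
  have hψd : ContDiff ℝ 1 ψ := by fun_prop
  obtain ⟨y, hy, hmx⟩ := (isCompact_Icc (a := a) (b := c)).exists_isMaxOn
    ⟨a, le_rfl, (hab.trans hbc).le⟩ (f := fun z => u z - ψ z) (hu.sub hψd.continuous.continuousOn)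
  have h1 : u b - ψ b ≤ u y - ψ y := hmx (a := b) ⟨hab.le, hbc.le⟩
  have h2 : ψ b = ρ' * (b - a) + ε := by simp [hψ]
  have hya : a < y := by
    refine hy.1.lt_of_ne fun h => ?_
    subst h
    have : 0 < ψ a := by simp only [hψ, sub_self, mul_zero, zero_add]; positivity
    linarith
  have hyc : y < c := by
    refine hy.2.lt_of_ne fun h => ?_
    subst h
    simp only [hψ] at h1 h2
    linarith
  have t := h y ⟨hya, hyc⟩ ψ hψd (by
    filter_upwards [Icc_mem_nhds hya hyc] with z hz using hmx hz)
  have d : HasDerivAt ψ (ρ' * 1 + ε * (Real.exp (N * (y - b)) * (N * 1))) y :=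
    (((hasDerivAt_id y).sub_const a).const_mul ρ').add
      (((((hasDerivAt_id y).sub_const b).const_mul N).exp).const_mul ε)
  rw [d.deriv] at t
  have : 0 < ε * (Real.exp (N * (y - b)) * (N * 1)) := by positivity
  linarith

lemma mul_le_sub_of_superAt {u : ℝ → ℝ} {a b c ρ : ℝ} (hu : ContinuousOn u (Icc a c))
    (hab : a < b) (hbc : b < c) (h : ∀ y ∈ Ioo a c, SuperAt (fun q => q) ρ u y) :
    ρ * (b - a) ≤ u b - u a := by
  have := sub_le_mul_of_subAt (u := fun x => -u x) (ρ := -ρ) hu.neg hab hbc fun y hy => by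
    simpa using superAt_iff_subAt_neg.1 (h y hy)
  linarith

/-- A continuous function with all test slopes from above bounded by `K` is
`K`-Lipschitz. -/
theorem abs_sub_le_of_subAt_abs {w : ℝ → ℝ} (hw : Continuous w) {K : ℝ}
    (h : ∀ y, SubAt (fun q => |q|) K w y) (x y : ℝ) :
    |w x - w y| ≤ K * |x - y| := by
  -- Since `|·|` is even, the reflected function satisfies the same bound; applied to it, the
  -- one-sided estimate gives the lower bound on increments.
  have hrefl : ∀ y, SubAt (fun q => |q|) K (fun z => w (-z)) y := by
    intro y φ hφ hm
    have := h (-y) (fun x => φ (-x)) (hφ.comp contDiff_neg) (by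
      have ht : Tendsto (fun x : ℝ => -x) (𝓝 (-y)) (𝓝 y) := by
        simpa using (continuous_neg (G := ℝ)).tendsto (-y)
      filter_upwards [ht.eventually hm] with x hx
      simpa using hx)
    rw [deriv_comp_neg] at this
    simpa using this
  have main : ∀ {x y : ℝ}, x < y → |w x - w y| ≤ K * |x - y| := by
    intro x y hxy
    have h1 := sub_le_mul_of_subAt (c := y + 1) hw.continuousOn hxy (by linarith)
      fun z _ => (h z).imp fun q hq => (le_abs_self q).trans hq
    have h2 := sub_le_mul_of_subAt (c := -x + 1) (u := fun z => w (-z))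
      (hw.comp continuous_neg).continuousOn (neg_lt_neg hxy) (by linarith)
      fun z _ => (hrefl z).imp fun q hq => (le_abs_self q).trans hq
    simp only [neg_neg] at h2
    rw [abs_sub_comm x y, abs_of_pos (sub_pos.2 hxy), abs_le]
    constructor <;> linarith
  rcases lt_trichotomy x y with hxy | hxy | hxy
  · exact main hxy
  · subst hxy; simp
  · rw [abs_sub_comm, abs_sub_comm x]; exact main hxy

/-! ### Perron's method below an obstacle -/

/-- A test function above the maximum touches whichever function is larger at `y`. The right-hand
side is allowed to depend on the value, as the discounted equation requires. -/
lemma SubAt.max {H : ℝ → ℝ} {c : ℝ → ℝ} {u w : ℝ → ℝ} {y : ℝ} (hu : SubAt H (c (u y)) u y)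
    (hw : SubAt H (c (w y)) w y) : SubAt H (c (max (u y) (w y))) (fun x => max (u x) (w x)) y := by
  intro φ hφ hm
  rcases le_total (u y) (w y) with h | h
  · rw [max_eq_right h]
    refine hw φ hφ ?_
    filter_upwards [hm] with x hx
    rw [max_eq_right h] at hx
    linarith [le_max_right (u x) (w x)]
  · rw [max_eq_left h]
    refine hu φ hφ ?_
    filter_upwards [hm] with x hx
    rw [max_eq_left h] at hx
    linarith [le_max_left (u x) (w x)]

lemma continuous_of_abs_sub_le {w : ℝ → ℝ} {K : ℝ} (h : ∀ x y, |w x - w y| ≤ K * |x - y|) :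
    Continuous w := by
  refine (LipschitzWith.of_dist_le_mul (K := K.toNNReal) fun x y => ?_).continuous
  rw [Real.dist_eq, Real.dist_eq]
  refine (h x y).trans ?_
  gcongr
  exact Real.le_coe_toNNReal K

/-- The `K`-Lipschitz functions below the obstacle `S` that are subsolutions of
`lam w + H (w') = g`. -/
structure IsObstacleSub (H g S : ℝ → ℝ) (lam K : ℝ) (w : ℝ → ℝ) : Prop where
  lip : ∀ x y, |w x - w y| ≤ K * |x - y|
  le : ∀ x, w x ≤ S x
  sub : ∀ y, SubAt H (g y - lam * w y) w y

/-- The supremum of the subsolutions below a supersolution. -/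
def obstacleSup (H g S : ℝ → ℝ) (lam K : ℝ) (x : ℝ) : ℝ :=
  sSup {t | ∃ w, IsObstacleSub H g S lam K w ∧ t = w x}

section Perron
variable {H g S w₀ : ℝ → ℝ} {lam K : ℝ}

lemma IsObstacleSub.le_sup {w : ℝ → ℝ} (hw : IsObstacleSub H g S lam K w) (x : ℝ) :
    w x ≤ obstacleSup H g S lam K x :=
  le_csSup ⟨S x, by rintro _ ⟨w, hw, rfl⟩; exact hw.le x⟩ ⟨w, hw, rfl⟩

lemma exists_lt_of_lt_obstacleSup (h₀ : IsObstacleSub H g S lam K w₀) {x t : ℝ}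
    (ht : t < obstacleSup H g S lam K x) : ∃ w, IsObstacleSub H g S lam K w ∧ t < w x := by
  have hne : {t | ∃ w, IsObstacleSub H g S lam K w ∧ t = w x}.Nonempty := ⟨_, w₀, h₀, rfl⟩
  obtain ⟨_, ⟨w, hw, rfl⟩, h⟩ := exists_lt_of_lt_csSup hne ht
  exact ⟨w, hw, h⟩

/-- Near `y` it suffices to use one member of the family that almost attains the supremum at `y`:
the common Lipschitz constant keeps its values, and hence the term `lam * w`, under control on a
small interval. -/
lemma isObstacleSub_obstacleSup (hH : Continuous H) (hg : Continuous g) (hlam : 0 ≤ lam)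
    (h₀ : IsObstacleSub H g S lam K w₀) :
    IsObstacleSub H g S lam K (obstacleSup H g S lam K) := by
  have hK : 0 ≤ K := by simpa using (abs_nonneg _).trans (h₀.lip 1 0)
  have hlip : ∀ x y, obstacleSup H g S lam K x - obstacleSup H g S lam K y ≤ K * |x - y| := by
    intro x y
    rw [sub_le_iff_le_add]
    refine csSup_le ⟨_, w₀, h₀, rfl⟩ ?_
    rintro _ ⟨w, hw, rfl⟩
    linarith [(abs_le.1 (hw.lip x y)).2, hw.le_sup y]
  refine ⟨fun x y => abs_le.2 ⟨?_, hlip x y⟩, fun x => csSup_le ⟨_, w₀, h₀, rfl⟩ ?_, fun y => ?_⟩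
  · have := hlip y x
    rw [abs_sub_comm] at this
    linarith
  · rintro _ ⟨w, hw, rfl⟩; exact hw.le x
  · refine subAt_of_approx hH fun η hη => ?_
    have e₁ : ∀ᶠ x in 𝓝 y, g x < g y + η / 2 :=
      hg.continuousAt.eventually_lt continuousAt_const (by linarith)
    obtain ⟨R, hR, hball⟩ := Metric.eventually_nhds_iff.1 e₁
    obtain ⟨r, hr, hrR, hrη⟩ : ∃ r : ℝ, 0 < r ∧ r < R ∧ lam * (r + K * r) ≤ η / 2 := by
      refine ⟨min (R / 2) (η / 2 / ((lam + 1) * (1 + K))), by positivity,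
        (min_le_left _ _).trans_lt (by linarith), ?_⟩
      have h1 : min (R / 2) (η / 2 / ((lam + 1) * (1 + K))) * ((lam + 1) * (1 + K)) ≤ η / 2 := by
        rw [← le_div_iff₀ (by positivity)]; exact min_le_right _ _
      have h2 : 0 ≤ min (R / 2) (η / 2 / ((lam + 1) * (1 + K))) := by positivity
      nlinarith [mul_nonneg h2 (by linarith : 0 ≤ 1 + K)]
    refine ⟨r, hr, fun δ hδ => ?_⟩
    obtain ⟨w, hw, hwy⟩ := exists_lt_of_lt_obstacleSup h₀ (x := y)
      (t := obstacleSup H g S lam K y - min δ r) (by linarith [lt_min hδ hr])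
    refine ⟨w, continuous_of_abs_sub_le hw.lip, fun x _ => by linarith [hw.le_sup x],
      by linarith [min_le_left δ r], fun x hx => (hw.sub x).mono ?_⟩
    have h1 := hball (y := x) (by rw [Real.dist_eq, abs_lt]; constructor <;> linarith [hx.1, hx.2])
    have h2 := (abs_le.1 (hw.lip x y)).1
    have h3 : K * |x - y| ≤ K * r := by
      gcongr; rw [abs_le]; constructor <;> linarith [hx.1, hx.2]
    have h4 : lam * (obstacleSup H g S lam K y - w x) ≤ lam * (r + K * r) := by
      gcongr; linarith [min_le_right δ r]
    linarith

/-- Suppose `φ` touches the supremum from below with too small a value of `H (φ')`. If the supremum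
meets the obstacle at `y`, then `φ` also touches `S`, which is a supersolution there. Otherwise a
slightly lifted `φ - (x - y)²` can be glued in, giving a larger member of the family. The hypothesis
`hK` is the a priori slope bound that keeps the glued function `K`-Lipschitz. -/
theorem superAt_obstacleSup (hH : Continuous H) (hg : Continuous g) (hS : Continuous S)
    (hlam : 0 ≤ lam) (h₀ : IsObstacleSub H g S lam K w₀)
    (hK : ∀ y q r, w₀ y ≤ r → r ≤ S y → H q ≤ g y - lam * r → |q| ≤ K) {y : ℝ}
    (hSsup : SuperAt H (g y - lam * S y) S y) :
    SuperAt H (g y - lam * obstacleSup H g S lam K y) (obstacleSup H g S lam K) y := by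
  have hU := isObstacleSub_obstacleSup hH hg hlam h₀
  set u := obstacleSup H g S lam K with hu
  have huc : Continuous u := continuous_of_abs_sub_le hU.lip
  intro φ hφ hm
  by_contra! hlt
  have hdφ : Continuous (deriv φ) := hφ.continuous_deriv le_rfl
  have hφc := hφ.continuous
  have huS : u y < S y := by
    refine (hU.le y).lt_of_ne fun h => ?_
    have := hSsup φ hφ (by
      filter_upwards [hm] with x hx
      rw [← h]
      linarith [hU.le x])
    rw [← h] at this
    linarith
  set ψ : ℝ → ℝ := fun x => φ x - (x - y) ^ 2 + (u y - φ y) with hψ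
  have hψd : ContDiff ℝ 1 ψ := by fun_prop
  have hψc := hψd.continuous
  have hdψ : Continuous (deriv ψ) := hψd.continuous_deriv le_rfl
  have hψy : ψ y = u y := by simp [hψ]
  have hdψy : deriv ψ y = deriv φ y := by
    have : HasDerivAt ψ (deriv φ y - 2 * (y - y) ^ 1 * 1) y :=
      ((hφ.differentiable (by simp) y).hasDerivAt.sub
        (((hasDerivAt_id y).sub_const y).pow 2)).add_const _
    rw [this.deriv]; ring
  obtain ⟨η₀, hη₀, hη1, hη2⟩ : ∃ η : ℝ, 0 < η ∧ H (deriv ψ y) < g y - lam * (ψ y + 2 * η) ∧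
      ψ y + 2 * η < S y := by
    have e1 : Tendsto (fun η : ℝ => g y - lam * (ψ y + 2 * η)) (𝓝[>] 0)
        (𝓝 (g y - lam * (ψ y + 2 * 0))) :=
      (Continuous.tendsto (by fun_prop) 0).mono_left nhdsWithin_le_nhds
    have e2 : Tendsto (fun η : ℝ => ψ y + 2 * η) (𝓝[>] 0) (𝓝 (ψ y + 2 * 0)) :=
      (Continuous.tendsto (by fun_prop) 0).mono_left nhdsWithin_le_nhds
    obtain ⟨η, h1, h2, h3⟩ := ((e1.eventually_const_lt (u := H (deriv ψ y))
      (by rw [hdψy, hψy]; simpa using hlt)).and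
      ((e2.eventually_lt_const (u := S y) (by simpa [hψy] using huS)).and
        self_mem_nhdsWithin)).exists
    exact ⟨η, h3, h1, h2⟩
  have e₁ : ∀ᶠ x in 𝓝 y, H (deriv ψ x) < g x - lam * (ψ x + η₀) := by
    refine ContinuousAt.eventually_lt (f := fun x => H (deriv ψ x))
      (g := fun x => g x - lam * (ψ x + η₀)) (by fun_prop) (by fun_prop) ?_
    nlinarith
  have e₂ : ∀ᶠ x in 𝓝 y, ψ x + η₀ < S x :=
    ContinuousAt.eventually_lt (f := fun x => ψ x + η₀) (by fun_prop) (by fun_prop)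
      (by linarith)
  obtain ⟨R, hR, hball⟩ := Metric.eventually_nhds_iff.1 ((e₁.and e₂).and hm)
  obtain ⟨r, hr, hrR⟩ : ∃ r : ℝ, 0 < r ∧ r < R := ⟨R / 2, by positivity, by linarith⟩
  -- The lift is less than `(r / 2)²`, so the bump is strictly below the supremum on the annulus `r
  -- / 2 ≤ |x - y| ≤ r` and the gluing is continuous.
  obtain ⟨η, hη, hηη, hηr⟩ : ∃ η : ℝ, 0 < η ∧ η ≤ η₀ ∧ η < r ^ 2 / 4 :=
    ⟨min η₀ (r ^ 2 / 8), by positivity, min_le_left _ _,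
      (min_le_right _ _).trans_lt (by nlinarith [sq_pos_of_pos hr])⟩
  have hout : ∀ x, r / 2 ≤ |x - y| → |x - y| ≤ r → ψ x + η < u x := by
    intro x h1 h2
    have h3 : u y - φ y ≤ u x - φ x := (hball (y := x) (by rw [Real.dist_eq]; linarith)).2
    have h4 : (r / 2) ^ 2 ≤ |x - y| ^ 2 := by gcongr
    rw [sq_abs] at h4
    simp only [hψ]
    nlinarith
  set w : ℝ → ℝ := fun x => if |x - y| < r then max (u x) (ψ x + η) else u x with hw
  have hwin : ∀ x, |x - y| < r → w =ᶠ[𝓝 x] fun z => max (u z) (ψ z + η) := by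
    intro x hx
    have : ∀ᶠ z in 𝓝 x, |z - y| < r :=
      ContinuousAt.eventually_lt (f := fun z => |z - y|) (by fun_prop) continuousAt_const hx
    filter_upwards [this] with z hz
    simp [hw, hz]
  have hwout : ∀ x, r / 2 < |x - y| → w =ᶠ[𝓝 x] u := by
    intro x hx
    have : ∀ᶠ z in 𝓝 x, r / 2 < |z - y| :=
      ContinuousAt.eventually_lt (g := fun z => |z - y|) continuousAt_const (by fun_prop) hx
    filter_upwards [this] with z hz
    simp only [hw]
    split_ifs with h
    · exact max_eq_left (hout z hz.le h.le).le
    · rfl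
  have huw : ∀ x, u x ≤ w x := by
    intro x
    simp only [hw]
    split_ifs with h
    · exact le_max_left _ _
    · exact le_rfl
  have hwS : ∀ x, w x ≤ S x := by
    intro x
    simp only [hw]
    split_ifs with h
    · refine max_le (hU.le x) ?_
      have := (hball (y := x) (by rw [Real.dist_eq]; linarith)).1.2
      linarith
    · exact hU.le x
  have hwc : Continuous w := by
    rw [continuous_iff_continuousAt]
    intro x
    rcases lt_or_ge (|x - y|) r with h | h
    · exact (Continuous.continuousAt (by fun_prop)).congr (hwin x h).symm
    · exact huc.continuousAt.congr (hwout x (by linarith)).symm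
  have hwsub : ∀ x, SubAt H (g x - lam * w x) w x := by
    intro x
    rcases lt_or_ge (|x - y|) r with h | h
    · have h1 := hball (y := x) (by rw [Real.dist_eq]; linarith)
      have hs1 := hU.sub x
      have hs2 : SubAt H (g x - lam * (ψ x + η)) (fun z => ψ z + η) x := by
        refine subAt_of_differentiableAt ((hψd.differentiable (by simp) x).add_const _) ?_
        rw [deriv_add_const]
        nlinarith [h1.1.1]
      have := SubAt.max (c := fun t => g x - lam * t) hs1 hs2
      rw [show max (u x) (ψ x + η) = w x by simp [hw, h]] at this
      refine this.congr (k := 0) ?_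
      filter_upwards [hwin x h] with z hz
      rw [hz, add_zero]
    · have h2 := hwout x (by linarith)
      have := hU.sub x
      rw [← h2.self_of_nhds] at this
      refine this.congr (k := 0) ?_
      filter_upwards [h2] with z hz
      rw [hz, add_zero]
  have hlipw := abs_sub_le_of_subAt_abs hwc (K := K) fun x => (hwsub x).imp
    fun q hq => hK x q (w x) ((h₀.le_sup x).trans (huw x)) (hwS x) hq
  have hwin : IsObstacleSub H g S lam K w := ⟨hlipw, hwS, hwsub⟩
  have h1 := hwin.le_sup y
  have h2 : ψ y + η ≤ w y := by simp [hw, hr]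
  rw [hψy] at h2
  rw [← hu] at h1
  linarith

end Perron

/-! ### The discounted cell problem -/

lemma abs_deriv_sqrt_one_add_sq_le (x : ℝ) : |deriv (fun y : ℝ => √(1 + y ^ 2)) x| ≤ 1 := by
  have h1 : (0 : ℝ) < 1 + x ^ 2 := by positivity
  have : HasDerivAt (fun y : ℝ => √(1 + y ^ 2)) ((2 * x ^ 1 * 1) / (2 * √(1 + x ^ 2))) x :=
    (((hasDerivAt_id x).pow 2).const_add 1).sqrt h1.ne'
  rw [this.deriv, abs_div, div_le_one (by positivity), abs_of_pos (a := 2 * √(1 + x ^ 2))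
    (by positivity)]
  have : |x| ≤ √(1 + x ^ 2) := Real.abs_le_sqrt (by linarith)
  simp only [pow_one, mul_one, abs_mul, abs_two]
  linarith

lemma contDiff_sqrt_one_add_sq : ContDiff ℝ 1 (fun y : ℝ => √(1 + y ^ 2)) :=
  ContDiff.sqrt (by fun_prop) fun x => by positivity

lemma abs_le_sqrt_one_add_sq (x : ℝ) : |x| ≤ √(1 + x ^ 2) := Real.abs_le_sqrt (by linarith)

lemma sqrt_one_add_sq_le (x : ℝ) : √(1 + x ^ 2) ≤ 1 + |x| := by
  rw [Real.sqrt_le_left (by positivity)]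
  nlinarith [sq_abs x, abs_nonneg x]

lemma SuperAt.add_mul_sqrt {H : ℝ → ℝ} {K : NNReal} (hH : LipschitzWith K H) {u : ℝ → ℝ}
    {c δ y : ℝ} (hδ : 0 ≤ δ) (h : SuperAt H c u y) :
    SuperAt H (c - K * δ) (fun x => u x + δ * √(1 + x ^ 2)) y := by
  refine (h.add_smooth (contDiff_const.mul contDiff_sqrt_one_add_sq)).imp fun q hq => ?_
  have h1 := hH.dist_le_mul (q - deriv (fun x => δ * √(1 + x ^ 2)) y) q
  rw [Real.dist_eq, Real.dist_eq, sub_sub_cancel_left, abs_neg,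
    deriv_const_mul _ (contDiff_sqrt_one_add_sq.differentiable (by simp) y), abs_mul,
    abs_of_nonneg hδ] at h1
  have h2 : (K : ℝ) * (δ * |deriv (fun x : ℝ => √(1 + x ^ 2)) y|) ≤ K * (δ * 1) := by
    gcongr; exact abs_deriv_sqrt_one_add_sq_le y
  have := (abs_le.1 (h1.trans h2)).2
  rw [deriv_const_mul _ (contDiff_sqrt_one_add_sq.differentiable (by simp) y)] at hq
  linarith

lemma SubAt.sub_mul_sqrt {H : ℝ → ℝ} {K : NNReal} (hH : LipschitzWith K H) {u : ℝ → ℝ}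
    {c δ y : ℝ} (hδ : 0 ≤ δ) (h : SubAt H c u y) :
    SubAt H (c + K * δ) (fun x => u x - δ * √(1 + x ^ 2)) y := by
  have h0 : SuperAt (fun q => -H (-q)) (-c) (fun x => -u x) y := by
    rw [superAt_iff_subAt_neg]; simpa using h
  have hH' : LipschitzWith K (fun q => -H (-q)) := by
    refine LipschitzWith.of_dist_le_mul fun x y => ?_
    rw [dist_neg_neg]
    simpa using hH.dist_le_mul (-x) (-y)
  have := h0.add_mul_sqrt hH' hδ
  rw [superAt_iff_subAt_neg] at this
  simp only [neg_neg] at this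
  convert this using 2 <;> ring

/-- Adding `δ √(1 + x²)` to `v₂` makes the difference attain its maximum at the price of an error `K
δ` in the equation. At the maximum, doubling gives `lam (v₁ - v₂) ≤ K δ`; then `δ → 0`. -/
theorem discounted_comparison {H : ℝ → ℝ} {K : NNReal} (hH : LipschitzWith K H) {g v₁ v₂ : ℝ → ℝ}
    {lam : ℝ} (hlam : 0 < lam) (hg : Continuous g) (c₁ : Continuous v₁) (c₂ : Continuous v₂)
    (h₁ : ∀ y, SubAt H (g y - lam * v₁ y) v₁ y) (h₂ : ∀ y, SuperAt H (g y - lam * v₂ y) v₂ y)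
    (hb : ∃ C, ∀ y, v₁ y - v₂ y ≤ C) (y : ℝ) : v₁ y ≤ v₂ y := by
  obtain ⟨C, hC⟩ := hb
  have key : ∀ δ > 0, v₁ y - v₂ y ≤ K * δ / lam + δ * √(1 + y ^ 2) := by
    intro δ hδ
    have hlim : Tendsto (fun x => v₁ x - (v₂ x + δ * √(1 + x ^ 2))) (cocompact ℝ) atBot := by
      have h1 : Tendsto (fun x : ℝ => C + -(δ * |x|)) (cocompact ℝ) atBot := by
        refine tendsto_atBot_add_const_left _ _ (tendsto_neg_atTop_atBot.comp ?_)
        exact (tendsto_norm_cocompact_atTop (E := ℝ)).const_mul_atTop hδ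
      refine tendsto_atBot_mono (fun x => ?_) h1
      have := mul_le_mul_of_nonneg_left (abs_le_sqrt_one_add_sq x) hδ.le
      linarith [hC x]
    have hcont : Continuous (fun x => v₁ x - (v₂ x + δ * √(1 + x ^ 2))) := by fun_prop
    obtain ⟨a, ha⟩ := hcont.exists_forall_ge hlim
    have := le_of_isLocalMax_sub hH (u₁ := v₁) (u₂ := fun x => v₂ x + δ * √(1 + x ^ 2))
      (s₁ := fun y => g y - lam * v₁ y) (s₂ := fun y => g y - lam * v₂ y - K * δ) c₁ (by fun_prop)
      (by fun_prop) (by fun_prop) (Eventually.of_forall h₁)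
      (Eventually.of_forall fun y => (h₂ y).add_mul_sqrt hH hδ.le) (y₀ := a)
      (Eventually.of_forall ha)
    have h3 : v₁ a - v₂ a ≤ K * δ / lam := by
      rw [le_div_iff₀ hlam]; linarith
    have h4 := ha y
    have h5 : 0 ≤ δ * √(1 + a ^ 2) := by positivity
    linarith
  have hlim : Tendsto (fun δ : ℝ => K * δ / lam + δ * √(1 + y ^ 2)) (𝓝[>] 0)
      (𝓝 (K * 0 / lam + 0 * √(1 + y ^ 2))) :=
    (Continuous.tendsto (by fun_prop) 0).mono_left nhdsWithin_le_nhds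
  have := ge_of_tendsto hlim (eventually_mem_nhdsWithin.mono key)
  simp at this
  linarith

lemma exists_bound_of_coercive {H : ℝ → ℝ} (hH : Tendsto H (cocompact ℝ) atTop) (c : ℝ) :
    ∃ R, 0 ≤ R ∧ ∀ q, H q ≤ c → |q| ≤ R := by
  have := hH.eventually_gt_atTop c
  rw [← Metric.cobounded_eq_cocompact, ← comap_norm_atTop, eventually_comap] at this
  obtain ⟨R, hR⟩ := eventually_atTop.1 this
  refine ⟨max R 0, le_max_right _ _, fun q hq => ?_⟩
  by_contra! h
  exact absurd (hR |q| ((le_max_left _ _).trans h.le) q rfl) (not_lt.2 hq)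

lemma lipschitzWith_comp_const_add {H : ℝ → ℝ} {K : NNReal} (hH : LipschitzWith K H) (q : ℝ) :
    LipschitzWith K (fun r => H (q + r)) :=
  LipschitzWith.of_dist_le_mul fun x y => by simpa using hH.dist_le_mul (q + x) (q + y)

/-- Perron's method between the constant subsolution `-(C + H q) / lam` and the constant
supersolution `C / lam`, where `|V| ≤ C`; uniqueness is comparison. -/
theorem existsUnique_isCellSolution {H : ℝ → ℝ} (hH : IsNormalizedHamiltonian H) (V : BUC)
    (q : ℝ) {lam : ℝ} (hlam : 0 < lam) : ∃! v, IsCellSolution H V.1 q lam v := by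
  obtain ⟨K, hK⟩ := hH.lipschitz
  have hKq := lipschitzWith_comp_const_add hK q
  obtain ⟨C, hC⟩ := V.2.2
  have hVc : Continuous V.1 := V.2.1.continuous
  have hC0 : 0 ≤ C := (abs_nonneg _).trans (hC 0)
  have hHq := hH.nonneg q
  -- Above the lower barrier `-V - lam * r` is at most `C + (C + H q)`. This bounds `q + s` for
  -- every test slope `s`, whence the Lipschitz constant `R + |q|`.
  obtain ⟨R, hR0, hR⟩ := exists_bound_of_coercive hH.coercive (C + (C + H q))
  set G : ℝ → ℝ := fun r => H (q + r) with hG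
  set g : ℝ → ℝ := fun y => -V.1 y with hgdef
  set S : ℝ → ℝ := fun _ => C / lam with hSdef
  have h₀ : IsObstacleSub G g S lam (R + |q|) (fun _ => -((C + H q) / lam)) := by
    refine ⟨fun x y => by simp; positivity, fun x => ?_, fun y => ?_⟩
    · have : 0 ≤ C / lam := by positivity
      have : 0 ≤ (C + H q) / lam := by positivity
      simp only [hSdef]; linarith
    · refine subAt_of_differentiableAt (differentiableAt_const _) ?_
      rw [deriv_const]
      have : lam * -((C + H q) / lam) = -(C + H q) := by field_simp
      simp only [hG, hgdef, this, add_zero]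
      linarith [(abs_le.1 (hC y)).2]
  have hgc : Continuous g := by fun_prop
  have hU := isObstacleSub_obstacleSup hKq.continuous hgc hlam.le h₀
  have hUS := fun y => superAt_obstacleSup hKq.continuous hgc
    continuous_const hlam.le h₀ (fun y p r h1 h2 h3 => by
      have h4 : -(C + H q) ≤ lam * r := by
        have := mul_le_mul_of_nonneg_left h1 hlam.le
        rwa [show lam * -((C + H q) / lam) = -(C + H q) by field_simp] at this
      have h5 := hR (q + p) (by
        simp only [hG, hgdef] at h3
        linarith [(abs_le.1 (hC y)).1])
      have : |p| = |(q + p) - q| := by congr 1; ring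
      rw [this]
      linarith [abs_sub (q + p) q]) (y := y) (by
      refine superAt_of_differentiableAt (differentiableAt_const _) ?_
      have h6 := hH.nonneg (q + deriv (fun _ : ℝ => C / lam) y)
      have : lam * (C / lam) = C := by field_simp
      simp only [hG, hgdef, this]
      linarith [(abs_le.1 (hC y)).1])
  refine ⟨obstacleSup G g S lam (R + |q|), isCellSolution_iff.2
    ⟨⟨max (C / lam) ((C + H q) / lam), fun y => ?_⟩, continuous_of_abs_sub_le hU.lip, hU.sub, hUS⟩,
    fun v hv => ?_⟩
  · rw [abs_le]
    have h1 := hU.le y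
    have h2 := h₀.le_sup y
    simp only [hSdef] at h1 h2
    constructor
    · linarith [le_max_right (C / lam) ((C + H q) / lam)]
    · linarith [le_max_left (C / lam) ((C + H q) / lam)]
  · obtain ⟨⟨C', hC'⟩, hvc, hv1, hv2⟩ := isCellSolution_iff.1 hv
    have huc := continuous_of_abs_sub_le hU.lip
    have hb1 : ∀ y, |obstacleSup G g S lam (R + |q|) y| ≤ C / lam + (C + H q) / lam := fun y => by
      have h1 := hU.le y
      have h2 := h₀.le_sup y
      have : 0 ≤ C / lam := by positivity
      have : 0 ≤ (C + H q) / lam := by positivity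
      simp only [hSdef] at h1 h2
      rw [abs_le]; constructor <;> linarith
    funext y
    refine le_antisymm ?_ ?_
    · refine discounted_comparison hKq hlam hgc hvc huc hv1 hUS
        ⟨C' + (C / lam + (C + H q) / lam), fun y => ?_⟩ y
      linarith [(abs_le.1 (hC' y)).2, (abs_le.1 (hb1 y)).1]
    · refine discounted_comparison hKq hlam hgc huc hvc hU.sub hv2
        ⟨C' + (C / lam + (C + H q) / lam), fun y => ?_⟩ y
      linarith [(abs_le.1 (hC' y)).1, (abs_le.1 (hb1 y)).2]

/-! ### Primitives of bounded functions -/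

/-- The primitive of `f` that vanishes at the origin. -/
def prim (f : ℝ → ℝ) (x : ℝ) : ℝ := ∫ t in (0 : ℝ)..x, f t

lemma MeasureTheory.MemLp.intervalIntegrable_top {f : ℝ → ℝ} (hf : MemLp f ⊤ volume) (a b : ℝ) :
    IntervalIntegrable f volume a b :=
  intervalIntegrable_iff.mpr (((hf.locallyIntegrable (by simp)).integrableOn_isCompact
    isCompact_uIcc).mono_set uIoc_subset_uIcc)

lemma memLp_top_of_abs_le {f : ℝ → ℝ} (hf : AEStronglyMeasurable f volume) {C : ℝ}
    (hC : ∀ x, |f x| ≤ C) : MemLp f ⊤ volume :=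
  memLp_top_of_bound hf C (Eventually.of_forall hC)

lemma prim_sub_prim {f : ℝ → ℝ} (hf : MemLp f ⊤ volume) (x y : ℝ) :
    prim f y - prim f x = ∫ t in x..y, f t := by
  have := intervalIntegral.integral_add_adjacent_intervals
    (hf.intervalIntegrable_top 0 x) (hf.intervalIntegrable_top x y)
  unfold prim
  linarith

lemma exists_lipschitzWith_prim {f : ℝ → ℝ} (hf : MemLp f ⊤ volume) :
    ∃ K, LipschitzWith K (prim f) := by
  have hae : ∀ᵐ x, ‖f x‖ ≤ (eLpNormEssSup f volume).toReal := by
    filter_upwards [ae_le_eLpNormEssSup (f := f) (μ := volume)] with x hx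
    have h2 := hf.2
    rw [eLpNorm_exponent_top] at h2
    have := ENNReal.toReal_mono h2.ne hx
    simpa using this
  refine ⟨(eLpNormEssSup f volume).toReal.toNNReal, LipschitzWith.of_dist_le_mul fun x y => ?_⟩
  rw [dist_comm, dist_eq_norm, prim_sub_prim hf, Real.coe_toNNReal _ ENNReal.toReal_nonneg,
    dist_comm, dist_eq_norm]
  exact intervalIntegral.norm_integral_le_of_norm_le_const_ae (hae.mono fun x hx _ => hx)

lemma continuous_prim {f : ℝ → ℝ} (hf : MemLp f ⊤ volume) : Continuous (prim f) :=
  (exists_lipschitzWith_prim hf).choose_spec.continuous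

lemma ae_hasDerivAt_prim {f : ℝ → ℝ} (hf : MemLp f ⊤ volume) :
    ∀ᵐ y, HasDerivAt (prim f) (f y) y := by
  filter_upwards [LocallyIntegrable.ae_hasDerivAt_integral (hf.locallyIntegrable (by simp))] with y hy using hy 0

lemma LipschitzWith.sub_eq_integral {u f : ℝ → ℝ} {K : NNReal} (hu : LipschitzWith K u)
    (hf : ∀ᵐ y, HasDerivAt u (f y) y) (x y : ℝ) : u y - u x = ∫ t in x..y, f t := by
  have hac : AbsolutelyContinuousOnInterval u x y :=
    (hu.lipschitzOnWith (s := uIcc x y)).absolutelyContinuousOnInterval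
  rw [← hac.integral_deriv_eq_sub]
  exact intervalIntegral.integral_congr_ae (hf.mono fun z hz _ => hz.deriv)

lemma LipschitzWith.eq_prim_add {u f : ℝ → ℝ} {K : NNReal} (hu : LipschitzWith K u)
    (hf : ∀ᵐ y, HasDerivAt u (f y) y) (x : ℝ) : u x = prim f x + u 0 := by
  have := hu.sub_eq_integral hf 0 x
  unfold prim
  linarith

lemma prim_congr_ae {f g : ℝ → ℝ} (h : f =ᵐ[volume] g) : prim f = prim g := by
  funext x
  exact intervalIntegral.integral_congr_ae (h.mono fun z hz _ => hz)

lemma prim_comp_add {f : ℝ → ℝ} (hf : MemLp f ⊤ volume) (z x : ℝ) :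
    prim (fun t => f (t + z)) x = prim f (x + z) - prim f z := by
  rw [prim_sub_prim hf]
  unfold prim
  rw [intervalIntegral.integral_comp_add_right (fun t => f t), zero_add]

lemma hasDerivWithinAt_prim_right {f : ℝ → ℝ} (hf : MemLp f ⊤ volume) {y r : ℝ}
    (hr : Tendsto f (𝓝[>] y) (𝓝 r)) : HasDerivWithinAt (prim f) r (Ici y) y :=
  intervalIntegral.integral_hasDerivWithinAt_of_tendsto_ae_right (t := Ioi y)
    (hf.intervalIntegrable_top 0 y) hf.1.stronglyMeasurableAtFilter
    (hr.mono_left inf_le_left)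

lemma hasDerivWithinAt_prim_left {f : ℝ → ℝ} (hf : MemLp f ⊤ volume) {y l : ℝ}
    (hl : Tendsto f (𝓝[<] y) (𝓝 l)) : HasDerivWithinAt (prim f) l (Iic y) y := by
  refine intervalIntegral.integral_hasDerivWithinAt_of_tendsto_ae_right (t := Iic y)
    (hf.intervalIntegrable_top 0 y) hf.1.stronglyMeasurableAtFilter
    (hl.mono_left ?_)
  -- The closed left neighbourhood filter may be replaced by the open one because the point `y` is
  -- null.
  rw [← Iio_union_right, nhdsWithin_union, inf_sup_right, sup_le_iff]
  refine ⟨inf_le_left, ?_⟩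
  have : ({y}ᶜ : Set ℝ) ∈ ae (volume : Measure ℝ) := by simp [mem_ae_iff]
  have h2 : 𝓝[{y}] y ⊓ ae (volume : Measure ℝ) = ⊥ := by
    rw [nhdsWithin_singleton, ← empty_mem_iff_bot]
    exact mem_inf_of_inter (mem_pure.2 (mem_singleton y)) this (by simp)
  rw [h2]; exact bot_le

/-! ### One-sided derivatives and test functions -/

lemma IsLocalMax.right_deriv_nonpos {h : ℝ → ℝ} {y r : ℝ} (hm : IsLocalMax h y)
    (hr : HasDerivWithinAt h r (Ici y) y) : r ≤ 0 := by
  have h1 := hasDerivWithinAt_iff_tendsto_slope.1 hr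
  rw [Ici_sdiff_left] at h1
  refine le_of_tendsto h1 ?_
  filter_upwards [mem_nhdsWithin_of_mem_nhds hm, self_mem_nhdsWithin] with x hx hxy
  rw [slope_def_field]
  exact div_nonpos_of_nonpos_of_nonneg (sub_nonpos.2 hx) (sub_nonneg.2 (le_of_lt hxy))

lemma IsLocalMax.left_deriv_nonneg {h : ℝ → ℝ} {y l : ℝ} (hm : IsLocalMax h y)
    (hl : HasDerivWithinAt h l (Iic y) y) : 0 ≤ l := by
  have h1 := hasDerivWithinAt_iff_tendsto_slope.1 hl
  rw [Iic_sdiff_right] at h1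
  refine ge_of_tendsto h1 ?_
  filter_upwards [mem_nhdsWithin_of_mem_nhds hm, self_mem_nhdsWithin] with x hx hxy
  rw [slope_def_field]
  exact div_nonneg_of_nonpos (sub_nonpos.2 hx) (sub_nonpos.2 (le_of_lt hxy))

/-- A smooth function touching from above has a slope between the right and the left derivative, so
a concave kink tests `H` on the whole interval and a convex one tests nothing. -/
lemma subAt_of_oneSided {H : ℝ → ℝ} {c y l r : ℝ} {u : ℝ → ℝ}
    (hl : HasDerivWithinAt u l (Iic y) y) (hr : HasDerivWithinAt u r (Ici y) y)
    (h : ∀ q, r ≤ q → q ≤ l → H q ≤ c) : SubAt H c u y := by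
  intro φ hφ hm
  have hd := (hφ.differentiable (by simp) y).hasDerivAt
  have h1 := hm.right_deriv_nonpos (hr.sub hd.hasDerivWithinAt)
  have h2 := hm.left_deriv_nonneg (hl.sub hd.hasDerivWithinAt)
  exact h _ (by linarith) (by linarith)

lemma superAt_of_oneSided {H : ℝ → ℝ} {c y l r : ℝ} {u : ℝ → ℝ}
    (hl : HasDerivWithinAt u l (Iic y) y) (hr : HasDerivWithinAt u r (Ici y) y)
    (h : ∀ q, l ≤ q → q ≤ r → c ≤ H q) : SuperAt H c u y := by
  rw [superAt_iff_subAt_neg]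
  refine subAt_of_oneSided hl.neg hr.neg fun q h1 h2 => ?_
  have := h (-q) (by linarith) (by linarith)
  linarith

lemma isLocalMax_of_oneSided {h : ℝ → ℝ} {y l r : ℝ} (hl : HasDerivWithinAt h l (Iic y) y)
    (hr : HasDerivWithinAt h r (Ici y) y) (hl0 : 0 < l) (hr0 : r < 0) : IsLocalMax h y := by
  have h1 := hasDerivWithinAt_iff_tendsto_slope.1 hr
  rw [Ici_sdiff_left] at h1
  have h2 := hasDerivWithinAt_iff_tendsto_slope.1 hl
  rw [Iic_sdiff_right] at h2
  have e1 : ∀ᶠ x in 𝓝[>] y, h x ≤ h y := by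
    filter_upwards [h1.eventually_lt_const hr0, self_mem_nhdsWithin] with x hx hxy
    rw [slope_def_field, div_lt_iff₀ (sub_pos.2 hxy)] at hx
    linarith
  have e2 : ∀ᶠ x in 𝓝[<] y, h x ≤ h y := by
    filter_upwards [h2.eventually_const_lt hl0, self_mem_nhdsWithin] with x hx hxy
    rw [slope_def_field, lt_div_iff_of_neg (sub_neg.2 hxy)] at hx
    linarith
  have : ∀ᶠ x in 𝓝[≠] y, h x ≤ h y := by
    rw [← Iio_union_Ioi, nhdsWithin_union]
    exact eventually_sup.2 ⟨e2, e1⟩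
  rw [eventually_nhdsWithin_iff] at this
  filter_upwards [this] with x hx
  by_cases hxy : x = y
  · rw [hxy]
  · exact hx hxy

/-- Each slope strictly between the one-sided derivatives is realised by a linear test function; the
endpoints follow by continuity of `H`. -/
lemma SubAt.of_oneSided {H : ℝ → ℝ} (hH : Continuous H) {c y l r : ℝ} {u : ℝ → ℝ}
    (h : SubAt H c u y) (hl : HasDerivWithinAt u l (Iic y) y)
    (hr : HasDerivWithinAt u r (Ici y) y) (hrl : r < l) {q : ℝ} (hq : q ∈ Icc r l) : H q ≤ c := by
  rw [← closure_Ioo hrl.ne] at hq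
  have hcl : IsClosed {q | H q ≤ c} := isClosed_le hH continuous_const
  refine hcl.closure_subset_iff.2 (fun q hq => ?_) hq
  have hq' : HasDerivAt (fun x : ℝ => q * x) q y := by simpa using (hasDerivAt_id y).const_mul q
  have := h (fun x => q * x) (by fun_prop) (isLocalMax_of_oneSided (hl.sub hq'.hasDerivWithinAt)
    (hr.sub hq'.hasDerivWithinAt) (by linarith [hq.2]) (by linarith [hq.1]))
  rwa [hq'.deriv] at this

lemma SuperAt.of_oneSided {H : ℝ → ℝ} (hH : Continuous H) {c y l r : ℝ} {u : ℝ → ℝ}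
    (h : SuperAt H c u y) (hl : HasDerivWithinAt u l (Iic y) y)
    (hr : HasDerivWithinAt u r (Ici y) y) (hlr : l < r) {q : ℝ} (hq : q ∈ Icc l r) : c ≤ H q := by
  have := (superAt_iff_subAt_neg.1 h).of_oneSided (by fun_prop) hl.neg hr.neg (neg_lt_neg hlr)
    (q := -q) ⟨by linarith [hq.2], by linarith [hq.1]⟩
  simpa using this

/-! ### Solution derivatives -/

/-- The primitive of the bounded function `f` is a viscosity solution of `H (u') = s`. -/
structure SolDeriv (H s f : ℝ → ℝ) : Prop where
  memLp : MemLp f ⊤ volume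
  sub : ∀ y, SubAt H (s y) (prim f) y
  sup : ∀ y, SuperAt H (s y) (prim f) y

/-- Lipschitz functions with almost everywhere derivative `f` differ by constants, so testing the
single primitive `prim f` suffices. -/
lemma isSolutionDerivative_iff {H V : ℝ → ℝ} {μ : ℝ} {f : ℝ → ℝ} :
    IsSolutionDerivative H V μ f ↔ SolDeriv H (fun y => μ - V y) f := by
  constructor
  · rintro ⟨h1, h2⟩
    have := isViscositySolution_iff.1 (h2 _ (exists_lipschitzWith_prim h1) (ae_hasDerivAt_prim h1))
    exact ⟨h1, this.2.1, this.2.2⟩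
  · rintro ⟨h1, h2, h3⟩
    refine ⟨h1, fun u ⟨K, hu⟩ hd => isViscositySolution_iff.2 ⟨hu.continuous, fun y => ?_,
      fun y => ?_⟩⟩
    · exact (h2 y).congr (Eventually.of_forall (hu.eq_prim_add hd))
    · exact (h3 y).congr (Eventually.of_forall (hu.eq_prim_add hd))

lemma SolDeriv.comp_add {H s f : ℝ → ℝ} (h : SolDeriv H s f) (z : ℝ) :
    SolDeriv H (fun y => s (y + z)) (fun y => f (y + z)) := by
  have hp : ∀ x, prim (fun t => f (t + z)) x = prim f (x + z) + -prim f z := fun x => by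
    rw [prim_comp_add h.memLp]; ring
  refine ⟨h.memLp.comp_measurePreserving (measurePreserving_add_right volume z), fun y => ?_,
    fun y => ?_⟩
  · exact (h.sub (y + z)).comp_add.congr (Eventually.of_forall hp)
  · exact (h.sup (y + z)).comp_add.congr (Eventually.of_forall hp)

lemma SolDeriv.congr_ae {H s f g : ℝ → ℝ} (h : SolDeriv H s f) (hfg : g =ᵐ[volume] f) :
    SolDeriv H s g :=
  ⟨(memLp_congr_ae hfg).2 h.memLp, by rw [prim_congr_ae hfg]; exact h.sub,
    by rw [prim_congr_ae hfg]; exact h.sup⟩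

lemma solDeriv_of_oneSided {H s f : ℝ → ℝ} (hf : MemLp f ⊤ volume)
    (h : ∀ y, ∃ l r, Tendsto f (𝓝[<] y) (𝓝 l) ∧ Tendsto f (𝓝[>] y) (𝓝 r) ∧
      (∀ q, r ≤ q → q ≤ l → H q ≤ s y) ∧ ∀ q, l ≤ q → q ≤ r → s y ≤ H q) :
    SolDeriv H s f := by
  refine ⟨hf, fun y => ?_, fun y => ?_⟩
  · obtain ⟨l, r, hl, hr, h1, h2⟩ := h y
    exact subAt_of_oneSided (hasDerivWithinAt_prim_left hf hl)
      (hasDerivWithinAt_prim_right hf hr) h1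
  · obtain ⟨l, r, hl, hr, h1, h2⟩ := h y
    exact superAt_of_oneSided (hasDerivWithinAt_prim_left hf hl)
      (hasDerivWithinAt_prim_right hf hr) h2

lemma solDeriv_of_continuous {H s f : ℝ → ℝ} (hf : Continuous f) {C : ℝ} (hC : ∀ x, |f x| ≤ C)
    (h : ∀ y, H (f y) = s y) : SolDeriv H s f := by
  refine solDeriv_of_oneSided (memLp_top_of_abs_le hf.aestronglyMeasurable hC) fun y =>
    ⟨f y, f y, hf.continuousAt.tendsto.mono_left nhdsWithin_le_nhds,
      hf.continuousAt.tendsto.mono_left nhdsWithin_le_nhds, fun q h1 h2 => ?_, fun q h1 h2 => ?_⟩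
  · rw [le_antisymm h2 h1, h]
  · rw [le_antisymm h2 h1, h]

lemma monotone_prim {f : ℝ → ℝ} (hf : MemLp f ⊤ volume) (h0 : ∀ x, 0 ≤ f x) :
    Monotone (prim f) := by
  intro x y hxy
  have := prim_sub_prim hf x y
  have h1 := intervalIntegral.integral_nonneg (μ := volume) (f := f) hxy fun t _ => h0 t
  linarith

lemma hasDerivAt_of_slopes {u : ℝ → ℝ} {y ρ : ℝ} (key : ∀ ε > 0, ∃ r > 0, ∀ a b, y - r < a →
    a < b → b < y + r → |u b - u a - ρ * (b - a)| ≤ ε * (b - a)) : HasDerivAt u ρ y := by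
  rw [hasDerivAt_iff_isLittleO, Asymptotics.isLittleO_iff]
  intro ε hε
  obtain ⟨r, hr, hk⟩ := key ε hε
  filter_upwards [Metric.ball_mem_nhds y hr] with x hx
  rw [Metric.mem_ball, Real.dist_eq, abs_lt] at hx
  rw [smul_eq_mul, Real.norm_eq_abs, Real.norm_eq_abs]
  rcases lt_trichotomy x y with hxy | hxy | hxy
  · have := hk x y (by linarith) hxy (by linarith)
    rw [abs_of_neg (sub_neg.2 hxy), ← abs_neg]
    convert this using 2 <;> ring
  · subst hxy; simp
  · have := hk y x (by linarith) hxy (by linarith)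
    rw [abs_of_pos (sub_pos.2 hxy)]
    convert this using 2; ring

/-! ### Regular values and comparison -/

/-- `ρ` separates `{H < c}` from `{H > c}` on `[0, ∞)`. -/
def IsRegularRoot (H : ℝ → ℝ) (c ρ : ℝ) : Prop :=
  0 ≤ ρ ∧ (∀ q, 0 ≤ q → q < ρ → H q < c) ∧ ∀ q, ρ < q → c < H q

/-- A nondecreasing viscosity solution of `H (u') = s`. -/
structure IsMonoSol (H s u : ℝ → ℝ) : Prop where
  continuous : Continuous u
  mono : Monotone u
  sub : ∀ y, SubAt H (s y) u y
  sup : ∀ y, SuperAt H (s y) u y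

lemma SolDeriv.isMonoSol {H s f : ℝ → ℝ} (h : SolDeriv H s f) (h0 : ∀ x, 0 ≤ f x) :
    IsMonoSol H s (prim f) :=
  ⟨continuous_prim h.memLp, monotone_prim h.memLp h0, h.sub, h.sup⟩

/-- This removes the negative branch of `H` from the supersolution test for nondecreasing functions.
-/
lemma deriv_nonneg_of_isLocalMin_of_monotone {u φ : ℝ → ℝ} (hu : Monotone u)
    (hφ : ContDiff ℝ 1 φ) {y : ℝ} (hm : IsLocalMin (fun x => u x - φ x) y) : 0 ≤ deriv φ y := by
  have hd := (hφ.differentiable (by simp) y).hasDerivAt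
  have h1 := hasDerivWithinAt_iff_tendsto_slope.1 (hd.hasDerivWithinAt (s := Iic y))
  rw [Iic_sdiff_right] at h1
  refine ge_of_tendsto h1 ?_
  filter_upwards [mem_nhdsWithin_of_mem_nhds hm, self_mem_nhdsWithin] with x hx hxy
  rw [slope_def_field]
  have h3 : x ≤ y := le_of_lt hxy
  have h2 : u x ≤ u y := hu h3
  exact div_nonneg_of_nonpos (by linarith) (sub_nonpos.2 h3)

/-- By compactness and coercivity, `H` exceeds `c` by a fixed amount to the right of `ρ + ε`. This
and the next two lemmas are the quantitative forms of a regular root that survive a small change of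
the right-hand side. -/
lemma IsRegularRoot.eventually_slope_le {H : ℝ → ℝ} (hH : Continuous H) (hco : Tendsto H (cocompact ℝ) atTop)
    {c ρ : ℝ} (h : IsRegularRoot H c ρ) {ε : ℝ} (hε : 0 < ε) :
    ∃ η > 0, ∀ q, H q ≤ c + η → q ≤ ρ + ε := by
  obtain ⟨R, hR0, hR⟩ := exists_bound_of_coercive hco (c + 1)
  by_cases hne : (Icc (ρ + ε) R).Nonempty
  · obtain ⟨q₀, hq₀, hmin⟩ := isCompact_Icc.exists_isMinOn hne hH.continuousOn
    have h1 : c < H q₀ := h.2.2 _ (by linarith [hq₀.1])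
    refine ⟨min 1 ((H q₀ - c) / 2), by have := sub_pos.2 h1; positivity, fun q hq => ?_⟩
    by_contra! hlt
    have h2 := hR q (hq.trans (by gcongr; exact min_le_left _ _))
    have h3 : H q₀ ≤ H q := hmin (a := q) ⟨hlt.le, (abs_le.1 h2).2⟩
    have := min_le_right 1 ((H q₀ - c) / 2)
    linarith
  · rw [nonempty_Icc, not_le] at hne
    refine ⟨1, one_pos, fun q hq => ?_⟩
    linarith [(abs_le.1 (hR q hq)).2]

lemma IsRegularRoot.eventually_le_slope {H : ℝ → ℝ} (hH : Continuous H)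
    {c ρ : ℝ} (h : IsRegularRoot H c ρ) {ε : ℝ} (hε : 0 < ε) :
    ∃ η > 0, ∀ q, 0 ≤ q → c - η ≤ H q → ρ - ε ≤ q := by
  by_cases hne : (Icc 0 (ρ - ε)).Nonempty
  · obtain ⟨q₀, hq₀, hmax⟩ := isCompact_Icc.exists_isMaxOn hne hH.continuousOn
    have h1 : H q₀ < c := h.2.1 _ hq₀.1 (by linarith [hq₀.2])
    refine ⟨(c - H q₀) / 2, by have := sub_pos.2 h1; positivity, fun q hq hqc => ?_⟩
    by_contra! hlt
    have h3 : H q ≤ H q₀ := hmax (a := q) ⟨hq, hlt.le⟩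
    linarith
  · rw [nonempty_Icc, not_le] at hne
    exact ⟨1, one_pos, fun q hq _ => by linarith⟩

lemma IsRegularRoot.exists_lt_slope {H : ℝ → ℝ} (hH : Continuous H)
    {c c' ρ : ℝ} (h : IsRegularRoot H c ρ) (hρ : H ρ = c)
    (hcc : c < c') : ∃ η > 0, ∃ ε > 0, ∀ q, 0 ≤ q → c' - η ≤ H q → ρ + ε ≤ q := by
  have e1 : ∀ᶠ q in 𝓝 ρ, H q < (c + c') / 2 :=
    hH.continuousAt.eventually_lt continuousAt_const (by rw [hρ]; linarith)
  obtain ⟨ε, hε, hball⟩ := Metric.eventually_nhds_iff.1 e1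
  refine ⟨(c' - c) / 2, by linarith, ε, hε, fun q hq hqc => ?_⟩
  by_contra! hlt
  rcases lt_or_ge q ρ with h1 | h1
  · linarith [h.2.1 q hq h1]
  · have := hball (y := q) (by rw [Real.dist_eq, abs_lt]; constructor <;> linarith)
    linarith

/-- At a regular value the slope of a nondecreasing solution is the unique nonnegative root. -/
lemma IsMonoSol.hasDerivAt {H : ℝ → ℝ} (hH : Continuous H) (hco : Tendsto H (cocompact ℝ) atTop)
    {s u : ℝ → ℝ} (hu : IsMonoSol H s u) (hs : Continuous s) {y ρ : ℝ}
    (h : IsRegularRoot H (s y) ρ) : HasDerivAt u ρ y := by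
  have key : ∀ ε > 0, ∃ r > 0, ∀ a b, y - r < a → a < b → b < y + r →
      u b - u a ≤ (ρ + ε) * (b - a) ∧ (ρ - ε) * (b - a) ≤ u b - u a := by
    intro ε hε
    obtain ⟨η₁, hη₁, h1⟩ := h.eventually_slope_le hH hco hε
    obtain ⟨η₂, hη₂, h2⟩ := h.eventually_le_slope hH hε
    have e1 : ∀ᶠ x in 𝓝 y, s x < s y + η₁ :=
      hs.continuousAt.eventually_lt continuousAt_const (by linarith)
    have e2 : ∀ᶠ x in 𝓝 y, s y - η₂ < s x :=
      continuousAt_const.eventually_lt hs.continuousAt (by linarith)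
    obtain ⟨r, hr, hball⟩ := Metric.eventually_nhds_iff.1 (e1.and e2)
    refine ⟨r, hr, fun a b ha hab hb => ⟨?_, ?_⟩⟩
    · refine sub_le_mul_of_subAt (c := y + r) hu.continuous.continuousOn hab hb fun z hz => ?_
      refine (hu.sub z).imp fun q hq => h1 q (hq.trans (hball ?_).1.le)
      rw [Real.dist_eq, abs_lt]; constructor <;> linarith [hz.1, hz.2]
    · refine mul_le_sub_of_superAt (c := y + r) hu.continuous.continuousOn hab hb fun z hz => ?_
      intro φ hφ hm
      refine h2 _ (deriv_nonneg_of_isLocalMin_of_monotone hu.mono hφ hm)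
        ((hball ?_).2.le.trans (hu.sup z φ hφ hm))
      rw [Real.dist_eq, abs_lt]; constructor <;> linarith [hz.1, hz.2]
  refine hasDerivAt_of_slopes fun ε hε => ?_
  obtain ⟨r, hr, hk⟩ := key ε hε
  refine ⟨r, hr, fun a b ha hab hb => ?_⟩
  obtain ⟨k1, k2⟩ := hk a b ha hab hb
  rw [abs_le]; constructor <;> linarith

/-- Near `y` the test slopes of `u₁` are at most `ρ + ε / 2`, while those of `u₂`, which sees a
strictly larger right-hand side, are at least `ρ + ε`. Recurrent points of this kind are what
anchors the comparison at infinity. -/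
lemma IsMonoSol.strictAntiOn_sub {H : ℝ → ℝ} (hH : Continuous H) (hco : Tendsto H (cocompact ℝ) atTop)
    {s₁ s₂ u₁ u₂ : ℝ → ℝ} (h₁ : IsMonoSol H s₁ u₁)
    (h₂ : IsMonoSol H s₂ u₂) (hs₁ : Continuous s₁) (hs₂ : Continuous s₂) {y ρ : ℝ}
    (h : IsRegularRoot H (s₁ y) ρ) (hρ : H ρ = s₁ y) (hlt : s₁ y < s₂ y) :
    ∃ r > 0, StrictAntiOn (fun x => u₁ x - u₂ x) (Ioo (y - r) (y + r)) := by
  obtain ⟨η₂, hη₂, ε, hε, h2⟩ := h.exists_lt_slope hH hρ hlt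
  obtain ⟨η₁, hη₁, h1⟩ := h.eventually_slope_le hH hco (half_pos hε)
  have e1 : ∀ᶠ x in 𝓝 y, s₁ x < s₁ y + η₁ :=
    hs₁.continuousAt.eventually_lt continuousAt_const (by linarith)
  have e2 : ∀ᶠ x in 𝓝 y, s₂ y - η₂ < s₂ x :=
    continuousAt_const.eventually_lt hs₂.continuousAt (by linarith)
  obtain ⟨r, hr, hball⟩ := Metric.eventually_nhds_iff.1 (e1.and e2)
  refine ⟨r, hr, fun a ha b hb hab => ?_⟩
  have k1 := sub_le_mul_of_subAt (c := y + r) (ρ := ρ + ε / 2) h₁.continuous.continuousOn hab hb.2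
    fun z hz => (h₁.sub z).imp fun q hq => h1 q (hq.trans (hball
      (by rw [Real.dist_eq, abs_lt]; constructor <;> linarith [hz.1, hz.2, ha.1])).1.le)
  have k2 := mul_le_sub_of_superAt (c := y + r) (ρ := ρ + ε) h₂.continuous.continuousOn hab hb.2
    fun z hz φ hφ hm => h2 _ (deriv_nonneg_of_isLocalMin_of_monotone h₂.mono hφ hm)
      ((hball (by rw [Real.dist_eq, abs_lt]; constructor <;> linarith [hz.1, hz.2, ha.1])).2.le.trans
        (h₂.sup z φ hφ hm))
  have : 0 < ε / 2 * (b - a) := mul_pos (half_pos hε) (sub_pos.2 hab)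
  simp only
  nlinarith

/-- A continuous function without local maxima outside its locally nonincreasing points, and
decreasing somewhere arbitrarily far to the right, is nonincreasing. -/
theorem antitone_of_no_isLocalMax {w : ℝ → ℝ} (hw : Continuous w)
    (h : ∀ y, IsLocalMax w y → ∃ r > 0, AntitoneOn w (Ioo (y - r) (y + r)))
    (hfar : ∀ y, ∃ z > y, ∃ r > 0, StrictAntiOn w (Ioo (z - r) (z + r))) : Antitone w := by
  intro x x' hxx
  by_contra! hlt
  obtain ⟨z, hz, r, hr, hanti⟩ := hfar x'
  obtain ⟨e, he, hez⟩ : ∃ e, max x' (z - r) < e ∧ e < z := exists_between (max_lt hz (by linarith))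
  rw [max_lt_iff] at he
  have hxz : x ≤ z := by linarith
  have hcpt : IsCompact (Icc x z) := isCompact_Icc
  obtain ⟨m, hm, hmax⟩ := hcpt.exists_isMaxOn ⟨x, le_rfl, hxz⟩ hw.continuousOn
  have hMx : w x < w m := hlt.trans_le (hmax (a := x') ⟨hxx, hz.le⟩)
  have hMz : w z < w m := (hanti (a := e) ⟨he.2, by linarith⟩ (b := z) ⟨by linarith, by linarith⟩
    hez).trans_le (hmax (a := e) ⟨by linarith, hez.le⟩)
  -- Take the leftmost maximum point. It is interior, and `w` is nonincreasing around it, so points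
  -- slightly to its left are maximum points too, a contradiction.
  have hcl : IsCompact (Icc x z ∩ {t | w t = w m}) :=
    hcpt.inter_right (isClosed_eq hw continuous_const)
  obtain ⟨y, ⟨hy, hyM⟩, hymin⟩ := hcl.exists_isLeast ⟨m, hm, rfl⟩
  simp only [mem_ofPred_eq] at hyM
  have hxy : x < y := hy.1.lt_of_ne fun h => by subst h; linarith
  have hyz : y < z := hy.2.lt_of_ne fun h => by subst h; linarith
  obtain ⟨r', hr', han⟩ := h y (by
    filter_upwards [Icc_mem_nhds hxy hyz] with t ht
    rw [hyM]; exact hmax ht)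
  obtain ⟨t, ht1, ht2⟩ := exists_between (max_lt hxy (by linarith : y - r' < y))
  rw [max_lt_iff] at ht1
  have h1 := han (a := t) ⟨ht1.2, by linarith⟩ (b := y) ⟨by linarith, by linarith⟩ ht2.le
  have h2 : w t ≤ w m := hmax (a := t) ⟨ht1.1.le, by linarith⟩
  have := hymin ⟨⟨ht1.1.le, by linarith⟩, (by rw [mem_ofPred_eq]; linarith)⟩
  linarith

/-! ### Monotone branches -/

lemma IsNormalizedHamiltonian.continuous {H : ℝ → ℝ} (hH : IsNormalizedHamiltonian H) :
    Continuous H := hH.lipschitz.choose_spec.continuous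

section Branches
variable {H : ℝ → ℝ} {L : ℕ} {p : ℕ → ℝ}

lemma HasBumps.antitone (hb : HasBumps H L p) {i j : ℕ} (hi : 1 ≤ i) (hij : i ≤ j)
    (hj : j ≤ 2 * L + 1) : p j ≤ p i := by
  induction j, hij using Nat.le_induction with
  | base => exact le_rfl
  | succ k hk ih => exact (hb.decreasing k (by omega) (by omega)).le.trans (ih (by omega))

lemma HasBumps.nonneg (hb : HasBumps H L p) {i : ℕ} (hi : 1 ≤ i) (hj : i ≤ 2 * L + 1) :
    0 ≤ p i := hb.last ▸ hb.antitone hi hj le_rfl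

lemma mem_branch_iff {j : ℕ} {q : ℝ} :
    q ∈ branch p j ↔ (if j = 1 then True else q ≤ p (j - 1)) ∧ p j ≤ q := by
  unfold branch
  split_ifs with h
  · simp [h]
  · rw [mem_Icc, and_comm]

lemma isClosed_branch (j : ℕ) : IsClosed (branch p j) := by
  unfold branch; split_ifs
  · exact isClosed_Ici
  · exact isClosed_Icc

lemma ordConnected_branch (j : ℕ) : OrdConnected (branch p j) := by
  unfold branch; split_ifs
  · exact ordConnected_Ici
  · exact ordConnected_Icc

lemma le_of_mem_branch {j : ℕ} {q : ℝ} (hq : q ∈ branch p j) : p j ≤ q := (mem_branch_iff.1 hq).2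

lemma le_pred_of_mem_branch {j : ℕ} {q : ℝ} (hq : q ∈ branch p j) (hj : j ≠ 1) :
    q ≤ p (j - 1) := by simpa [hj] using (mem_branch_iff.1 hq).1

lemma HasBumps.left_mem (hb : HasBumps H L p) {j : ℕ} (h1 : 1 ≤ j) (h2 : j ≤ 2 * L + 1) :
    p j ∈ branch p j := by
  refine mem_branch_iff.2 ⟨?_, le_rfl⟩
  split_ifs with h
  · exact hb.antitone (by omega) (by omega) h2

lemma HasBumps.right_mem (hb : HasBumps H L p) {j : ℕ} (h1 : 2 ≤ j) (h2 : j ≤ 2 * L + 1) :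
    p (j - 1) ∈ branch p j := by
  refine mem_branch_iff.2 ⟨?_, hb.antitone (by omega) (by omega) h2⟩
  rw [if_neg (by omega)]

lemma HasBumps.nonneg_of_mem (hb : HasBumps H L p) {j : ℕ} (h1 : 1 ≤ j) (h2 : j ≤ 2 * L + 1)
    {q : ℝ} (hq : q ∈ branch p j) : 0 ≤ q := (hb.nonneg h1 h2).trans (le_of_mem_branch hq)

lemma HasBumps.exists_mem_branch (hb : HasBumps H L p) {q : ℝ} (hq : 0 ≤ q) :
    ∃ j, 1 ≤ j ∧ j ≤ 2 * L + 1 ∧ q ∈ branch p j := by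
  classical
  have hex : ∃ j, 1 ≤ j ∧ p j ≤ q := ⟨2 * L + 1, by omega, by rw [hb.last]; exact hq⟩
  have h := Nat.find_spec hex
  have hle : Nat.find hex ≤ 2 * L + 1 := Nat.find_min' hex ⟨by omega, by rw [hb.last]; exact hq⟩
  refine ⟨Nat.find hex, h.1, hle, mem_branch_iff.2 ⟨?_, h.2⟩⟩
  split_ifs with h1
  · have := Nat.find_min hex (m := Nat.find hex - 1) (by omega)
    push Not at this
    exact (this (by omega)).le

lemma HasBumps.strictMonoOn (hb : HasBumps H L p) {j : ℕ} (h2 : j ≤ 2 * L + 1) (hodd : Odd j) :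
    StrictMonoOn H (branch p j) := by
  obtain ⟨k, rfl⟩ := hodd
  unfold branch
  split_ifs with h
  · exact hb.mono_outer
  · exact hb.mono_inner k (by omega) (by omega)

lemma HasBumps.strictAntiOn (hb : HasBumps H L p) {j : ℕ} (h1 : 1 ≤ j) (h2 : j ≤ 2 * L + 1)
    (heven : Even j) : StrictAntiOn H (branch p j) := by
  obtain ⟨k, rfl⟩ := heven
  unfold branch
  rw [if_neg (by omega), ← two_mul]
  exact hb.anti_inner k (by omega) (by omega)

lemma HasBumps.injOn (hb : HasBumps H L p) {j : ℕ} (h1 : 1 ≤ j) (h2 : j ≤ 2 * L + 1) :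
    InjOn H (branch p j) := by
  rcases Nat.even_or_odd j with h | h
  · exact (hb.strictAntiOn h1 h2 h).injOn
  · exact (hb.strictMonoOn h2 h).injOn

lemma mem_criticalValues {i : ℕ} (h1 : 1 ≤ i) (h2 : i ≤ 2 * L) :
    H (p i) ∈ criticalValues H p L := by
  rcases Nat.even_or_odd i with ⟨k, hk⟩ | ⟨k, hk⟩
  · refine ⟨k, by omega, by omega, Or.inr ?_⟩
    unfold maxValue; congr 2; omega
  · refine ⟨k + 1, by omega, by omega, Or.inl ?_⟩
    unfold minValue; congr 2

lemma exists_of_mem_criticalValues {c : ℝ} (hc : c ∈ criticalValues H p L) :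
    ∃ i, 1 ≤ i ∧ i ≤ 2 * L ∧ c = H (p i) := by
  obtain ⟨j, h1, h2, h | h⟩ := hc
  · exact ⟨2 * j - 1, by omega, by omega, h⟩
  · exact ⟨2 * j, by omega, by omega, h⟩

lemma finite_criticalValues : (criticalValues H p L).Finite := by
  refine ((finite_Icc 1 (2 * L)).image fun i => H (p i)).subset fun c hc => ?_
  obtain ⟨i, h1, h2, rfl⟩ := exists_of_mem_criticalValues hc
  exact ⟨i, ⟨h1, h2⟩, rfl⟩

lemma HasBumps.pos_of_mem_criticalValues (hb : HasBumps H L p) {c : ℝ}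
    (hc : c ∈ criticalValues H p L) : 0 < c := by
  obtain ⟨i, h1, h2, rfl⟩ := exists_of_mem_criticalValues hc
  exact hb.values_pos i h1 h2

lemma IsNormalizedHamiltonian.exists_le (hH : IsNormalizedHamiltonian H) (c q₀ : ℝ) :
    ∃ q, q₀ ≤ q ∧ c ≤ H q := by
  obtain ⟨R, hR0, hR⟩ := exists_bound_of_coercive hH.coercive c
  refine ⟨max q₀ (R + 1), le_max_left _ _, ?_⟩
  by_contra! h
  have := (le_abs_self _).trans (hR _ h.le)
  linarith [le_max_right q₀ (R + 1)]

lemma IsNormalizedHamiltonian.exists_root (hH : IsNormalizedHamiltonian H) {c q₀ : ℝ}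
    (h0 : H q₀ ≤ c) : ∃ q, q₀ ≤ q ∧ H q = c := by
  obtain ⟨q, hq, hc⟩ := hH.exists_le c q₀
  obtain ⟨r, hr, h⟩ := intermediate_value_Icc hq hH.continuous.continuousOn ⟨h0, hc⟩
  exact ⟨r, hr.1, h⟩

/-- A value stays in the range of a branch as long as no critical value is crossed. -/
lemma HasBumps.mem_image_of_noncritical (hb : HasBumps H L p) (hH : IsNormalizedHamiltonian H)
    {j : ℕ} (h1 : 1 ≤ j) (h2 : j ≤ 2 * L + 1) {d e : ℝ} (hd : d ∈ H '' branch p j) (he : 0 ≤ e)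
    (hcrit : ∀ c ∈ uIcc d e, c ≠ e → c ∉ criticalValues H p L) : e ∈ H '' branch p j := by
  obtain ⟨x, hx, rfl⟩ := hd
  have hc := hH.continuous
  have hoc := ordConnected_branch (p := p) j
  have key : ∀ y ∈ branch p j, e ∈ uIcc (H x) (H y) → e ∈ H '' branch p j := by
    intro y hy hey
    obtain ⟨z, hz, h⟩ := intermediate_value_uIcc (hc.continuousOn (s := uIcc x y)) hey
    exact ⟨z, hoc.uIcc_subset hx hy hz, h⟩
  have crit_up : ∀ i, 1 ≤ i → i ≤ 2 * L → H x ≤ H (p i) → H x ≤ e → e ≤ H (p i) := by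
    intro i h1 h2 h3 h4
    by_contra! h5
    exact hcrit (H (p i)) (by rw [uIcc_of_le h4]; exact ⟨h3, h5.le⟩) h5.ne
      (mem_criticalValues h1 h2)
  have crit_down : ∀ i, 1 ≤ i → i ≤ 2 * L → H (p i) ≤ H x → e ≤ H x → H (p i) ≤ e := by
    intro i h1 h2 h3 h4
    by_contra! h5
    exact hcrit (H (p i)) (by rw [uIcc_of_ge h4]; exact ⟨h5.le, h3⟩) h5.ne'
      (mem_criticalValues h1 h2)
  have hl := hb.left_mem h1 h2
  rcases Nat.even_or_odd j with hj | hj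
  · have hanti := (hb.strictAntiOn h1 h2 hj).antitoneOn
    have hj2 : 2 ≤ j := by obtain ⟨k, rfl⟩ := hj; omega
    have hj3 : j ≤ 2 * L := by obtain ⟨k, rfl⟩ := hj; omega
    have hr := hb.right_mem hj2 h2
    rcases le_total (H x) e with hxe | hxe
    · have := hanti hl hx (le_of_mem_branch hx)
      exact key _ hl (by rw [uIcc_of_le this]; exact ⟨hxe, crit_up j h1 hj3 this hxe⟩)
    · have := hanti hx hr (le_pred_of_mem_branch hx (by omega))
      exact key _ hr (by rw [uIcc_of_ge this]
                         exact ⟨crit_down (j - 1) (by omega) (by omega) this hxe, hxe⟩)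
  · have hmono := (hb.strictMonoOn h2 hj).monotoneOn
    rcases le_total (H x) e with hxe | hxe
    · by_cases hj1 : j = 1
      · subst hj1
        obtain ⟨z, hz, hze⟩ := hH.exists_root hxe
        refine ⟨z, ?_, hze⟩
        have := le_of_mem_branch hx
        exact mem_branch_iff.2 ⟨by simp, by linarith⟩
      · have hj2 : 2 ≤ j := by omega
        have hr := hb.right_mem hj2 h2
        have := hmono hx hr (le_pred_of_mem_branch hx (by omega))
        exact key _ hr (by rw [uIcc_of_le this]
                           exact ⟨hxe, crit_up (j - 1) (by omega) (by omega) this hxe⟩)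
    · have := hmono hl hx (le_of_mem_branch hx)
      refine key _ hl ?_
      rw [uIcc_of_ge this]
      refine ⟨?_, hxe⟩
      by_cases hjL : j = 2 * L + 1
      · rw [hjL, hb.last, hH.zero]; exact he
      · exact crit_down j h1 (by omega) this hxe

lemma branchInv_mem {j : ℕ} {c : ℝ} (hc : c ∈ H '' branch p j) :
    branchInv H p j c ∈ branch p j := Function.invFunOn_mem hc

lemma apply_branchInv {j : ℕ} {c : ℝ} (hc : c ∈ H '' branch p j) :
    H (branchInv H p j c) = c := Function.invFunOn_eq hc

lemma HasBumps.branchInv_apply (hb : HasBumps H L p) {j : ℕ} (h1 : 1 ≤ j) (h2 : j ≤ 2 * L + 1)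
    {q : ℝ} (hq : q ∈ branch p j) : branchInv H p j (H q) = q :=
  hb.injOn h1 h2 (branchInv_mem ⟨q, hq, rfl⟩) hq (apply_branchInv ⟨q, hq, rfl⟩)

lemma HasBumps.branchInv_nonneg (hb : HasBumps H L p) {j : ℕ} (h1 : 1 ≤ j) (h2 : j ≤ 2 * L + 1)
    {c : ℝ} (hc : c ∈ H '' branch p j) : 0 ≤ branchInv H p j c :=
  hb.nonneg_of_mem h1 h2 (branchInv_mem hc)

lemma HasBumps.branchInv_le (hb : HasBumps H L p) {j k : ℕ} (h1 : 1 ≤ j) (hjk : j ≤ k)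
    (h2 : k ≤ 2 * L + 1) {c : ℝ} (hj : c ∈ H '' branch p j) (hk : c ∈ H '' branch p k) :
    branchInv H p k c ≤ branchInv H p j c := by
  rcases hjk.eq_or_lt with rfl | h
  · exact le_rfl
  · exact (le_pred_of_mem_branch (branchInv_mem hk) (by omega)).trans
      ((hb.antitone h1 (by omega) (by omega)).trans (le_of_mem_branch (branchInv_mem hj)))

/-- Different branches meet only at one of the points `p i`, whose value is critical. -/
lemma HasBumps.index_unique (hb : HasBumps H L p) {j k : ℕ} (hj1 : 1 ≤ j) (hj2 : j ≤ 2 * L + 1)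
    (hk1 : 1 ≤ k) (hk2 : k ≤ 2 * L + 1) {q : ℝ} (hj : q ∈ branch p j) (hk : q ∈ branch p k)
    (hq : H q ∉ criticalValues H p L) : j = k := by
  have key : ∀ j k : ℕ, 1 ≤ j → k ≤ 2 * L + 1 → q ∈ branch p j → q ∈ branch p k → ¬ j < k := by
    intro j k h1 h2 hj hk h
    have h3 := le_pred_of_mem_branch hk (by omega)
    have h4 := hb.antitone h1 (j := k - 1) (by omega) (by omega)
    have h5 : q = p j := le_antisymm (h3.trans h4) (le_of_mem_branch hj)
    exact hq (h5 ▸ mem_criticalValues h1 (by omega))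
  have h1 := key j k hj1 hk2 hj hk
  have h2 := key k j hk1 hj2 hk hj
  omega

lemma isClosed_image_branch (hH : IsNormalizedHamiltonian H) (j : ℕ) :
    IsClosed (H '' branch p j) := by
  have hc := hH.continuous
  have hp : IsProperMap H := isProperMap_iff_tendsto_cocompact.2
    ⟨hc, hH.coercive.mono_right atTop_le_cocompact⟩
  exact hp.isClosedMap _ (isClosed_branch j)

/-- `H` is injective on the closed branch and coercive: on the compact set of bounded branch points
at distance at least `ε` from the root `x₀`, the values of `H` stay away from `c₀`. -/
lemma HasBumps.continuousOn_branchInv (hb : HasBumps H L p) (hH : IsNormalizedHamiltonian H)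
    {j : ℕ} (h1 : 1 ≤ j) (h2 : j ≤ 2 * L + 1) :
    ContinuousOn (branchInv H p j) (H '' branch p j) := by
  have hc := hH.continuous
  rw [Metric.continuousOn_iff]
  intro c₀ hc₀ ε hε
  set x₀ := branchInv H p j c₀ with hx₀
  have hx₀m := branchInv_mem hc₀
  have hHx₀ := apply_branchInv hc₀
  obtain ⟨R, hR0, hR⟩ := exists_bound_of_coercive hH.coercive (c₀ + 1)
  set A := Icc (-R) R ∩ (branch p j ∩ {q | ε ≤ |q - x₀|}) with hA
  have hAc : IsCompact A := isCompact_Icc.inter_right ((isClosed_branch j).inter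
    (isClosed_le continuous_const (by fun_prop)))
  obtain ⟨δ, hδ, hδA⟩ : ∃ δ > 0, ∀ q ∈ A, δ ≤ |H q - c₀| := by
    by_cases hne : A.Nonempty
    · obtain ⟨q, hq, hmin⟩ := hAc.exists_isMinOn hne (f := fun q => |H q - c₀|) (by fun_prop)
      refine ⟨|H q - c₀|, abs_pos.2 fun h => ?_, fun r hr => hmin hr⟩
      have : q = x₀ := hb.injOn h1 h2 hq.2.1 hx₀m (by rw [hHx₀]; linarith)
      have h3 : ε ≤ |q - x₀| := hq.2.2
      rw [this] at h3; simp at h3; linarith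
    · rw [not_nonempty_iff_eq_empty] at hne
      exact ⟨1, one_pos, by simp [hne]⟩
  refine ⟨min 1 δ, by positivity, fun c hcm hcd => ?_⟩
  rw [Real.dist_eq] at hcd ⊢
  by_contra! hlt
  have h3 : branchInv H p j c ∈ A := by
    have := hR (branchInv H p j c) (by
      rw [apply_branchInv hcm]
      linarith [(abs_lt.1 (hcd.trans_le (min_le_left _ _))).2])
    exact ⟨⟨by linarith [(abs_le.1 this).1], (abs_le.1 this).2⟩, branchInv_mem hcm, hlt⟩
  have := hδA _ h3
  rw [apply_branchInv hcm] at this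
  exact absurd (hcd.trans_le (min_le_right _ _)) (not_lt.2 this)

/-- Passing from a root `x` at level `c` to the closest root above it at a higher level. -/
lemma HasBumps.exists_branch_up (hb : HasBumps H L p) (hH : IsNormalizedHamiltonian H) {x c d : ℝ}
    (hx : 0 ≤ x) (hxc : H x = c) (hcd : c < d) (hcrit : ∀ e ∈ Ioc c d, e ∉ criticalValues H p L) :
    ∃ j, 1 ≤ j ∧ j ≤ 2 * L + 1 ∧ d ∈ H '' branch p j ∧ c ∈ H '' branch p j ∧
      x ≤ branchInv H p j c ∧ ∀ q, x ≤ q → q ≤ branchInv H p j c → H q ≤ c := by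
  have hHc := hH.continuous
  have hcl : IsClosed (Ici x ∩ {q | d ≤ H q}) :=
    isClosed_Ici.inter (isClosed_le continuous_const hHc)
  obtain ⟨q₁, hq₁, hq₁d⟩ := hH.exists_le d x
  have hbdd : BddBelow (Ici x ∩ {q | d ≤ H q}) := ⟨x, fun q hq => hq.1⟩
  -- The first point to the right of `x` where `H` reaches `d`; coercivity guarantees that there is
  -- one.
  obtain ⟨x', ⟨hxx', hx'd⟩, hmin⟩ : ∃ x', IsLeast (Ici x ∩ {q | d ≤ H q}) x' :=
    ⟨_, hcl.isLeast_csInf ⟨q₁, hq₁, hq₁d⟩ hbdd⟩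
  have hx'd : d ≤ H x' := hx'd
  have hxx' : x ≤ x' := hxx'
  have hlt : ∀ q, x ≤ q → q < x' → H q < d := fun q h1 h2 => by
    by_contra! h3; exact absurd (hmin ⟨h1, h3⟩) (not_le.2 h2)
  have hHx' : H x' = d := by
    refine le_antisymm ?_ hx'd
    obtain ⟨r, hr, hrd⟩ := intermediate_value_Icc hxx' hHc.continuousOn
      (show d ∈ Icc (H x) (H x') from ⟨by linarith, hx'd⟩)
    have : x' ≤ r := hmin ⟨hr.1, hrd.ge⟩
    rw [← hrd, le_antisymm this hr.2]
  have hxlt : x < x' := hxx'.lt_of_ne fun h => by rw [← h] at hHx'; linarith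
  obtain ⟨j, h1, h2, hj⟩ := hb.exists_mem_branch (hx.trans hxx')
  have hdcrit : d ∉ criticalValues H p L := hcrit d ⟨hcd, le_rfl⟩
  -- `H` is below `d` just to the left of `x'`, so `x'` cannot lie on a decreasing branch; it is not
  -- an endpoint since `d` is noncritical.
  have hodd : Odd j := by
    rw [← Nat.not_even_iff_odd]
    intro heven
    have hanti := hb.strictAntiOn h1 h2 heven
    have hne : p j ≠ x' := fun h => hdcrit (by
      rw [← hHx', ← h]
      exact mem_criticalValues h1 (by obtain ⟨k, rfl⟩ := heven; omega))
    obtain ⟨q, hq1, hq2⟩ := exists_between (max_lt hxlt ((le_of_mem_branch hj).lt_of_ne hne))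
    rw [max_lt_iff] at hq1
    have := hanti ((ordConnected_branch j).out (hb.left_mem h1 h2) hj ⟨hq1.2.le, hq2.le⟩) hj hq2
    linarith [hlt q hq1.1.le hq2]
  have hmono := hb.strictMonoOn h2 hodd
  have hdj : d ∈ H '' branch p j := ⟨x', hj, hHx'⟩
  have hcj : c ∈ H '' branch p j := by
    refine hb.mem_image_of_noncritical hH h1 h2 hdj (hxc ▸ hH.nonneg x) fun e he hne => hcrit e ?_
    rw [uIcc_of_ge hcd.le] at he
    exact ⟨he.1.lt_of_ne' hne, he.2⟩
  set y := branchInv H p j c with hy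
  have hyj : y ∈ branch p j := branchInv_mem hcj
  have hHy : H y = c := apply_branchInv hcj
  have hyx' : y < x' := (hmono.lt_iff_lt hyj hj).1 (by rw [hHy, hHx']; exact hcd)
  have hxy : x ≤ y := by
    by_contra! h
    have := hmono hyj ((ordConnected_branch j).out hyj hj ⟨h.le, hxx'⟩) h
    linarith
  refine ⟨j, h1, h2, hdj, hcj, hxy, fun q hxq hqy => ?_⟩
  -- A point between `x` and `y` with value above `c` would force a local maximum before `x'` with
  -- value in `(c, d]`, which is excluded as critical, or would contradict monotonicity on its own
  -- branch.
  by_contra! hq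
  have hqd := hlt q hxq (hqy.trans_lt hyx')
  obtain ⟨k, k1, k2, hk⟩ := hb.exists_mem_branch (hx.trans hxq)
  have hjump : ∀ i, 1 ≤ i → i ≤ 2 * L → H q ≤ H (p i) → x ≤ p i → x' ≤ p i := by
    intro i i1 i2 h3 h4
    by_contra! h5
    exact hcrit (H (p i)) ⟨by linarith, (hlt _ h4 h5).le⟩ (mem_criticalValues i1 i2)
  rcases Nat.even_or_odd k with hev | hod
  · have hanti := (hb.strictAntiOn k1 k2 hev).antitoneOn
    have h3 := hanti (hb.left_mem k1 k2) hk (le_of_mem_branch hk)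
    have h4 := le_of_mem_branch hk
    have hkL : k ≤ 2 * L := by obtain ⟨m, rfl⟩ := hev; omega
    rcases le_or_gt x (p k) with h5 | h5
    · have := hjump k k1 hkL h3 h5
      linarith
    · have hxk := (ordConnected_branch k).out (hb.left_mem k1 k2) hk ⟨h5.le, hxq⟩
      have := hanti hxk hk hxq
      linarith
  · have hmk := (hb.strictMonoOn k2 hod).monotoneOn
    have hx'k : x' ∈ branch p k := by
      refine mem_branch_iff.2 ⟨?_, by linarith [le_of_mem_branch hk]⟩
      split_ifs with hk1
      · have hkr := hb.right_mem (by omega) k2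
        have h5 := le_pred_of_mem_branch hk hk1
        exact hjump (k - 1) (by omega) (by omega) (hmk hk hkr h5) (by linarith)
    have hyk := (ordConnected_branch k).out hk hx'k ⟨hqy, hyx'.le⟩
    have := hmk hk hyk hqy
    linarith

/-- Passing from a root `x` at level `c` to the closest root below it at a lower level. -/
lemma HasBumps.exists_branch_down (hb : HasBumps H L p) (hH : IsNormalizedHamiltonian H)
    {x c d : ℝ} (hx : 0 ≤ x) (hxc : H x = c) (hd : 0 ≤ d) (hcd : d < c)
    (hcrit : ∀ e ∈ Ico d c, e ∉ criticalValues H p L) :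
    ∃ j, 1 ≤ j ∧ j ≤ 2 * L + 1 ∧ d ∈ H '' branch p j ∧ c ∈ H '' branch p j ∧
      branchInv H p j c ≤ x ∧ ∀ q, branchInv H p j c ≤ q → q ≤ x → c ≤ H q := by
  have hHc := hH.continuous
  have hcl : IsClosed (Icc 0 x ∩ {q | H q ≤ d}) :=
    isClosed_Icc.inter (isClosed_le hHc continuous_const)
  have hbdd : BddAbove (Icc 0 x ∩ {q | H q ≤ d}) := ⟨x, fun q hq => hq.1.2⟩
  -- The last point before `x` where `H` is at most `d`; the search succeeds because `H` vanishes at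
  -- `0`.
  obtain ⟨x', ⟨⟨hx'0, hxx'⟩, hx'd⟩, hmax⟩ : ∃ x', IsGreatest (Icc 0 x ∩ {q | H q ≤ d}) x' :=
    ⟨_, hcl.isGreatest_csSup ⟨0, ⟨le_rfl, hx⟩, by rw [mem_ofPred_eq, hH.zero]; exact hd⟩ hbdd⟩
  have hx'd : H x' ≤ d := hx'd
  have hlt : ∀ q, x' < q → q ≤ x → d < H q := fun q h1 h2 => by
    by_contra! h3; exact absurd (hmax ⟨⟨hx'0.trans h1.le, h2⟩, h3⟩) (not_le.2 h1)
  have hHx' : H x' = d := by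
    refine le_antisymm hx'd ?_
    obtain ⟨r, hr, hrd⟩ := intermediate_value_Icc hxx' hHc.continuousOn
      (show d ∈ Icc (H x') (H x) from ⟨hx'd, by linarith⟩)
    have : r ≤ x' := hmax ⟨⟨hx'0.trans hr.1, hr.2⟩, hrd.le⟩
    rw [← hrd, le_antisymm this hr.1]
  have hxlt : x' < x := hxx'.lt_of_ne fun h => by rw [h] at hHx'; linarith
  obtain ⟨j, h1, h2, hj⟩ := hb.exists_mem_branch hx'0
  have hdcrit : d ∉ criticalValues H p L := hcrit d ⟨le_rfl, hcd⟩
  have hodd : Odd j := by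
    rw [← Nat.not_even_iff_odd]
    intro heven
    have hanti := hb.strictAntiOn h1 h2 heven
    have hj2 : 2 ≤ j := by obtain ⟨k, rfl⟩ := heven; omega
    have hjL : j ≤ 2 * L := by obtain ⟨k, rfl⟩ := heven; omega
    have hne : x' ≠ p (j - 1) := fun h => hdcrit (by
      rw [← hHx', h]
      exact mem_criticalValues (by omega) (by omega))
    obtain ⟨q, hq1, hq2⟩ := exists_between
      (lt_min hxlt ((le_pred_of_mem_branch hj (by omega)).lt_of_ne hne))
    rw [lt_min_iff] at hq2
    have := hanti hj ((ordConnected_branch j).out hj (hb.right_mem hj2 h2) ⟨hq1.le, hq2.2.le⟩) hq1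
    linarith [hlt q hq1 hq2.1.le]
  have hmono := hb.strictMonoOn h2 hodd
  have hdj : d ∈ H '' branch p j := ⟨x', hj, hHx'⟩
  have hcj : c ∈ H '' branch p j := by
    refine hb.mem_image_of_noncritical hH h1 h2 hdj (hxc ▸ hH.nonneg x) fun e he hne => hcrit e ?_
    rw [uIcc_of_le hcd.le] at he
    exact ⟨he.1, he.2.lt_of_ne hne⟩
  set y := branchInv H p j c with hy
  have hyj : y ∈ branch p j := branchInv_mem hcj
  have hHy : H y = c := apply_branchInv hcj
  have hyx' : x' < y := (hmono.lt_iff_lt hj hyj).1 (by rw [hHy, hHx']; exact hcd)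
  have hxy : y ≤ x := by
    by_contra! h
    have := hmono ((ordConnected_branch j).out hj hyj ⟨hxx', h.le⟩) hyj h
    linarith
  refine ⟨j, h1, h2, hdj, hcj, hxy, fun q hyq hqx => ?_⟩
  by_contra! hq
  have hqd := hlt q (hyx'.trans_le hyq) hqx
  obtain ⟨k, k1, k2, hk⟩ := hb.exists_mem_branch (q := q) (by linarith)
  have hjump : ∀ i, 1 ≤ i → i ≤ 2 * L → H (p i) ≤ H q → p i ≤ x → p i ≤ x' := by
    intro i i1 i2 h3 h4
    by_contra! h5
    exact hcrit (H (p i)) ⟨(hlt _ h5 h4).le, by linarith⟩ (mem_criticalValues i1 i2)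
  rcases Nat.even_or_odd k with hev | hod
  · have hanti := (hb.strictAntiOn k1 k2 hev).antitoneOn
    have hk2 : 2 ≤ k := by obtain ⟨m, rfl⟩ := hev; omega
    have hkL : k ≤ 2 * L := by obtain ⟨m, rfl⟩ := hev; omega
    have hkr := hb.right_mem hk2 k2
    have h4 := le_pred_of_mem_branch hk (by omega)
    have h3 := hanti hk hkr h4
    rcases le_or_gt (p (k - 1)) x with h5 | h5
    · have := hjump (k - 1) (by omega) (by omega) h3 h5
      linarith
    · have hxk := (ordConnected_branch k).out hk hkr ⟨hqx, h5.le⟩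
      have := hanti hk hxk hqx
      linarith
  · have hmk := (hb.strictMonoOn k2 hod).monotoneOn
    have hpk : p k ≤ x' := by
      by_cases hkL : k = 2 * L + 1
      · rw [hkL, hb.last]; exact hx'0
      · have h5 := le_of_mem_branch hk
        exact hjump k k1 (by omega) (hmk (hb.left_mem k1 k2) hk h5) (by linarith)
    have hyk := (ordConnected_branch k).out (hb.left_mem k1 k2) hk ⟨hpk.trans hyx'.le, hyq⟩
    have := hmk hyk hk hyq
    linarith

end Branches

/-! ### Decompositions of the line -/

/-- The continuous function `s ≥ 0` takes critical values on a discrete set that is unbounded in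
both directions. -/
structure IsBumpRhs (H : ℝ → ℝ) (p : ℕ → ℝ) (L : ℕ) (s : ℝ → ℝ) : Prop where
  continuous : Continuous s
  nonneg : ∀ y, 0 ≤ s y
  finite : ∀ a b, (Icc a b ∩ {y | s y ∈ criticalValues H p L}).Finite
  top : ∀ x, ∃ y, x < y ∧ s y ∈ criticalValues H p L
  bot : ∀ x, ∃ y, y < x ∧ s y ∈ criticalValues H p L

/-- On every open interval without critical points, `f` follows one branch of the inverse. -/
def IsBranchwise (H : ℝ → ℝ) (p : ℕ → ℝ) (L : ℕ) (s f : ℝ → ℝ) : Prop :=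
  ∀ x y, x < y → (∀ z ∈ Ioo x y, s z ∉ criticalValues H p L) →
    ∃ j, 1 ≤ j ∧ j ≤ 2 * L + 1 ∧ ∀ z ∈ Ioo x y, s z ∈ H '' branch p j ∧ f z = branchInv H p j (s z)

/-- A solution derivative with values in `[0, b]` that follows the branches. -/
structure AdmDeriv (H : ℝ → ℝ) (p : ℕ → ℝ) (L : ℕ) (s : ℝ → ℝ) (b : ℝ) (f : ℝ → ℝ) : Prop where
  sol : SolDeriv H s f
  nonneg : ∀ y, 0 ≤ f y
  le : ∀ y, f y ≤ b
  branchwise : IsBranchwise H p L s f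

/-- A locally finite set of reals that is unbounded in both directions is order isomorphic to `ℤ`.
-/
lemma exists_int_orderEmbedding {Z : Set ℝ} (hfin : ∀ a b, (Icc a b ∩ Z).Finite)
    (htop : ∀ x, ∃ y ∈ Z, x < y) (hbot : ∀ x, ∃ y ∈ Z, y < x) :
    ∃ a : ℤ → ℝ, StrictMono a ∧ Tendsto a atTop atTop ∧ Tendsto a atBot atBot ∧ range a = Z := by
  classical
  have hfin' : ∀ a b : Z, (Icc a b).Finite := fun a b => by
    refine Finite.of_finite_image ((hfin a b).subset ?_) Subtype.val_injective.injOn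
    rintro _ ⟨z, hz, rfl⟩
    exact ⟨⟨hz.1, hz.2⟩, z.2⟩
  let _ : LocallyFiniteOrder Z := LocallyFiniteOrder.ofFiniteIcc hfin'
  let _ : SuccOrder Z := LinearLocallyFiniteOrder.succOrder Z
  let _ : PredOrder Z := LinearLocallyFiniteOrder.predOrder Z
  have _ : NoMaxOrder Z := ⟨fun z => by
    obtain ⟨y, hy, h⟩ := htop z; exact ⟨⟨y, hy⟩, h⟩⟩
  have _ : NoMinOrder Z := ⟨fun z => by
    obtain ⟨y, hy, h⟩ := hbot z; exact ⟨⟨y, hy⟩, h⟩⟩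
  have _ : Nonempty Z := by obtain ⟨y, hy, h⟩ := htop 0; exact ⟨⟨y, hy⟩⟩
  let e : Z ≃o ℤ := orderIsoIntOfLinearSuccPredArch
  have hmono : StrictMono fun i : ℤ => (e.symm i : ℝ) := fun i j hij => e.symm.strictMono hij
  refine ⟨fun i => e.symm i, hmono, ?_, ?_, ?_⟩
  · refine tendsto_atTop_atTop_of_monotone hmono.monotone fun x => ?_
    obtain ⟨y, hy, h⟩ := htop x
    exact ⟨e ⟨y, hy⟩, by simpa using h.le⟩
  · refine tendsto_atBot_atBot_of_monotone hmono.monotone fun x => ?_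
    obtain ⟨y, hy, h⟩ := hbot x
    exact ⟨e ⟨y, hy⟩, by simpa using h.le⟩
  · ext z
    constructor
    · rintro ⟨i, rfl⟩; exact (e.symm i).2
    · intro hz; exact ⟨e ⟨z, hz⟩, by simp⟩

lemma exists_index {a : ℤ → ℝ} (ha : StrictMono a) (htop : Tendsto a atTop atTop)
    (hbot : Tendsto a atBot atBot) (y : ℝ) : ∃ i, a i ≤ y ∧ y < a (i + 1) := by
  obtain ⟨N, hN⟩ := (htop.eventually_gt_atTop y).exists
  obtain ⟨M, hM⟩ := (hbot.eventually_le_atBot y).exists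
  obtain ⟨i, hi, hmax⟩ := Int.exists_greatest_of_bdd (P := fun i => a i ≤ y)
    ⟨N, fun z hz => by
      by_contra! h
      exact absurd hz (not_le.2 (hN.trans (ha h)))⟩ ⟨M, hM⟩
  refine ⟨i, hi, ?_⟩
  by_contra! h
  have := hmax _ h
  omega

/-- A backward-extendable finite-state relation has a two-sided infinite chain. -/
lemma exists_int_chain {P : ℤ → ℕ → Prop} {R : ℤ → ℕ → ℕ → Prop} {B : ℕ}
    (hB : ∀ i j, P i j → j ≤ B) (h0 : ∀ i, ∃ j, P i j)
    (hstep : ∀ i j, P i j → ∃ j', P (i - 1) j' ∧ R i j' j) :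
    ∃ J : ℤ → ℕ, ∀ i, P i (J i) ∧ R i (J (i - 1)) (J i) := by
  classical
  -- Backward extension produces, for each `N`, a chain on `(-∞, N]`.
  have hchain : ∀ N : ℤ, ∃ K : ℕ → ℕ, ∀ n : ℕ, P (N - n) (K n) ∧ R (N - n) (K (n + 1)) (K n) := by
    intro N
    choose g hg using h0
    choose! st hst using hstep
    let K : ℕ → ℕ := fun n => Nat.rec (g N) (fun n k => st (N - n) k) n
    have hK : ∀ n : ℕ, P (N - n) (K n) := by
      intro n
      induction n with
      | zero => simpa [K] using hg N
      | succ n ih =>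
        have := (hst _ _ ih).1
        rw [show N - ((n + 1 : ℕ) : ℤ) = N - n - 1 by push_cast; ring]
        exact this
    exact ⟨K, fun n => ⟨hK n, (hst _ _ (hK n)).2⟩⟩
  choose K hK using hchain
  -- At each index the states are bounded, so along an ultrafilter `N → ∞` they become constant; the
  -- limiting states form a chain on all of `ℤ`, as each relation involves only two of them.
  let U : Ultrafilter ℕ := hyperfilter ℕ
  have hU : (U : Filter ℕ) ≤ atTop := Nat.hyperfilter_le_atTop
  have hev : ∀ i : ℤ, ∀ᶠ N : ℕ in U, i ≤ N := fun i => by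
    refine hU ?_
    filter_upwards [eventually_ge_atTop i.toNat] with N hN
    omega
  let F : ℕ → ℤ → ℕ := fun N i => K N (N - i).toNat
  have hF : ∀ i : ℤ, ∃ v, ∀ᶠ N in U, F N i = v := by
    intro i
    have : ∀ᶠ N in U, ∃ v ∈ Iic B, F N i = v := by
      filter_upwards [hev i] with N hN
      refine ⟨_, hB i _ ?_, rfl⟩
      have := (hK N (N - i).toNat).1
      rwa [show (N : ℤ) - ((N - i).toNat : ℤ) = i by omega] at this
    obtain ⟨v, -, hv⟩ := (U.eventually_exists_mem_iff (finite_Iic B)).1 this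
    exact ⟨v, hv⟩
  choose J hJ using hF
  refine ⟨J, fun i => ?_⟩
  obtain ⟨N, h1, h2, h3⟩ := ((hJ i).and ((hJ (i - 1)).and (hev i))).exists
  have := hK N (N - i).toNat
  rw [show (N : ℤ) - ((N - i).toNat : ℤ) = i by omega,
    show (N - i).toNat + 1 = ((N : ℤ) - (i - 1)).toNat by omega] at this
  simp only [F] at h1 h2
  rwa [h1, h2] at this

section Adm
variable {H : ℝ → ℝ} {L : ℕ} {p : ℕ → ℝ} {s f : ℝ → ℝ} {b : ℝ}

lemma HasBumps.image_of_critFree (hb : HasBumps H L p) (hH : IsNormalizedHamiltonian H)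
    (hs : Continuous s) (hs0 : ∀ y, 0 ≤ s y) {x y z a : ℝ}
    (hfree : ∀ z ∈ Ioo x y, s z ∉ criticalValues H p L) (hz : z ∈ Ioo x y) (ha : a ∈ Icc x y)
    {j : ℕ} (h1 : 1 ≤ j) (h2 : j ≤ 2 * L + 1) (hj : s z ∈ H '' branch p j) :
    s a ∈ H '' branch p j := by
  refine hb.mem_image_of_noncritical hH h1 h2 hj (hs0 a) fun c hc hne => ?_
  obtain ⟨w, hw, rfl⟩ := intermediate_value_uIcc (hs.continuousOn (s := uIcc z a)) hc
  have hwa : w ≠ a := fun h => hne (by rw [h])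
  refine hfree w ?_
  rcases le_total z a with h | h
  · rw [uIcc_of_le h] at hw
    exact ⟨hz.1.trans_le hw.1, (hw.2.lt_of_ne hwa).trans_le ha.2⟩
  · rw [uIcc_of_ge h] at hw
    exact ⟨ha.1.trans_lt (hw.1.lt_of_ne' hwa), hw.2.trans_lt hz.2⟩

lemma HasBumps.tendsto_right_of_branch (hb : HasBumps H L p) (hH : IsNormalizedHamiltonian H)
    (hs : Continuous s) {x y : ℝ} (hxy : x < y) {j : ℕ} (h1 : 1 ≤ j) (h2 : j ≤ 2 * L + 1)
    (hj : ∀ z ∈ Ioo x y, s z ∈ H '' branch p j ∧ f z = branchInv H p j (s z)) :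
    s x ∈ H '' branch p j ∧ Tendsto f (𝓝[>] x) (𝓝 (branchInv H p j (s x))) := by
  have hst : Tendsto s (𝓝[>] x) (𝓝 (s x)) := hs.continuousAt.tendsto.mono_left nhdsWithin_le_nhds
  have hev : ∀ᶠ z in 𝓝[>] x, z ∈ Ioo x y := Ioo_mem_nhdsGT hxy
  have hx : s x ∈ H '' branch p j :=
    (isClosed_image_branch hH j).mem_of_tendsto hst (hev.mono fun z hz => (hj z hz).1)
  refine ⟨hx, ?_⟩
  have := (hb.continuousOn_branchInv hH h1 h2 _ hx).tendsto.comp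
    (tendsto_nhdsWithin_iff.2 ⟨hst, hev.mono fun z hz => (hj z hz).1⟩)
  exact this.congr' (hev.mono fun z hz => (hj z hz).2.symm)

lemma HasBumps.tendsto_left_of_branch (hb : HasBumps H L p) (hH : IsNormalizedHamiltonian H)
    (hs : Continuous s) {x y : ℝ} (hxy : x < y) {j : ℕ} (h1 : 1 ≤ j) (h2 : j ≤ 2 * L + 1)
    (hj : ∀ z ∈ Ioo x y, s z ∈ H '' branch p j ∧ f z = branchInv H p j (s z)) :
    s y ∈ H '' branch p j ∧ Tendsto f (𝓝[<] y) (𝓝 (branchInv H p j (s y))) := by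
  have hst : Tendsto s (𝓝[<] y) (𝓝 (s y)) := hs.continuousAt.tendsto.mono_left nhdsWithin_le_nhds
  have hev : ∀ᶠ z in 𝓝[<] y, z ∈ Ioo x y := Ioo_mem_nhdsLT hxy
  have hx : s y ∈ H '' branch p j :=
    (isClosed_image_branch hH j).mem_of_tendsto hst (hev.mono fun z hz => (hj z hz).1)
  refine ⟨hx, ?_⟩
  have := (hb.continuousOn_branchInv hH h1 h2 _ hx).tendsto.comp
    (tendsto_nhdsWithin_iff.2 ⟨hst, hev.mono fun z hz => (hj z hz).1⟩)
  exact this.congr' (hev.mono fun z hz => (hj z hz).2.symm)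

lemma IsBumpRhs.exists_critFree (h : IsBumpRhs H p L s) (y : ℝ) :
    ∃ x z, x < y ∧ y < z ∧ (∀ t ∈ Ioo x y, s t ∉ criticalValues H p L) ∧
      ∀ t ∈ Ioo y z, s t ∉ criticalValues H p L := by
  have hfin : (Icc (y - 1) (y + 1) ∩ {t | s t ∈ criticalValues H p L ∧ t ≠ y}).Finite :=
    (h.finite (y - 1) (y + 1)).subset fun t ht => ⟨ht.1, ht.2.1⟩
  have hn := hfin.isClosed.isOpen_compl.mem_nhds (show y ∈ _ by simp)
  obtain ⟨r, hr, hball⟩ := Metric.mem_nhds_iff.1 hn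
  have key : ∀ t, t ≠ y → |t - y| < min r 1 → s t ∉ criticalValues H p L := by
    intro t hty ht hc
    have h1 : t ∈ Metric.ball y r := by
      rw [Metric.mem_ball, Real.dist_eq]; exact ht.trans_le (min_le_left _ _)
    have h2 := abs_lt.1 (ht.trans_le (min_le_right _ _))
    exact hball h1 ⟨⟨by linarith, by linarith⟩, hc, hty⟩
  have hm : 0 < min r 1 := by positivity
  refine ⟨y - min r 1, y + min r 1, by linarith, by linarith, fun t ht => key t ht.2.ne ?_,
    fun t ht => key t ht.1.ne' ?_⟩
  · rw [abs_lt]; constructor <;> linarith [ht.1, ht.2]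
  · rw [abs_lt]; constructor <;> linarith [ht.1, ht.2]

lemma IsBumpRhs.isOpen_compl (h : IsBumpRhs H p L s) :
    IsOpen {y | s y ∉ criticalValues H p L} :=
  (finite_criticalValues.isClosed.preimage h.continuous).isOpen_compl

lemma IsBumpRhs.countable (h : IsBumpRhs H p L s) :
    {y | s y ∈ criticalValues H p L}.Countable := by
  have : {y | s y ∈ criticalValues H p L}
      = ⋃ n : ℕ, Icc (-(n : ℝ)) n ∩ {y | s y ∈ criticalValues H p L} := by
    ext y
    simp only [mem_iUnion]
    constructor
    · intro hy
      obtain ⟨n, hn⟩ := exists_nat_ge |y|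
      exact ⟨n, abs_le.1 hn, hy⟩
    · rintro ⟨n, -, hy⟩; exact hy
  rw [this]
  exact countable_iUnion fun n => (h.finite _ _).countable

lemma IsBumpRhs.ae_notMem (h : IsBumpRhs H p L s) : ∀ᵐ y, s y ∉ criticalValues H p L := by
  have := h.countable.measure_zero volume
  rw [ae_iff]
  simpa using this

/-- Near a noncritical point, `f` follows one branch. -/
lemma IsBumpRhs.exists_nhds_branch (h : IsBumpRhs H p L s) (hf : IsBranchwise H p L s f) {y : ℝ}
    (hy : s y ∉ criticalValues H p L) : ∃ x z j, x < y ∧ y < z ∧ 1 ≤ j ∧ j ≤ 2 * L + 1 ∧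
      ∀ t ∈ Ioo x z, s t ∈ H '' branch p j ∧ f t = branchInv H p j (s t) := by
  obtain ⟨x, z, hx, hz, h1, h2⟩ := h.exists_critFree y
  obtain ⟨j, j1, j2, hj⟩ := hf x z (hx.trans hz) (fun t ht => by
    rcases lt_trichotomy t y with h3 | h3 | h3
    · exact h1 t ⟨ht.1, h3⟩
    · rw [h3]; exact hy
    · exact h2 t ⟨h3, ht.2⟩)
  exact ⟨x, z, j, hx, hz, j1, j2, hj⟩

lemma IsBumpRhs.continuousAt (h : IsBumpRhs H p L s) (hb : HasBumps H L p)
    (hH : IsNormalizedHamiltonian H) (hf : IsBranchwise H p L s f) {y : ℝ}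
    (hy : s y ∉ criticalValues H p L) : ContinuousAt f y := by
  obtain ⟨x, z, j, hx, hz, j1, j2, hj⟩ := h.exists_nhds_branch hf hy
  have h1 : ∀ᶠ t in 𝓝 y, t ∈ Ioo x z := Ioo_mem_nhds hx hz
  have h2 := (hb.continuousOn_branchInv hH j1 j2 _ (hj y ⟨hx, hz⟩).1).tendsto.comp
    (tendsto_nhdsWithin_iff.2 ⟨h.continuous.continuousAt.tendsto, h1.mono fun t ht => (hj t ht).1⟩)
  rw [ContinuousAt, (hj y ⟨hx, hz⟩).2]
  exact h2.congr' (h1.mono fun t ht => (hj t ht).2.symm)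

lemma IsBumpRhs.apply_eq (h : IsBumpRhs H p L s) (hf : IsBranchwise H p L s f) {y : ℝ}
    (hy : s y ∉ criticalValues H p L) : H (f y) = s y := by
  obtain ⟨x, z, j, hx, hz, j1, j2, hj⟩ := h.exists_nhds_branch hf hy
  obtain ⟨h1, h2⟩ := hj y ⟨hx, hz⟩
  rw [h2, apply_branchInv h1]

lemma IsBumpRhs.memLp (h : IsBumpRhs H p L s) (hb : HasBumps H L p)
    (hH : IsNormalizedHamiltonian H) (hf : IsBranchwise H p L s f) (h0 : ∀ y, 0 ≤ f y)
    (hle : ∀ y, f y ≤ b) : MemLp f ⊤ volume := by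
  have hc : ContinuousOn f {y | s y ∉ criticalValues H p L} := fun y hy =>
    (h.continuousAt hb hH hf hy).continuousWithinAt
  have hm := hc.aestronglyMeasurable (μ := volume) h.isOpen_compl.measurableSet
  rw [Measure.restrict_eq_self_of_ae_mem (s := {y | s y ∉ criticalValues H p L}) h.ae_notMem] at hm
  exact memLp_top_of_abs_le hm fun y => by rw [abs_of_nonneg (h0 y)]; exact hle y

/-- A branchwise function whose jumps satisfy the viscosity conditions is a solution derivative. -/
lemma IsBumpRhs.admDeriv_of_kink (h : IsBumpRhs H p L s) (hb : HasBumps H L p)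
    (hH : IsNormalizedHamiltonian H) (hf : IsBranchwise H p L s f) (h0 : ∀ y, 0 ≤ f y)
    (hle : ∀ y, f y ≤ b) (hk : ∀ y l r, s y ∈ criticalValues H p L → H l = s y → H r = s y →
      Tendsto f (𝓝[<] y) (𝓝 l) → Tendsto f (𝓝[>] y) (𝓝 r) →
      (r < l → ∀ q ∈ Icc r l, H q ≤ s y) ∧ (l < r → ∀ q ∈ Icc l r, s y ≤ H q)) :
    AdmDeriv H p L s b f := by
  refine ⟨solDeriv_of_oneSided (h.memLp hb hH hf h0 hle) fun y => ?_, h0, hle, hf⟩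
  obtain ⟨x, z, hx, hz, h1, h2⟩ := h.exists_critFree y
  obtain ⟨i, i1, i2, hi⟩ := hf x y hx h1
  obtain ⟨j, j1, j2, hj⟩ := hf y z hz h2
  obtain ⟨hi', hl⟩ := hb.tendsto_left_of_branch hH h.continuous hx i1 i2 hi
  obtain ⟨hj', hr⟩ := hb.tendsto_right_of_branch hH h.continuous hz j1 j2 hj
  have hHl := apply_branchInv hi'
  have hHr := apply_branchInv hj'
  have hk' : (branchInv H p j (s y) < branchInv H p i (s y) →
      ∀ q ∈ Icc (branchInv H p j (s y)) (branchInv H p i (s y)), H q ≤ s y) ∧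
      (branchInv H p i (s y) < branchInv H p j (s y) →
      ∀ q ∈ Icc (branchInv H p i (s y)) (branchInv H p j (s y)), s y ≤ H q) := by
    by_cases hy : s y ∈ criticalValues H p L
    · exact hk y _ _ hy hHl hHr hl hr
    · have hc := (h.continuousAt hb hH hf hy).tendsto
      have e1 := tendsto_nhds_unique hl (hc.mono_left nhdsWithin_le_nhds)
      have e2 := tendsto_nhds_unique hr (hc.mono_left nhdsWithin_le_nhds)
      rw [e1, e2]
      exact ⟨fun h => absurd h (lt_irrefl _), fun h => absurd h (lt_irrefl _)⟩
  refine ⟨_, _, hl, hr, fun q hq1 hq2 => ?_, fun q hq1 hq2 => ?_⟩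
  · rcases (hq1.trans hq2).eq_or_lt with he | hlt
    · rw [← he] at hq2
      rw [le_antisymm hq2 hq1, hHr]
    · exact hk'.1 hlt q ⟨hq1, hq2⟩
  · rcases (hq1.trans hq2).eq_or_lt with he | hlt
    · rw [← he] at hq2
      rw [le_antisymm hq2 hq1, hHl]
    · exact hk'.2 hlt q ⟨hq1, hq2⟩

lemma AdmDeriv.kink (hf : AdmDeriv H p L s b f) (hH : Continuous H) {y l r : ℝ}
    (hl : Tendsto f (𝓝[<] y) (𝓝 l)) (hr : Tendsto f (𝓝[>] y) (𝓝 r)) :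
    (r < l → ∀ q ∈ Icc r l, H q ≤ s y) ∧ (l < r → ∀ q ∈ Icc l r, s y ≤ H q) := by
  have dl := hasDerivWithinAt_prim_left hf.sol.memLp hl
  have dr := hasDerivWithinAt_prim_right hf.sol.memLp hr
  exact ⟨fun h q hq => (hf.sol.sub y).of_oneSided hH dl dr h hq,
    fun h q hq => (hf.sol.sup y).of_oneSided hH dl dr h hq⟩

/-- Existence of admissible derivatives: follow the increasing branches from right to left. -/
theorem IsBumpRhs.exists_admDeriv (h : IsBumpRhs H p L s) (hb : HasBumps H L p)
    (hH : IsNormalizedHamiltonian H) (hb0 : 0 ≤ b)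
    (hbd : ∀ y q, 0 ≤ q → H q = s y → q ≤ b) : ∃ f, AdmDeriv H p L s b f := by
  classical
  obtain ⟨a, ha, htop, hbot, hrange⟩ := exists_int_orderEmbedding h.finite
    (fun x => by obtain ⟨y, h1, h2⟩ := h.top x; exact ⟨y, h2, h1⟩)
    (fun x => by obtain ⟨y, h1, h2⟩ := h.bot x; exact ⟨y, h2, h1⟩)
  have hfree : ∀ i, ∀ z ∈ Ioo (a i) (a (i + 1)), s z ∉ criticalValues H p L := by
    intro i z hz hc
    obtain ⟨k, rfl⟩ : z ∈ range a := hrange ▸ hc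
    have h1 := ha.lt_iff_lt.1 hz.1
    have h2 := ha.lt_iff_lt.1 hz.2
    omega
  have hcrit : ∀ i, s (a i) ∈ criticalValues H p L := fun i => by
    have : a i ∈ {y | s y ∈ criticalValues H p L} := hrange ▸ mem_range_self i
    exact this
  set m : ℤ → ℝ := fun i => (a i + a (i + 1)) / 2 with hm
  have hmm : ∀ i, m i ∈ Ioo (a i) (a (i + 1)) := fun i => by
    have := ha (show i < i + 1 by omega)
    constructor <;> simp only [hm] <;> linarith
  -- States are branch indices on the successive intervals, and `R` is the pair of viscosity
  -- conditions at the kink `a i`, with left slope from `j'` and right slope from `j`.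
  obtain ⟨J, hJ⟩ := exists_int_chain (B := 2 * L + 1)
    (P := fun i j => 1 ≤ j ∧ j ≤ 2 * L + 1 ∧ s (m i) ∈ H '' branch p j)
    (R := fun i j' j => (∀ q, branchInv H p j (s (a i)) ≤ q → q ≤ branchInv H p j' (s (a i)) →
        H q ≤ s (a i)) ∧
      ∀ q, branchInv H p j' (s (a i)) ≤ q → q ≤ branchInv H p j (s (a i)) → s (a i) ≤ H q)
    (fun i j hj => hj.2.1)
    (fun i => by
      obtain ⟨q, hq, hqs⟩ := hH.exists_root (c := s (m i)) (q₀ := 0)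
        (by rw [hH.zero]; exact h.nonneg _)
      obtain ⟨j, h1, h2, h3⟩ := hb.exists_mem_branch hq
      exact ⟨j, h1, h2, q, h3, hqs⟩)
    -- Going left: if `s` is larger there, climb to the next root above, which creates a concave
    -- kink with `H ≤ s`; if `s` is smaller, descend to the next root below, which creates a convex
    -- kink with `H ≥ s`. Such a root always exists in this direction, by coercivity above and `H 0
    -- = 0` below. Equality is impossible since `s (a i)` is critical.
    (fun i j ⟨h1, h2, h3⟩ => by
      have hlt : a (i - 1) < a i := ha (by omega)
      have hmi := hmm (i - 1)
      have hfi := hfree (i - 1)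
      rw [sub_add_cancel] at hmi hfi
      have hai : s (a i) ∈ H '' branch p j := hb.image_of_critFree hH h.continuous h.nonneg
        (hfree i) (hmm i) ⟨le_rfl, (ha (by omega)).le⟩ h1 h2 h3
      have hx0 := hb.branchInv_nonneg h1 h2 hai
      have hxc := apply_branchInv hai
      have hvals : ∀ e ∈ uIcc (s (m (i - 1))) (s (a i)), e ≠ s (a i) →
          e ∉ criticalValues H p L := by
        intro e he hne
        obtain ⟨w, hw, rfl⟩ := intermediate_value_uIcc
          (h.continuous.continuousOn (s := uIcc (m (i - 1)) (a i))) he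
        rw [uIcc_of_le hmi.2.le] at hw
        exact hfi w ⟨hmi.1.trans_le hw.1, hw.2.lt_of_ne fun h => hne (by rw [h])⟩
      rcases lt_trichotomy (s (m (i - 1))) (s (a i)) with hlt' | heq | hgt
      · obtain ⟨j', k1, k2, k3, k4, k5, k6⟩ := hb.exists_branch_down hH hx0 hxc (h.nonneg _) hlt'
          fun e he => hvals e (by rw [uIcc_of_le hlt'.le]; exact ⟨he.1, he.2.le⟩) he.2.ne
        refine ⟨j', ⟨k1, k2, k3⟩, fun q hq1 hq2 => ?_, k6⟩
        rw [le_antisymm (hq2.trans k5) hq1, hxc]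
      · exact absurd (heq ▸ hcrit i) (hfi _ hmi)
      · obtain ⟨j', k1, k2, k3, k4, k5, k6⟩ := hb.exists_branch_up hH hx0 hxc hgt
          fun e he => hvals e (by rw [uIcc_of_ge hgt.le]; exact ⟨he.1.le, he.2⟩) he.1.ne'
        refine ⟨j', ⟨k1, k2, k3⟩, k6, fun q hq1 hq2 => ?_⟩
        rw [le_antisymm hq2 (k5.trans hq1), hxc])
  choose idx hidx using exists_index ha htop hbot
  have hidx_eq : ∀ i, ∀ y ∈ Ioo (a i) (a (i + 1)), idx y = i := by
    intro i y hy
    have h1 := ha.lt_iff_lt.1 ((hidx y).1.trans_lt hy.2)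
    have h2 := ha.lt_iff_lt.1 (hy.1.trans (hidx y).2)
    omega
  -- The value `0` at critical points is a convention on a null set; it only has to respect the
  -- bounds `[0, b]`.
  set f : ℝ → ℝ := fun y => if s y ∈ criticalValues H p L then 0 else
    branchInv H p (J (idx y)) (s y) with hf
  have himg : ∀ i, ∀ y ∈ Ioo (a i) (a (i + 1)), s y ∈ H '' branch p (J i) := fun i y hy =>
    hb.image_of_critFree hH h.continuous h.nonneg (hfree i) (hmm i) ⟨hy.1.le, hy.2.le⟩
      (hJ i).1.1 (hJ i).1.2.1 (hJ i).1.2.2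
  have hfi : ∀ i, ∀ y ∈ Ioo (a i) (a (i + 1)),
      s y ∈ H '' branch p (J i) ∧ f y = branchInv H p (J i) (s y) := by
    intro i y hy
    refine ⟨himg i y hy, ?_⟩
    simp only [hf]
    rw [if_neg (hfree i y hy), hidx_eq i y hy]
  have hmem : ∀ y, s y ∉ criticalValues H p L → y ∈ Ioo (a (idx y)) (a (idx y + 1)) := by
    intro y hy
    refine ⟨(hidx y).1.lt_of_ne fun h => hy (h ▸ hcrit _), (hidx y).2⟩
  have hroot : ∀ y, 0 ≤ f y ∧ f y ≤ b := by
    intro y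
    by_cases hy : s y ∈ criticalValues H p L
    · simp [hf, hy, hb0]
    · obtain ⟨h1, h2⟩ := hfi _ y (hmem y hy)
      have h3 := hb.branchInv_nonneg (hJ (idx y)).1.1 (hJ (idx y)).1.2.1 h1
      rw [h2]
      exact ⟨h3, hbd y _ h3 (apply_branchInv h1)⟩
  have hbw : IsBranchwise H p L s f := by
    intro x y hxy hxyf
    have hz : (x + y) / 2 ∈ Ioo x y := ⟨by linarith, by linarith⟩
    set i := idx ((x + y) / 2)
    have hi := hidx ((x + y) / 2)
    refine ⟨J i, (hJ i).1.1, (hJ i).1.2.1, fun t ht => hfi i t ⟨?_, ?_⟩⟩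
    · by_contra! hlt
      exact hxyf (a i) ⟨ht.1.trans_le hlt, hi.1.trans_lt hz.2⟩ (hcrit i)
    · by_contra! hlt
      exact hxyf (a (i + 1)) ⟨hz.1.trans hi.2, hlt.trans_lt ht.2⟩ (hcrit (i + 1))
  refine ⟨f, h.admDeriv_of_kink hb hH hbw (fun y => (hroot y).1) (fun y => (hroot y).2) ?_⟩
  intro y l r hy _ _ hl hr
  obtain ⟨i, rfl⟩ : y ∈ range a := hrange ▸ hy
  have hJi := hJ i
  have hfl := hfi (i - 1)
  rw [sub_add_cancel] at hfl
  have hl' := (hb.tendsto_left_of_branch hH h.continuous (ha (by omega : i - 1 < i))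
    (hJ (i - 1)).1.1 (hJ (i - 1)).1.2.1 hfl).2
  have hr' := (hb.tendsto_right_of_branch hH h.continuous (ha (by omega : i < i + 1))
    (hJ i).1.1 (hJ i).1.2.1 (hfi i)).2
  rw [tendsto_nhds_unique hl hl', tendsto_nhds_unique hr hr']
  exact ⟨fun _ q hq => hJi.2.1 q hq.1 hq.2, fun _ q hq => hJi.2.2 q hq.1 hq.2⟩

/-! ### The extremal admissible derivatives -/

/-- The pointwise supremum of the admissible derivatives. -/
def supDeriv (H : ℝ → ℝ) (p : ℕ → ℝ) (L : ℕ) (s : ℝ → ℝ) (b y : ℝ) : ℝ :=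
  sSup {t | ∃ f, AdmDeriv H p L s b f ∧ t = f y}

/-- The pointwise infimum of the admissible derivatives. -/
def infDeriv (H : ℝ → ℝ) (p : ℕ → ℝ) (L : ℕ) (s : ℝ → ℝ) (b y : ℝ) : ℝ :=
  sInf {t | ∃ f, AdmDeriv H p L s b f ∧ t = f y}

lemma AdmDeriv.le_supDeriv (hf : AdmDeriv H p L s b f) (y : ℝ) : f y ≤ supDeriv H p L s b y :=
  le_csSup ⟨b, by rintro _ ⟨g, hg, rfl⟩; exact hg.le y⟩ ⟨f, hf, rfl⟩

lemma AdmDeriv.infDeriv_le (hf : AdmDeriv H p L s b f) (y : ℝ) : infDeriv H p L s b y ≤ f y :=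
  csInf_le ⟨0, by rintro _ ⟨g, hg, rfl⟩; exact hg.nonneg y⟩ ⟨f, hf, rfl⟩

/-- On an interval without critical points only finitely many branches compete, and they are
ordered: a smaller index gives a larger inverse. The supremum is therefore attained by one
derivative, that of least index. -/
lemma HasBumps.exists_supDeriv_eq (hb : HasBumps H L p) (hne : ∃ f, AdmDeriv H p L s b f) {x y : ℝ}
    (hxy : x < y) (hfree : ∀ z ∈ Ioo x y, s z ∉ criticalValues H p L) :
    ∃ f, AdmDeriv H p L s b f ∧ ∀ z ∈ Ioo x y, supDeriv H p L s b z = f z := by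
  classical
  have hex : ∃ j, ∃ f, AdmDeriv H p L s b f ∧ 1 ≤ j ∧ j ≤ 2 * L + 1 ∧
      ∀ z ∈ Ioo x y, s z ∈ H '' branch p j ∧ f z = branchInv H p j (s z) := by
    obtain ⟨f, hf⟩ := hne
    obtain ⟨j, h1, h2, h3⟩ := hf.branchwise x y hxy hfree
    exact ⟨j, f, hf, h1, h2, h3⟩
  obtain ⟨f, hf, h1, h2, h3⟩ := Nat.find_spec hex
  refine ⟨f, hf, fun z hz => le_antisymm (csSup_le ⟨_, f, hf, rfl⟩ ?_) (hf.le_supDeriv z)⟩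
  rintro _ ⟨g, hg, rfl⟩
  obtain ⟨k, k1, k2, k3⟩ := hg.branchwise x y hxy hfree
  rw [(h3 z hz).2, (k3 z hz).2]
  exact hb.branchInv_le h1 (Nat.find_min' hex ⟨g, hg, k1, k2, k3⟩) k2 (h3 z hz).1 (k3 z hz).1

lemma HasBumps.exists_infDeriv_eq (hb : HasBumps H L p) (hne : ∃ f, AdmDeriv H p L s b f) {x y : ℝ}
    (hxy : x < y) (hfree : ∀ z ∈ Ioo x y, s z ∉ criticalValues H p L) :
    ∃ f, AdmDeriv H p L s b f ∧ ∀ z ∈ Ioo x y, infDeriv H p L s b z = f z := by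
  classical
  -- The index is recorded as `2 L + 1 - j`, so that `Nat.find` selects the greatest `j`.
  have hex : ∃ j', ∃ j, ∃ f, AdmDeriv H p L s b f ∧ 1 ≤ j ∧ j + j' = 2 * L + 1 ∧
      ∀ z ∈ Ioo x y, s z ∈ H '' branch p j ∧ f z = branchInv H p j (s z) := by
    obtain ⟨f, hf⟩ := hne
    obtain ⟨j, h1, h2, h3⟩ := hf.branchwise x y hxy hfree
    exact ⟨2 * L + 1 - j, j, f, hf, h1, by omega, h3⟩
  obtain ⟨j, f, hf, h1, h2, h3⟩ := Nat.find_spec hex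
  refine ⟨f, hf, fun z hz => le_antisymm (hf.infDeriv_le z) (le_csInf ⟨_, f, hf, rfl⟩ ?_)⟩
  rintro _ ⟨g, hg, rfl⟩
  obtain ⟨k, k1, k2, k3⟩ := hg.branchwise x y hxy hfree
  have := Nat.find_min' hex (m := 2 * L + 1 - k) ⟨k, g, hg, k1, by omega, k3⟩
  rw [(h3 z hz).2, (k3 z hz).2]
  exact hb.branchInv_le k1 (by omega) (by omega) (k3 z hz).1 (h3 z hz).1

lemma IsBumpRhs.exists_oneSided (h : IsBumpRhs H p L s) (hb : HasBumps H L p)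
    (hH : IsNormalizedHamiltonian H) (hf : IsBranchwise H p L s f) (y : ℝ) :
    ∃ l r, Tendsto f (𝓝[<] y) (𝓝 l) ∧ Tendsto f (𝓝[>] y) (𝓝 r) := by
  obtain ⟨x, z, hx, hz, h1, h2⟩ := h.exists_critFree y
  obtain ⟨i, i1, i2, hi⟩ := hf x y hx h1
  obtain ⟨j, j1, j2, hj⟩ := hf y z hz h2
  exact ⟨_, _, (hb.tendsto_left_of_branch hH h.continuous hx i1 i2 hi).2,
    (hb.tendsto_right_of_branch hH h.continuous hz j1 j2 hj).2⟩

/-- Kink conditions are inherited. An `f` that attains the supremum on the left of `y` has right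
limit at most `r`, so its own concave kink contains `[r, l]`; a `g` that attains it on the right has
left limit at most `l` and handles convex kinks. -/
theorem IsBumpRhs.admDeriv_supDeriv (h : IsBumpRhs H p L s) (hb : HasBumps H L p)
    (hH : IsNormalizedHamiltonian H) (hne : ∃ f, AdmDeriv H p L s b f) :
    AdmDeriv H p L s b (supDeriv H p L s b) := by
  obtain ⟨f₀, hf₀⟩ := hne
  refine h.admDeriv_of_kink hb hH (fun x y hxy hfree => ?_)
    (fun y => (hf₀.nonneg y).trans (hf₀.le_supDeriv y))
    (fun y => csSup_le ⟨_, f₀, hf₀, rfl⟩ (by rintro _ ⟨g, hg, rfl⟩; exact hg.le y)) ?_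
  · obtain ⟨f, hf, he⟩ := hb.exists_supDeriv_eq ⟨f₀, hf₀⟩ hxy hfree
    obtain ⟨j, h1, h2, h3⟩ := hf.branchwise x y hxy hfree
    exact ⟨j, h1, h2, fun z hz => ⟨(h3 z hz).1, by rw [he z hz, (h3 z hz).2]⟩⟩
  · intro y l r hy _ _ hl hr
    obtain ⟨x, z, hx, hz, h1, h2⟩ := h.exists_critFree y
    obtain ⟨f, hf, hfe⟩ := hb.exists_supDeriv_eq ⟨f₀, hf₀⟩ hx h1
    obtain ⟨g, hg, hge⟩ := hb.exists_supDeriv_eq ⟨f₀, hf₀⟩ hz h2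
    obtain ⟨fl, fr, hfl, hfr⟩ := h.exists_oneSided hb hH hf.branchwise y
    obtain ⟨gl, gr, hgl, hgr⟩ := h.exists_oneSided hb hH hg.branchwise y
    have e1 : fl = l := tendsto_nhds_unique (hfl.congr' (by
      filter_upwards [Ioo_mem_nhdsLT hx] with t ht using (hfe t ht).symm)) hl
    have e2 : gr = r := tendsto_nhds_unique (hgr.congr' (by
      filter_upwards [Ioo_mem_nhdsGT hz] with t ht using (hge t ht).symm)) hr
    have l1 : fr ≤ r := le_of_tendsto_of_tendsto hfr hr (Eventually.of_forall hf.le_supDeriv)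
    have l2 : gl ≤ l := le_of_tendsto_of_tendsto hgl hl (Eventually.of_forall hg.le_supDeriv)
    subst e1 e2
    exact ⟨fun hlt q hq => (hf.kink hH.continuous hfl hfr).1 (l1.trans_lt hlt) q
      ⟨l1.trans hq.1, hq.2⟩, fun hlt q hq => (hg.kink hH.continuous hgl hgr).2 (l2.trans_lt hlt) q
      ⟨l2.trans hq.1, hq.2⟩⟩

theorem IsBumpRhs.admDeriv_infDeriv (h : IsBumpRhs H p L s) (hb : HasBumps H L p)
    (hH : IsNormalizedHamiltonian H) (hne : ∃ f, AdmDeriv H p L s b f) :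
    AdmDeriv H p L s b (infDeriv H p L s b) := by
  obtain ⟨f₀, hf₀⟩ := hne
  refine h.admDeriv_of_kink hb hH (fun x y hxy hfree => ?_)
    (fun y => le_csInf ⟨_, f₀, hf₀, rfl⟩ (by rintro _ ⟨g, hg, rfl⟩; exact hg.nonneg y))
    (fun y => (hf₀.infDeriv_le y).trans (hf₀.le y)) ?_
  · obtain ⟨f, hf, he⟩ := hb.exists_infDeriv_eq ⟨f₀, hf₀⟩ hxy hfree
    obtain ⟨j, h1, h2, h3⟩ := hf.branchwise x y hxy hfree
    exact ⟨j, h1, h2, fun z hz => ⟨(h3 z hz).1, by rw [he z hz, (h3 z hz).2]⟩⟩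
  · intro y l r hy _ _ hl hr
    obtain ⟨x, z, hx, hz, h1, h2⟩ := h.exists_critFree y
    obtain ⟨f, hf, hfe⟩ := hb.exists_infDeriv_eq ⟨f₀, hf₀⟩ hx h1
    obtain ⟨g, hg, hge⟩ := hb.exists_infDeriv_eq ⟨f₀, hf₀⟩ hz h2
    obtain ⟨fl, fr, hfl, hfr⟩ := h.exists_oneSided hb hH hf.branchwise y
    obtain ⟨gl, gr, hgl, hgr⟩ := h.exists_oneSided hb hH hg.branchwise y
    have e1 : fl = l := tendsto_nhds_unique (hfl.congr' (by
      filter_upwards [Ioo_mem_nhdsLT hx] with t ht using (hfe t ht).symm)) hl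
    have e2 : gr = r := tendsto_nhds_unique (hgr.congr' (by
      filter_upwards [Ioo_mem_nhdsGT hz] with t ht using (hge t ht).symm)) hr
    have l1 : r ≤ fr := le_of_tendsto_of_tendsto hr hfr (Eventually.of_forall hf.infDeriv_le)
    have l2 : l ≤ gl := le_of_tendsto_of_tendsto hl hgl (Eventually.of_forall hg.infDeriv_le)
    subst e1 e2
    exact ⟨fun hlt q hq => (hg.kink hH.continuous hgl hgr).1 (hlt.trans_le l2) q
      ⟨hq.1, hq.2.trans l2⟩, fun hlt q hq => (hf.kink hH.continuous hfl hfr).2 (hlt.trans_le l1) q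
      ⟨hq.1, hq.2.trans l1⟩⟩

end Adm

/-! ### Limits of admissible derivatives -/

lemma eventually_abs_sub_le_of_equiLipschitz {ι : Type*} {l : Filter ι} {w : ι → ℝ → ℝ}
    {u : ℝ → ℝ} {K : ℝ} (hw : ∀ i x y, |w i x - w i y| ≤ K * |x - y|)
    (hu : ∀ x y, |u x - u y| ≤ K * |x - y|) (hlim : ∀ x, Tendsto (fun i => w i x) l (𝓝 (u x)))
    (a b : ℝ) {ε : ℝ} (hε : 0 < ε) : ∀ᶠ i in l, ∀ x ∈ Icc a b, |w i x - u x| ≤ ε := by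
  have hK : 0 ≤ K := by simpa using (abs_nonneg _).trans (hu 1 0)
  obtain ⟨t, -, htf, ht⟩ := (isCompact_Icc (a := a) (b := b)).finite_cover_balls
    (e := ε / (3 * (K + 1))) (by positivity)
  have hev : ∀ᶠ i in l, ∀ z ∈ t, |w i z - u z| < ε / 3 := by
    rw [eventually_all_finite htf]
    intro z _
    have := (Metric.tendsto_nhds.1 (hlim z)) (ε / 3) (by positivity)
    simpa [Real.dist_eq] using this
  filter_upwards [hev] with i hi x hx
  obtain ⟨z, hz, hxz⟩ := mem_iUnion₂.1 (ht hx)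
  rw [Metric.mem_ball, Real.dist_eq] at hxz
  have h1 : K * |x - z| ≤ ε / 3 := by
    calc K * |x - z| ≤ K * (ε / (3 * (K + 1))) := by gcongr
      _ = K / (K + 1) * (ε / 3) := by field_simp
      _ ≤ 1 * (ε / 3) := by
        gcongr
        rw [div_le_one (by positivity)]; linarith
      _ = ε / 3 := one_mul _
  have h2 := abs_le.1 ((hw i x z).trans h1)
  have h3 := abs_le.1 ((hu x z).trans h1)
  have h4 := abs_lt.1 (hi z hz)
  rw [abs_le]; constructor <;> linarith

lemma abs_prim_sub_le {f : ℝ → ℝ} (hf : MemLp f ⊤ volume) {B : ℝ} (hB : ∀ x, |f x| ≤ B) (x y : ℝ) :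
    |prim f x - prim f y| ≤ B * |x - y| := by
  rw [prim_sub_prim hf, ← Real.norm_eq_abs]
  exact intervalIntegral.norm_integral_le_of_norm_le_const fun t _ => hB t

lemma prim_zero (f : ℝ → ℝ) : prim f 0 = 0 := intervalIntegral.integral_same

lemma Ultrafilter.exists_tendsto_of_abs_le {ι : Type*} (U : Ultrafilter ι) {g : ι → ℝ} {B : ℝ}
    (hg : ∀ i, |g i| ≤ B) : ∃ v, Tendsto g U (𝓝 v) := by
  have : ∀ᶠ i in (U : Filter ι), g i ∈ Icc (-B) B := Eventually.of_forall fun i => abs_le.1 (hg i)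
  obtain ⟨v, -, hv⟩ := (isCompact_Icc (a := -B) (b := B)).ultrafilter_le_nhds' (U.map g) this
  exact ⟨v, hv⟩

section Limit
variable {H : ℝ → ℝ} {L : ℕ} {p : ℕ → ℝ} {s : ℝ → ℝ} {B : ℝ}

lemma AdmDeriv.abs_le {f : ℝ → ℝ} (hf : AdmDeriv H p L s B f) (y : ℝ) : |f y| ≤ B := by
  rw [abs_of_nonneg (hf.nonneg y)]; exact hf.le y

/-- On a compact interval where `s` avoids the critical values, nearby right-hand sides avoid them
too. Each `f i` then follows one branch, and the ultrafilter selects one of the finitely many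
indices. -/
lemma IsBumpRhs.eventually_branch (h : IsBumpRhs H p L s) {ι : Type*} (U : Ultrafilter ι)
    {t : ι → ℝ → ℝ} {f : ι → ℝ → ℝ} (hf : ∀ i, IsBranchwise H p L (t i) (f i))
    (hts : ∀ a b : ℝ, ∀ ε > 0, ∀ᶠ i in U, ∀ x ∈ Icc a b, |t i x - s x| ≤ ε) {x y : ℝ} (hxy : x < y)
    (hfree : ∀ z ∈ Icc x y, s z ∉ criticalValues H p L) :
    ∃ j, 1 ≤ j ∧ j ≤ 2 * L + 1 ∧ ∀ᶠ i in U, ∀ z ∈ Ioo x y,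
      t i z ∈ H '' branch p j ∧ f i z = branchInv H p j (t i z) := by
  obtain ⟨δ, hδ, hth⟩ := ((isCompact_Icc (a := x) (b := y)).image
    h.continuous).exists_thickening_subset_open
    (finite_criticalValues (H := H) (p := p) (L := L)).isClosed.isOpen_compl
    (by rintro _ ⟨z, hz, rfl⟩; exact hfree z hz)
  have hev : ∀ᶠ i in U, ∃ j ∈ Icc 1 (2 * L + 1), ∀ z ∈ Ioo x y,
      t i z ∈ H '' branch p j ∧ f i z = branchInv H p j (t i z) := by
    filter_upwards [hts x y (δ / 2) (by positivity)] with i hi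
    obtain ⟨j, h1, h2, h3⟩ := hf i x y hxy fun z hz => hth (Metric.mem_thickening_iff.2
      ⟨s z, mem_image_of_mem s ⟨hz.1.le, hz.2.le⟩, by
        rw [Real.dist_eq]; linarith [hi z ⟨hz.1.le, hz.2.le⟩]⟩)
    exact ⟨j, ⟨h1, h2⟩, h3⟩
  obtain ⟨j, hj, h⟩ := (U.eventually_exists_mem_iff (finite_Icc 1 (2 * L + 1))).1 hev
  exact ⟨j, hj.1, hj.2, h⟩

/-- Take ultrafilter limits of the slopes pointwise and of the primitives. Away from critical points
the common branch identifies the limiting slope as the derivative of the limiting primitive. -/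
theorem IsBumpRhs.exists_limit_admDeriv (h : IsBumpRhs H p L s) (hb : HasBumps H L p)
    (hH : IsNormalizedHamiltonian H) {ι : Type*} (U : Ultrafilter ι)
    {t : ι → ℝ → ℝ} {f : ι → ℝ → ℝ} (hf : ∀ i, AdmDeriv H p L (t i) B (f i))
    (hts : ∀ a b : ℝ, ∀ ε > 0, ∀ᶠ i in U, ∀ x ∈ Icc a b, |t i x - s x| ≤ ε) :
    ∃ g, AdmDeriv H p L s B g ∧ ∀ x, Tendsto (fun i => prim (f i) x) U (𝓝 (prim g x)) := by
  have hg : ∀ y, ∃ v, Tendsto (fun i => f i y) U (𝓝 v) := fun y =>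
    U.exists_tendsto_of_abs_le fun i => (hf i).abs_le y
  have hu : ∀ y, ∃ v, Tendsto (fun i => prim (f i) y) U (𝓝 v) := fun y =>
    U.exists_tendsto_of_abs_le (B := B * |y|) fun i => by
      simpa [prim_zero] using abs_prim_sub_le (hf i).sol.memLp (hf i).abs_le y 0
  choose g hg using hg
  choose u hu using hu
  have hg0 : ∀ y, 0 ≤ g y := fun y => ge_of_tendsto (hg y)
    (Eventually.of_forall fun i => (hf i).nonneg y)
  have hgB : ∀ y, g y ≤ B := fun y => le_of_tendsto (hg y)
    (Eventually.of_forall fun i => (hf i).le y)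
  have hpt : ∀ y, Tendsto (fun i => t i y) U (𝓝 (s y)) := fun y => by
    rw [Metric.tendsto_nhds]
    intro ε hε
    filter_upwards [hts y y (ε / 2) (by positivity)] with i hi
    rw [Real.dist_eq]; linarith [hi y ⟨le_rfl, le_rfl⟩]
  have hbr : ∀ {j x y z}, 1 ≤ j → j ≤ 2 * L + 1 → z ∈ Ioo x y → (∀ᶠ i in U, ∀ z ∈ Ioo x y,
      t i z ∈ H '' branch p j ∧ f i z = branchInv H p j (t i z)) →
      s z ∈ H '' branch p j ∧ g z = branchInv H p j (s z) := by
    intro j x y z h1 h2 hz hev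
    have hs : s z ∈ H '' branch p j := (isClosed_image_branch hH j).mem_of_tendsto (hpt z)
      (hev.mono fun i hi => (hi z hz).1)
    refine ⟨hs, tendsto_nhds_unique (hg z) ?_⟩
    have := (hb.continuousOn_branchInv hH h1 h2 _ hs).tendsto.comp
      (tendsto_nhdsWithin_iff.2 ⟨hpt z, hev.mono fun i hi => (hi z hz).1⟩)
    exact this.congr' (hev.mono fun i hi => (hi z hz).2.symm)
  have hgbw : IsBranchwise H p L s g := by
    intro x y hxy hfree
    have hz : (x + y) / 2 ∈ Ioo x y := ⟨by linarith, by linarith⟩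
    set z := (x + y) / 2
    have hloc : ∀ w ∈ Ioo x y, ∃ j, 1 ≤ j ∧ j ≤ 2 * L + 1 ∧
        (s z ∈ H '' branch p j ∧ g z = branchInv H p j (s z)) ∧
        (s w ∈ H '' branch p j ∧ g w = branchInv H p j (s w)) := by
      intro w hw
      obtain ⟨x', hx1, hx2⟩ := exists_between (lt_min hz.1 hw.1)
      obtain ⟨y', hy1, hy2⟩ := exists_between (max_lt hz.2 hw.2)
      rw [lt_min_iff] at hx2
      rw [max_lt_iff] at hy1
      obtain ⟨j, h1, h2, h3⟩ := h.eventually_branch U (fun i => (hf i).branchwise) hts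
        (hx2.1.trans hy1.1) fun t ht => hfree t ⟨hx1.trans_le ht.1, ht.2.trans_lt hy2⟩
      exact ⟨j, h1, h2, hbr h1 h2 ⟨hx2.1, hy1.1⟩ h3, hbr h1 h2 ⟨hx2.2, hy1.2⟩ h3⟩
    obtain ⟨j, h1, h2, h3, -⟩ := hloc z hz
    refine ⟨j, h1, h2, fun w hw => ?_⟩
    obtain ⟨k, k1, k2, k3, k4⟩ := hloc w hw
    -- The branch obtained on each compact subinterval is the same, since at the noncritical
    -- midpoint `z` the value `g z` determines its index.
    have : j = k := by
      refine hb.index_unique (q := g z) h1 h2 k1 k2 ?_ ?_ ?_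
      · rw [h3.2]; exact branchInv_mem h3.1
      · rw [k3.2]; exact branchInv_mem k3.1
      · rw [h3.2, apply_branchInv h3.1]; exact hfree z hz
    rw [this]; exact k4
  have hmem := h.memLp hb hH hgbw hg0 hgB
  have hlipi : ∀ i x y, |prim (f i) x - prim (f i) y| ≤ B * |x - y| := fun i =>
    abs_prim_sub_le (hf i).sol.memLp (hf i).abs_le
  have hlipu : ∀ x y, |u x - u y| ≤ B * |x - y| := fun x y =>
    le_of_tendsto ((hu x).sub (hu y)).abs (Eventually.of_forall fun i => hlipi i x y)
  have hB : 0 ≤ B := (hg0 0).trans (hgB 0)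
  have huL : LipschitzWith B.toNNReal u := LipschitzWith.of_dist_le_mul fun x y => by
    rw [Real.dist_eq, Real.dist_eq, Real.coe_toNNReal _ hB]; exact hlipu x y
  have hd : ∀ y, s y ∉ criticalValues H p L → HasDerivAt u (g y) y := by
    intro y hy
    refine hasDerivAt_of_slopes fun ε hε => ?_
    obtain ⟨r₀, hr₀, hball⟩ := Metric.isOpen_iff.1 h.isOpen_compl y hy
    obtain ⟨j, h1, h2, h3⟩ := h.eventually_branch U (fun i => (hf i).branchwise) hts
      (x := y - r₀ / 2) (y := y + r₀ / 2) (by linarith) fun z hz => hball (by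
        rw [Metric.mem_ball, Real.dist_eq, abs_lt]; constructor <;> linarith [hz.1, hz.2])
    obtain ⟨hsy, hgy⟩ := hbr h1 h2 (z := y) ⟨by linarith, by linarith⟩ h3
    obtain ⟨δ, hδ, hψ⟩ := Metric.continuousOn_iff.1 (hb.continuousOn_branchInv hH h1 h2) _ hsy ε hε
    obtain ⟨r₁, hr₁, hs1⟩ := Metric.continuousAt_iff.1 (h.continuous.continuousAt (x := y)) (δ / 2)
      (by positivity)
    have hm : 0 < min (r₀ / 2) r₁ := by positivity
    refine ⟨min (r₀ / 2) r₁, hm, fun a c ha hac hc => ?_⟩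
    have m1 := min_le_left (r₀ / 2) r₁
    have m2 := min_le_right (r₀ / 2) r₁
    refine le_of_tendsto (((hu c).sub (hu a)).sub_const _).abs ?_
    filter_upwards [h3, hts (y - r₁) (y + r₁) (δ / 4) (by positivity)] with i hi1 hi2
    have hpt : ∀ z ∈ Icc a c, |f i z - g y| ≤ ε := by
      intro z hz
      obtain ⟨e1, e2⟩ := hi1 z ⟨by linarith [hz.1], by linarith [hz.2]⟩
      have e3 := hi2 z ⟨by linarith [hz.1], by linarith [hz.2]⟩
      have e4 := hs1 (x := z) (by
        rw [Real.dist_eq, abs_lt]; constructor <;> linarith [hz.1, hz.2])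
      rw [Real.dist_eq] at e4
      have := hψ _ e1 (by
        rw [Real.dist_eq]
        have := abs_sub_le (t i z) (s z) (s y)
        linarith)
      rw [Real.dist_eq, ← e2, ← hgy] at this
      exact this.le
    have : prim (f i) c - prim (f i) a - g y * (c - a) = ∫ t in a..c, (f i t - g y) := by
      rw [intervalIntegral.integral_sub ((hf i).sol.memLp.intervalIntegrable_top _ _)
        intervalIntegrable_const, prim_sub_prim (hf i).sol.memLp]
      simp [mul_comm]
    rw [this, ← Real.norm_eq_abs]
    refine (intervalIntegral.norm_integral_le_of_norm_le_const (C := ε) fun t ht => ?_).trans ?_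
    · rw [uIoc_of_le hac.le] at ht
      exact hpt t ⟨ht.1.le, ht.2⟩
    · rw [abs_of_pos (sub_pos.2 hac)]
  have hu0 : u 0 = 0 := tendsto_nhds_unique (hu 0) (by simp [prim_zero])
  have hueq : ∀ x, u x = prim g x := fun x => by
    have := huL.eq_prim_add (h.ae_notMem.mono hd) x
    rw [hu0, add_zero] at this
    exact this
  have hue : u = prim g := funext hueq
  rw [hue] at hu hlipu
  have hloc := fun a b ε (hε : 0 < ε) =>
    eventually_abs_sub_le_of_equiLipschitz hlipi hlipu hu a b hε
  -- The solution property at all points, critical ones included, comes from stability of viscosity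
  -- solutions; no kink analysis is needed.
  refine ⟨g, ⟨⟨hmem, fun y => ?_, fun y => ?_⟩, hg0, hgB, hgbw⟩, hu⟩
  · exact subAt_of_tendsto (l := U) hH.continuous h.continuous
      (fun i => continuous_prim (hf i).sol.memLp) (fun i => (hf i).sol.sub) hloc hts y
  · exact superAt_of_tendsto (l := U) hH.continuous h.continuous
      (fun i => continuous_prim (hf i).sol.memLp) (fun i => (hf i).sol.sup) hloc hts y

/-! ### Regular values -/

/-- A nonnegative value below all the local minima or above all the local maxima. -/
def IsRegularValue (H : ℝ → ℝ) (p : ℕ → ℝ) (L : ℕ) (c : ℝ) : Prop :=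
  0 ≤ c ∧ ((∀ i, 1 ≤ i → i ≤ L → c < minValue H p i) ∨ ∀ i, 1 ≤ i → i ≤ L → maxValue H p i < c)

lemma HasBumps.lt_of_low (hb : HasBumps H L p) {c : ℝ}
    (hc : ∀ i, 1 ≤ i → i ≤ L → c < minValue H p i) {j : ℕ} (h1 : 1 ≤ j) (h2 : j ≤ 2 * L) {q : ℝ}
    (hq : q ∈ branch p j) : c < H q := by
  rcases Nat.even_or_odd j with hj | hj
  · have hj' := hj
    obtain ⟨k, rfl⟩ := hj'
    have := (hb.strictAntiOn h1 (by omega) hj).antitoneOn hq (hb.right_mem (by omega) (by omega))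
      (le_pred_of_mem_branch hq (by omega))
    refine (hc k (by omega) (by omega)).trans_le ?_
    rwa [minValue, two_mul]
  · have hj' := hj
    obtain ⟨k, rfl⟩ := hj'
    have := (hb.strictMonoOn (by omega) hj).monotoneOn (hb.left_mem h1 (by omega)) hq
      (le_of_mem_branch hq)
    refine (hc (k + 1) (by omega) (by omega)).trans_le ?_
    rwa [minValue, show 2 * (k + 1) - 1 = 2 * k + 1 by omega]

lemma HasBumps.lt_of_high (hb : HasBumps H L p) {c : ℝ}
    (hc : ∀ i, 1 ≤ i → i ≤ L → maxValue H p i < c) {j : ℕ} (h1 : 2 ≤ j) (h2 : j ≤ 2 * L + 1) {q : ℝ}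
    (hq : q ∈ branch p j) : H q < c := by
  rcases Nat.even_or_odd j with hj | hj
  · have hj' := hj
    obtain ⟨k, rfl⟩ := hj'
    have := (hb.strictAntiOn (by omega) (by omega) hj).antitoneOn
      (hb.left_mem (by omega) (by omega)) hq (le_of_mem_branch hq)
    refine lt_of_le_of_lt ?_ (hc k (by omega) (by omega))
    rwa [maxValue, two_mul]
  · have hj' := hj
    obtain ⟨k, rfl⟩ := hj'
    have := (hb.strictMonoOn (by omega) hj).monotoneOn hq (hb.right_mem h1 (by omega))
      (le_pred_of_mem_branch hq (by omega))
    exact lt_of_le_of_lt this (hc k (by omega) (by omega))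

lemma HasBumps.isRegularRoot_low (hb : HasBumps H L p) (hH : IsNormalizedHamiltonian H) {c : ℝ}
    (h0 : 0 ≤ c) (hc : ∀ i, 1 ≤ i → i ≤ L → c < minValue H p i) :
    c ∈ H '' branch p (2 * L + 1) ∧ IsRegularRoot H c (branchInv H p (2 * L + 1) c) := by
  obtain ⟨q, hq, hqc⟩ := hH.exists_root (c := c) (q₀ := 0) (by rw [hH.zero]; exact h0)
  obtain ⟨j, h1, h2, h3⟩ := hb.exists_mem_branch hq
  have hj : j = 2 * L + 1 := by
    by_contra h
    have := hb.lt_of_low hc h1 (by omega) h3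
    linarith
  subst hj
  have himg : c ∈ H '' branch p (2 * L + 1) := ⟨q, h3, hqc⟩
  refine ⟨himg, ?_⟩
  rw [← hqc, hb.branchInv_apply h1 h2 h3]
  have hmono := hb.strictMonoOn h2 (by simp : Odd (2 * L + 1))
  refine ⟨hq, fun r hr hrq => hmono ((ordConnected_branch _).out (hb.left_mem h1 h2) h3
    ⟨by rw [hb.last]; exact hr, hrq.le⟩) h3 hrq, fun r hr => ?_⟩
  obtain ⟨k, k1, k2, k3⟩ := hb.exists_mem_branch (hq.trans hr.le)
  by_cases hk : k = 2 * L + 1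
  · subst hk; exact hmono h3 k3 hr
  · rw [hqc]; exact hb.lt_of_low hc k1 (by omega) k3

lemma HasBumps.isRegularRoot_high (hb : HasBumps H L p) (hH : IsNormalizedHamiltonian H) {c : ℝ}
    (h0 : 0 ≤ c) (hc : ∀ i, 1 ≤ i → i ≤ L → maxValue H p i < c) :
    c ∈ H '' branch p 1 ∧ IsRegularRoot H c (branchInv H p 1 c) := by
  obtain ⟨q, hq, hqc⟩ := hH.exists_root (c := c) (q₀ := 0) (by rw [hH.zero]; exact h0)
  obtain ⟨j, h1, h2, h3⟩ := hb.exists_mem_branch hq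
  have hj : j = 1 := by
    by_contra h
    have := hb.lt_of_high hc (by omega) h2 h3
    linarith
  subst hj
  refine ⟨⟨q, h3, hqc⟩, ?_⟩
  rw [← hqc, hb.branchInv_apply h1 h2 h3]
  have hmono := hb.strictMonoOn h2 (by simp : Odd 1)
  refine ⟨hq, fun r hr hrq => ?_, fun r hr => hmono h3 ?_ hr⟩
  · obtain ⟨k, k1, k2, k3⟩ := hb.exists_mem_branch hr
    by_cases hk : k = 1
    · subst hk; exact hmono k3 h3 hrq
    · rw [hqc]; exact hb.lt_of_high hc (by omega) k2 k3
  · exact mem_branch_iff.2 ⟨by simp, (le_of_mem_branch h3).trans hr.le⟩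

lemma IsRegularValue.exists_root {c : ℝ} (hc : IsRegularValue H p L c) (hb : HasBumps H L p)
    (hH : IsNormalizedHamiltonian H) : ∃ ρ, IsRegularRoot H c ρ ∧ H ρ = c := by
  obtain ⟨h0, h | h⟩ := hc
  · exact ⟨_, (hb.isRegularRoot_low hH h0 h).2, apply_branchInv (hb.isRegularRoot_low hH h0 h).1⟩
  · exact ⟨_, (hb.isRegularRoot_high hH h0 h).2, apply_branchInv (hb.isRegularRoot_high hH h0 h).1⟩

lemma IsRegularRoot.le {c₁ c₂ ρ₁ ρ₂ : ℝ} (h₁ : IsRegularRoot H c₁ ρ₁) (h₂ : IsRegularRoot H c₂ ρ₂)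
    (hc : c₁ ≤ c₂) : ρ₁ ≤ ρ₂ := by
  by_contra! hlt
  obtain ⟨q, h3, h4⟩ := exists_between hlt
  linarith [h₁.2.1 q (h₂.1.trans h3.le) h4, h₂.2.2 q h3]

/-- Comparison of nondecreasing solutions with ordered right-hand sides. -/
theorem IsMonoSol.antitone_sub (hb : HasBumps H L p) (hH : IsNormalizedHamiltonian H)
    {s₁ s₂ u₁ u₂ : ℝ → ℝ} (h₁ : IsMonoSol H s₁ u₁) (h₂ : IsMonoSol H s₂ u₂) (c₁ : Continuous s₁)
    (c₂ : Continuous s₂) (hle : ∀ y, s₁ y < s₂ y ∨ ∃ r > 0, ∀ z ∈ Ioo (y - r) (y + r),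
      s₁ z ≤ s₂ z ∧ IsRegularValue H p L (s₁ z) ∧ IsRegularValue H p L (s₂ z))
    (hreset : ∀ x, ∃ y > x, s₁ y < s₂ y ∧ IsRegularValue H p L (s₁ y)) :
    Antitone (fun x => u₁ x - u₂ x) := by
  obtain ⟨K, hK⟩ := hH.lipschitz
  have cu₁ := h₁.continuous
  have cu₂ := h₂.continuous
  refine antitone_of_no_isLocalMax (by fun_prop) (fun y hy => ?_) fun x => ?_
  -- Doubling gives `s₂ y ≤ s₁ y` at a local maximum. Strict order excludes this; otherwise all
  -- nearby values are regular, both slopes are the unique roots, and these are ordered as the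
  -- right-hand sides are.
  · have h3 := le_of_isLocalMax_sub hK cu₁ cu₂ c₁ c₂ (Eventually.of_forall h₁.sub)
      (Eventually.of_forall h₂.sup) hy
    rcases hle y with h | ⟨r, hr, hreg⟩
    · exact absurd h3 (not_le.2 h)
    · refine ⟨r, hr, ?_⟩
      have hder : ∀ z ∈ Ioo (y - r) (y + r), ∃ d ≤ 0, HasDerivAt (fun x => u₁ x - u₂ x) d z := by
        intro z hz
        obtain ⟨h4, h5, h6⟩ := hreg z hz
        obtain ⟨ρ₁, k1, -⟩ := h5.exists_root hb hH
        obtain ⟨ρ₂, k2, -⟩ := h6.exists_root hb hH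
        exact ⟨ρ₁ - ρ₂, sub_nonpos.2 (k1.le k2 h4),
          (h₁.hasDerivAt hH.continuous hH.coercive c₁ k1).sub
          (h₂.hasDerivAt hH.continuous hH.coercive c₂ k2)⟩
      refine antitoneOn_of_deriv_nonpos (convex_Ioo _ _) (by fun_prop)
        (fun z hz => ?_) (fun z hz => ?_)
      · rw [interior_Ioo] at hz
        obtain ⟨d, -, hd⟩ := hder z hz
        exact hd.differentiableAt.differentiableWithinAt
      · rw [interior_Ioo] at hz
        obtain ⟨d, hd0, hd⟩ := hder z hz
        rw [hd.deriv]; exact hd0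
  · obtain ⟨y, hy, hlt, hreg⟩ := hreset x
    obtain ⟨ρ, k1, k2⟩ := hreg.exists_root hb hH
    exact ⟨y, hy, h₁.strictAntiOn_sub hH.continuous hH.coercive h₂ c₁ c₂ k1 k2 hlt⟩

end Limit

/-! ### Oscillating right-hand sides -/

/-- A continuous function with values in `[lo, hi]` and discrete level sets that takes every value
in `(lo, hi)` arbitrarily far to the left and to the right. -/
structure Oscillates (s : ℝ → ℝ) (lo hi : ℝ) : Prop where
  continuous : Continuous s
  ge : ∀ y, lo ≤ s y
  le : ∀ y, s y ≤ hi
  finite : ∀ c a b, (Icc a b ∩ {y | s y = c}).Finite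
  top : ∀ c ∈ Ioo lo hi, ∀ x, ∃ y, x < y ∧ s y = c
  bot : ∀ c ∈ Ioo lo hi, ∀ x, ∃ y, y < x ∧ s y = c

lemma Oscillates.const_mul {s : ℝ → ℝ} {lo hi t : ℝ} (h : Oscillates s lo hi) (ht : 0 < t) :
    Oscillates (fun y => t * s y) (t * lo) (t * hi) := by
  have hdiv : ∀ c ∈ Ioo (t * lo) (t * hi), c / t ∈ Ioo lo hi := fun c hc =>
    ⟨by rw [lt_div_iff₀ ht]; linarith [hc.1], by rw [div_lt_iff₀ ht]; linarith [hc.2]⟩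
  refine ⟨continuous_const.mul h.continuous, fun y => mul_le_mul_of_nonneg_left (h.ge y) ht.le,
    fun y => mul_le_mul_of_nonneg_left (h.le y) ht.le, fun c a b => ?_, fun c hc x => ?_,
    fun c hc x => ?_⟩
  · refine (h.finite (c / t) a b).subset fun y hy => ⟨hy.1, ?_⟩
    have : t * s y = c := hy.2
    change s y = c / t
    rw [eq_div_iff ht.ne']; linarith
  · obtain ⟨y, hy, e⟩ := h.top _ (hdiv c hc) x
    exact ⟨y, hy, by rw [e]; field_simp⟩
  · obtain ⟨y, hy, e⟩ := h.bot _ (hdiv c hc) x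
    exact ⟨y, hy, by rw [e]; field_simp⟩

lemma Oscillates.const_sub {V : ℝ → ℝ} {lo hi : ℝ} (h : Oscillates V lo hi) (μ : ℝ) :
    Oscillates (fun y => μ - V y) (μ - hi) (μ - lo) := by
  have hs : ∀ c ∈ Ioo (μ - hi) (μ - lo), μ - c ∈ Ioo lo hi := fun c hc =>
    ⟨by linarith [hc.2], by linarith [hc.1]⟩
  refine ⟨continuous_const.sub h.continuous, fun y => by linarith [h.le y],
    fun y => by linarith [h.ge y], fun c a b => ?_, fun c hc x => ?_, fun c hc x => ?_⟩
  · refine (h.finite (μ - c) a b).subset fun y hy => ⟨hy.1, ?_⟩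
    have : μ - V y = c := hy.2
    change V y = μ - c
    linarith
  · obtain ⟨y, hy, e⟩ := h.top _ (hs c hc) x
    exact ⟨y, hy, by rw [e]; ring⟩
  · obtain ⟨y, hy, e⟩ := h.bot _ (hs c hc) x
    exact ⟨y, hy, by rw [e]; ring⟩

section Extremal
variable {H : ℝ → ℝ} {L : ℕ} {p : ℕ → ℝ} {s u : ℝ → ℝ} {lo hi b : ℝ}

lemma Oscillates.isBumpRhs (h : Oscillates s lo hi) (h0 : 0 ≤ lo)
    (hc : ∃ c ∈ criticalValues H p L, c ∈ Ioo lo hi) : IsBumpRhs H p L s := by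
  obtain ⟨c, hc, hI⟩ := hc
  refine ⟨h.continuous, fun y => h0.trans (h.ge y), fun a b => ?_, fun x => ?_, fun x => ?_⟩
  · refine ((finite_criticalValues (H := H) (p := p) (L := L)).biUnion fun c _ =>
      h.finite c a b).subset fun y hy => ?_
    exact mem_biUnion (show s y ∈ criticalValues H p L from hy.2) ⟨hy.1, rfl⟩
  · obtain ⟨y, hy, e⟩ := h.top c hI x
    exact ⟨y, hy, e ▸ hc⟩
  · obtain ⟨y, hy, e⟩ := h.bot c hI x
    exact ⟨y, hy, e ▸ hc⟩

/-- All critical values are positive and there are finitely many of them. -/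
lemma HasBumps.exists_isRegularValue_near_zero (hb : HasBumps H L p) :
    ∃ δ > 0, ∀ c, 0 ≤ c → c < δ → IsRegularValue H p L c := by
  have hfin := finite_criticalValues (H := H) (p := p) (L := L)
  have : (criticalValues H p L)ᶜ ∈ 𝓝 (0 : ℝ) := hfin.isClosed.isOpen_compl.mem_nhds fun h =>
    (hb.pos_of_mem_criticalValues h).false
  have hev : ∀ᶠ c in 𝓝 (0 : ℝ), ∀ d ∈ criticalValues H p L, c < d := by
    rw [eventually_all_finite hfin]
    exact fun d hd => eventually_lt_nhds (hb.pos_of_mem_criticalValues hd)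
  obtain ⟨δ, hδ, h⟩ := Metric.eventually_nhds_iff.1 hev
  refine ⟨δ, hδ, fun c h0 hc => ⟨h0, Or.inl fun i h1 h2 => h ?_ _ ⟨i, h1, h2, Or.inl rfl⟩⟩⟩
  rw [Real.dist_eq, sub_zero, abs_of_nonneg h0]; exact hc

lemma IsRegularValue.eventually (c : ℝ) (hc : IsRegularValue H p L c) (h0 : 0 < c) :
    ∀ᶠ d in 𝓝 c, IsRegularValue H p L d := by
  obtain ⟨-, h | h⟩ := hc
  · have : ∀ᶠ d in 𝓝 c, ∀ i ∈ Icc 1 L, d < minValue H p i := by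
      rw [eventually_all_finite (finite_Icc 1 L)]
      exact fun i hi => eventually_lt_nhds (h i hi.1 hi.2)
    filter_upwards [this, eventually_gt_nhds h0] with d hd h0
    exact ⟨h0.le, Or.inl fun i h1 h2 => hd i ⟨h1, h2⟩⟩
  · have : ∀ᶠ d in 𝓝 c, ∀ i ∈ Icc 1 L, maxValue H p i < d := by
      rw [eventually_all_finite (finite_Icc 1 L)]
      exact fun i hi => eventually_gt_nhds (h i hi.1 hi.2)
    filter_upwards [this, eventually_gt_nhds h0] with d hd h0
    exact ⟨h0.le, Or.inr fun i h1 h2 => hd i ⟨h1, h2⟩⟩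

/-- The comparison hypothesis for proportional right-hand sides. -/
lemma HasBumps.le_or_regular_of_scale (hb : HasBumps H L p) {r t : ℝ} (hs : Continuous s)
    (h0 : ∀ y, 0 ≤ s y) (hr : 0 ≤ r) (hrt : r < t) (y : ℝ) :
    r * s y < t * s y ∨ ∃ e > 0, ∀ z ∈ Ioo (y - e) (y + e), r * s z ≤ t * s z ∧
      IsRegularValue H p L (r * s z) ∧ IsRegularValue H p L (t * s z) := by
  rcases (h0 y).eq_or_lt with h | h
  · right
    obtain ⟨δ, hδ, hreg⟩ := hb.exists_isRegularValue_near_zero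
    have : ∀ᶠ z in 𝓝 y, t * s z < δ := (continuous_const.mul hs).continuousAt.eventually_lt
      continuousAt_const (by simpa [← h] using hδ)
    obtain ⟨e, he, hball⟩ := Metric.eventually_nhds_iff.1 this
    refine ⟨e, he, fun z hz => ?_⟩
    have h1 := hball (y := z) (by rw [Real.dist_eq, abs_lt]; constructor <;> linarith [hz.1, hz.2])
    have h2 := mul_le_mul_of_nonneg_right hrt.le (h0 z)
    exact ⟨h2, hreg _ (mul_nonneg hr (h0 z)) (h2.trans_lt h1),
      hreg _ (mul_nonneg (hr.trans hrt.le) (h0 z)) h1⟩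
  · exact Or.inl (mul_lt_mul_of_pos_right hrt h)

lemma tendsto_scale (s : ℝ → ℝ) (hs : Continuous s) {ι : Type*} {l : Filter ι} {t : ι → ℝ}
    (ht : Tendsto t l (𝓝 1)) (a b ε : ℝ) (hε : ε > 0) :
    ∀ᶠ i in l, ∀ x ∈ Icc a b, |t i * s x - s x| ≤ ε := by
  obtain ⟨C, hC⟩ := (isCompact_Icc (a := a) (b := b)).exists_bound_of_continuousOn hs.continuousOn
  have hC' : ∀ x ∈ Icc a b, |s x| ≤ |C| + 1 := fun x hx =>
    (hC x hx).trans ((le_abs_self C).trans (by linarith))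
  have := (Metric.tendsto_nhds.1 ht) (ε / (|C| + 1)) (by positivity)
  filter_upwards [this] with i hi x hx
  rw [Real.dist_eq] at hi
  rw [show t i * s x - s x = (t i - 1) * s x by ring, abs_mul]
  calc |t i - 1| * |s x| ≤ ε / (|C| + 1) * (|C| + 1) := by
        gcongr
        exact hC' x hx
    _ = ε := by field_simp

/-- Off the critical points the values are roots of `H = s` and already obey the sharper bound, so
the truncation changes `g` only on a null set. -/
lemma AdmDeriv.cap (h : IsBumpRhs H p L s) {B : ℝ} {g : ℝ → ℝ} (hg : AdmDeriv H p L s B g)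
    (hb0 : 0 ≤ b) (hbd : ∀ y q, 0 ≤ q → H q = s y → q ≤ b) :
    AdmDeriv H p L s b (fun y => min (g y) b) ∧ prim (fun y => min (g y) b) = prim g := by
  have heq : ∀ y, s y ∉ criticalValues H p L → min (g y) b = g y := fun y hy =>
    min_eq_left (hbd y _ (hg.nonneg y) (h.apply_eq hg.branchwise hy))
  have hae : (fun y => min (g y) b) =ᵐ[volume] g := h.ae_notMem.mono heq
  refine ⟨⟨hg.sol.congr_ae hae, fun y => le_min (hg.nonneg y) hb0, fun y => min_le_right _ _,
    fun x y hxy hfree => ?_⟩, prim_congr_ae hae⟩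
  obtain ⟨j, h1, h2, h3⟩ := hg.branchwise x y hxy hfree
  exact ⟨j, h1, h2, fun z hz => ⟨(h3 z hz).1, by rw [← (h3 z hz).2, heq z (hfree z hz)]⟩⟩

lemma antitone_prim_sub {f g : ℝ → ℝ} (hf : MemLp f ⊤ volume) (hg : MemLp g ⊤ volume)
    (h : ∀ y, f y ≤ g y) : Antitone (fun x => prim f x - prim g x) := by
  intro x y hxy
  have h1 := prim_sub_prim hf x y
  have h2 := prim_sub_prim hg x y
  have h3 := intervalIntegral.integral_mono_on (μ := volume) hxy (hf.intervalIntegrable_top x y)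
    (hg.intervalIntegrable_top x y) fun t _ => h t
  simp only
  linarith

lemma IsNormalizedHamiltonian.exists_root_bound (hH : IsNormalizedHamiltonian H) (c : ℝ) :
    ∃ B, 0 ≤ B ∧ ∀ q, H q ≤ c → q ≤ B := by
  obtain ⟨R, hR0, hR⟩ := exists_bound_of_coercive hH.coercive c
  exact ⟨R, hR0, fun q hq => (le_abs_self q).trans (hR q hq)⟩

/-- Any nondecreasing solution lies between the limits of admissible derivatives for slightly
smaller and slightly larger right-hand sides. -/
lemma Oscillates.exists_admDeriv_comparison (h : Oscillates s lo hi) (hb : HasBumps H L p)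
    (hH : IsNormalizedHamiltonian H) (h0 : 0 ≤ lo)
    (hc : ∃ c ∈ criticalValues H p L, c ∈ Ioo lo hi)
    (hr : ∃ c, IsRegularValue H p L c ∧ c ∈ Ioo lo hi) (hb0 : 0 ≤ b)
    (hbd : ∀ y q, 0 ≤ q → H q = s y → q ≤ b) (hu : IsMonoSol H s u) :
    (∃ g, AdmDeriv H p L s b g ∧ Antitone fun x => u x - prim g x) ∧
    ∃ g, AdmDeriv H p L s b g ∧ Antitone fun x => prim g x - u x := by
  have hs := h.isBumpRhs h0 hc
  obtain ⟨c, hcc, hcI⟩ := hc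
  obtain ⟨d, hd, hdI⟩ := hr
  have hd0 : 0 < d := h0.trans_lt hdI.1
  -- One bound for all scalings `t ≤ 2`; the sharp bound `b` is restored in the limit by truncation.
  obtain ⟨B, hB0, hB⟩ := hH.exists_root_bound (2 * hi)
  have hhi : 0 ≤ hi := h0.trans (hdI.1.trans hdI.2).le
  have hexists : ∀ t : ℝ, 0 < t → t ≤ 2 → c ∈ Ioo (t * lo) (t * hi) →
      ∃ f, AdmDeriv H p L (fun y => t * s y) B f := by
    intro t ht ht2 hct
    refine ((h.const_mul ht).isBumpRhs (by positivity) ⟨c, hcc, hct⟩).exists_admDeriv hb hH hB0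
      fun y q hq hqs => hB q (hqs.le.trans ?_)
    exact (mul_le_mul_of_nonneg_left (h.le y) ht.le).trans (mul_le_mul_of_nonneg_right ht2 hhi)
  have hev : ∀ e ∈ Ioo lo hi, ∀ᶠ t in 𝓝 (1 : ℝ), e ∈ Ioo (t * lo) (t * hi) := by
    intro e he
    have c1 : Tendsto (fun t : ℝ => t * lo) (𝓝 1) (𝓝 (1 * lo)) := tendsto_id.mul_const lo
    have c2 : Tendsto (fun t : ℝ => t * hi) (𝓝 1) (𝓝 (1 * hi)) := tendsto_id.mul_const hi
    rw [one_mul] at c1 c2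
    exact (c1.eventually_lt_const he.1).and (c2.eventually_const_lt he.2)
  have hgood : ∀ᶠ t in 𝓝 (1 : ℝ), 0 < t ∧ t ≤ 2 ∧ c ∈ Ioo (t * lo) (t * hi) ∧
      d ∈ Ioo (t * lo) (t * hi) :=
    (eventually_gt_nhds one_pos).and ((eventually_le_nhds one_lt_two).and
      ((hev c hcI).and (hev d hdI)))
  have hmain : ∀ t : ℕ → ℝ, Tendsto t atTop (𝓝 1) → (∀ n, 0 < t n ∧ t n ≤ 2 ∧
      c ∈ Ioo (t n * lo) (t n * hi)) → ∃ f : ℕ → ℝ → ℝ,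
      (∀ n, AdmDeriv H p L (fun y => t n * s y) B (f n)) ∧ ∃ g, AdmDeriv H p L s b g ∧
      ∀ x, Tendsto (fun n => prim (f n) x) (hyperfilter ℕ : Filter ℕ) (𝓝 (prim g x)) := by
    intro t ht hg
    choose f hf using fun n => hexists (t n) (hg n).1 (hg n).2.1 (hg n).2.2
    obtain ⟨g, hgA, hlim⟩ := hs.exists_limit_admDeriv hb hH (hyperfilter ℕ) hf
      (tendsto_scale s h.continuous (ht.mono_left Nat.hyperfilter_le_atTop))
    obtain ⟨k1, k2⟩ := hgA.cap hs hb0 hbd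
    exact ⟨f, hf, _, k1, by rw [k2]; exact hlim⟩
  have hanti : ∀ (w : ℕ → ℝ → ℝ) (v : ℝ → ℝ), (∀ n, Antitone (w n)) →
      (∀ x, Tendsto (fun n => w n x) (hyperfilter ℕ : Filter ℕ) (𝓝 (v x))) → Antitone v :=
    fun w v hw hv x y hxy => le_of_tendsto_of_tendsto (hv y) (hv x)
      (Eventually.of_forall fun n => hw n hxy)
  constructor
  -- Scalings decreasing to `1`: the approximants have the larger right-hand side, and the recurrent
  -- points are where `s` itself takes the regular value `d`.
  · obtain ⟨t, ht, hg⟩ := exists_seq_forall_of_frequently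
      (hgood.filter_mono nhdsWithin_le_nhds |>.and self_mem_nhdsWithin :
        ∀ᶠ t in 𝓝[>] (1 : ℝ), _).frequently
    obtain ⟨f, hf, g, hgA, hlim⟩ := hmain t (ht.mono_right nhdsWithin_le_nhds)
      fun n => ⟨(hg n).1.1, (hg n).1.2.1, (hg n).1.2.2.1⟩
    refine ⟨g, hgA, hanti (fun n x => u x - prim (f n) x) _ (fun n => ?_)
      fun x => (hlim x).const_sub (u x)⟩
    have h1 : 1 < t n := (hg n).2
    refine hu.antitone_sub hb hH ((hf n).sol.isMonoSol (hf n).nonneg) h.continuous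
      (continuous_const.mul h.continuous) (fun y => ?_) fun x => ?_
    · simpa using hb.le_or_regular_of_scale h.continuous hs.nonneg zero_le_one h1 y
    · obtain ⟨y, hy, e⟩ := h.top d hdI x
      exact ⟨y, hy, by rw [e]; nlinarith, e ▸ hd⟩
  -- Scalings increasing to `1`: now the scaled right-hand side is the smaller one, so it is `t * s`
  -- that must take the value `d` recurrently.
  · obtain ⟨t, ht, hg⟩ := exists_seq_forall_of_frequently
      (hgood.filter_mono nhdsWithin_le_nhds |>.and self_mem_nhdsWithin :
        ∀ᶠ t in 𝓝[<] (1 : ℝ), _).frequently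
    obtain ⟨f, hf, g, hgA, hlim⟩ := hmain t (ht.mono_right nhdsWithin_le_nhds)
      fun n => ⟨(hg n).1.1, (hg n).1.2.1, (hg n).1.2.2.1⟩
    refine ⟨g, hgA, hanti (fun n x => prim (f n) x - u x) _ (fun n => ?_)
      fun x => (hlim x).sub_const (u x)⟩
    have h1 : t n < 1 := (hg n).2
    have h2 : 0 < t n := (hg n).1.1
    refine ((hf n).sol.isMonoSol (hf n).nonneg).antitone_sub hb hH hu
      (continuous_const.mul h.continuous) h.continuous (fun y => ?_) fun x => ?_
    · simpa using hb.le_or_regular_of_scale h.continuous hs.nonneg h2.le h1 y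
    · obtain ⟨y, hy, e⟩ := (h.const_mul h2).top d (hg n).1.2.2.2 x
      refine ⟨y, hy, ?_, by rw [e]; exact hd⟩
      have : 0 < s y := by
        have := hs.nonneg y
        rcases this.eq_or_lt with h3 | h3
        · rw [← h3] at e; simp at e; linarith
        · exact h3
      nlinarith

/-- The least and the greatest derivative of nondecreasing solutions. -/
structure IsExtremalPair (H s f g : ℝ → ℝ) (b : ℝ) : Prop where
  lower : SolDeriv H s f
  upper : SolDeriv H s g
  nonneg : ∀ y, 0 ≤ f y
  le : ∀ y, f y ≤ g y
  bound : ∀ y, g y ≤ b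
  sub_upper : ∀ u, IsMonoSol H s u → Antitone fun x => u x - prim g x
  lower_sub : ∀ u, IsMonoSol H s u → Antitone fun x => prim f x - u x

/-- An arbitrary nondecreasing solution is squeezed between admissible derivatives, and these lie
between their pointwise infimum and supremum. -/
theorem Oscillates.isExtremalPair_of_critical (h : Oscillates s lo hi) (hb : HasBumps H L p)
    (hH : IsNormalizedHamiltonian H) (h0 : 0 ≤ lo)
    (hc : ∃ c ∈ criticalValues H p L, c ∈ Ioo lo hi)
    (hr : ∃ c, IsRegularValue H p L c ∧ c ∈ Ioo lo hi) (hb0 : 0 ≤ b)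
    (hbd : ∀ y q, 0 ≤ q → H q = s y → q ≤ b) :
    AdmDeriv H p L s b (infDeriv H p L s b) ∧ AdmDeriv H p L s b (supDeriv H p L s b) ∧
      IsExtremalPair H s (infDeriv H p L s b) (supDeriv H p L s b) b := by
  have hs := h.isBumpRhs h0 hc
  obtain ⟨f₀, hf₀⟩ := hs.exists_admDeriv hb hH hb0 hbd
  have hi' := hs.admDeriv_infDeriv hb hH ⟨f₀, hf₀⟩
  have hs' := hs.admDeriv_supDeriv hb hH ⟨f₀, hf₀⟩
  refine ⟨hi', hs', hi'.sol, hs'.sol, hi'.nonneg, fun y => (hf₀.infDeriv_le y).trans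
    (hf₀.le_supDeriv y), hs'.le, fun u hu => ?_, fun u hu => ?_⟩
  · obtain ⟨g, hg, ha⟩ := (h.exists_admDeriv_comparison hb hH h0 hc hr hb0 hbd hu).1
    have := ha.add (antitone_prim_sub hg.sol.memLp hs'.sol.memLp fun y => hg.le_supDeriv y)
    refine fun x y hxy => ?_
    have := this hxy
    simp only at this
    linarith
  · obtain ⟨g, hg, ha⟩ := (h.exists_admDeriv_comparison hb hH h0 hc hr hb0 hbd hu).2
    have := ha.add (antitone_prim_sub hi'.sol.memLp hg.sol.memLp fun y => hg.infDeriv_le y)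
    refine fun x y hxy => ?_
    have := this hxy
    simp only at this
    linarith

/-- Off a countable set the slope of any nondecreasing solution is forced to be `f`, so all of them
have the same increments. -/
lemma isExtremalPair_of_regular (hH : IsNormalizedHamiltonian H) (hs : Continuous s) {f : ℝ → ℝ}
    (hf : Continuous f) (hf0 : ∀ y, 0 ≤ f y) (hfb : ∀ y, f y ≤ b) (hHf : ∀ y, H (f y) = s y)
    {N : Set ℝ} (hN : N.Countable) (hroot : ∀ y, y ∉ N → IsRegularRoot H (s y) (f y)) :
    IsExtremalPair H s f f b := by
  have hsol : SolDeriv H s f := solDeriv_of_continuous hf (C := b)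
    (fun y => by rw [abs_of_nonneg (hf0 y)]; exact hfb y) hHf
  have key : ∀ u, IsMonoSol H s u → ∀ x y, u y - u x = prim f y - prim f x := by
    intro u hu x y
    rw [prim_sub_prim hsol.memLp]
    exact (integral_eq_of_hasDerivAt_off_countable u f hN hu.continuous.continuousOn
      (fun z hz => hu.hasDerivAt hH.continuous hH.coercive hs (hroot z hz.2))
      (hsol.memLp.intervalIntegrable_top _ _)).symm
  refine ⟨hsol, hsol, hf0, fun y => le_rfl, hfb, fun u hu x y hxy => ?_, fun u hu x y hxy => ?_⟩
  · have := key u hu x y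
    simp only; linarith
  · have := key u hu x y
    simp only; linarith

end Extremal

/-! ### The extremal derivatives at a given level -/

section Level
variable {H : ℝ → ℝ} {L : ℕ} {p : ℕ → ℝ} {V s f : ℝ → ℝ} {mbar μ : ℝ}

lemma IsAdmissibleDecomposition.comp_add {a : ℤ → ℝ}
    (ha : IsAdmissibleDecomposition H p L V μ a) (z : ℝ) :
    IsAdmissibleDecomposition H p L (fun y => V (y + z)) μ (fun i => a i - z) := by
  refine ⟨fun i j hij => sub_lt_sub_right (ha.strictMono hij) z,
    tendsto_atTop_add_const_right _ _ ha.tendsto_top,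
    tendsto_atBot_add_const_right _ _ ha.tendsto_bot, fun i => ?_, fun i y hy => ?_⟩
  · simpa using ha.endpoint i
  · exact ha.interior i (y + z) ⟨by linarith [hy.1], by linarith [hy.2]⟩

lemma IsAdmissible.comp_add (hf : IsAdmissible H p L mbar V μ f) (z : ℝ) :
    IsAdmissible H p L mbar (fun y => V (y + z)) μ (fun y => f (y + z)) := by
  obtain ⟨h1, h2, a, ha, h3⟩ := hf
  refine ⟨isSolutionDerivative_iff.2 ((isSolutionDerivative_iff.1 h1).comp_add z),
    fun y => h2 (y + z), _, ha.comp_add z, fun i => ?_⟩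
  obtain ⟨j, j1, j2, hj⟩ := h3 i
  exact ⟨j, j1, j2, fun y hy => hj (y + z) ⟨by linarith [hy.1], by linarith [hy.2]⟩⟩

/-- Admissibility commutes with translation for every `V`; this makes the extremal derivatives
stationary without any exceptional set. -/
lemma setOf_isAdmissible_translate (z : ℝ) (V : BUC) (y : ℝ) :
    {t | ∃ f, IsAdmissible H p L mbar (BUC.translate z V).1 μ f ∧ t = f y} =
      {t | ∃ f, IsAdmissible H p L mbar V.1 μ f ∧ t = f (y + z)} := by
  ext t
  constructor
  · rintro ⟨f, hf, rfl⟩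
    refine ⟨fun x => f (x + -z), ?_, by simp⟩
    have := hf.comp_add (-z)
    simpa [BUC.translate] using this
  · rintro ⟨f, hf, rfl⟩
    exact ⟨fun x => f (x + z), hf.comp_add z, rfl⟩

lemma isStationaryField_upperDerivative : IsStationaryField (upperDerivative H p L mbar μ) := by
  intro z V y
  unfold upperDerivative
  rw [setOf_isAdmissible_translate]
  rfl

lemma isStationaryField_lowerDerivative : IsStationaryField (lowerDerivative H p L mbar μ) := by
  intro z V y
  unfold lowerDerivative
  rw [setOf_isAdmissible_translate]
  rfl

/-- The largest nonnegative momentum whose energy is at most `μ + mbar`. -/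
def levelBound (H : ℝ → ℝ) (mbar μ : ℝ) : ℝ := sSup {q | 0 ≤ q ∧ H q ≤ μ + mbar}

lemma IsNormalizedHamiltonian.le_levelBound (hH : IsNormalizedHamiltonian H) {q : ℝ} (h0 : 0 ≤ q)
    (hq : H q ≤ μ + mbar) : q ≤ levelBound H mbar μ := by
  obtain ⟨B, -, hB⟩ := hH.exists_root_bound (μ + mbar)
  exact le_csSup ⟨B, fun q hq => hB q hq.2⟩ ⟨h0, hq⟩

lemma IsNormalizedHamiltonian.levelBound_nonneg (hH : IsNormalizedHamiltonian H)
    (h : 0 ≤ μ + mbar) : 0 ≤ levelBound H mbar μ :=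
  hH.le_levelBound le_rfl (by rwa [hH.zero])

/-- The intervals of an admissible decomposition are exactly the maximal ones free of critical
points. Following a branch on each critical-free interval is therefore the same condition, and it
does not mention the decomposition. -/
lemma isAdmissible_iff (hs : IsBumpRhs H p L (fun y => μ - V y)) :
    IsAdmissible H p L mbar V μ f ↔
      AdmDeriv H p L (fun y => μ - V y) (levelBound H mbar μ) f := by
  constructor
  · rintro ⟨h1, h2, a, ha, h3⟩
    refine ⟨isSolutionDerivative_iff.1 h1, fun y => (h2 y).1, fun y => (h2 y).2,
      fun x y hxy hfree => ?_⟩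
    obtain ⟨i, i1, i2⟩ := exists_index ha.strictMono ha.tendsto_top ha.tendsto_bot ((x + y) / 2)
    have h4 : a i ≤ x := by
      by_contra! h
      exact hfree (a i) ⟨h, by linarith⟩ (ha.endpoint i)
    have h5 : y ≤ a (i + 1) := by
      by_contra! h
      exact hfree (a (i + 1)) ⟨by linarith, h⟩ (ha.endpoint (i + 1))
    obtain ⟨j, j1, j2, hj⟩ := h3 i
    exact ⟨j, j1, j2, fun z hz => hj z ⟨h4.trans_lt hz.1, hz.2.trans_le h5⟩⟩
  · rintro ⟨h1, h2, h3, h4⟩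
    obtain ⟨a, ha, htop, hbot, hrange⟩ := exists_int_orderEmbedding hs.finite
      (fun x => by obtain ⟨y, h1, h2⟩ := hs.top x; exact ⟨y, h2, h1⟩)
      (fun x => by obtain ⟨y, h1, h2⟩ := hs.bot x; exact ⟨y, h2, h1⟩)
    have hfree : ∀ i, ∀ z ∈ Ioo (a i) (a (i + 1)), μ - V z ∉ criticalValues H p L := by
      intro i z hz hc
      obtain ⟨k, rfl⟩ : z ∈ range a := hrange ▸ hc
      have h1 := ha.lt_iff_lt.1 hz.1
      have h2 := ha.lt_iff_lt.1 hz.2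
      omega
    exact ⟨isSolutionDerivative_iff.2 h1, fun y => ⟨h2 y, h3 y⟩, a, ⟨ha, htop, hbot,
      fun i => by have := hrange.subset ⟨i, rfl⟩; exact this, hfree⟩,
      fun i => h4 _ _ (ha (by omega)) (hfree i)⟩

lemma HasBumps.minValue_lt_maxValue (hb : HasBumps H L p) {i : ℕ} (h1 : 1 ≤ i) (h2 : i ≤ L) :
    minValue H p i < maxValue H p i := by
  have hlt := hb.decreasing (2 * i - 1) (by omega) (by omega)
  rw [show 2 * i - 1 + 1 = 2 * i by omega] at hlt
  exact hb.anti_inner i h1 h2 ⟨le_rfl, hlt.le⟩ ⟨hlt.le, le_rfl⟩ hlt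

lemma HasBumps.mem_image_last (hb : HasBumps H L p) (hH : IsNormalizedHamiltonian H) {c : ℝ}
    (h0 : 0 ≤ c) (hc : ∀ i, 1 ≤ i → i ≤ L → c ≤ minValue H p i) :
    c ∈ H '' branch p (2 * L + 1) := by
  refine hb.mem_image_of_noncritical hH (by omega) le_rfl
    ⟨p (2 * L + 1), hb.left_mem (by omega) le_rfl, rfl⟩ h0 fun e he hne hcrit => ?_
  rw [hb.last, hH.zero, uIcc_of_le h0] at he
  obtain ⟨j, j1, j2, rfl | rfl⟩ := hcrit
  · exact hne (le_antisymm he.2 (hc j j1 j2))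
  · have := hb.minValue_lt_maxValue j1 j2
    linarith [he.2, hc j j1 j2]

lemma HasBumps.mem_image_one (hb : HasBumps H L p) (hH : IsNormalizedHamiltonian H) {c : ℝ}
    (h0 : 0 ≤ c) (hc : ∀ i, 1 ≤ i → i ≤ L → maxValue H p i ≤ c) : c ∈ H '' branch p 1 := by
  have hp1 : H (p 1) ≤ c := by
    rcases Nat.eq_zero_or_pos L with rfl | hL
    · have := hb.last
      simp only [mul_zero, zero_add] at this
      rw [this, hH.zero]; exact h0
    · exact (hb.minValue_lt_maxValue le_rfl hL).le.trans (hc 1 le_rfl hL)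
  obtain ⟨q, hq, hqc⟩ := hH.exists_root hp1
  exact ⟨q, mem_branch_iff.2 ⟨by simp, hq⟩, hqc⟩

/-- If all `M_i` are below `μ + mbar`, values just below `μ + mbar` exceed every maximum. Otherwise
some `M_i ≥ μ + mbar`, strictness gives `m_j > μ` for all `j`, and values just above `μ` lie below
every minimum. -/
lemma exists_isRegularValue_Ioo (hm : 0 < mbar) (h0 : 0 ≤ μ)
    (hstrict : ∀ i j, 1 ≤ i → i ≤ L → 1 ≤ j → j ≤ L → maxValue H p i - minValue H p j < mbar) :
    ∃ c, IsRegularValue H p L c ∧ c ∈ Ioo μ (μ + mbar) := by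
  by_cases h : ∀ i, 1 ≤ i → i ≤ L → maxValue H p i < μ + mbar
  · have : ∀ᶠ c in 𝓝[<] (μ + mbar), ∀ i ∈ Icc 1 L, maxValue H p i < c := by
      rw [eventually_all_finite (finite_Icc 1 L)]
      exact fun i hi => nhdsWithin_le_nhds (eventually_gt_nhds (h i hi.1 hi.2))
    obtain ⟨c, h1, h2⟩ := (this.and (Ioo_mem_nhdsLT (show μ < μ + mbar by linarith))).exists
    exact ⟨c, ⟨h0.trans h2.1.le, Or.inr fun i i1 i2 => h1 i ⟨i1, i2⟩⟩, h2⟩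
  · push Not at h
    obtain ⟨i, i1, i2, hi⟩ := h
    have : ∀ᶠ c in 𝓝[>] μ, ∀ j ∈ Icc 1 L, c < minValue H p j := by
      rw [eventually_all_finite (finite_Icc 1 L)]
      exact fun j hj => nhdsWithin_le_nhds (eventually_lt_nhds (by
        linarith [hstrict i j i1 i2 hj.1 hj.2]))
    obtain ⟨c, h1, h2⟩ := (this.and (Ioo_mem_nhdsGT (show μ < μ + mbar by linarith))).exists
    exact ⟨c, ⟨h0.trans h2.1.le, Or.inl fun i i1 i2 => h1 i ⟨i1, i2⟩⟩, h2⟩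

/-- For a minimum `m_i < μ + mbar` and a maximum `M_j > μ`: either `m_i > μ` already serves, or `m_i
≤ μ` and strictness gives `M_j < m_i + mbar ≤ μ + mbar`. -/
lemma exists_criticalValue_Ioo (hμ : μ ∈ bumpLevels H p L mbar)
    (hstrict : ∀ i j, 1 ≤ i → i ≤ L → 1 ≤ j → j ≤ L → maxValue H p i - minValue H p j < mbar) :
    ∃ c ∈ criticalValues H p L, c ∈ Ioo μ (μ + mbar) := by
  obtain ⟨-, ⟨i, i1, i2, hi⟩, j, j1, j2, hj⟩ := hμ
  by_cases h : μ < minValue H p i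
  · exact ⟨_, ⟨i, i1, i2, Or.inl rfl⟩, h, by linarith⟩
  · exact ⟨_, ⟨j, j1, j2, Or.inr rfl⟩, hj, by linarith [hstrict j i j1 j2 i1 i2]⟩

lemma Oscillates.countable_criticalPoints {lo hi : ℝ} (h : Oscillates s lo hi) :
    {y | s y ∈ criticalValues H p L}.Countable := by
  have : {y | s y ∈ criticalValues H p L} ⊆
      ⋃ n : ℕ, ⋃ c ∈ criticalValues H p L, Icc (-(n : ℝ)) n ∩ {y | s y = c} := by
    intro y hy
    obtain ⟨n, hn⟩ := exists_nat_ge |y|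
    exact mem_iUnion.2 ⟨n, mem_biUnion (show s y ∈ criticalValues H p L from hy)
      ⟨abs_le.1 hn, rfl⟩⟩
  exact (countable_iUnion fun n => finite_criticalValues.countable.biUnion
    fun c _ => (h.finite c _ _).countable).mono this

/-- Outside `bumpLevels` all values of `μ - V` lie weakly below every minimum or weakly above every
maximum, so a single branch applies everywhere; the root can fail to be regular only where a
critical value is attained. -/
lemma outerDerivative_spec (hb : HasBumps H L p) (hH : IsNormalizedHamiltonian H)
    (hV : Oscillates V (-mbar) 0) (h0 : 0 ≤ μ) (hμ : μ ∉ bumpLevels H p L mbar) :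
    Continuous (outerDerivative H p L mbar μ V) ∧
    (∀ y, 0 ≤ outerDerivative H p L mbar μ V y) ∧
    (∀ y, H (outerDerivative H p L mbar μ V y) = μ - V y) ∧
    ∀ y, μ - V y ∉ criticalValues H p L →
      IsRegularRoot H (μ - V y) (outerDerivative H p L mbar μ V y) := by
  have hV0 := hV.le
  have hV1 := hV.ge
  have hs0 : ∀ y, 0 ≤ μ - V y := fun y => by linarith [hV0 y]
  have hsc : Continuous fun y => μ - V y := continuous_const.sub hV.continuous
  unfold outerDerivative
  split_ifs with h
  · have hle : ∀ y i, 1 ≤ i → i ≤ L → μ - V y ≤ minValue H p i := fun y i i1 i2 => by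
      linarith [h i i1 i2, hV1 y]
    have himg := fun y => hb.mem_image_last hH (hs0 y) (hle y)
    refine ⟨(hb.continuousOn_branchInv hH (by omega) le_rfl).comp_continuous hsc himg,
      fun y => hb.branchInv_nonneg (by omega) le_rfl (himg y), fun y => apply_branchInv (himg y),
      fun y hy => (hb.isRegularRoot_low hH (hs0 y) fun i i1 i2 => ?_).2⟩
    exact lt_of_le_of_ne (hle y i i1 i2) fun e => hy ⟨i, i1, i2, Or.inl e⟩
  · push Not at h
    obtain ⟨j, j1, j2, hj⟩ := h
    have hle : ∀ y i, 1 ≤ i → i ≤ L → maxValue H p i ≤ μ - V y := fun y i i1 i2 => by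
      by_contra! hlt
      exact hμ ⟨h0, ⟨j, j1, j2, hj⟩, i, i1, i2, by linarith [hV0 y]⟩
    have himg := fun y => hb.mem_image_one hH (hs0 y) (hle y)
    refine ⟨(hb.continuousOn_branchInv hH le_rfl (by omega)).comp_continuous hsc himg,
      fun y => hb.branchInv_nonneg le_rfl (by omega) (himg y), fun y => apply_branchInv (himg y),
      fun y hy => (hb.isRegularRoot_high hH (hs0 y) fun i i1 i2 => ?_).2⟩
    exact lt_of_le_of_ne (hle y i i1 i2) fun e => hy ⟨i, i1, i2, Or.inr e.symm⟩

theorem isExtremalPair_level (hb : HasBumps H L p) (hH : IsNormalizedHamiltonian H)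
    (hstrict : ∀ i j, 1 ≤ i → i ≤ L → 1 ≤ j → j ≤ L → maxValue H p i - minValue H p j < mbar)
    (hm : 0 < mbar) {V : BUC} (hV : Oscillates V.1 (-mbar) 0) (h0 : 0 ≤ μ) :
    IsExtremalPair H (fun y => μ - V.1 y) (lowerDerivative H p L mbar μ V)
      (upperDerivative H p L mbar μ V) (levelBound H mbar μ) ∧
    (μ ∈ bumpLevels H p L mbar → IsAdmissible H p L mbar V.1 μ (lowerDerivative H p L mbar μ V) ∧
      IsAdmissible H p L mbar V.1 μ (upperDerivative H p L mbar μ V)) := by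
  have hs : Oscillates (fun y => μ - V.1 y) μ (μ + mbar) := by
    have := hV.const_sub μ
    simpa using this
  have hbd : ∀ y q, 0 ≤ q → H q = μ - V.1 y → q ≤ levelBound H mbar μ := fun y q hq e =>
    hH.le_levelBound hq (by rw [e]; exact hs.le y)
  have hb0 := hH.levelBound_nonneg (show 0 ≤ μ + mbar by linarith)
  by_cases hμ : μ ∈ bumpLevels H p L mbar
  · have hc := exists_criticalValue_Ioo hμ hstrict
    have hbr := hs.isBumpRhs h0 hc
    obtain ⟨h1, h2, h3⟩ := hs.isExtremalPair_of_critical hb hH h0 hc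
      (exists_isRegularValue_Ioo hm h0 hstrict) hb0 hbd
    have e1 : lowerDerivative H p L mbar μ V =
        infDeriv H p L (fun y => μ - V.1 y) (levelBound H mbar μ) := by
      funext y
      unfold lowerDerivative infDeriv
      rw [if_pos hμ]
      simp_rw [isAdmissible_iff hbr]
    have e2 : upperDerivative H p L mbar μ V =
        supDeriv H p L (fun y => μ - V.1 y) (levelBound H mbar μ) := by
      funext y
      unfold upperDerivative supDeriv
      rw [if_pos hμ]
      simp_rw [isAdmissible_iff hbr]
    rw [e1, e2, isAdmissible_iff hbr, isAdmissible_iff hbr]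
    exact ⟨h3, fun _ => ⟨h1, h2⟩⟩
  · have e1 : lowerDerivative H p L mbar μ V = outerDerivative H p L mbar μ V.1 := by
      funext y
      unfold lowerDerivative
      rw [if_neg hμ]
    have e2 : upperDerivative H p L mbar μ V = outerDerivative H p L mbar μ V.1 := by
      funext y
      unfold upperDerivative
      rw [if_neg hμ]
    obtain ⟨k1, k2, k3, k4⟩ := outerDerivative_spec hb hH hV h0 hμ
    rw [e1, e2]
    exact ⟨isExtremalPair_of_regular hH hs.continuous k1 k2 (fun y => hbd y _ (k2 y) (k3 y)) k3
      hs.countable_criticalPoints k4, fun h => absurd h hμ⟩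

/-- The greatest derivative at a level is below the least derivative at any higher level. -/
lemma antitone_upper_sub_lower (hb : HasBumps H L p) (hH : IsNormalizedHamiltonian H)
    (hstrict : ∀ i j, 1 ≤ i → i ≤ L → 1 ≤ j → j ≤ L → maxValue H p i - minValue H p j < mbar)
    (hm : 0 < mbar) (hV : Oscillates V (-mbar) 0) (h0 : 0 ≤ μ) {ν : ℝ} (hμν : μ < ν)
    {u v : ℝ → ℝ} (hu : IsMonoSol H (fun y => μ - V y) u) (hv : IsMonoSol H (fun y => ν - V y) v) :
    Antitone (fun x => u x - v x) := by
  obtain ⟨c, hc, hcI⟩ := exists_isRegularValue_Ioo hm h0 hstrict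
  refine hu.antitone_sub hb hH hv (continuous_const.sub hV.continuous)
    (continuous_const.sub hV.continuous) (fun y => Or.inl (by linarith)) fun x => ?_
  obtain ⟨y, hy, e⟩ := (hV.const_sub μ).top c (by simpa using hcI) x
  exact ⟨y, hy, by linarith, e ▸ hc⟩

end Level

/-! ### The negative branch -/

section Left
variable {H : ℝ → ℝ}

lemma leftInv_spec (hH : IsNormalizedHamiltonian H) {c : ℝ} (hc : 0 ≤ c) :
    leftInv H c ≤ 0 ∧ H (leftInv H c) = c := by
  have : c ∈ H '' Iic 0 := by
    obtain ⟨R, hR0, hR⟩ := exists_bound_of_coercive hH.coercive c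
    have h1 : c ≤ H (-(R + 1)) := by
      by_contra! h
      have := hR _ h.le
      rw [abs_neg, abs_of_nonneg (by linarith)] at this
      linarith
    obtain ⟨q, hq, e⟩ := intermediate_value_Icc' (show -(R + 1) ≤ 0 by linarith)
      hH.continuous.continuousOn ⟨by rw [hH.zero]; exact hc, h1⟩
    exact ⟨q, hq.2, e⟩
  exact ⟨Function.invFunOn_mem this, Function.invFunOn_eq this⟩

lemma strictAntiOn_leftInv (hH : IsNormalizedHamiltonian H) (hleft : StrictAntiOn H (Iic 0)) :
    StrictAntiOn (leftInv H) (Ici 0) := by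
  intro c hc d hd hcd
  obtain ⟨h1, h2⟩ := leftInv_spec hH hc
  obtain ⟨h3, h4⟩ := leftInv_spec hH hd
  rw [← hleft.lt_iff_gt h1 h3, h2, h4]
  exact hcd

/-- `-leftInv H` is a strictly increasing map of `[0, ∞)` onto itself, hence continuous. -/
lemma continuousOn_leftInv (hH : IsNormalizedHamiltonian H) (hleft : StrictAntiOn H (Iic 0)) :
    ContinuousOn (leftInv H) (Ici 0) := by
  have hmap : ∀ c, 0 ≤ c → leftInv H c ≤ 0 := fun c hc => (leftInv_spec hH hc).1
  have hmono : StrictMonoOn (fun c => -leftInv H c) (Ici 0) := fun c hc d hd h =>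
    neg_lt_neg (strictAntiOn_leftInv hH hleft hc hd h)
  have hsurj : (fun c => -leftInv H c) '' Ici 0 = Ici 0 := by
    ext q
    constructor
    · rintro ⟨c, hc, rfl⟩
      exact neg_nonneg.2 (hmap c hc)
    · intro hq
      have hq' : -q ∈ Iic (0 : ℝ) := mem_Iic.2 (neg_nonpos.2 hq)
      refine ⟨H (-q), hH.nonneg _, ?_⟩
      have h := leftInv_spec hH (hH.nonneg (-q))
      have := hleft.injOn h.1 hq' h.2
      simp only [this, neg_neg]
  have hcont : ContinuousOn (fun c => -leftInv H c) (Ici 0) := by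
    intro c hc
    rcases (show (0 : ℝ) ≤ c from hc).eq_or_lt with rfl | hpos
    · have h00 : -leftInv H 0 = 0 := by
        have h := leftInv_spec hH le_rfl
        rw [hleft.injOn h.1 (mem_Iic.2 le_rfl) (by rw [h.2, hH.zero]), neg_zero]
      refine hmono.continuousWithinAt_right_of_surjOn (s := Ici 0) self_mem_nhdsWithin ?_
      rw [SurjOn, hsurj, h00]
      exact Ioi_subset_Ici_self
    · refine (hmono.continuousAt_of_image_mem_nhds (Ici_mem_nhds hpos) ?_).continuousWithinAt
      rw [hsurj]
      refine Ici_mem_nhds ?_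
      have h1 := hmono (mem_Ici.2 (le_refl (0 : ℝ))) hc hpos
      have h2 := neg_nonneg.2 (hmap 0 le_rfl)
      exact lt_of_le_of_lt h2 h1
  exact hcont.neg.congr fun c _ => (neg_neg _).symm

lemma solDeriv_leftInv (hH : IsNormalizedHamiltonian H) (hleft : StrictAntiOn H (Iic 0))
    {s : ℝ → ℝ} {C : ℝ} (hs : Continuous s) (h0 : ∀ y, 0 ≤ s y) (hC : ∀ y, s y ≤ C) :
    Continuous (fun y => leftInv H (s y)) ∧ (∀ y, leftInv H C ≤ leftInv H (s y)) ∧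
      SolDeriv H s (fun y => leftInv H (s y)) := by
  have hc : Continuous (fun y => leftInv H (s y)) :=
    (continuousOn_leftInv hH hleft).comp_continuous hs h0
  have hle : ∀ y, leftInv H C ≤ leftInv H (s y) := fun y =>
    (strictAntiOn_leftInv hH hleft).antitoneOn (h0 y) ((h0 y).trans (hC y)) (hC y)
  refine ⟨hc, hle, solDeriv_of_continuous hc (C := -leftInv H C) (fun y => ?_)
    fun y => (leftInv_spec hH (h0 y)).2⟩
  rw [abs_of_nonpos (leftInv_spec hH (h0 y)).1]
  exact neg_le_neg (hle y)

end Left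

/-! ### Maximal ergodic inequality -/

section Maximal
variable {α : Type*} {T : α → α} {g : α → ℝ}

/-- The running maximum of the Birkhoff sums, starting with `0`. -/
def birkhoffMax (T : α → α) (g : α → ℝ) : ℕ → α → ℝ
  | 0, _ => 0
  | n + 1, x => max 0 (g x + birkhoffMax T g n (T x))

lemma birkhoffMax_nonneg (n : ℕ) (x : α) : 0 ≤ birkhoffMax T g n x := by
  cases n
  · exact le_rfl
  · exact le_max_left _ _

lemma birkhoffMax_le_succ (n : ℕ) (x : α) : birkhoffMax T g n x ≤ birkhoffMax T g (n + 1) x := by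
  induction n generalizing x with
  | zero => exact birkhoffMax_nonneg 1 x
  | succ n ih => exact max_le_max le_rfl (by linarith [ih (T x)])

lemma birkhoffSum_le_birkhoffMax (n : ℕ) (x : α) : birkhoffSum T g n x ≤ birkhoffMax T g n x := by
  induction n generalizing x with
  | zero => simp [birkhoffMax]
  | succ n ih =>
    rw [birkhoffSum_succ']
    exact (add_le_add le_rfl (ih (T x))).trans (le_max_right _ _)

lemma measurable_birkhoffMax [MeasurableSpace α] (hT : Measurable T) (hg : Measurable g) (n : ℕ) :
    Measurable (birkhoffMax T g n) := by
  induction n with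
  | zero => exact measurable_const
  | succ n ih => exact measurable_const.max (hg.add (ih.comp hT))

lemma birkhoffMax_le {C : ℝ} (hC : ∀ x, |g x| ≤ C) (n : ℕ) (x : α) :
    birkhoffMax T g n x ≤ n * C := by
  have h0 : 0 ≤ C := (abs_nonneg _).trans (hC x)
  induction n generalizing x with
  | zero => simp [birkhoffMax]
  | succ n ih =>
    refine max_le (by positivity) ?_
    push_cast
    linarith [ih (T x), (abs_le.1 (hC x)).2]

/-- Garsia's argument: on the event that the running maximum is positive, `g` dominates the maximum
minus its shift, whose integral is nonnegative by invariance. These events increase to the full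
space. -/
theorem integral_nonneg_of_birkhoffSum_pos [MeasurableSpace α] {P : Measure α} [IsProbabilityMeasure P] (hT : MeasurePreserving T P P)
    (hg : Measurable g) {C : ℝ} (hC : ∀ x, |g x| ≤ C)
    (hpos : ∀ᵐ x ∂P, ∃ n, 0 < birkhoffSum T g n x) : 0 ≤ ∫ x, g x ∂P := by
  have hM := measurable_birkhoffMax (g := g) hT.measurable hg
  have hint : ∀ n, Integrable (birkhoffMax T g n) P := fun n =>
    Integrable.of_bound (hM n).aestronglyMeasurable (n * C) (Eventually.of_forall fun x => by
      rw [Real.norm_eq_abs, abs_of_nonneg (birkhoffMax_nonneg n x)]; exact birkhoffMax_le hC n x)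
  have hgint : Integrable g P := Integrable.of_bound hg.aestronglyMeasurable C
    (Eventually.of_forall hC)
  let A : ℕ → Set α := fun n => {x | 0 < birkhoffMax T g n x}
  have hA : ∀ n, MeasurableSet (A n) := fun n => measurableSet_lt measurable_const (hM n)
  have hmono : Monotone A := monotone_nat_of_le_succ fun n x hx =>
    lt_of_lt_of_le hx (birkhoffMax_le_succ n x)
  have hstep : ∀ n, 0 ≤ ∫ x in A n, g x ∂P := by
    intro n
    have hcomp : Integrable (fun x => birkhoffMax T g n (T x)) P :=
      hT.integrable_comp_of_integrable (hint n)
    have h1 : ∀ x, birkhoffMax T g n x - birkhoffMax T g n (T x) ≤ (A n).indicator g x := by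
      intro x
      by_cases hx : x ∈ A n
      · rw [indicator_of_mem hx]
        have h2 := birkhoffMax_le_succ (T := T) (g := g) n x
        have h3 : 0 < birkhoffMax T g n x := hx
        have h4 : birkhoffMax T g n x ≤ max 0 (g x + birkhoffMax T g n (T x)) := h2
        rcases le_max_iff.1 h4 with h | h <;> linarith
      · rw [indicator_of_notMem hx]
        have : birkhoffMax T g n x ≤ 0 := not_lt.1 hx
        linarith [birkhoffMax_nonneg (T := T) (g := g) n (T x)]
    have h2 := integral_mono ((hint n).sub hcomp) (hgint.indicator (hA n)) h1
    rw [integral_indicator (hA n)] at h2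
    refine le_trans (le_of_eq ?_) h2
    have h3 : ∫ x, birkhoffMax T g n (T x) ∂P = ∫ x, birkhoffMax T g n x ∂P := by
      rw [← integral_map hT.measurable.aemeasurable
        (by rw [hT.map_eq]; exact (hM n).aestronglyMeasurable), hT.map_eq]
    simp only [Pi.sub_apply]
    rw [integral_sub (hint n) hcomp, h3, sub_self]
  have hlim := tendsto_setIntegral_of_monotone hA hmono hgint.integrableOn
  have huniv : (⋃ n, A n) =ᵐ[P] univ := by
    filter_upwards [hpos] with x hx
    obtain ⟨n, hn⟩ := hx
    exact eq_true (mem_iUnion.2 ⟨n, hn.trans_le (birkhoffSum_le_birkhoffMax n x)⟩)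
  rw [setIntegral_congr_set huniv, setIntegral_univ] at hlim
  exact ge_of_tendsto' hlim hstep

end Maximal

/-! ### Translations of potentials -/

namespace BUC

lemma measurable_eval (x : ℝ) : Measurable fun V : BUC => V.1 x :=
  (measurable_pi_apply x).comp measurable_subtype_coe

lemma continuous_coe (V : BUC) : Continuous V.1 := V.2.1.continuous

lemma measurable_uncurry_eval : Measurable fun z : BUC × ℝ => z.1.1 z.2 := by
  have := measurable_uncurry_of_continuous_of_measurable (u := fun (y : ℝ) (V : BUC) => V.1 y)
    (fun V => V.continuous_coe) measurable_eval
  exact this.comp measurable_swap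

lemma measurable_uncurry_translate : Measurable fun z : BUC × ℝ => translate z.2 z.1 := by
  refine Measurable.subtype_mk (measurable_pi_lambda _ fun x => ?_)
  have : Measurable fun z : BUC × ℝ => (z.1, x + z.2) := by fun_prop
  exact measurable_uncurry_eval.comp this

lemma measurable_translate (y : ℝ) : Measurable (translate y) :=
  measurable_uncurry_translate.comp (measurable_id.prodMk measurable_const)

lemma translate_translate (y z : ℝ) (V : BUC) : translate y (translate z V) = translate (y + z) V :=
  Subtype.ext (funext fun x => congrArg V.1 (add_assoc x y z))

lemma translate_zero (V : BUC) : translate 0 V = V :=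
  Subtype.ext (funext fun x => congrArg V.1 (add_zero x))

lemma image_translate (y : ℝ) (E : Set BUC) : translate y '' E = translate (-y) ⁻¹' E := by
  ext V
  constructor
  · rintro ⟨W, hW, rfl⟩
    rw [mem_preimage, translate_translate, neg_add_cancel, translate_zero]
    exact hW
  · intro h
    exact ⟨_, h, by rw [translate_translate, add_neg_cancel, translate_zero]⟩

end BUC

section Law
variable {P : Measure BUC} {mbar : ℝ}

lemma IsPotentialLaw.measurePreserving (hP : IsPotentialLaw P mbar) (y : ℝ) :
    MeasurePreserving (BUC.translate y) P P := by
  refine ⟨BUC.measurable_translate y, Measure.ext fun E hE => ?_⟩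
  rw [Measure.map_apply (BUC.measurable_translate y) hE, ← hP.stationary E hE (-y),
    BUC.image_translate, neg_neg]

/-- Translations form a group, so an event stable under all of them equals the intersection of its
translates. -/
lemma IsPotentialLaw.prob_zero_or_one (hP : IsPotentialLaw P mbar) {E : Set BUC}
    (hE : MeasurableSet E) (hinv : ∀ z V, V ∈ E → BUC.translate z V ∈ E) : P E = 0 ∨ P E = 1 := by
  have : ⋂ z : ℝ, BUC.translate z '' E = E := by
    ext V
    rw [mem_iInter]
    constructor
    · intro h
      have := h 0
      rw [BUC.image_translate, mem_preimage, neg_zero, BUC.translate_zero] at this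
      exact this
    · intro h z
      rw [BUC.image_translate]
      exact hinv _ _ h
  have h := hP.ergodic E hE
  rwa [this] at h

/-- The integral of the stationary field generated by `F` over `[0, x]`. -/
def fieldPrim (F : BUC → ℝ) (V : BUC) (x : ℝ) : ℝ := prim (fun y => F (BUC.translate y V)) x

variable {F : BUC → ℝ} {C : ℝ}

lemma measurable_field (hF : Measurable F) :
    Measurable fun z : BUC × ℝ => F (BUC.translate z.2 z.1) :=
  hF.comp BUC.measurable_uncurry_translate

lemma memLp_field (hF : Measurable F) (hC : ∀ V, |F V| ≤ C) (V : BUC) :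
    MemLp (fun y => F (BUC.translate y V)) ⊤ volume :=
  memLp_top_of_abs_le ((measurable_field hF).comp
    (measurable_const.prodMk measurable_id)).aestronglyMeasurable fun _ => hC _

lemma measurable_fieldPrim (hF : Measurable F) (x : ℝ) : Measurable fun V => fieldPrim F V x := by
  have h := (measurable_field hF).stronglyMeasurable
  unfold fieldPrim prim
  simp only [intervalIntegral]
  exact (StronglyMeasurable.integral_prod_right (f := fun (V : BUC) y => F (BUC.translate y V)) h
    |>.sub (StronglyMeasurable.integral_prod_right
      (f := fun (V : BUC) y => F (BUC.translate y V)) h)).measurable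

lemma fieldPrim_translate (hF : Measurable F) (hC : ∀ V, |F V| ≤ C) (V : BUC) (z x : ℝ) :
    fieldPrim F (BUC.translate z V) x = fieldPrim F V (x + z) - fieldPrim F V z := by
  unfold fieldPrim
  rw [← prim_comp_add (memLp_field hF hC V)]
  simp_rw [BUC.translate_translate]

lemma abs_fieldPrim_sub_le (hF : Measurable F) (hC : ∀ V, |F V| ≤ C) (V : BUC) (x y : ℝ) :
    |fieldPrim F V x - fieldPrim F V y| ≤ C * |x - y| :=
  abs_prim_sub_le (memLp_field hF hC V) (fun _ => hC _) x y

lemma fieldPrim_zero (V : BUC) : fieldPrim F V 0 = 0 := prim_zero _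

lemma birkhoffSum_fieldPrim (hF : Measurable F) (hC : ∀ V, |F V| ≤ C) (e : ℝ) (n : ℕ) (V : BUC) :
    birkhoffSum (BUC.translate e) (fun V => fieldPrim F V e) n V = fieldPrim F V (n * e) := by
  induction n generalizing V with
  | zero => simp [fieldPrim_zero]
  | succ n ih =>
    rw [birkhoffSum_succ', ih, fieldPrim_translate hF hC]
    push_cast
    rw [add_one_mul]
    ring

variable [IsProbabilityMeasure P]

lemma integral_fieldPrim (hP : IsPotentialLaw P mbar) (hF : Measurable F) (hC : ∀ V, |F V| ≤ C)
    (x : ℝ) : ∫ V, fieldPrim F V x ∂P = x * ∫ V, F V ∂P := by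
  unfold fieldPrim prim
  rw [← intervalIntegral_integral_swap]
  · have : ∀ y, ∫ V, F (BUC.translate y V) ∂P = ∫ V, F V ∂P := fun y => by
      rw [← integral_map (BUC.measurable_translate y).aemeasurable
        (by rw [(hP.measurePreserving y).map_eq]; exact hF.aestronglyMeasurable),
        (hP.measurePreserving y).map_eq]
    simp [this]
  · have : IsFiniteMeasure (volume.restrict (uIoc 0 x)) := ⟨by simp [uIoc]⟩
    refine Integrable.of_bound (C := C) ?_ (Eventually.of_forall fun z => hC _)
    exact ((measurable_field hF).comp measurable_swap).aestronglyMeasurable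

/-- The limsup event is invariant under all real translations, so its probability is `0` or `1` by
ergodicity of the whole group; a single translation need not be ergodic. Probability one would
contradict the maximal inequality. -/
lemma IsPotentialLaw.ae_fieldPrim_le (hP : IsPotentialLaw P mbar) (hF : Measurable F)
    (hC : ∀ V, |F V| ≤ C) (e : ℝ) {r : ℝ} (hr : e * ∫ V, F V ∂P < r) :
    ∀ᵐ V ∂P, ∀ᶠ n : ℕ in atTop, fieldPrim F V (n * e) ≤ r * n := by
  have hC0 : 0 ≤ C := (abs_nonneg _).trans (hC ⟨fun _ => 0, uniformContinuous_const, 0, by simp⟩)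
  -- The margins `1 / (k + 1)` absorb the bounded change of `fieldPrim` under translation, at the
  -- cost of passing from `k` to `k + 1`; this makes `E` invariant.
  let E : Set BUC := {V | ∀ k N : ℕ, ∃ n ≥ N, (r - 1 / ((k : ℝ) + 1)) * n < fieldPrim F V (n * e)}
  have hE : MeasurableSet E := by
    have : E = ⋂ k : ℕ, ⋂ N : ℕ, ⋃ n : ℕ, ⋃ _ : n ≥ N,
        {V | (r - 1 / ((k : ℝ) + 1)) * n < fieldPrim F V (n * e)} := by
      ext V; simp [E]
    rw [this]
    exact MeasurableSet.iInter fun k => MeasurableSet.iInter fun N => MeasurableSet.iUnion fun n =>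
      MeasurableSet.iUnion fun _ => measurableSet_lt measurable_const (measurable_fieldPrim hF _)
  have hinv : ∀ z V, V ∈ E → BUC.translate z V ∈ E := by
    intro z V hV k N
    have hgap : 0 < 1 / ((k : ℝ) + 1) - 1 / ((k : ℝ) + 1 + 1) := by
      rw [sub_pos]
      exact one_div_lt_one_div_of_lt (by positivity) (by linarith)
    set d := 1 / ((k : ℝ) + 1) - 1 / ((k : ℝ) + 1 + 1) with hd
    obtain ⟨M, hM⟩ := exists_nat_ge (2 * (C * |z|) / d)
    obtain ⟨n, hn, h⟩ := hV (k + 1) (max N M)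
    refine ⟨n, (le_max_left _ _).trans hn, ?_⟩
    rw [fieldPrim_translate hF hC]
    have h1 := abs_le.1 (abs_fieldPrim_sub_le hF hC V (n * e + z) (n * e))
    have h2 := abs_le.1 (abs_fieldPrim_sub_le hF hC V z 0)
    rw [fieldPrim_zero] at h2
    simp only [add_sub_cancel_left, sub_zero] at h1 h2
    have h3 : (M : ℝ) ≤ n := by exact_mod_cast (le_max_right N M).trans hn
    have h4 : 2 * (C * |z|) ≤ d * n := by
      have := hM.trans h3
      rw [div_le_iff₀ hgap] at this
      linarith
    push_cast at h
    have h5 : (r - 1 / ((k : ℝ) + 1)) * n = (r - 1 / ((k : ℝ) + 1 + 1)) * n - d * n := by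
      rw [hd]; ring
    linarith [h1.1, h2.2]
  have hE0 : P E = 0 := by
    rcases hP.prob_zero_or_one hE hinv with h | h
    · exact h
    · exfalso
      obtain ⟨k, hk⟩ := exists_nat_one_div_lt (sub_pos.2 hr)
      have hmeas : Measurable fun V => fieldPrim F V e - (r - 1 / ((k : ℝ) + 1)) :=
        (measurable_fieldPrim hF e).sub measurable_const
      have hfe : ∀ V, |fieldPrim F V e| ≤ C * |e| := fun V => by
        simpa [fieldPrim_zero] using abs_fieldPrim_sub_le hF hC V e 0
      have hEae : ∀ᵐ V ∂P, V ∈ E := by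
        rw [ae_iff]
        exact (prob_compl_eq_zero_iff hE).2 h
      have := integral_nonneg_of_birkhoffSum_pos (hP.measurePreserving e) hmeas
        (C := C * |e| + |r - 1 / ((k : ℝ) + 1)|) (fun V => (abs_sub _ _).trans
          (add_le_add (hfe V) le_rfl)) (by
        filter_upwards [hEae] with V hV
        obtain ⟨n, -, hn⟩ := hV k 0
        refine ⟨n, ?_⟩
        have h1 := birkhoffSum_fieldPrim hF hC e n V
        rw [birkhoffSum] at h1 ⊢
        rw [Finset.sum_sub_distrib, h1]
        simp only [Finset.sum_const, Finset.card_range, nsmul_eq_mul]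
        linarith)
      rw [integral_sub (Integrable.of_bound (measurable_fieldPrim hF e).aestronglyMeasurable _
        (Eventually.of_forall hfe)) (integrable_const _), integral_fieldPrim hP hF hC] at this
      simp at this
      rw [one_div] at hk
      linarith
  have : ∀ᵐ V ∂P, V ∉ E := measure_eq_zero_iff_ae_notMem.1 hE0
  filter_upwards [this] with V hV
  simp only [E, mem_ofPred_eq, not_forall, not_exists, not_and, not_lt] at hV
  obtain ⟨k, N, h⟩ := hV
  filter_upwards [eventually_ge_atTop N] with n hn
  refine (h n hn).trans (mul_le_mul_of_nonneg_right ?_ (Nat.cast_nonneg n))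
  have : 0 < 1 / ((k : ℝ) + 1) := by positivity
  linarith

/-- The pointwise ergodic theorem for bounded stationary fields. -/
theorem IsPotentialLaw.ae_abs_fieldPrim_sub_le (hP : IsPotentialLaw P mbar) (hF : Measurable F)
    (hC : ∀ V, |F V| ≤ C) : ∀ᵐ V ∂P, ∀ ε > 0, ∃ D, ∀ x,
      |fieldPrim F V x - x * ∫ V, F V ∂P| ≤ ε * |x| + D := by
  have hC0 : 0 ≤ C := (abs_nonneg _).trans (hC ⟨fun _ => 0, uniformContinuous_const, 0, by simp⟩)
  set m := ∫ V, F V ∂P with hm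
  have hneg : ∀ V x, fieldPrim (fun V => -F V) V x = -fieldPrim F V x := fun V x =>
    intervalIntegral.integral_neg
  have hbd : ∀ e : ℝ, ∀ᵐ V ∂P, ∀ k : ℕ, ∀ᶠ n : ℕ in atTop,
      |fieldPrim F V (n * e) - n * e * m| ≤ 1 / ((k : ℝ) + 1) * n := by
    intro e
    rw [ae_all_iff]
    intro k
    have hk : 0 < 1 / ((k : ℝ) + 1) := by positivity
    have h1 := hP.ae_fieldPrim_le hF hC e (r := e * m + 1 / ((k : ℝ) + 1)) (by linarith)
    have h2 := hP.ae_fieldPrim_le (F := fun V => -F V) hF.neg (C := C)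
      (fun V => by rw [abs_neg]; exact hC V) e (r := -(e * m) + 1 / ((k : ℝ) + 1)) (by
        rw [integral_neg]; linarith)
    filter_upwards [h1, h2] with V h1 h2
    filter_upwards [h1, h2] with n h1 h2
    rw [hneg] at h2
    rw [abs_le]; constructor <;> nlinarith
  filter_upwards [hbd 1, hbd (-1)] with V h1 h2 ε hε
  obtain ⟨k, hk⟩ := exists_nat_one_div_lt hε
  obtain ⟨N, hN⟩ := eventually_atTop.1 ((h1 k).and (h2 k))
  -- Real `x` are compared with the integer part of `|x|` in the same direction by the Lipschitz
  -- bound; the constant also covers `|x| < N + 1`, where the asymptotics is not yet available.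
  refine ⟨(C + |m|) * (N + 2), fun x => ?_⟩
  have hlip : ∀ x y, |(fieldPrim F V x - x * m) - (fieldPrim F V y - y * m)| ≤
      (C + |m|) * |x - y| := by
    intro x y
    have := abs_fieldPrim_sub_le hF hC V x y
    calc _ = |(fieldPrim F V x - fieldPrim F V y) - (x - y) * m| := by congr 1; ring
      _ ≤ |fieldPrim F V x - fieldPrim F V y| + |(x - y) * m| := abs_sub _ _
      _ ≤ C * |x - y| + |x - y| * |m| := by rw [abs_mul]; gcongr
      _ = _ := by ring
  obtain ⟨e, he, hxe⟩ : ∃ e : ℝ, (e = 1 ∨ e = -1) ∧ x = |x| * e := by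
    rcases le_total 0 x with h | h
    · exact ⟨1, Or.inl rfl, by rw [abs_of_nonneg h, mul_one]⟩
    · exact ⟨-1, Or.inr rfl, by rw [abs_of_nonpos h]; ring⟩
  have hee : |e| = 1 := by rcases he with rfl | rfl <;> simp
  set n := ⌊|x|⌋₊ with hn
  have hn1 : (n : ℝ) ≤ |x| := Nat.floor_le (abs_nonneg x)
  have hn2 : |x| < n + 1 := Nat.lt_floor_add_one _
  have hpos : 0 ≤ C + |m| := by positivity
  by_cases hnN : N ≤ n
  · have h3 : |fieldPrim F V (n * e) - n * e * m| ≤ 1 / ((k : ℝ) + 1) * n := by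
      rcases he with rfl | rfl
      · exact (hN n hnN).1
      · exact (hN n hnN).2
    have h4 := hlip x (n * e)
    have h5 : |x - n * e| ≤ 1 := by
      rw [show x - n * e = (|x| - n) * e by rw [sub_mul, ← hxe], abs_mul, hee, mul_one, abs_le]
      constructor <;> linarith
    have h6 := abs_sub_abs_le_abs_sub (fieldPrim F V x - x * m) (fieldPrim F V (n * e) - n * e * m)
    have h7 : (C + |m|) * |x - n * e| ≤ (C + |m|) * 1 := by gcongr
    have h8 : 1 / ((k : ℝ) + 1) * n ≤ ε * |x| := by gcongr
    nlinarith [Nat.cast_nonneg (α := ℝ) N]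
  · have h4 := hlip x 0
    rw [fieldPrim_zero] at h4
    simp only [zero_mul, sub_zero] at h4
    have h5 : |x| ≤ N + 2 := by
      have : (n : ℝ) ≤ N := by exact_mod_cast (not_le.1 hnN).le
      linarith
    have := mul_le_mul_of_nonneg_left h5 hpos
    have h9 : 0 ≤ ε * |x| := by positivity
    linarith

end Law

/-! ### Almost sure behaviour of the potential -/

lemma le_essSup_of_continuous {V : ℝ → ℝ} (hV : Continuous V) {C : ℝ} (hC : ∀ x, |V x| ≤ C) :
    (∀ x, V x ≤ essSup V volume) ∧ ∀ c, c < essSup V volume → ∃ x, c < V x := by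
  have hb : IsBoundedUnder (· ≤ ·) (ae volume) V :=
    isBoundedUnder_of ⟨C, fun x => (le_abs_self _).trans (hC x)⟩
  have hb' : IsBoundedUnder (· ≥ ·) (ae volume) V :=
    isBoundedUnder_of ⟨-C, fun x => (abs_le.1 (hC x)).1⟩
  constructor
  · intro x
    by_contra! h
    have hae : ∀ᵐ y, V y ≤ essSup V volume := ae_le_essSup hb
    have hopen : IsOpen {y | essSup V volume < V y} := isOpen_lt continuous_const hV
    have hpos := hopen.measure_pos volume ⟨x, h⟩
    refine hpos.ne' ?_
    rw [ae_iff] at hae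
    simpa using hae
  · intro c hc
    by_contra! h
    exact absurd (essSup_le_of_ae_le c (Eventually.of_forall h) hb'.isCoboundedUnder_flip)
      (not_le.2 hc)

section Law
variable {P : Measure BUC} {mbar : ℝ}

lemma IsPotentialLaw.ae_comp_translate (hP : IsPotentialLaw P mbar) (y : ℝ) {q : BUC → Prop}
    (h : ∀ᵐ V ∂P, q V) : ∀ᵐ V ∂P, q (BUC.translate y V) :=
  (hP.measurePreserving y).quasiMeasurePreserving.ae h

lemma IsPotentialLaw.ae_bounds (hP : IsPotentialLaw P mbar) :
    ∀ᵐ V ∂P, (∀ x, -mbar ≤ V.1 x) ∧ (∀ x, V.1 x ≤ 0) ∧ (∀ c < 0, ∃ x, c < V.1 x) ∧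
      ∀ c > -mbar, ∃ x, V.1 x < c := by
  filter_upwards [hP.esssup_eq, hP.esssup_neg_eq] with V h1 h2
  obtain ⟨C, hC⟩ := V.2.2
  have k1 := le_essSup_of_continuous V.continuous_coe hC
  have k2 := le_essSup_of_continuous V.continuous_coe.neg (C := C)
    (fun x => by rw [Pi.neg_apply, abs_neg]; exact hC x)
  have h2' : essSup (-V.1) volume = mbar := h2
  have h1' : essSup V.1 volume = 0 := h1
  rw [h1'] at k1
  rw [h2'] at k2
  refine ⟨fun x => ?_, k1.1, k1.2, fun c hc => ?_⟩
  · have := k2.1 x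
    rw [Pi.neg_apply] at this
    linarith
  · obtain ⟨x, hx⟩ := k2.2 (-c) (by linarith)
    rw [Pi.neg_apply] at hx
    exact ⟨x, by linarith⟩

variable [IsProbabilityMeasure P]

/-- Fubini together with stationarity. The property need not be measurable, so its exceptional set
is first enlarged to a measurable null set. -/
lemma IsPotentialLaw.ae_ae_translate (hP : IsPotentialLaw P mbar) {q : BUC → Prop}
    (h : ∀ᵐ V ∂P, q V) : ∀ᵐ V ∂P, ∀ᵐ y, q (BUC.translate y V) := by
  obtain ⟨N, hN, hNm, hN0⟩ := exists_measurable_superset_of_null (ae_iff.1 h)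
  have hq : ∀ V, V ∉ N → q V := fun V hV => by
    by_contra h'
    exact hV (hN h')
  have hms : MeasurableSet {z : BUC × ℝ | BUC.translate z.2 z.1 ∉ N} :=
    BUC.measurable_uncurry_translate hNm.compl
  have := (Measure.ae_ae_comm (μ := P) (ν := volume)
    (p := fun V y => BUC.translate y V ∉ N) hms).2 (Eventually.of_forall fun y =>
      hP.ae_comp_translate y (measure_eq_zero_iff_ae_notMem.1 hN0))
  filter_upwards [this] with V hV
  filter_upwards [hV] with y hy using hq _ hy

lemma IsPotentialLaw.ae_of_ae_ae_translate (hP : IsPotentialLaw P mbar) {E : Set BUC}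
    (hE : MeasurableSet E) (h : ∀ᵐ V ∂P, ∀ᵐ y, BUC.translate y V ∈ E) : ∀ᵐ V ∂P, V ∈ E := by
  have hms : MeasurableSet {z : BUC × ℝ | BUC.translate z.2 z.1 ∈ E} :=
    BUC.measurable_uncurry_translate hE
  obtain ⟨y, hy⟩ := ((Measure.ae_ae_comm (μ := P) (ν := volume)
    (p := fun V y => BUC.translate y V ∈ E) hms).1 h).exists
  have := hP.ae_comp_translate (-y) hy
  simpa [BUC.translate_translate, BUC.translate_zero] using this

/-- The events that `c` is exceeded beyond `n` decrease in `n`, have equal probability by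
stationarity, and exhaust the full space as `n → -∞`; hence all have probability one. -/
lemma IsPotentialLaw.ae_recurrent (hP : IsPotentialLaw P mbar) {e σ c : ℝ} (he : e = 1 ∨ e = -1)
    (h : ∀ᵐ V ∂P, ∃ x, c < σ * V.1 x) : ∀ᵐ V ∂P, ∀ x, ∃ y, x < e * y ∧ c < σ * V.1 y := by
  let E : ℤ → Set BUC := fun n => {V | ∃ q : ℚ, (n : ℝ) < e * q ∧ c < σ * V.1 q}
  have hE : ∀ n, MeasurableSet (E n) := by
    intro n
    have : E n = ⋃ q : ℚ, ⋃ _ : (n : ℝ) < e * q, {V | c < σ * V.1 q} := by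
      ext V; simp [E]
    rw [this]
    exact MeasurableSet.iUnion fun q => MeasurableSet.iUnion fun _ =>
      measurableSet_lt measurable_const ((BUC.measurable_eval _).const_mul σ)
  -- The sign is needed as an integer so that the shifted points remain rational.
  obtain ⟨d, hd⟩ : ∃ d : ℤ, (d : ℝ) = e ∧ e * e = 1 := by
    rcases he with rfl | rfl
    · exact ⟨1, by simp⟩
    · exact ⟨-1, by simp⟩
  have hEq : ∀ n, P (E n) = P (E 0) := by
    intro n
    rw [← (hP.measurePreserving (e * n)).measure_preimage (hE 0).nullMeasurableSet]
    congr 1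
    ext V
    constructor
    · rintro ⟨q, h1, h2⟩
      refine ⟨q - d * n, ?_, ?_⟩
      · push_cast
        rw [hd.1, mul_sub, ← mul_assoc, hd.2]
        linarith
      · simpa [BUC.translate, hd.1] using h2
    · rintro ⟨q, h1, h2⟩
      refine ⟨q + d * n, ?_, ?_⟩
      · push_cast at h1 ⊢
        rw [hd.1, mul_add, ← mul_assoc, hd.2]
        linarith
      · simpa [BUC.translate, hd.1] using h2
  have hmono : Monotone fun k : ℕ => E (-(k : ℤ)) := by
    intro k l hkl V hV
    obtain ⟨q, h1, h2⟩ := hV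
    refine ⟨q, lt_of_le_of_lt ?_ h1, h2⟩
    have : (k : ℝ) ≤ l := by exact_mod_cast hkl
    push_cast
    linarith
  have hunion : P (⋃ k : ℕ, E (-(k : ℤ))) = 1 := by
    have hms : MeasurableSet (⋃ k : ℕ, E (-(k : ℤ))) := MeasurableSet.iUnion fun _ => hE _
    rw [← prob_compl_eq_zero_iff hms, ← mem_ae_iff]
    filter_upwards [h] with V hV
    obtain ⟨x, hx⟩ := hV
    have hopen : IsOpen {x | c < σ * V.1 x} :=
      isOpen_lt continuous_const (continuous_const.mul V.continuous_coe)
    obtain ⟨q, hq⟩ := Rat.denseRange_cast.exists_mem_open hopen ⟨x, hx⟩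
    obtain ⟨k, hk⟩ := exists_nat_gt (-(e * (q : ℝ)))
    exact mem_iUnion.2 ⟨k, q, by push_cast; linarith, hq⟩
  have hlim := tendsto_measure_iUnion_atTop (μ := P) hmono
  have hconst : P (E 0) = 1 := by
    rw [hunion] at hlim
    refine tendsto_nhds_unique ?_ hlim
    simp only [Function.comp_def, hEq]
    exact tendsto_const_nhds
  have hall : ∀ᵐ V ∂P, ∀ n : ℤ, V ∈ E n := by
    rw [ae_all_iff]
    intro n
    rw [ae_iff]
    exact (prob_compl_eq_zero_iff (hE n)).2 ((hEq n).trans hconst)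
  filter_upwards [hall] with V hV x
  obtain ⟨q, h1, h2⟩ := hV ⌈x⌉
  exact ⟨q, (Int.le_ceil x).trans_lt h1, h2⟩

lemma HasDiscreteLevels.finite {V : ℝ → ℝ} (hV : HasDiscreteLevels V) (c a b : ℝ) :
    (Icc a b ∩ {y | V y = c}).Finite := by
  by_contra h
  obtain ⟨x, -, hx⟩ := Set.Infinite.exists_accPt_of_subset_isCompact h isCompact_Icc
    inter_subset_left
  exact hV.2 c x (hx.mono (principal_mono.2 inter_subset_right))

/-- Countably many rational levels are exceeded, and undershot, arbitrarily far out in both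
directions; intermediate levels are then attained by continuity. -/
lemma IsPotentialLaw.ae_oscillates (hP : IsPotentialLaw P mbar)
    (hV : ∀ᵐ V ∂P, HasDiscreteLevels V.1) : ∀ᵐ V ∂P, Oscillates V.1 (-mbar) 0 := by
  have hup : ∀ e : ℝ, e = 1 ∨ e = -1 → ∀ᵐ V ∂P, ∀ c : ℚ, (c : ℝ) < 0 → ∀ x, ∃ y, x < e * y ∧
      (c : ℝ) < V.1 y := by
    intro e he
    rw [ae_all_iff]
    intro c
    by_cases hc : (c : ℝ) < 0
    · have := hP.ae_recurrent (σ := 1) (c := c) he (by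
        filter_upwards [hP.ae_bounds] with V h
        obtain ⟨x, hx⟩ := h.2.2.1 c hc
        exact ⟨x, by rwa [one_mul]⟩)
      filter_upwards [this] with V h _
      simpa using h
    · exact Eventually.of_forall fun V h => absurd h hc
  have hdn : ∀ e : ℝ, e = 1 ∨ e = -1 → ∀ᵐ V ∂P, ∀ c : ℚ, -mbar < (c : ℝ) → ∀ x, ∃ y, x < e * y ∧
      V.1 y < (c : ℝ) := by
    intro e he
    rw [ae_all_iff]
    intro c
    by_cases hc : -mbar < (c : ℝ)
    · have := hP.ae_recurrent (σ := -1) (c := -c) he (by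
        filter_upwards [hP.ae_bounds] with V h
        obtain ⟨x, hx⟩ := h.2.2.2 c hc
        exact ⟨x, by linarith⟩)
      filter_upwards [this] with V h _
      simpa using h
    · exact Eventually.of_forall fun V h => absurd h hc
  filter_upwards [hV, hP.ae_bounds, hup 1 (Or.inl rfl), hup (-1) (Or.inr rfl),
    hdn 1 (Or.inl rfl), hdn (-1) (Or.inr rfl)] with V h0 h1 h2 h3 h4 h5
  have hiv : ∀ a b c, V.1 a < c → c < V.1 b → ∃ y ∈ uIcc a b, V.1 y = c := fun a b c ha hb =>
    intermediate_value_uIcc V.continuous_coe.continuousOn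
      (by rw [uIcc_of_le (ha.trans hb).le]; exact ⟨ha.le, hb.le⟩)
  refine ⟨V.continuous_coe, h1.1, h1.2.1, h0.finite, fun c hc x => ?_, fun c hc x => ?_⟩
  · obtain ⟨q, hq1, hq2⟩ := exists_rat_btwn hc.1
    obtain ⟨r, hr1, hr2⟩ := exists_rat_btwn hc.2
    obtain ⟨a, ha1, ha2⟩ := h2 r hr2 x
    obtain ⟨b, hb1, hb2⟩ := h4 q hq1 x
    obtain ⟨y, hy, e⟩ := hiv b a c (hb2.trans hq2) (hr1.trans ha2)
    refine ⟨y, lt_of_lt_of_le (lt_min ?_ ?_) hy.1, e⟩ <;> linarith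
  · obtain ⟨q, hq1, hq2⟩ := exists_rat_btwn hc.1
    obtain ⟨r, hr1, hr2⟩ := exists_rat_btwn hc.2
    obtain ⟨a, ha1, ha2⟩ := h3 r hr2 (-x)
    obtain ⟨b, hb1, hb2⟩ := h5 q hq1 (-x)
    obtain ⟨y, hy, e⟩ := hiv b a c (hb2.trans hq2) (hr1.trans ha2)
    refine ⟨y, lt_of_le_of_lt hy.2 (max_lt ?_ ?_), e⟩ <;> linarith

/-- For each such `V` the level sets are countable, so almost every translate avoids `S` at the
origin; Fubini transfers this to `V` itself. -/
lemma IsPotentialLaw.ae_eval_ne (hP : IsPotentialLaw P mbar)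
    (hV : ∀ᵐ V ∂P, HasDiscreteLevels V.1) {S : Set ℝ} (hS : S.Finite) : ∀ᵐ V ∂P, V.1 0 ∉ S := by
  have hms : MeasurableSet {V : BUC | V.1 0 ∉ S} :=
    (BUC.measurable_eval 0) hS.measurableSet.compl
  refine hP.ae_of_ae_ae_translate hms ?_
  filter_upwards [hV] with V h
  have hcount : {y | V.1 y ∈ S}.Countable := by
    have : {y | V.1 y ∈ S} ⊆ ⋃ n : ℕ, ⋃ c ∈ S, Icc (-(n : ℝ)) n ∩ {y | V.1 y = c} := by
      intro y hy
      obtain ⟨n, hn⟩ := exists_nat_ge |y|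
      exact mem_iUnion.2 ⟨n, mem_biUnion (show V.1 y ∈ S from hy) ⟨abs_le.1 hn, rfl⟩⟩
    exact (countable_iUnion fun n => hS.countable.biUnion
      fun c _ => (h.finite c _ _).countable).mono this
  filter_upwards [hcount.ae_notMem volume] with y hy
  change V.1 (0 + y) ∉ S
  rw [zero_add]
  exact hy

end Law

/-! ### Measurability of functionals of continuous functions -/

section Meas
variable {Ω E : Type*} [MeasurableSpace Ω] [PseudoMetricSpace E]

lemma eventually_dist_le_of_tendsto {ι : Type*} {l : Filter ι} {φ : ι → C(ℝ, E)} {ψ : C(ℝ, E)}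
    (h : Tendsto φ l (𝓝 ψ)) (a b ε : ℝ) (hε : 0 < ε) :
    ∀ᶠ i in l, ∀ x ∈ Icc a b, dist (φ i x) (ψ x) ≤ ε := by
  have := ContinuousMap.tendsto_iff_forall_isCompact_tendstoUniformlyOn.1 h (Icc a b) isCompact_Icc
  filter_upwards [Metric.tendstoUniformlyOn_iff.1 this ε hε] with i hi x hx
  rw [dist_comm]
  exact (hi x hx).le

variable [MeasurableSpace E] [BorelSpace E]

/-- By compactness the image stays at a positive distance from the complement of `U`, and this can
be read off on a countable dense subset of `K`. -/
lemma measurableSet_mapsTo {Φ : Ω → C(ℝ, E)} (hΦ : ∀ x, Measurable fun ω => Φ ω x) {K : Set ℝ}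
    (hK : IsCompact K) {U : Set E} (hU : IsOpen U) : MeasurableSet {ω | MapsTo (Φ ω) K U} := by
  rcases K.eq_empty_or_nonempty with rfl | hKne
  · simp only [mapsTo_empty, ofPred_true, MeasurableSet.univ]
  rcases Uᶜ.eq_empty_or_nonempty with hUe | hUne
  · rw [compl_empty_iff] at hUe
    simp only [hUe, mapsTo_univ, ofPred_true, MeasurableSet.univ]
  obtain ⟨D, hDc, hDd⟩ := TopologicalSpace.exists_countable_dense K
  have : {ω | MapsTo (Φ ω) K U} =
      ⋃ n : ℕ, ⋂ x ∈ D, {ω | 1 / ((n : ℝ) + 1) ≤ Metric.infDist (Φ ω (x : ℝ)) Uᶜ} := by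
    ext ω
    have hc : Continuous fun x : ℝ => Metric.infDist (Φ ω x) Uᶜ :=
      (Metric.continuous_infDist_pt _).comp (Φ ω).continuous
    simp only [mem_iUnion, mem_iInter]
    constructor
    · intro h
      obtain ⟨x₀, hx₀, hmin⟩ := hK.exists_isMinOn hKne hc.continuousOn
      have hpos : 0 < Metric.infDist (Φ ω x₀) Uᶜ :=
        (hU.isClosed_compl.notMem_iff_infDist_pos hUne).1 fun h' => h' (h hx₀)
      obtain ⟨n, hn⟩ := exists_nat_one_div_lt hpos
      exact ⟨n, fun x _ => hn.le.trans (hmin x.2)⟩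
    · rintro ⟨n, hn⟩ x hx
      have hcl : IsClosed {x : K | 1 / ((n : ℝ) + 1) ≤ Metric.infDist (Φ ω (x : ℝ)) Uᶜ} :=
        isClosed_le continuous_const (hc.comp continuous_subtype_val)
      have hall := hcl.closure_subset_iff.2 hn (hDd ⟨x, hx⟩)
      by_contra hxU
      have h0 : Metric.infDist (Φ ω x) Uᶜ = 0 := Metric.infDist_zero_of_mem hxU
      have h1 : 1 / ((n : ℝ) + 1) ≤ Metric.infDist (Φ ω x) Uᶜ := hall
      rw [h0] at h1
      exact absurd h1 (not_le.2 (by positivity))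
  rw [this]
  exact MeasurableSet.iUnion fun n => MeasurableSet.biInter hDc fun x _ =>
    measurableSet_le measurable_const ((hΦ x).infDist)

variable [SecondCountableTopology E]

/-- The compact-open topology has a subbasis of the sets just treated, which generates its Borel
sigma-algebra. Measurable evaluations thus suffice to measure every closed condition on the path. -/
lemma measurableSet_preimage_of_isClosed {Φ : Ω → C(ℝ, E)} (hΦ : ∀ x, Measurable fun ω => Φ ω x)
    {A : Set C(ℝ, E)} (hA : IsClosed A) : MeasurableSet (Φ ⁻¹' A) := by
  have h := borel_eq_generateFrom_of_subbasis
    (ContinuousMap.compactOpen_eq (X := ℝ) (Y := E))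
  have hm : @Measurable Ω C(ℝ, E) _ (borel _) Φ := by
    rw [h]
    refine @measurable_generateFrom _ _ _ _ _ ?_
    rintro _ ⟨K, hK, U, hU, rfl⟩
    exact measurableSet_mapsTo hΦ hK hU
  exact hm (MeasurableSpace.measurableSet_generateFrom (s := {s | IsOpen s}) hA.isOpen_compl).of_compl

lemma aemeasurable_of_isClosed {P : Measure Ω} {Φ : Ω → C(ℝ, E)}
    (hΦ : ∀ x, Measurable fun ω => Φ ω x) {g : Ω → ℝ} {A : ℝ → Set C(ℝ, E)}
    (hA : ∀ t, IsClosed (A t)) (h : ∀ᵐ ω ∂P, ∀ t, t ≤ g ω ↔ Φ ω ∈ A t) : AEMeasurable g P := by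
  refine NullMeasurable.aemeasurable (measurable_of_Ici (δ := NullMeasurableSpace Ω P) fun t => ?_)
  have hms : MeasurableSet (Φ ⁻¹' A t) := measurableSet_preimage_of_isClosed hΦ (hA t)
  refine NullMeasurableSet.congr (s := Φ ⁻¹' A t) hms.nullMeasurableSet ?_
  filter_upwards [h] with ω hω
  exact propext (hω t).symm

lemma isClosed_of_ultrafilter {X : Type*} [TopologicalSpace X] {A : Set X}
    (h : ∀ (x : X) (U : Ultrafilter A), Tendsto (Subtype.val : A → X) U (𝓝 x) → x ∈ A) :
    IsClosed A := by
  refine isClosed_of_closure_subset fun x hx => ?_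
  have := mem_closure_iff_comap_neBot.1 hx
  refine h x (Ultrafilter.of (comap Subtype.val (𝓝 x))) ?_
  exact tendsto_iff_comap.2 (Ultrafilter.of_le _)

end Meas

/-- The potential as a continuous map. -/
def BUC.toC (V : BUC) : C(ℝ, ℝ) := ⟨V.1, V.continuous_coe⟩

/-! ### Measurability of the extremal primitives -/

section Extremal
variable {H : ℝ → ℝ} {μ B y : ℝ}

/-- The admitted solutions are normalised at `0` and equi-Lipschitz, so they are compact for locally
uniform convergence, and the equation is stable under such limits. -/
lemma isClosed_setOf_isMonoSol (hH : Continuous H) (t : ℝ) :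
    IsClosed {φ : C(ℝ, ℝ) | ∃ u, IsMonoSol H (fun x => μ - φ x) u ∧
      (∀ x z, |u x - u z| ≤ B * |x - z|) ∧ u 0 = 0 ∧ t ≤ u y} := by
  refine isClosed_of_ultrafilter fun ψ U hU => ?_
  choose u hu hlip hu0 hut using fun φ : {φ : C(ℝ, ℝ) | ∃ u, IsMonoSol H (fun x => μ - φ x) u ∧
      (∀ x z, |u x - u z| ≤ B * |x - z|) ∧ u 0 = 0 ∧ t ≤ u y} => φ.2
  have hlim : ∀ x, ∃ v, Tendsto (fun i => u i x) U (𝓝 v) := fun x =>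
    U.exists_tendsto_of_abs_le (B := B * |x|) fun i => by simpa [hu0 i] using hlip i x 0
  choose v hv using hlim
  have hvlip : ∀ x z, |v x - v z| ≤ B * |x - z| := fun x z =>
    le_of_tendsto ((hv x).sub (hv z)).abs (Eventually.of_forall fun i => hlip i x z)
  have hloc := fun a b ε (hε : 0 < ε) =>
    eventually_abs_sub_le_of_equiLipschitz hlip hvlip hv a b hε
  have hs := fun (a b ε : ℝ) (hε : ε > 0) => (eventually_dist_le_of_tendsto hU a b ε hε).mono
    fun i hi x hx => show |(μ - i.1 x) - (μ - ψ x)| ≤ ε by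
      have := hi x hx
      rw [Real.dist_eq, abs_sub_comm] at this
      rwa [show μ - i.1 x - (μ - ψ x) = ψ x - i.1 x by ring]
  have hsc : Continuous fun x => μ - ψ x := continuous_const.sub ψ.continuous
  refine ⟨v, ⟨continuous_of_abs_sub_le hvlip, fun x z hxz => le_of_tendsto_of_tendsto (hv x) (hv z)
    (Eventually.of_forall fun i => (hu i).mono hxz), ?_, ?_⟩, hvlip, ?_, ?_⟩
  · exact subAt_of_tendsto (l := U) hH hsc (fun i => (hu i).continuous) (fun i => (hu i).sub)
      hloc hs
  · exact superAt_of_tendsto (l := U) hH hsc (fun i => (hu i).continuous) (fun i => (hu i).sup)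
      hloc hs
  · exact tendsto_nhds_unique (hv 0) (by simp only [hu0]; exact tendsto_const_nhds)
  · exact ge_of_tendsto (hv y) (Eventually.of_forall hut)

variable {P : Measure BUC} {f g : BUC → ℝ → ℝ}

/-- For `y > 0` the number `prim (g V) y` is the maximum of `u y` over all normalised nondecreasing
solutions. Its superlevel sets are therefore closed conditions on `V`, although the supremum
defining `g` is uncountable. -/
lemma aemeasurable_prim_upper (hH : Continuous H)
    (h : ∀ᵐ V ∂P, IsExtremalPair H (fun x => μ - V.1 x) (f V) (g V) B) (hy : 0 < y) :
    AEMeasurable (fun V => prim (g V) y) P := by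
  refine aemeasurable_of_isClosed (Φ := BUC.toC) BUC.measurable_eval
    (isClosed_setOf_isMonoSol (μ := μ) (B := B) (y := y) hH) ?_
  filter_upwards [h] with V hV t
  constructor
  · intro ht
    refine ⟨prim (g V), hV.upper.isMonoSol fun y => (hV.nonneg y).trans (hV.le y),
      abs_prim_sub_le hV.upper.memLp fun x => ?_, prim_zero _, ht⟩
    rw [abs_of_nonneg ((hV.nonneg x).trans (hV.le x))]
    exact hV.bound x
  · rintro ⟨u, hu, -, hu0, hut⟩
    have := hV.sub_upper u hu hy.le
    simp only [prim_zero, hu0] at this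
    linarith

/-- To the left of the origin the least derivative has the greatest primitive, so the same closed
sets apply. -/
lemma aemeasurable_prim_lower (hH : Continuous H)
    (h : ∀ᵐ V ∂P, IsExtremalPair H (fun x => μ - V.1 x) (f V) (g V) B) (hy : y < 0) :
    AEMeasurable (fun V => prim (f V) y) P := by
  refine aemeasurable_of_isClosed (Φ := BUC.toC) BUC.measurable_eval
    (isClosed_setOf_isMonoSol (μ := μ) (B := B) (y := y) hH) ?_
  filter_upwards [h] with V hV t
  constructor
  · intro ht
    refine ⟨prim (f V), hV.lower.isMonoSol hV.nonneg,
      abs_prim_sub_le hV.lower.memLp fun x => ?_, prim_zero _, ht⟩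
    rw [abs_of_nonneg (hV.nonneg x)]
    exact (hV.le x).trans (hV.bound x)
  · rintro ⟨u, hu, -, hu0, hut⟩
    have := hV.lower_sub u hu hy.le
    simp only [prim_zero, hu0] at this
    linarith

end Extremal

/-! ### Stationary fields -/

section Field
variable {P : Measure BUC} {mbar C : ℝ} {f : BUC → ℝ → ℝ}

/-- `F` is a bounded measurable generator of the stationary field `f`. -/
structure IsGenerator (P : Measure BUC) (C : ℝ) (F : BUC → ℝ) (f : BUC → ℝ → ℝ) : Prop where
  measurable : Measurable F
  bound : ∀ V, |F V| ≤ C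
  eq_zero : ∀ᵐ V ∂P, f V 0 = F V
  ae_eq : ∀ᵐ V ∂P, f V =ᵐ[volume] fun y => F (BUC.translate y V)

/-- Only the value at the origin is known to be almost everywhere measurable. A truncated measurable
version of it reproduces the field at almost every `y`, by stationarity and Fubini. -/
lemma IsPotentialLaw.exists_isGenerator [IsProbabilityMeasure P] (hP : IsPotentialLaw P mbar) (hf : IsStationaryField f)
    (hC : ∀ᵐ V ∂P, |f V 0| ≤ C) (hm : AEMeasurable (fun V => f V 0) P) :
    ∃ F, IsGenerator P C F f := by
  have hC0 : 0 ≤ C := by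
    obtain ⟨V, hV⟩ := hC.exists
    exact (abs_nonneg _).trans hV
  let F : BUC → ℝ := fun V => max (-C) (min C (hm.mk _ V))
  have hF : Measurable F := measurable_const.max (measurable_const.min hm.measurable_mk)
  have h0 : ∀ᵐ V ∂P, f V 0 = F V := by
    filter_upwards [hm.ae_eq_mk, hC] with V h1 h2
    simp only [F]
    rw [← h1, min_eq_right (abs_le.1 h2).2, max_eq_right (abs_le.1 h2).1]
  refine ⟨F, hF, fun V => abs_le.2 ⟨le_max_left _ _, max_le (by linarith) (min_le_left _ _)⟩, h0, ?_⟩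
  filter_upwards [hP.ae_ae_translate h0] with V hV
  filter_upwards [hV] with y hy
  rw [← hy, hf y V 0, zero_add]

lemma IsGenerator.prim_eq {F : BUC → ℝ} (h : IsGenerator P C F f) :
    ∀ᵐ V ∂P, prim (f V) = fieldPrim F V := by
  filter_upwards [h.ae_eq] with V hV
  rw [prim_congr_ae hV]
  rfl

lemma IsGenerator.integrable [IsProbabilityMeasure P] {F : BUC → ℝ} (h : IsGenerator P C F f) :
    Integrable (fun V => f V 0) P :=
  (Integrable.of_bound h.measurable.aestronglyMeasurable C (Eventually.of_forall h.bound)).congr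
    (h.eq_zero.mono fun _ h => h.symm)

lemma IsGenerator.integral_eq {F : BUC → ℝ} (h : IsGenerator P C F f) :
    ∫ V, f V 0 ∂P = ∫ V, F V ∂P := integral_congr_ae h.eq_zero

lemma isStationaryField_generated (F : BUC → ℝ) :
    IsStationaryField fun V y => F (BUC.translate y V) := fun z V y =>
  congrArg F (BUC.translate_translate y z V)

lemma isGenerator_self {F : BUC → ℝ} (hF : Measurable F) (hC : ∀ V, |F V| ≤ C) :
    IsGenerator P C F fun V y => F (BUC.translate y V) :=
  ⟨hF, hC, Eventually.of_forall fun V => by rw [BUC.translate_zero], Eventually.of_forall fun _ =>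
    EventuallyEq.rfl⟩

end Field

/-! ### The extremal stationary derivatives are random variables -/

section Derivative
variable {P : Measure BUC} {f : BUC → ℝ → ℝ}

/-- Almost sure continuity at `0` recovers the field there as a limit of difference quotients of its
primitive. Right and left versions are separate because the greatest primitive is measurable for `y
> 0` and the least one for `y < 0`. -/
lemma aemeasurable_of_right_slope (hmem : ∀ᵐ V ∂P, MemLp (f V) ⊤ volume)
    (hc : ∀ᵐ V ∂P, ContinuousAt (f V) 0)
    (hm : ∀ y > 0, AEMeasurable (fun V => prim (f V) y) P) : AEMeasurable (fun V => f V 0) P := by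
  refine aemeasurable_of_tendsto_metrizable_ae' (f := fun (n : ℕ) V =>
    slope (prim (f V)) 0 (1 / ((n : ℝ) + 1))) (fun n => ?_) ?_
  · simp only [slope, vsub_eq_sub, prim_zero, sub_zero, smul_eq_mul]
    exact (hm _ (by positivity)).const_mul _
  · filter_upwards [hmem, hc] with V h1 h2
    have h3 := hasDerivWithinAt_prim_right h1 (h2.tendsto.mono_left nhdsWithin_le_nhds : Tendsto
      (f V) (𝓝[>] 0) (𝓝 (f V 0)))
    have h4 := hasDerivWithinAt_iff_tendsto_slope.1 h3
    rw [Ici_sdiff_left] at h4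
    exact h4.comp (tendsto_nhdsWithin_iff.2 ⟨tendsto_one_div_add_atTop_nhds_zero_nat,
      Eventually.of_forall fun n => by rw [mem_Ioi]; positivity⟩)

lemma aemeasurable_of_left_slope (hmem : ∀ᵐ V ∂P, MemLp (f V) ⊤ volume)
    (hc : ∀ᵐ V ∂P, ContinuousAt (f V) 0)
    (hm : ∀ y < 0, AEMeasurable (fun V => prim (f V) y) P) : AEMeasurable (fun V => f V 0) P := by
  refine aemeasurable_of_tendsto_metrizable_ae' (f := fun (n : ℕ) V =>
    slope (prim (f V)) 0 (-(1 / ((n : ℝ) + 1)))) (fun n => ?_) ?_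
  · simp only [slope, vsub_eq_sub, prim_zero, sub_zero, smul_eq_mul]
    exact (hm _ (by simp only [Left.neg_neg_iff]; positivity)).const_mul _
  · filter_upwards [hmem, hc] with V h1 h2
    have h3 := hasDerivWithinAt_prim_left h1 (h2.tendsto.mono_left nhdsWithin_le_nhds : Tendsto
      (f V) (𝓝[<] 0) (𝓝 (f V 0)))
    have h4 := hasDerivWithinAt_iff_tendsto_slope.1 h3
    rw [Iic_sdiff_right] at h4
    refine h4.comp (tendsto_nhdsWithin_iff.2 ⟨?_, Eventually.of_forall fun n => by
      rw [mem_Iio, Left.neg_neg_iff]; positivity⟩)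
    have := (tendsto_one_div_add_atTop_nhds_zero_nat (𝕜 := ℝ)).neg
    rwa [neg_zero] at this

end Derivative

/-- The standing assumptions, with the strict oscillation condition. -/
structure IsStrictSetting (P : Measure BUC) (mbar : ℝ) (H : ℝ → ℝ) (L : ℕ) (p : ℕ → ℝ) : Prop where
  law : IsPotentialLaw P mbar
  levels : ∀ᵐ V ∂P, HasDiscreteLevels V.1
  ham : IsNormalizedHamiltonian H
  bumps : HasBumps H L p
  left : StrictAntiOn H (Iic 0)
  strict : ∀ i j, 1 ≤ i → i ≤ L → 1 ≤ j → j ≤ L → maxValue H p i - minValue H p j < mbar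

section Strict
variable {P : Measure BUC} {mbar μ : ℝ} {H : ℝ → ℝ} {L : ℕ} {p : ℕ → ℝ}

lemma continuousAt_level (hb : HasBumps H L p) (hH : IsNormalizedHamiltonian H)
    (hstrict : ∀ i j, 1 ≤ i → i ≤ L → 1 ≤ j → j ≤ L → maxValue H p i - minValue H p j < mbar)
    (hm : 0 < mbar) {V : BUC} (hV : Oscillates V.1 (-mbar) 0) (h0 : 0 ≤ μ) {y : ℝ}
    (hy : μ - V.1 y ∉ criticalValues H p L) :
    ContinuousAt (lowerDerivative H p L mbar μ V) y ∧
      ContinuousAt (upperDerivative H p L mbar μ V) y := by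
  by_cases hμ : μ ∈ bumpLevels H p L mbar
  · have hs : Oscillates (fun y => μ - V.1 y) μ (μ + mbar) := by
      have := hV.const_sub μ
      simpa using this
    have hbr := hs.isBumpRhs h0 (exists_criticalValue_Ioo hμ hstrict)
    obtain ⟨h1, h2⟩ := (isExtremalPair_level hb hH hstrict hm hV h0).2 hμ
    rw [isAdmissible_iff hbr] at h1 h2
    exact ⟨hbr.continuousAt hb hH h1.branchwise hy, hbr.continuousAt hb hH h2.branchwise hy⟩
  · have hc := (outerDerivative_spec hb hH hV h0 hμ).1
    have e1 : lowerDerivative H p L mbar μ V = outerDerivative H p L mbar μ V.1 := by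
      funext y
      unfold lowerDerivative
      rw [if_neg hμ]
    have e2 : upperDerivative H p L mbar μ V = outerDerivative H p L mbar μ V.1 := by
      funext y
      unfold upperDerivative
      rw [if_neg hμ]
    rw [e1, e2]
    exact ⟨hc.continuousAt, hc.continuousAt⟩

lemma IsPotentialLaw.ae_solDeriv_left (hP : IsPotentialLaw P mbar)
    (hH : IsNormalizedHamiltonian H) (hleft : StrictAntiOn H (Iic 0)) (h0 : 0 ≤ μ) :
    ∀ᵐ V ∂P, Continuous (fun y => leftInv H (μ - V.1 y)) ∧
      (∀ y, leftInv H (μ + mbar) ≤ leftInv H (μ - V.1 y)) ∧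
      SolDeriv H (fun y => μ - V.1 y) (fun y => leftInv H (μ - V.1 y)) := by
  filter_upwards [hP.ae_bounds] with V hV
  exact solDeriv_leftInv hH hleft (continuous_const.sub V.continuous_coe)
    (fun y => by linarith [hV.2.1 y]) (fun y => by linarith [hV.1 y])

variable [IsProbabilityMeasure P]

namespace IsStrictSetting

lemma ae_oscillates (h : IsStrictSetting P mbar H L p) :
    ∀ᵐ V ∂P, Oscillates V.1 (-mbar) 0 := h.law.ae_oscillates h.levels

lemma ae_extremal (h : IsStrictSetting P mbar H L p) (h0 : 0 ≤ μ) :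
    ∀ᵐ V ∂P, IsExtremalPair H (fun y => μ - V.1 y) (lowerDerivative H p L mbar μ V)
      (upperDerivative H p L mbar μ V) (levelBound H mbar μ) := by
  filter_upwards [h.ae_oscillates] with V hV
  exact (isExtremalPair_level h.bumps h.ham h.strict h.law.mbar_pos hV h0).1

lemma ae_continuousAt (h : IsStrictSetting P mbar H L p) (h0 : 0 ≤ μ) :
    ∀ᵐ V ∂P, ContinuousAt (lowerDerivative H p L mbar μ V) 0 ∧
      ContinuousAt (upperDerivative H p L mbar μ V) 0 := by
  have hfin : ((fun c => μ - c) '' criticalValues H p L).Finite :=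
    finite_criticalValues.image _
  filter_upwards [h.ae_oscillates, h.law.ae_eval_ne h.levels hfin] with V hV hne
  exact continuousAt_level h.bumps h.ham h.strict h.law.mbar_pos hV h0
    fun hc => hne ⟨_, hc, by ring⟩

theorem exists_generator_upper (h : IsStrictSetting P mbar H L p) (h0 : 0 ≤ μ) :
    ∃ F, IsGenerator P (levelBound H mbar μ) F (upperDerivative H p L mbar μ) := by
  have he := h.ae_extremal h0
  refine h.law.exists_isGenerator isStationaryField_upperDerivative ?_ ?_
  · filter_upwards [he] with V hV
    rw [abs_of_nonneg ((hV.nonneg 0).trans (hV.le 0))]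
    exact hV.bound 0
  · exact aemeasurable_of_right_slope (he.mono fun V hV => hV.upper.memLp)
      ((h.ae_continuousAt h0).mono fun V hV => hV.2)
      fun y hy => aemeasurable_prim_upper h.ham.continuous he hy

theorem exists_generator_lower (h : IsStrictSetting P mbar H L p) (h0 : 0 ≤ μ) :
    ∃ F, IsGenerator P (levelBound H mbar μ) F (lowerDerivative H p L mbar μ) := by
  have he := h.ae_extremal h0
  refine h.law.exists_isGenerator isStationaryField_lowerDerivative ?_ ?_
  · filter_upwards [he] with V hV
    rw [abs_of_nonneg (hV.nonneg 0)]
    exact (hV.le 0).trans (hV.bound 0)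
  · exact aemeasurable_of_left_slope (he.mono fun V hV => hV.lower.memLp)
      ((h.ae_continuousAt h0).mono fun V hV => hV.1)
      fun y hy => aemeasurable_prim_lower h.ham.continuous he hy

end IsStrictSetting

lemma continuous_leftInv_max (hH : IsNormalizedHamiltonian H) (hleft : StrictAntiOn H (Iic 0)) :
    Continuous fun c => leftInv H (max 0 c) :=
  (continuousOn_leftInv hH hleft).comp_continuous (by fun_prop) fun c => le_max_left 0 c

theorem IsPotentialLaw.exists_generator_left (hP : IsPotentialLaw P mbar)
    (hH : IsNormalizedHamiltonian H) (hleft : StrictAntiOn H (Iic 0)) (h0 : 0 ≤ μ) :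
    ∃ F, IsGenerator P (-leftInv H (μ + mbar)) F fun V y => leftInv H (μ - V.1 y) := by
  refine hP.exists_isGenerator (fun z V y => rfl) ?_ ?_
  · filter_upwards [hP.ae_bounds] with V hV
    have h1 : 0 ≤ μ - V.1 0 := by linarith [hV.2.1 0]
    have h2 : μ - V.1 0 ≤ μ + mbar := by linarith [hV.1 0]
    rw [abs_of_nonpos (leftInv_spec hH h1).1]
    exact neg_le_neg ((strictAntiOn_leftInv hH hleft).antitoneOn h1 (h1.trans h2) h2)
  -- Clipping at `0` extends `leftInv H` to a continuous function on the line and changes nothing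
  -- almost surely.
  · have hm : Measurable fun V : BUC => leftInv H (max 0 (μ - V.1 0)) :=
      (continuous_leftInv_max hH hleft).measurable.comp
        (measurable_const.sub (BUC.measurable_eval 0))
    refine hm.aemeasurable.congr ?_
    filter_upwards [hP.ae_bounds] with V hV
    rw [max_eq_right (by linarith [hV.2.1 0])]

end Strict

/-! ### Homogenization from sublinear correctors -/

/-- `w` grows like `q y`, up to a sublinear error. -/
def HasSlope (w : ℝ → ℝ) (q : ℝ) : Prop := ∀ ε > 0, ∃ D, ∀ y, |w y - q * y| ≤ ε * |y| + D

section Corrector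
variable {H : ℝ → ℝ} {K : NNReal} {V : BUC} {q h : ℝ} {w : ℝ → ℝ}

lemma exists_corrector_params (K : NNReal) {R ε : ℝ} (hR : 0 < R) (hε : 0 < ε)
    (hsl : HasSlope w q) : ∃ η > 0, ∃ D, (∀ y, |w y - q * y| ≤ η * |y| + D) ∧
      ∀ᶠ lam in 𝓝[>] (0 : ℝ), 0 < lam ∧ ∀ y, |y| ≤ R / lam →
        lam * (η * |y| + D + D + 2 * η * (1 + |y|)) + K * (2 * η) ≤ ε := by
  -- With `lam * |y| ≤ R` the total coefficient of `η` that does not vanish with `lam` is at most `3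
  -- R + 2 K`.
  set M : ℝ := 3 * R + 2 * K + 1 with hM
  have hMpos : 0 < M := by positivity
  obtain ⟨D, hD⟩ := hsl (ε / (2 * M)) (by positivity)
  refine ⟨ε / (2 * M), by positivity, D, hD, ?_⟩
  have hlim : Tendsto (fun lam : ℝ => lam * (2 * D + 2 * (ε / (2 * M)))) (𝓝[>] 0) (𝓝 0) := by
    have : Continuous fun lam : ℝ => lam * (2 * D + 2 * (ε / (2 * M))) := by fun_prop
    have := this.tendsto 0
    rw [zero_mul] at this
    exact this.mono_left nhdsWithin_le_nhds
  filter_upwards [hlim.eventually_le_const (half_pos hε), self_mem_nhdsWithin] with lam h1 h2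
  have h2' : 0 < lam := h2
  refine ⟨h2', fun y hy => ?_⟩
  have h3 : lam * |y| ≤ R := by
    rw [le_div_iff₀ h2'] at hy; linarith
  have h4 : ε / (2 * M) * (3 * R + 2 * K) ≤ ε / 2 := by
    calc ε / (2 * M) * (3 * R + 2 * K) ≤ ε / (2 * M) * M := by gcongr; linarith
      _ = ε / 2 := by field_simp
  have h5 : ε / (2 * M) * (lam * |y|) ≤ ε / (2 * M) * R := by gcongr
  nlinarith

/-- The corrector minus `q x`, lowered by a constant of order `1 / lam` and by `2 η √(1 + x²)`, is a
subsolution of the discounted equation. The penalty beats the slope error `η |x|`, so it is bounded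
above and comparison applies. -/
theorem cell_lower_bound (hK : LipschitzWith K H) (hw : Continuous w)
    (hsub : ∀ y, SubAt H (h - V.1 y) w y) (hsl : HasSlope w q) {R ε : ℝ} (hR : 0 < R)
    (hε : 0 < ε) : ∀ᶠ lam in 𝓝[>] (0 : ℝ), ∀ v, IsCellSolution H V.1 q lam v →
      ∀ y, |y| ≤ R / lam → -ε ≤ lam * v y + h := by
  obtain ⟨η, hη, D, hD, hev⟩ := exists_corrector_params K hR hε hsl
  filter_upwards [hev] with lam ⟨hlam, hlam'⟩ v hv y hy
  obtain ⟨⟨C, hC⟩, hvc, -, hvs⟩ := isCellSolution_iff.1 hv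
  have hKq := lipschitzWith_comp_const_add hK q
  let z : ℝ → ℝ := fun x => w x + (-q * x - (D + (h + K * (2 * η)) / lam)) - 2 * η * √(1 + x ^ 2)
  have hψ : ContDiff ℝ 1 fun x : ℝ => -q * x - (D + (h + K * (2 * η)) / lam) := by fun_prop
  have hzle : ∀ x, lam * z x ≤ -(h + K * (2 * η)) := by
    intro x
    have h1 : z x ≤ -((h + K * (2 * η)) / lam) := by
      have := mul_le_mul_of_nonneg_left (abs_le_sqrt_one_add_sq x) (by positivity : 0 ≤ 2 * η)
      have h2 := (abs_le.1 (hD x)).2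
      have h3 : 0 ≤ η * |x| := by positivity
      simp only [z]; linarith
    calc lam * z x ≤ lam * -((h + K * (2 * η)) / lam) := by gcongr
      _ = _ := by field_simp
  have hzsub : ∀ x, SubAt (fun r => H (q + r)) (-V.1 x - lam * z x) z x := by
    intro x
    have h1 : SubAt (fun r => H (q + r)) (h - V.1 x)
        (fun x => w x + (-q * x - (D + (h + K * (2 * η)) / lam))) x := by
      refine ((hsub x).add_smooth hψ).imp fun r hr => ?_
      have : deriv (fun x : ℝ => -q * x - (D + (h + K * (2 * η)) / lam)) x = -q := by
        rw [deriv_sub_const, deriv_const_mul _ differentiableAt_id]; simp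
      rw [this] at hr
      rwa [show q + r = r - -q by ring]
    refine (h1.sub_mul_sqrt hKq (by positivity : 0 ≤ 2 * η)).mono ?_
    linarith [hzle x]
  have hzc : Continuous z := by fun_prop
  have hle := discounted_comparison hKq hlam (g := fun x => -V.1 x) V.continuous_coe.neg hzc hvc
    hzsub hvs ⟨-(h + K * (2 * η)) / lam + C, fun x => by
      have h1 := hzle x
      have h2 := (abs_le.1 (hC x)).1
      have h3 : z x ≤ -(h + K * (2 * η)) / lam := by rw [le_div_iff₀ hlam]; linarith
      linarith⟩ y
  have h1 := hlam' y hy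
  have h2 := mul_le_mul_of_nonneg_left hle hlam.le
  have h3 : lam * -(η * |y| + D + D + 2 * η * (1 + |y|)) - (h + K * (2 * η)) ≤ lam * z y := by
    have h4 := (abs_le.1 (hD y)).1
    have h5 := mul_le_mul_of_nonneg_left (sqrt_one_add_sq_le y) (by positivity : 0 ≤ 2 * η)
    have h6 : -(η * |y| + D + D + 2 * η * (1 + |y|)) - (h + K * (2 * η)) / lam ≤ z y := by
      simp only [z]; linarith
    calc _ = lam * (-(η * |y| + D + D + 2 * η * (1 + |y|)) - (h + K * (2 * η)) / lam) := by
          field_simp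
      _ ≤ _ := by gcongr
  linarith

theorem cell_upper_bound (hK : LipschitzWith K H) (hw : Continuous w)
    (hsup : ∀ y, SuperAt H (h - V.1 y) w y) (hsl : HasSlope w q) {R ε : ℝ} (hR : 0 < R)
    (hε : 0 < ε) : ∀ᶠ lam in 𝓝[>] (0 : ℝ), ∀ v, IsCellSolution H V.1 q lam v →
      ∀ y, |y| ≤ R / lam → lam * v y + h ≤ ε := by
  obtain ⟨η, hη, D, hD, hev⟩ := exists_corrector_params K hR hε hsl
  filter_upwards [hev] with lam ⟨hlam, hlam'⟩ v hv y hy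
  obtain ⟨⟨C, hC⟩, hvc, hvs, -⟩ := isCellSolution_iff.1 hv
  have hKq := lipschitzWith_comp_const_add hK q
  let z : ℝ → ℝ := fun x => w x + (-q * x + (D - (h - K * (2 * η)) / lam)) + 2 * η * √(1 + x ^ 2)
  have hψ : ContDiff ℝ 1 fun x : ℝ => -q * x + (D - (h - K * (2 * η)) / lam) := by fun_prop
  have hzle : ∀ x, -(h - K * (2 * η)) ≤ lam * z x := by
    intro x
    have h1 : -((h - K * (2 * η)) / lam) ≤ z x := by
      have := mul_le_mul_of_nonneg_left (abs_le_sqrt_one_add_sq x) (by positivity : 0 ≤ 2 * η)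
      have h2 := (abs_le.1 (hD x)).1
      have h3 : 0 ≤ η * |x| := by positivity
      simp only [z]; linarith
    calc _ = lam * -((h - K * (2 * η)) / lam) := by field_simp
      _ ≤ lam * z x := by gcongr
  have hzsup : ∀ x, SuperAt (fun r => H (q + r)) (-V.1 x - lam * z x) z x := by
    intro x
    have h1 : SuperAt (fun r => H (q + r)) (h - V.1 x)
        (fun x => w x + (-q * x + (D - (h - K * (2 * η)) / lam))) x := by
      refine ((hsup x).add_smooth hψ).imp fun r hr => ?_
      have : deriv (fun x : ℝ => -q * x + (D - (h - K * (2 * η)) / lam)) x = -q := by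
        rw [deriv_add_const, deriv_const_mul _ differentiableAt_id]; simp
      rw [this] at hr
      rwa [show q + r = r - -q by ring]
    refine (h1.add_mul_sqrt hKq (by positivity : 0 ≤ 2 * η)).mono ?_
    linarith [hzle x]
  have hzc : Continuous z := by fun_prop
  have hle := discounted_comparison hKq hlam (g := fun x => -V.1 x) V.continuous_coe.neg hvc hzc
    hvs hzsup ⟨(h - K * (2 * η)) / lam + C, fun x => by
      have h1 := hzle x
      have h2 := (abs_le.1 (hC x)).2
      have h3 : -(h - K * (2 * η)) / lam ≤ z x := by rw [div_le_iff₀ hlam]; linarith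
      rw [neg_div] at h3
      linarith⟩ y
  have h1 := hlam' y hy
  have h2 := mul_le_mul_of_nonneg_left hle hlam.le
  have h3 : lam * z y ≤ lam * (η * |y| + D + D + 2 * η * (1 + |y|)) - (h - K * (2 * η)) := by
    have h4 := (abs_le.1 (hD y)).2
    have h5 := mul_le_mul_of_nonneg_left (sqrt_one_add_sq_le y) (by positivity : 0 ≤ 2 * η)
    have h6 : z y ≤ (η * |y| + D + D + 2 * η * (1 + |y|)) - (h - K * (2 * η)) / lam := by
      simp only [z]; linarith
    calc lam * z y ≤ lam * ((η * |y| + D + D + 2 * η * (1 + |y|)) - (h - K * (2 * η)) / lam) := by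
          gcongr
      _ = _ := by field_simp
  linarith

end Corrector

section Homogenization
variable {P : Measure BUC} {mbar q h h' C : ℝ} {H : ℝ → ℝ}

/-- Almost surely there is a subsolution of `H (w') + V = h` with slope `q`. -/
def HasSubCorrector (P : Measure BUC) (H : ℝ → ℝ) (q h : ℝ) : Prop :=
  ∀ᵐ V ∂P, ∃ w, Continuous w ∧ (∀ y, SubAt H (h - V.1 y) w y) ∧ HasSlope w q

/-- Almost surely there is a supersolution of `H (w') + V = h` with slope `q`. -/
def HasSuperCorrector (P : Measure BUC) (H : ℝ → ℝ) (q h : ℝ) : Prop :=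
  ∀ᵐ V ∂P, ∃ w, Continuous w ∧ (∀ y, SuperAt H (h - V.1 y) w y) ∧ HasSlope w q

lemma ae_forall_pos {q : BUC → ℝ → Prop} (hmono : ∀ V δ δ', δ ≤ δ' → q V δ → q V δ')
    (h : ∀ δ > 0, ∀ᵐ V ∂P, q V δ) : ∀ᵐ V ∂P, ∀ δ > 0, q V δ := by
  have : ∀ᵐ V ∂P, ∀ n : ℕ, q V (1 / ((n : ℝ) + 1)) :=
    ae_all_iff.2 fun n => h _ (by positivity)
  filter_upwards [this] with V hV δ hδ
  obtain ⟨n, hn⟩ := exists_nat_one_div_lt hδ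
  exact hmono V _ _ hn.le (hV n)

/-- Subsolutions bound `lam * v` from below and supersolutions from above. The slack `δ` is needed
at the minimum level, where supersolutions of prescribed slope are constructed only strictly below
it. -/
theorem isRegularlyHomogenizableAt_of_correctors (hP : IsPotentialLaw P mbar)
    (hH : IsNormalizedHamiltonian H) (hsub : ∀ δ > 0, HasSubCorrector P H q (h + δ))
    (hsup : ∀ δ > 0, HasSuperCorrector P H q (h - δ)) :
    IsRegularlyHomogenizableAt P mbar H q h := by
  obtain ⟨K, hK⟩ := hH.lipschitz
  refine ⟨hP, hH.continuous, hH.coercive, fun V lam hlam => existsUnique_isCellSolution hH V q hlam,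
    fun R hR => ?_⟩
  have h1 := ae_forall_pos (q := fun V δ => ∃ w, Continuous w ∧
    (∀ y, SubAt H (h + δ - V.1 y) w y) ∧ HasSlope w q) (fun V δ δ' hδ ⟨w, w1, w2, w3⟩ =>
      ⟨w, w1, fun y => (w2 y).mono (by linarith), w3⟩) hsub
  have h2 := ae_forall_pos (q := fun V δ => ∃ w, Continuous w ∧
    (∀ y, SuperAt H (h - δ - V.1 y) w y) ∧ HasSlope w q) (fun V δ δ' hδ ⟨w, w1, w2, w3⟩ =>
      ⟨w, w1, fun y => (w2 y).mono (by linarith), w3⟩) hsup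
  filter_upwards [h1, h2] with V h1 h2 ε hε
  obtain ⟨w₁, a1, a2, a3⟩ := h1 (ε / 2) (by positivity)
  obtain ⟨w₂, b1, b2, b3⟩ := h2 (ε / 2) (by positivity)
  filter_upwards [cell_lower_bound hK a1 a2 a3 hR (half_pos hε),
    cell_upper_bound hK b1 b2 b3 hR (half_pos hε)] with lam k1 k2 v hv y hy
  have k3 := k1 v hv y hy
  have k4 := k2 v hv y hy
  rw [abs_le]; constructor <;> linarith

lemma IsRegularlyHomogenizableAt.unique [IsProbabilityMeasure P]
    (h₁ : IsRegularlyHomogenizableAt P mbar H q h) (h₂ : IsRegularlyHomogenizableAt P mbar H q h') :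
    h = h' := by
  obtain ⟨V, k1, k2⟩ := ((h₁.limit 1 one_pos).and (h₂.limit 1 one_pos)).exists
  refine eq_of_abs_sub_le_all fun ε hε => ?_
  obtain ⟨lam, ⟨k3, k4⟩, k5⟩ := (((k1 (ε / 2) (by positivity)).and
    (k2 (ε / 2) (by positivity))).and self_mem_nhdsWithin).exists
  have hlam : 0 < lam := k5
  obtain ⟨v, hv, -⟩ := h₁.wellposed V lam hlam
  have e0 : |(0 : ℝ)| ≤ 1 / lam := by rw [abs_zero]; positivity
  have e1 := abs_le.1 (k3 v hv 0 e0)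
  have e2 := abs_le.1 (k4 v hv 0 e0)
  rw [abs_le]; constructor <;> linarith

variable {F : BUC → ℝ}

lemma IsPotentialLaw.ae_hasSlope [IsProbabilityMeasure P] (hP : IsPotentialLaw P mbar)
    (hF : Measurable F) (hC : ∀ V, |F V| ≤ C) :
    ∀ᵐ V ∂P, HasSlope (fieldPrim F V) (∫ V, F V ∂P) := by
  filter_upwards [hP.ae_abs_fieldPrim_sub_le hF hC] with V hV ε hε
  simp_rw [mul_comm (∫ V, F V ∂P)]
  exact hV ε hε

lemma IsGenerator.hasSubCorrector [IsProbabilityMeasure P] (hP : IsPotentialLaw P mbar)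
    {f : BUC → ℝ → ℝ} (hg : IsGenerator P C F f)
    (hsub : ∀ᵐ V ∂P, ∀ y, SubAt H (h - V.1 y) (prim (f V)) y) :
    HasSubCorrector P H (∫ V, f V 0 ∂P) h := by
  rw [hg.integral_eq]
  filter_upwards [hsub, hg.prim_eq, hP.ae_hasSlope hg.measurable hg.bound] with V h1 h2 h3
  rw [h2] at h1
  exact ⟨_, continuous_prim (memLp_field hg.measurable hg.bound V), h1, h3⟩

lemma IsGenerator.hasSuperCorrector [IsProbabilityMeasure P] (hP : IsPotentialLaw P mbar)
    {f : BUC → ℝ → ℝ} (hg : IsGenerator P C F f)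
    (hsup : ∀ᵐ V ∂P, ∀ y, SuperAt H (h - V.1 y) (prim (f V)) y) :
    HasSuperCorrector P H (∫ V, f V 0 ∂P) h := by
  rw [hg.integral_eq]
  filter_upwards [hsup, hg.prim_eq, hP.ae_hasSlope hg.measurable hg.bound] with V h1 h2 h3
  rw [h2] at h1
  exact ⟨_, continuous_prim (memLp_field hg.measurable hg.bound V), h1, h3⟩

lemma HasSubCorrector.mono (hs : HasSubCorrector P H q h) (hh : h ≤ h') :
    HasSubCorrector P H q h' := by
  filter_upwards [hs] with V ⟨w, w1, w2, w3⟩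
  exact ⟨w, w1, fun y => (w2 y).mono (by linarith), w3⟩

lemma HasSuperCorrector.mono (hs : HasSuperCorrector P H q h) (hh : h' ≤ h) :
    HasSuperCorrector P H q h' := by
  filter_upwards [hs] with V ⟨w, w1, w2, w3⟩
  exact ⟨w, w1, fun y => (w2 y).mono (by linarith), w3⟩

theorem isRegularlyHomogenizableAt_of_exact (hP : IsPotentialLaw P mbar)
    (hH : IsNormalizedHamiltonian H) (hsub : HasSubCorrector P H q h)
    (hsup : HasSuperCorrector P H q h) : IsRegularlyHomogenizableAt P mbar H q h :=
  isRegularlyHomogenizableAt_of_correctors hP hH (fun _ hδ => hsub.mono (by linarith))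
    fun _ hδ => hsup.mono (by linarith)

end Homogenization

/-! ### Mixtures of two fields -/

/-- The event that the potential takes the value `c` on `[-τ, 0]`. -/
def recentHit (c τ : ℝ) : Set BUC := {V | ∃ z ∈ Icc (-τ) 0, V.1 z = c}

lemma translate_mem_recentHit {c τ y : ℝ} {V : BUC} :
    BUC.translate y V ∈ recentHit c τ ↔ ∃ z ∈ Icc (y - τ) y, V.1 z = c := by
  constructor
  · rintro ⟨z, hz, h⟩
    exact ⟨z + y, ⟨by linarith [hz.1], by linarith [hz.2]⟩, h⟩
  · rintro ⟨z, hz, h⟩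
    exact ⟨z - y, ⟨by linarith [hz.1], by linarith [hz.2]⟩, by simpa [BUC.translate] using h⟩

lemma measurableSet_recentHit (c τ : ℝ) : MeasurableSet (recentHit c τ) := by
  have h := measurableSet_mapsTo (Φ := BUC.toC) BUC.measurable_eval
    (isCompact_Icc (a := -τ) (b := 0)) (isOpen_ne (x := c))
  have : recentHit c τ = {V | MapsTo (BUC.toC V) (Icc (-τ) 0) {x | x ≠ c}}ᶜ := by
    ext V
    simp only [recentHit, MapsTo, mem_compl_iff, mem_ofPred_eq, not_forall, not_not]
    constructor
    · rintro ⟨z, hz, h⟩; exact ⟨z, hz, h⟩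
    · rintro ⟨z, hz, h⟩; exact ⟨z, hz, h⟩
  rw [this]
  exact h.compl

open Classical in
/-- The generator of the field that equals the first field for a time `τ` after each hitting of
`c`, and the second one otherwise. -/
def mixGen (c τ : ℝ) (F G : BUC → ℝ) (V : BUC) : ℝ := if V ∈ recentHit c τ then F V else G V

section Mean
variable {P : Measure BUC} {mbar c C : ℝ} {F G : BUC → ℝ}

lemma measurable_mixGen (hF : Measurable F) (hG : Measurable G) (τ : ℝ) :
    Measurable (mixGen c τ F G) := by
  classical
  exact Measurable.ite (measurableSet_recentHit c τ) hF hG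

lemma abs_mixGen_le (hF : ∀ V, |F V| ≤ C) (hG : ∀ V, |G V| ≤ C) (τ : ℝ) (V : BUC) :
    |mixGen c τ F G V| ≤ C := by
  unfold mixGen
  split_ifs
  · exact hF V
  · exact hG V

/-- As `τ` varies, membership can change only when `V (-τ) = c`, an event of probability zero for
each `τ`; this makes the mean of the mixture continuous in `τ`. -/
lemma eventually_mem_recentHit_iff {V : BUC} {τ : ℝ} (hne : V.1 (-τ) ≠ c)
    {t : ℕ → ℝ} (ht : Tendsto t atTop (𝓝 τ)) :
    ∀ᶠ n in atTop, (V ∈ recentHit c (t n) ↔ V ∈ recentHit c τ) := by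
  have hev : ∀ᶠ z in 𝓝 (-τ), V.1 z ≠ c := V.continuous_coe.continuousAt.eventually_ne hne
  obtain ⟨r, hr, hball⟩ := Metric.eventually_nhds_iff.1 hev
  filter_upwards [Metric.tendsto_nhds.1 ht r hr] with n hn
  rw [Real.dist_eq, abs_lt] at hn
  constructor
  · rintro ⟨z, hz, h⟩
    refine ⟨z, ⟨?_, hz.2⟩, h⟩
    by_contra! hlt
    exact hball (y := z) (by rw [Real.dist_eq, abs_lt]; constructor <;> linarith [hz.1]) h
  · rintro ⟨z, hz, h⟩
    refine ⟨z, ⟨?_, hz.2⟩, h⟩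
    by_contra! hlt
    exact hball (y := z) (by rw [Real.dist_eq, abs_lt]; constructor <;> linarith [hz.1]) h

variable [IsProbabilityMeasure P]

lemma IsPotentialLaw.continuous_mean_mixGen (hP : IsPotentialLaw P mbar)
    (hV : ∀ᵐ V ∂P, HasDiscreteLevels V.1) (hF : Measurable F) (hG : Measurable G)
    (hFC : ∀ V, |F V| ≤ C) (hGC : ∀ V, |G V| ≤ C) :
    Continuous (fun τ => ∫ V, mixGen c τ F G V ∂P) := by
  refine continuous_iff_continuousAt.2 fun τ => tendsto_of_seq_tendsto fun t ht => ?_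
  have hne : ∀ᵐ V ∂P, V.1 (-τ) ≠ c := by
    have := hP.ae_comp_translate (-τ) (hP.ae_eval_ne hV (finite_singleton c))
    filter_upwards [this] with V h e
    exact h (by simpa [BUC.translate] using e)
  refine tendsto_integral_filter_of_dominated_convergence (fun _ => C)
    (Eventually.of_forall fun n => (measurable_mixGen hF hG _).aestronglyMeasurable)
    (Eventually.of_forall fun n => Eventually.of_forall fun V => abs_mixGen_le hFC hGC _ V)
    (integrable_const C) ?_
  filter_upwards [hne] with V h
  refine tendsto_const_nhds.congr' ?_
  filter_upwards [eventually_mem_recentHit_iff h ht] with n hn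
  by_cases hmem : V ∈ recentHit c τ
  · simp only [mixGen, if_pos hmem, if_pos (hn.2 hmem)]
  · simp only [mixGen, if_neg hmem, if_neg fun h => hmem (hn.1 h)]

lemma IsPotentialLaw.mean_mixGen_zero (hP : IsPotentialLaw P mbar)
    (hV : ∀ᵐ V ∂P, HasDiscreteLevels V.1) :
    ∫ V, mixGen c 0 F G V ∂P = ∫ V, G V ∂P := by
  refine integral_congr_ae ?_
  filter_upwards [hP.ae_eval_ne hV (finite_singleton c)] with V hne
  unfold mixGen
  rw [if_neg]
  rintro ⟨z, hz, h⟩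
  rw [neg_zero] at hz
  rw [le_antisymm hz.2 hz.1] at h
  exact hne h

lemma IsPotentialLaw.tendsto_mean_mixGen (hP : IsPotentialLaw P mbar)
    (hV : ∀ᵐ V ∂P, HasDiscreteLevels V.1) (hF : Measurable F) (hG : Measurable G)
    (hFC : ∀ V, |F V| ≤ C) (hGC : ∀ V, |G V| ≤ C) (hc : c ∈ Ioo (-mbar) 0) :
    Tendsto (fun n : ℕ => ∫ V, mixGen c n F G V ∂P) atTop (𝓝 (∫ V, F V ∂P)) := by
  refine tendsto_integral_filter_of_dominated_convergence (fun _ => C)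
    (Eventually.of_forall fun n => (measurable_mixGen hF hG _).aestronglyMeasurable)
    (Eventually.of_forall fun n => Eventually.of_forall fun V => abs_mixGen_le hFC hGC _ V)
    (integrable_const C) ?_
  filter_upwards [hP.ae_oscillates hV] with V h
  obtain ⟨z, hz, e⟩ := h.bot c hc 0
  obtain ⟨N, hN⟩ := exists_nat_ge (-z)
  refine tendsto_const_nhds.congr' ?_
  filter_upwards [eventually_ge_atTop N] with n hn
  have : (N : ℝ) ≤ n := by exact_mod_cast hn
  have hmem : V ∈ recentHit c n := ⟨z, ⟨by linarith, hz.le⟩, e⟩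
  simp only [mixGen, if_pos hmem]

/-- The mean moves continuously from that of `G` at `τ = 0` to that of `F` as `τ → ∞`, because
almost surely `c` was hit at some time in the past. -/
theorem IsPotentialLaw.exists_mixGen_mean (hP : IsPotentialLaw P mbar)
    (hV : ∀ᵐ V ∂P, HasDiscreteLevels V.1) (hF : Measurable F) (hG : Measurable G)
    (hFC : ∀ V, |F V| ≤ C) (hGC : ∀ V, |G V| ≤ C) (hc : c ∈ Ioo (-mbar) 0) {q : ℝ}
    (hq : (∫ V, G V ∂P < q ∧ q < ∫ V, F V ∂P) ∨ (∫ V, F V ∂P < q ∧ q < ∫ V, G V ∂P)) :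
    ∃ τ > 0, ∫ V, mixGen c τ F G V ∂P = q := by
  have hcont := hP.continuous_mean_mixGen (c := c) hV hF hG hFC hGC
  have h0 := hP.mean_mixGen_zero (c := c) (F := F) (G := G) hV
  have hlim := hP.tendsto_mean_mixGen hV hF hG hFC hGC hc
  have hpos : ∀ τ ∈ Ici (0 : ℝ), ∫ V, mixGen c τ F G V ∂P = q → q ≠ ∫ V, G V ∂P → τ > 0 := by
    intro τ hτ e hne
    refine lt_of_le_of_ne hτ fun h => hne ?_
    rw [← e, ← h, h0]
  rcases hq with ⟨h1, h2⟩ | ⟨h1, h2⟩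
  · obtain ⟨n, hn⟩ := (hlim.eventually_const_lt h2).exists
    obtain ⟨τ, hτ, e⟩ := intermediate_value_Icc (Nat.cast_nonneg n)
      hcont.continuousOn ⟨by rw [h0]; exact h1.le, hn.le⟩
    exact ⟨τ, hpos τ hτ.1 e h1.ne', e⟩
  · obtain ⟨n, hn⟩ := (hlim.eventually_lt_const h1).exists
    obtain ⟨τ, hτ, e⟩ := intermediate_value_Icc' (Nat.cast_nonneg n)
      hcont.continuousOn ⟨hn.le, by rw [h0]; exact h2.le⟩
    exact ⟨τ, hpos τ hτ.1 e h2.ne, e⟩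

end Mean

/-! ### One-sided comparison of kinks -/

section Kink
variable {H : ℝ → ℝ} {a y : ℝ} {u w : ℝ → ℝ}

/-- If `u` lies below `w` near a contact point, whatever touches `u` from below there also touches
`w`. -/
lemma SuperAt.of_le (h : SuperAt H a w y) (hle : ∀ᶠ x in 𝓝 y, u x - u y ≤ w x - w y) :
    SuperAt H a u y := by
  intro φ hφ hm
  refine h φ hφ ?_
  filter_upwards [hm, hle] with x h1 h2
  linarith

lemma SubAt.of_ge (h : SubAt H a w y) (hle : ∀ᶠ x in 𝓝 y, w x - w y ≤ u x - u y) :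
    SubAt H a u y := by
  intro φ hφ hm
  refine h φ hφ ?_
  filter_upwards [hm, hle] with x h1 h2
  linarith

lemma prim_sub_le_of_le {f g : ℝ → ℝ} (hf : MemLp f ⊤ volume) (hg : MemLp g ⊤ volume) {x z : ℝ}
    (hxz : x ≤ z) (h : ∀ᵐ t, t ∈ Ioo x z → f t ≤ g t) :
    prim f z - prim f x ≤ prim g z - prim g x := by
  rw [prim_sub_prim hf, prim_sub_prim hg]
  refine intervalIntegral.integral_mono_ae_restrict hxz (hf.intervalIntegrable_top x z)
    (hg.intervalIntegrable_top x z) ?_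
  rw [← restrict_Ioo_eq_restrict_Icc]
  exact (ae_restrict_iff' measurableSet_Ioo).2 h

end Kink

/-! ### Viscosity properties of mixtures -/

lemma prim_eventually_eq_of_ae {f g : ℝ → ℝ} (hf : MemLp f ⊤ volume) (hg : MemLp g ⊤ volume)
    {y r : ℝ} (hr : 0 < r) (h : ∀ᵐ x, x ∈ Ioo (y - r) (y + r) → f x = g x) :
    ∀ᶠ x in 𝓝 y, prim f x - prim f y = prim g x - prim g y := by
  have hI : Ioo (y - r) (y + r) ∈ 𝓝 y := Ioo_mem_nhds (by linarith) (by linarith)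
  filter_upwards [hI] with x hx
  have key : ∀ {a b : ℝ}, a ∈ Ioo (y - r) (y + r) → b ∈ Ioo (y - r) (y + r) → a ≤ b →
      prim f b - prim f a = prim g b - prim g a := fun {a b} ha hb hab => le_antisymm
    (prim_sub_le_of_le hf hg hab (h.mono fun t ht hI =>
      (ht ⟨ha.1.trans hI.1, hI.2.trans hb.2⟩).le))
    (prim_sub_le_of_le hg hf hab (h.mono fun t ht hI =>
      (ht ⟨ha.1.trans hI.1, hI.2.trans hb.2⟩).ge))
  have hy : y ∈ Ioo (y - r) (y + r) := ⟨by linarith, by linarith⟩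
  rcases le_total x y with hxy | hxy
  · linarith [key hx hy hxy]
  · linarith [key hy hx hxy]

section Mix
variable {H V f g m : ℝ → ℝ} {a c τ y : ℝ}

/-- `m` equals `f` for a time `τ` after each visit of `V` to `c`, and `g` otherwise. -/
structure IsMix (V : ℝ → ℝ) (c τ : ℝ) (f g m : ℝ → ℝ) : Prop where
  continuous : Continuous V
  pos : 0 < τ
  left : MemLp f ⊤ volume
  right : MemLp g ⊤ volume
  mem : MemLp m ⊤ volume
  eq_left : ∀ᵐ x, (∃ z ∈ Icc (x - τ) x, V z = c) → m x = f x
  eq_right : ∀ᵐ x, (¬ ∃ z ∈ Icc (x - τ) x, V z = c) → m x = g x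

/-- If the closed window `[y - τ, y]` contains no visit, this persists nearby and the mixture is `g`
on both sides. If it contains one, the visit lies strictly before `y`, and the mixture follows `f`
immediately to the left of `y`, though possibly not to the right. -/
lemma IsMix.cases (h : IsMix V c τ f g m) (hy : V y ≠ c) :
    (∀ᶠ x in 𝓝 y, prim m x - prim m y = prim g x - prim g y) ∨
      ∀ᶠ x in 𝓝 y, x ≤ y → prim m x - prim m y = prim f x - prim f y := by
  by_cases hA : ∃ z ∈ Icc (y - τ) y, V z = c
  · right
    obtain ⟨z, hz, hzc⟩ := hA
    have hzy : z < y := lt_of_le_of_ne hz.2 fun e => hy (e ▸ hzc)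
    filter_upwards [Ioi_mem_nhds hzy] with x hx hxy
    have hx' : z < x := hx
    have heq : ∀ᵐ t, t ∈ Ioo x y → m t = f t := h.eq_left.mono fun t ht hI =>
      ht ⟨z, ⟨by linarith [hz.1, hI.2], by linarith [hI.1]⟩, hzc⟩
    have h1 := prim_sub_le_of_le h.mem h.left hxy (heq.mono fun t ht hI => (ht hI).le)
    have h2 := prim_sub_le_of_le h.left h.mem hxy (heq.mono fun t ht hI => (ht hI).ge)
    linarith
  · left
    have hsub : Icc (y - τ) y ⊆ {z | V z ≠ c} := fun z hz e => hA ⟨z, hz, e⟩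
    obtain ⟨r, hr, hth⟩ := isCompact_Icc.exists_thickening_subset_open
      (isOpen_ne_fun h.continuous continuous_const) hsub
    refine prim_eventually_eq_of_ae h.mem h.right hr (h.eq_right.mono fun x hx hI => hx ?_)
    rintro ⟨z, hz, e⟩
    refine hth (Metric.mem_thickening_iff.2 ⟨z - (x - y), ⟨by linarith [hz.1], by linarith [hz.2]⟩,
      ?_⟩) e
    rw [Real.dist_eq, sub_sub_cancel, abs_lt]
    constructor <;> linarith [hI.1, hI.2]

lemma IsMix.le_left (h : IsMix V c τ f g m) (hle : ∀ᵐ x, g x ≤ f x) : ∀ᵐ x, g x ≤ m x ∧ m x ≤ f x := by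
  filter_upwards [h.eq_left, h.eq_right, hle] with x h1 h2 h3
  by_cases hA : ∃ z ∈ Icc (x - τ) x, V z = c
  · rw [h1 hA]; exact ⟨h3, le_rfl⟩
  · rw [h2 hA]; exact ⟨le_rfl, h3⟩

lemma IsMix.le_right (h : IsMix V c τ f g m) (hle : ∀ᵐ x, f x ≤ g x) :
    ∀ᵐ x, f x ≤ m x ∧ m x ≤ g x := by
  filter_upwards [h.eq_left, h.eq_right, hle] with x h1 h2 h3
  by_cases hA : ∃ z ∈ Icc (x - τ) x, V z = c
  · rw [h1 hA]; exact ⟨le_rfl, h3⟩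
  · rw [h2 hA]; exact ⟨h3, le_rfl⟩

/-- When `g ≤ f`, the return from `f` to `g` is a downward jump of slope: the primitive stays below
that of `f` around the switch, so the supersolution property is inherited. Only the visits to `c`,
where the slope may jump up, need a separate argument. -/
lemma IsMix.superAt (h : IsMix V c τ f g m) (hle : ∀ᵐ x, g x ≤ f x)
    (hf : SuperAt H a (prim f) y) (hg : SuperAt H a (prim g) y)
    (hZ : V y = c → SuperAt H a (prim m) y) : SuperAt H a (prim m) y := by
  by_cases hy : V y = c
  · exact hZ hy
  rcases h.cases hy with h1 | h1
  · exact hg.of_le (h1.mono fun x hx => hx.le)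
  · refine hf.of_le (h1.mono fun x hx => ?_)
    rcases le_total x y with hxy | hxy
    · exact (hx hxy).le
    · exact prim_sub_le_of_le h.mem h.left hxy ((h.le_left hle).mono fun t ht _ => ht.2)

lemma IsMix.subAt (h : IsMix V c τ f g m) (hle : ∀ᵐ x, f x ≤ g x)
    (hf : SubAt H a (prim f) y) (hg : SubAt H a (prim g) y)
    (hZ : V y = c → SubAt H a (prim m) y) : SubAt H a (prim m) y := by
  by_cases hy : V y = c
  · exact hZ hy
  rcases h.cases hy with h1 | h1
  · exact hg.of_ge (h1.mono fun x hx => hx.ge)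
  · refine hf.of_ge (h1.mono fun x hx => ?_)
    rcases le_total x y with hxy | hxy
    · exact (hx hxy).ge
    · exact prim_sub_le_of_le h.left h.mem hxy ((h.le_right hle).mono fun t ht _ => ht.1)

/-- A downward kink of a mixture at a visit to `c`. -/
lemma IsMix.subAt_kink (h : IsMix V c τ f g m) (hle : ∀ᵐ x, f x ≤ g x) (hy : V y = c) {l r : ℝ}
    (hl : HasDerivAt (prim g) l y) (hr : HasDerivAt (prim f) r y)
    (hH : ∀ q, r ≤ q → q ≤ l → H q ≤ a) : SubAt H a (prim m) y := by
  -- The comparison function has slopes from `g` on the left and from `f` on the right. It lies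
  -- below the mixture, since `m ≤ g` to the left and `m = f` for a time `τ` to the right.
  let v : ℝ → ℝ := fun x => if x ≤ y then prim g x - prim g y else prim f x - prim f y
  have hvl : HasDerivWithinAt v l (Iic y) y :=
    (hl.sub_const (prim g y)).hasDerivWithinAt.congr (fun x hx => if_pos hx) (if_pos le_rfl)
  have hvr : HasDerivWithinAt v r (Ici y) y := by
    refine (hr.sub_const (prim f y)).hasDerivWithinAt.congr (fun x hx => ?_) ?_
    · rcases (show y ≤ x from hx).eq_or_lt with rfl | hlt
      · simp [v]
      · exact if_neg (not_le.2 hlt)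
    · simp [v]
  refine (subAt_of_oneSided hvl hvr hH).of_ge ?_
  have hvy : v y = 0 := by simp [v]
  filter_upwards [Iio_mem_nhds (show y < y + τ by linarith [h.pos])] with x hx
  rw [hvy, sub_zero]
  rcases le_or_gt x y with hxy | hxy
  · simp only [v, if_pos hxy]
    have := prim_sub_le_of_le h.mem h.right hxy ((h.le_right hle).mono fun t ht _ => ht.2)
    linarith
  · simp only [v, if_neg (not_le.2 hxy)]
    have hx' : x < y + τ := hx
    refine prim_sub_le_of_le h.left h.mem hxy.le (h.eq_left.mono fun t ht hI => (ht ?_).ge)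
    exact ⟨y, ⟨by linarith [hI.2], hI.1.le⟩, hy⟩

end Mix

section Regular
variable {H : ℝ → ℝ} {L : ℕ} {p : ℕ → ℝ} {s f g : ℝ → ℝ} {b y : ℝ}

/-- The extremal derivatives agree near regular points. -/
lemma IsExtremalPair.ae_eq_near (h : IsExtremalPair H s f g b) (hb : HasBumps H L p)
    (hH : IsNormalizedHamiltonian H) (hs : Continuous s) (hy : IsRegularValue H p L (s y))
    (h0 : 0 < s y) : ∃ r > 0, (∀ᵐ x, x ∈ Ioo (y - r) (y + r) → f x = g x) ∧
      ∀ x ∈ Ioo (y - r) (y + r), ∃ ρ, IsRegularRoot H (s x) ρ ∧ H ρ = s x ∧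
        HasDerivAt (prim f) ρ x ∧ HasDerivAt (prim g) ρ x := by
  have hev : ∀ᶠ x in 𝓝 y, IsRegularValue H p L (s x) :=
    hs.continuousAt.eventually (hy.eventually _ h0)
  obtain ⟨r, hr, hball⟩ := Metric.eventually_nhds_iff.1 hev
  have hmf := h.lower.isMonoSol h.nonneg
  have hmg := h.upper.isMonoSol fun x => (h.nonneg x).trans (h.le x)
  have hroot : ∀ x ∈ Ioo (y - r) (y + r), ∃ ρ, IsRegularRoot H (s x) ρ ∧ H ρ = s x ∧
      HasDerivAt (prim f) ρ x ∧ HasDerivAt (prim g) ρ x := by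
    intro x hx
    obtain ⟨ρ, h1, h2⟩ := (hball (y := x) (by
      rw [Real.dist_eq, abs_lt]; constructor <;> linarith [hx.1, hx.2])).exists_root hb hH
    exact ⟨ρ, h1, h2, hmf.hasDerivAt hH.continuous hH.coercive hs h1,
      hmg.hasDerivAt hH.continuous hH.coercive hs h1⟩
  refine ⟨r, hr, ?_, hroot⟩
  filter_upwards [ae_hasDerivAt_prim h.lower.memLp, ae_hasDerivAt_prim h.upper.memLp] with x h1 h2 hx
  obtain ⟨ρ, -, -, h3, h4⟩ := hroot x hx
  rw [h1.unique h3, h2.unique h4]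

end Regular

/-! ### Correctors from mixtures and homogenization slope by slope -/

section Correctors
variable {P : Measure BUC} {mbar c τ C μ q : ℝ} {H : ℝ → ℝ} {L : ℕ} {p : ℕ → ℝ} {F G : BUC → ℝ}
  {f g : BUC → ℝ → ℝ}

lemma IsGenerator.ae_isMix (hf : IsGenerator P C F f) (hg : IsGenerator P C G g) (hτ : 0 < τ) :
    ∀ᵐ V ∂P, IsMix V.1 c τ (f V) (g V) fun y => mixGen c τ F G (BUC.translate y V) := by
  filter_upwards [hf.ae_eq, hg.ae_eq] with V h1 h2
  refine ⟨V.continuous_coe, hτ, (memLp_congr_ae h1).2 (memLp_field hf.measurable hf.bound V),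
    (memLp_congr_ae h2).2 (memLp_field hg.measurable hg.bound V),
    memLp_field (measurable_mixGen hf.measurable hg.measurable τ)
      (abs_mixGen_le hf.bound hg.bound τ) V, ?_, ?_⟩
  · filter_upwards [h1] with x hx hA
    rw [hx]
    exact if_pos (translate_mem_recentHit.2 hA)
  · filter_upwards [h2] with x hx hA
    rw [hx]
    exact if_neg fun h => hA (translate_mem_recentHit.1 h)

lemma IsGenerator.mono {C' : ℝ} (hf : IsGenerator P C F f) (h : C ≤ C') : IsGenerator P C' F f :=
  ⟨hf.measurable, fun V => (hf.bound V).trans h, hf.eq_zero, hf.ae_eq⟩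

lemma isGenerator_const (N : ℝ) : IsGenerator P |N| (fun _ => N) fun _ _ => N :=
  isGenerator_self measurable_const fun _ => le_rfl

lemma integral_mixGen_field :
    ∫ V, mixGen c τ F G (BUC.translate 0 V) ∂P = ∫ V, mixGen c τ F G V ∂P := by
  simp_rw [BUC.translate_zero]

lemma IsStrictSetting.exists_regular_level (h : IsStrictSetting P mbar H L p) (h0 : 0 ≤ μ) :
    ∃ c ∈ Ioo (-mbar) 0, IsRegularValue H p L (μ - c) ∧ 0 < μ - c := by
  obtain ⟨r, hr, hI⟩ := exists_isRegularValue_Ioo h.law.mbar_pos h0 h.strict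
  exact ⟨μ - r, ⟨by linarith [hI.2], by linarith [hI.1]⟩, by rwa [sub_sub_cancel],
    by linarith [hI.1]⟩

variable [IsProbabilityMeasure P]

/-- Below the level zero there are supersolutions of every slope. -/
theorem IsPotentialLaw.hasSuperCorrector_neg (hP : IsPotentialLaw P mbar)
    (hV : ∀ᵐ V ∂P, HasDiscreteLevels V.1) (hH : IsNormalizedHamiltonian H) {δ : ℝ}
    (hδ : δ ∈ Ioo 0 mbar) (q : ℝ) : HasSuperCorrector P H q (-δ) := by
  obtain ⟨R, hR0, hR⟩ := exists_bound_of_coercive hH.coercive mbar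
  -- The slopes `±N` are steep enough for `H ≥ mbar`, which dominates the right-hand side
  -- everywhere, and `q` lies strictly between them.
  set N := R + |q| + 1 with hN
  have hN0 : 0 ≤ N := by positivity
  have hHN : ∀ r, |r| = N → mbar ≤ H r := fun r hr => by
    by_contra! h
    have := hR r h.le
    rw [hr, hN] at this
    linarith [abs_nonneg q]
  have h1 : IsGenerator P N (fun _ => N) fun _ _ => N := by
    simpa [abs_of_nonneg hN0] using isGenerator_const (P := P) N
  have h2 : IsGenerator P N (fun _ => -N) fun _ _ => -N := by
    simpa [abs_of_nonneg hN0] using isGenerator_const (P := P) (-N)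
  have hq := abs_lt.1 (show |q| < N by linarith)
  obtain ⟨τ, hτ, e⟩ := hP.exists_mixGen_mean (c := -δ) hV h1.measurable h2.measurable h1.bound
    h2.bound ⟨by linarith [hδ.2], by linarith [hδ.1]⟩ (q := q)
    (Or.inl (by simpa using hq))
  have hm := isGenerator_self (P := P) (measurable_mixGen (c := -δ) h1.measurable h2.measurable τ)
    (abs_mixGen_le h1.bound h2.bound τ)
  have := hm.hasSuperCorrector (H := H) (h := -δ) hP (by
    filter_upwards [h1.ae_isMix h2 hτ, hP.ae_bounds] with V hmix hb y
    have hconst : ∀ r, |r| = N → SuperAt H (-δ - V.1 y) (prim fun _ => r) y := by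
      intro r hr
      have hd : HasDerivAt (prim fun _ => r) r y := by
        have : prim (fun _ => r) = fun x => x * r := by
          funext x; simp [prim]
        rw [this]
        simpa using (hasDerivAt_id y).mul_const r
      refine superAt_of_differentiableAt hd.differentiableAt ?_
      rw [hd.deriv]
      linarith [hHN r hr, hb.1 y, hδ.1]
    -- At a visit `V = -δ`, so the right-hand side is zero and any test slope is allowed because `H
    -- ≥ 0`.
    refine hmix.superAt (Eventually.of_forall fun _ => by linarith) (hconst N (abs_of_nonneg hN0))
      (hconst (-N) (by rw [abs_neg, abs_of_nonneg hN0])) fun hy φ _ _ => ?_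
    rw [hy]
    linarith [hH.nonneg (deriv φ y)])
  rwa [integral_mixGen_field, e] at this

namespace IsStrictSetting

/-- Since `μ - c` is a regular value, the extremal derivatives coincide near every visit to `c`, so
switching there creates no kink. -/
lemma ae_mix_reset (h : IsStrictSetting P mbar H L p) (h0 : 0 ≤ μ)
    (hc : IsRegularValue H p L (μ - c)) (hc0 : 0 < μ - c) :
    ∀ᵐ V ∂P, ∀ y, V.1 y = c → ∃ r > 0, ∀ᵐ x, x ∈ Ioo (y - r) (y + r) →
      lowerDerivative H p L mbar μ V x = upperDerivative H p L mbar μ V x := by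
  filter_upwards [h.ae_extremal h0] with V hV y hy
  obtain ⟨r, hr, h1, -⟩ := hV.ae_eq_near h.bumps h.ham (continuous_const.sub V.continuous_coe)
    (y := y) (by rw [hy]; exact hc) (by rw [hy]; exact hc0)
  exact ⟨r, hr, h1⟩

/-- The supersolution that follows the greatest derivative for a time `τ` after each reset. -/
lemma ae_superAt_mix (h : IsStrictSetting P mbar H L p) (h0 : 0 ≤ μ)
    (hc : IsRegularValue H p L (μ - c)) (hc0 : 0 < μ - c)
    (hF : IsGenerator P C F (upperDerivative H p L mbar μ))
    (hG : IsGenerator P C G (lowerDerivative H p L mbar μ)) (hτ : 0 < τ) :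
    ∀ᵐ V ∂P, ∀ y, SuperAt H (μ - V.1 y)
      (prim fun y => mixGen c τ F G (BUC.translate y V)) y := by
  filter_upwards [hF.ae_isMix hG hτ, h.ae_extremal h0, h.ae_mix_reset h0 hc hc0]
    with V hmix hV hreset y
  have hle : ∀ᵐ x, lowerDerivative H p L mbar μ V x ≤ upperDerivative H p L mbar μ V x :=
    Eventually.of_forall hV.le
  refine hmix.superAt hle (hV.upper.sup y) (hV.lower.sup y) fun hy => ?_
  obtain ⟨r, hr, heq⟩ := hreset y hy
  refine (hV.upper.sup y).of_le ((prim_eventually_eq_of_ae hmix.mem hmix.left hr ?_).mono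
    fun x hx => hx.le)
  filter_upwards [heq, hmix.le_left hle] with x h1 h2 hx
  exact le_antisymm h2.2 ((h1 hx).symm.le.trans h2.1)

lemma ae_subAt_mix (h : IsStrictSetting P mbar H L p) (h0 : 0 ≤ μ)
    (hc : IsRegularValue H p L (μ - c)) (hc0 : 0 < μ - c)
    (hF : IsGenerator P C F (lowerDerivative H p L mbar μ))
    (hG : IsGenerator P C G (upperDerivative H p L mbar μ)) (hτ : 0 < τ) :
    ∀ᵐ V ∂P, ∀ y, SubAt H (μ - V.1 y)
      (prim fun y => mixGen c τ F G (BUC.translate y V)) y := by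
  filter_upwards [hF.ae_isMix hG hτ, h.ae_extremal h0, h.ae_mix_reset h0 hc hc0]
    with V hmix hV hreset y
  have hle : ∀ᵐ x, lowerDerivative H p L mbar μ V x ≤ upperDerivative H p L mbar μ V x :=
    Eventually.of_forall hV.le
  refine hmix.subAt hle (hV.lower.sub y) (hV.upper.sub y) fun hy => ?_
  obtain ⟨r, hr, heq⟩ := hreset y hy
  refine (hV.lower.sub y).of_ge ((prim_eventually_eq_of_ae hmix.mem hmix.left hr ?_).mono
    fun x hx => hx.ge)
  filter_upwards [heq, hmix.le_right hle] with x h1 h2 hx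
  exact le_antisymm (h2.2.trans (h1 hx).ge) h2.1

/-- Two mixtures of the same mean: greatest derivative first gives the supersolution, least
derivative first the subsolution. At the endpoints the extremal derivatives themselves are exact
correctors. -/
theorem homogenizable_right (h : IsStrictSetting P mbar H L p) (h0 : 0 ≤ μ)
    (hq : q ∈ Icc (∫ V, lowerDerivative H p L mbar μ V 0 ∂P)
      (∫ V, upperDerivative H p L mbar μ V 0 ∂P)) :
    IsRegularlyHomogenizableAt P mbar H q μ := by
  obtain ⟨F, hF⟩ := h.exists_generator_upper h0
  obtain ⟨G, hG⟩ := h.exists_generator_lower h0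
  have hex := h.ae_extremal h0
  rcases hq.1.eq_or_lt with e | h1
  · rw [← e]
    exact isRegularlyHomogenizableAt_of_exact h.law h.ham
      (hG.hasSubCorrector h.law (hex.mono fun V hV => hV.lower.sub))
      (hG.hasSuperCorrector h.law (hex.mono fun V hV => hV.lower.sup))
  rcases hq.2.eq_or_lt with e | h2
  · rw [e]
    exact isRegularlyHomogenizableAt_of_exact h.law h.ham
      (hF.hasSubCorrector h.law (hex.mono fun V hV => hV.upper.sub))
      (hF.hasSuperCorrector h.law (hex.mono fun V hV => hV.upper.sup))
  obtain ⟨c, hc, hc1, hc0⟩ := h.exists_regular_level h0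
  rw [hG.integral_eq] at h1
  rw [hF.integral_eq] at h2
  obtain ⟨τ, hτ, e⟩ := h.law.exists_mixGen_mean h.levels hF.measurable hG.measurable hF.bound
    hG.bound hc (q := q) (Or.inl ⟨h1, h2⟩)
  obtain ⟨σ, hσ, e'⟩ := h.law.exists_mixGen_mean h.levels hG.measurable hF.measurable hG.bound
    hF.bound hc (q := q) (Or.inr ⟨h1, h2⟩)
  have k1 := (isGenerator_self (P := P) (measurable_mixGen hF.measurable hG.measurable τ)
    (abs_mixGen_le (c := c) hF.bound hG.bound τ)).hasSuperCorrector h.law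
    (h.ae_superAt_mix h0 hc1 hc0 hF hG hτ)
  have k2 := (isGenerator_self (P := P) (measurable_mixGen hG.measurable hF.measurable σ)
    (abs_mixGen_le (c := c) hG.bound hF.bound σ)).hasSubCorrector h.law
    (h.ae_subAt_mix h0 hc1 hc0 hG hF hσ)
  rw [integral_mixGen_field, e] at k1
  rw [integral_mixGen_field, e'] at k2
  exact isRegularlyHomogenizableAt_of_exact h.law h.ham k2 k1

/-- Supersolutions of any slope exist just below level zero, so only a subsolution at level zero has
to be found. It mixes the negative branch with the least derivative. -/
theorem homogenizable_flat (h : IsStrictSetting P mbar H L p)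
    (hq1 : ∫ V, leftInv H (-V.1 0) ∂P ≤ q)
    (hq2 : q ≤ ∫ V, lowerDerivative H p L mbar 0 V 0 ∂P) :
    IsRegularlyHomogenizableAt P mbar H q 0 := by
  obtain ⟨F, hF⟩ := h.law.exists_generator_left h.ham h.left (le_refl (0 : ℝ))
  obtain ⟨G, hG⟩ := h.exists_generator_lower (le_refl (0 : ℝ))
  simp only [zero_sub] at hF
  have hex := h.ae_extremal (le_refl (0 : ℝ))
  have hleft := h.law.ae_solDeriv_left h.ham h.left (le_refl (0 : ℝ))
  simp only [zero_sub] at hex hleft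
  have hsup : ∀ δ > 0, HasSuperCorrector P H q (0 - δ) := by
    intro δ hδ
    have hm := h.law.mbar_pos
    refine (h.law.hasSuperCorrector_neg h.levels h.ham (δ := min δ (mbar / 2))
      ⟨by positivity, ?_⟩ q).mono ?_
    · exact (min_le_right _ _).trans_lt (by linarith)
    · rw [zero_sub]; exact neg_le_neg (min_le_left _ _)
  suffices hsub : HasSubCorrector P H q 0 from
    isRegularlyHomogenizableAt_of_correctors h.law h.ham (fun δ hδ => hsub.mono (by linarith)) hsup
  rcases hq1.eq_or_lt with e | h1
  · rw [← e]
    refine hF.hasSubCorrector h.law ?_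
    filter_upwards [hleft] with V hV y
    rw [zero_sub]; exact hV.2.2.sub y
  rcases hq2.eq_or_lt with e | h2
  · rw [e]
    refine hG.hasSubCorrector h.law ?_
    filter_upwards [hex] with V hV y
    rw [zero_sub]; exact hV.lower.sub y
  obtain ⟨δ, hδ, hreg⟩ := h.bumps.exists_isRegularValue_near_zero
  have hm := h.law.mbar_pos
  -- Visits to `-κ` serve as switching times: `κ` is small enough to be a regular value and lies in
  -- `(0, mbar)`, so it is attained recurrently.
  set κ := min (δ / 2) (mbar / 2) with hκ
  have hκ0 : 0 < κ := by positivity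
  have hκδ : κ < δ := (min_le_left _ _).trans_lt (by linarith)
  have hκm : κ < mbar := (min_le_right _ _).trans_lt (by linarith)
  rw [hF.integral_eq] at h1
  rw [hG.integral_eq] at h2
  have hF' := hF.mono (le_max_left _ (levelBound H mbar 0))
  have hG' := hG.mono (le_max_right (-leftInv H (0 + mbar)) _)
  obtain ⟨τ, hτ, e⟩ := h.law.exists_mixGen_mean (c := -κ) h.levels hF.measurable hG.measurable
    hF'.bound hG'.bound ⟨by linarith, by linarith⟩ (q := q) (Or.inr ⟨h1, h2⟩)
  have k := (isGenerator_self (P := P) (measurable_mixGen hF.measurable hG.measurable τ)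
    (abs_mixGen_le (c := -κ) hF'.bound hG'.bound τ)).hasSubCorrector (H := H) (h := 0) h.law (by
    filter_upwards [hF'.ae_isMix hG' hτ, hex, hleft, h.law.ae_bounds] with V hmix hV hl hbd y
    rw [zero_sub]
    have hs0 : ∀ x, 0 ≤ -V.1 x := fun x => by linarith [hbd.2.1 x]
    have hle : ∀ᵐ x, leftInv H (-V.1 x) ≤ lowerDerivative H p L mbar 0 V x :=
      Eventually.of_forall fun x => ((leftInv_spec h.ham (hs0 x)).1).trans (hV.nonneg x)
    refine hmix.subAt hle (hl.2.2.sub y) (hV.lower.sub y) fun hy => ?_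
    have hsy : -V.1 y = κ := by rw [hy, neg_neg]
    obtain ⟨r, hr, -, hroot⟩ := hV.ae_eq_near h.bumps h.ham V.continuous_coe.neg (y := y)
      (by rw [hsy]; exact hreg κ hκ0.le hκδ) (by rw [hsy]; exact hκ0)
    obtain ⟨ρ, k1, k2, k3, -⟩ := hroot y ⟨by linarith, by linarith⟩
    have hd : HasDerivAt (prim fun x => leftInv H (-V.1 x)) (leftInv H (-V.1 y)) y :=
      intervalIntegral.integral_hasDerivAt_right (hl.1.intervalIntegrable _ _)
        (hl.1.stronglyMeasurableAtFilter _ _) hl.1.continuousAt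
    -- The slope drops from the positive root `ρ` to `Ψ κ`. In between `H ≤ κ`: by monotonicity on
    -- the negative side, and because `ρ` is a regular root on the positive side.
    refine hmix.subAt_kink hle hy k3 hd fun x hx1 hx2 => ?_
    have hspec := leftInv_spec h.ham (hs0 y)
    rcases le_total x 0 with hx0 | hx0
    · have := h.left.antitoneOn hspec.1 hx0 hx1
      rwa [hspec.2] at this
    · rcases hx2.eq_or_lt with e | hlt
      · rw [e, k2]
      · exact (k1.2.1 x hx0 hlt).le)
  rwa [integral_mixGen_field, e] at k

theorem homogenizable_left (h : IsStrictSetting P mbar H L p) (h0 : 0 ≤ μ)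
    (hq : q = ∫ V, leftInv H (μ - V.1 0) ∂P) : IsRegularlyHomogenizableAt P mbar H q μ := by
  obtain ⟨F, hF⟩ := h.law.exists_generator_left h.ham h.left h0
  have hleft := h.law.ae_solDeriv_left h.ham h.left h0
  rw [hq]
  exact isRegularlyHomogenizableAt_of_exact h.law h.ham
    (hF.hasSubCorrector h.law (hleft.mono fun V hV => hV.2.2.sub))
    (hF.hasSuperCorrector h.law (hleft.mono fun V hV => hV.2.2.sup))

end IsStrictSetting
end Correctors

/-! ### The greatest subsolution below a stationary supersolution -/

lemma Ultrafilter.exists_tendsto_of_eventually_mem_Icc {ι : Type*} (U : Ultrafilter ι) {g : ι → ℝ}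
    {a b : ℝ} (hg : ∀ᶠ i in (U : Filter ι), g i ∈ Icc a b) : ∃ v, Tendsto g U (𝓝 v) := by
  obtain ⟨v, -, hv⟩ := (isCompact_Icc (a := a) (b := b)).ultrafilter_le_nhds' (U.map g) hg
  exact ⟨v, hv⟩

section Obstacle
variable {H g S : ℝ → ℝ} {K z k : ℝ}

lemma IsObstacleSub.comp_add {w : ℝ → ℝ} (h : IsObstacleSub H g S 0 K w) (z k : ℝ) :
    IsObstacleSub H (fun x => g (x + z)) (fun x => S (x + z) - k) 0 K fun x => w (x + z) - k := by
  refine ⟨fun x y => ?_, fun x => by linarith [h.le (x + z)], fun y => ?_⟩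
  · have := h.lip (x + z) (y + z)
    rwa [show w (x + z) - k - (w (y + z) - k) = w (x + z) - w (y + z) by ring,
      show x - y = x + z - (y + z) by ring]
  · have := (h.sub (y + z))
    rw [zero_mul, sub_zero] at this ⊢
    exact (this.comp_add).congr (k := -k) (Eventually.of_forall fun x => sub_eq_add_neg _ _)

lemma obstacleSup_comp_add {w₀ : ℝ → ℝ} (h₀ : IsObstacleSub H g S 0 K w₀) (z k x : ℝ) :
    obstacleSup H (fun x => g (x + z)) (fun x => S (x + z) - k) 0 K x =
      obstacleSup H g S 0 K (x + z) - k := by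
  refine le_antisymm (csSup_le ⟨_, _, h₀.comp_add z k, rfl⟩ ?_) ?_
  · rintro _ ⟨w, hw, rfl⟩
    have h1 := hw.comp_add (-z) (-k)
    simp only [neg_add_cancel_right, sub_neg_eq_add, sub_add_cancel] at h1
    have := h1.le_sup (x + z)
    rw [add_neg_cancel_right] at this
    linarith
  · rw [sub_le_iff_le_add]
    refine csSup_le ⟨_, w₀, h₀, rfl⟩ ?_
    rintro _ ⟨w, hw, rfl⟩
    have := (hw.comp_add z k).le_sup x
    linarith

/-- Increments commute with translations for every potential; if the family is empty, both suprema
take the default value and the increments vanish. -/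
lemma obstacleSup_sub_comp_add (H g S : ℝ → ℝ) (K z k x y : ℝ) :
    obstacleSup H (fun x => g (x + z)) (fun x => S (x + z) - k) 0 K x -
      obstacleSup H (fun x => g (x + z)) (fun x => S (x + z) - k) 0 K y =
      obstacleSup H g S 0 K (x + z) - obstacleSup H g S 0 K (y + z) := by
  by_cases h : ∃ w, IsObstacleSub H g S 0 K w
  · obtain ⟨w, hw⟩ := h
    rw [obstacleSup_comp_add hw, obstacleSup_comp_add hw]; ring
  · have h' : ¬ ∃ w, IsObstacleSub H (fun x => g (x + z)) (fun x => S (x + z) - k) 0 K w := by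
      rintro ⟨w, hw⟩
      have h1 := hw.comp_add (-z) (-k)
      simp only [neg_add_cancel_right, sub_neg_eq_add, sub_add_cancel] at h1
      exact h ⟨_, h1⟩
    push Not at h h'
    simp [obstacleSup, h, h']

/-- Compactness comes from the obstacle above, from `t ≤ w y` with the Lipschitz bound below, and
from stability of subsolutions. -/
lemma isClosed_setOf_isObstacleSub (hH : Continuous H) (μ K y t : ℝ) :
    IsClosed {φ : C(ℝ, ℝ × ℝ) | ∃ w, IsObstacleSub H (fun x => μ - (φ x).1)
      (fun x => (φ x).2) 0 K w ∧ t ≤ w y} := by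
  refine isClosed_of_ultrafilter fun ψ U hU => ?_
  choose w hw hwt using fun φ : {φ : C(ℝ, ℝ × ℝ) | ∃ w, IsObstacleSub H (fun x => μ - (φ x).1)
      (fun x => (φ x).2) 0 K w ∧ t ≤ w y} => φ.2
  have hpt : ∀ x, Tendsto (fun i : {φ : C(ℝ, ℝ × ℝ) | ∃ w, IsObstacleSub H
      (fun x => μ - (φ x).1) (fun x => (φ x).2) 0 K w ∧ t ≤ w y} => i.1 x) U (𝓝 (ψ x)) := fun x =>
    ((continuous_eval_const x).tendsto ψ).comp hU
  have hlim : ∀ x, ∃ v, Tendsto (fun i => w i x) U (𝓝 v) := fun x => by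
    refine U.exists_tendsto_of_eventually_mem_Icc (a := t - K * |x - y|) (b := (ψ x).2 + 1) ?_
    have := ((continuous_snd.tendsto (ψ x)).comp (hpt x)).eventually_le_const
      (lt_add_one (ψ x).2)
    filter_upwards [this] with i hi
    exact ⟨by linarith [(abs_le.1 ((hw i).lip x y)).1, hwt i], ((hw i).le x).trans hi⟩
  choose v hv using hlim
  have hvlip : ∀ x z, |v x - v z| ≤ K * |x - z| := fun x z =>
    le_of_tendsto ((hv x).sub (hv z)).abs (Eventually.of_forall fun i => (hw i).lip x z)
  have hloc := fun a b ε (hε : 0 < ε) =>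
    eventually_abs_sub_le_of_equiLipschitz (fun i => (hw i).lip) hvlip hv a b hε
  have hs := fun (a b ε : ℝ) (hε : ε > 0) => (eventually_dist_le_of_tendsto hU a b ε hε).mono
    fun i hi x hx => show |(μ - (i.1 x).1 - 0 * w i x) - (μ - (ψ x).1 - 0 * v x)| ≤ ε by
      have := (le_max_left _ _).trans (hi x hx)
      rw [Real.dist_eq, abs_sub_comm] at this
      rwa [show μ - (i.1 x).1 - 0 * w i x - (μ - (ψ x).1 - 0 * v x) = (ψ x).1 - (i.1 x).1 by ring]
  have hvc := continuous_of_abs_sub_le hvlip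
  refine ⟨v, ⟨hvlip, fun x => ?_, ?_⟩, ge_of_tendsto (hv y) (Eventually.of_forall hwt)⟩
  · exact le_of_tendsto_of_tendsto (hv x) ((continuous_snd.tendsto (ψ x)).comp (hpt x))
      (Eventually.of_forall fun i => (hw i).le x)
  · exact subAt_of_tendsto (l := U) hH (by fun_prop)
      (fun i => continuous_of_abs_sub_le (hw i).lip) (fun i => (hw i).sub) hloc hs

end Obstacle

/-- The greatest subsolution below the primitive of the stationary field generated by `M`. -/
def fieldSup (H : ℝ → ℝ) (μ K : ℝ) (M : BUC → ℝ) (V : BUC) : ℝ → ℝ :=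
  obstacleSup H (fun y => μ - V.1 y) (fieldPrim M V) 0 K

section FieldSup
variable {P : Measure BUC} {mbar μ K C : ℝ} {H : ℝ → ℝ} {M : BUC → ℝ}

/-- The obstacle is stationary only up to an additive constant, so only the increments of the
greatest subsolution are stationary. -/
lemma fieldSup_translate_sub (hM : Measurable M) (hC : ∀ V, |M V| ≤ C) (z : ℝ) (V : BUC) (x y : ℝ) :
    fieldSup H μ K M (BUC.translate z V) x - fieldSup H μ K M (BUC.translate z V) y =
      fieldSup H μ K M V (x + z) - fieldSup H μ K M V (y + z) := by
  have h := obstacleSup_sub_comp_add H (fun y => μ - V.1 y) (fieldPrim M V) K z (fieldPrim M V z) x y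
  have e : (fun x => fieldPrim M V (x + z) - fieldPrim M V z) = fieldPrim M (BUC.translate z V) :=
    funext fun x => (fieldPrim_translate hM hC V z x).symm
  rw [e] at h
  exact h

lemma aemeasurable_fieldSup (hH : Continuous H) (hM : Measurable M) (hC : ∀ V, |M V| ≤ C)
    (h : ∀ᵐ V ∂P, ∃ w, IsObstacleSub H (fun y => μ - V.1 y) (fieldPrim M V) 0 K w) (y : ℝ) :
    AEMeasurable (fun V => fieldSup H μ K M V y) P := by
  let Φ : BUC → C(ℝ, ℝ × ℝ) := fun V => ⟨fun x => (V.1 x, fieldPrim M V x),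
    V.continuous_coe.prodMk (continuous_prim (memLp_field hM hC V))⟩
  refine aemeasurable_of_isClosed (Φ := Φ)
    (fun x => (BUC.measurable_eval x).prodMk (measurable_fieldPrim hM x))
    (isClosed_setOf_isObstacleSub (μ := μ) (K := K) (y := y) hH) ?_
  filter_upwards [h] with V ⟨w, hw⟩ t
  constructor
  · exact fun ht => ⟨_, isObstacleSub_obstacleSup hH (continuous_const.sub V.continuous_coe)
      le_rfl hw, ht⟩
  · rintro ⟨w, hw, ht⟩
    exact ht.trans (hw.le_sup y)

variable [IsProbabilityMeasure P]

/-- The increments of the greatest subsolution are generated by a stationary field. -/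
lemma IsPotentialLaw.exists_generator_fieldSup (hP : IsPotentialLaw P mbar) (hH : Continuous H)
    (hM : Measurable M) (hC : ∀ V, |M V| ≤ C)
    (h : ∀ᵐ V ∂P, ∃ w, IsObstacleSub H (fun y => μ - V.1 y) (fieldPrim M V) 0 K w) :
    ∃ F : BUC → ℝ, Measurable F ∧ (∀ V, |F V| ≤ K) ∧
      ∀ᵐ V ∂P, ∀ x, fieldSup H μ K M V x = fieldPrim F V x + fieldSup H μ K M V 0 := by
  -- The limsup of difference quotients is defined for every `V` and `y`, is stationary without
  -- exceptional sets, and equals the derivative wherever that exists.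
  let d : BUC → ℝ → ℕ → ℝ := fun V y n => ((n : ℝ) + 1) *
    (fieldSup H μ K M V (1 / ((n : ℝ) + 1) + y) - fieldSup H μ K M V (0 + y))
  let f : BUC → ℝ → ℝ := fun V y => limsup (d V y) atTop
  have hlip : ∀ᵐ V ∂P, ∀ x y, |fieldSup H μ K M V x - fieldSup H μ K M V y| ≤ K * |x - y| := by
    filter_upwards [h] with V ⟨w, hw⟩
    exact (isObstacleSub_obstacleSup hH (continuous_const.sub V.continuous_coe) le_rfl hw).lip
  have hst : IsStationaryField f := by
    intro z V y
    have : d (BUC.translate z V) y = d V (y + z) := by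
      funext n
      simp only [d]
      rw [fieldSup_translate_sub hM hC, add_assoc, add_assoc]
    simp only [f, this]
  have hbd : ∀ᵐ V ∂P, |f V 0| ≤ K := by
    filter_upwards [hlip] with V hV
    have hd : ∀ n, |d V 0 n| ≤ K := by
      intro n
      have hn : (0 : ℝ) < n + 1 := by positivity
      simp only [d]
      rw [abs_mul, abs_of_pos hn]
      calc _ ≤ ((n : ℝ) + 1) * (K * |1 / ((n : ℝ) + 1) + 0 - (0 + 0)|) := by gcongr; exact hV _ _
        _ = K := by
          rw [add_zero, add_zero, sub_zero, abs_of_pos (by positivity)]; field_simp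
    rw [abs_le]
    constructor
    · refine le_limsup_of_frequently_le (Frequently.of_forall fun n => (abs_le.1 (hd n)).1)
        ⟨K, ?_⟩
      exact eventually_map.2 (Eventually.of_forall fun n => (abs_le.1 (hd n)).2)
    · refine limsup_le_of_le ⟨-K, fun a ha => ?_⟩
        (Eventually.of_forall fun n => (abs_le.1 (hd n)).2)
      obtain ⟨n, hn⟩ := (eventually_map.1 ha).exists
      exact (abs_le.1 (hd n)).1.trans hn
  have hmeas : AEMeasurable (fun V => f V 0) P := by
    have hd : ∀ n, AEMeasurable (fun V => d V 0 n) P := fun n =>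
      ((aemeasurable_fieldSup hH hM hC h _).sub (aemeasurable_fieldSup hH hM hC h _)).const_mul _
    refine ⟨_, Measurable.limsup fun n => (hd n).measurable_mk, ?_⟩
    filter_upwards [ae_all_iff.2 fun n => (hd n).ae_eq_mk] with V hV
    simp only [f]
    congr 1
    exact funext hV
  obtain ⟨F, hF⟩ := hP.exists_isGenerator hst hbd hmeas
  refine ⟨F, hF.measurable, hF.bound, ?_⟩
  filter_upwards [hF.ae_eq, hlip] with V hV hVlip x
  have hL : LipschitzWith K.toNNReal (fieldSup H μ K M V) :=
    LipschitzWith.of_dist_le_mul fun x y => by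
      rw [Real.dist_eq, Real.dist_eq]
      refine (hVlip x y).trans ?_
      gcongr
      exact Real.le_coe_toNNReal K
  refine (hL.eq_prim_add (f := fun y => F (BUC.translate y V)) ?_ x)
  filter_upwards [hV, hL.ae_differentiableAt_real] with y hy hdiff
  rw [← hy]
  have h1 := (hasDerivAt_iff_tendsto_slope_zero.1 hdiff.hasDerivAt).mono_left
    (nhdsWithin_mono _ (fun t ht => ne_of_gt ht) : 𝓝[>] (0 : ℝ) ≤ 𝓝[≠] 0)
  have h2 : Tendsto (fun n : ℕ => 1 / ((n : ℝ) + 1)) atTop (𝓝[>] 0) :=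
    tendsto_nhdsWithin_iff.2 ⟨tendsto_one_div_add_atTop_nhds_zero_nat,
      Eventually.of_forall fun n => by rw [mem_Ioi]; positivity⟩
  have h3 : Tendsto (d V y) atTop (𝓝 (deriv (fieldSup H μ K M V) y)) := by
    refine (h1.comp h2).congr fun n => ?_
    simp only [d, Function.comp, one_div, inv_inv, smul_eq_mul, zero_add]
    rw [add_comm y]
  rw [show f V y = deriv (fieldSup H μ K M V) y from h3.limsup_eq]
  exact hdiff.hasDerivAt

end FieldSup

/-! ### Exact correctors of intermediate slope -/

section Touching
variable {H s V f g m : ℝ → ℝ} {b c τ r K : ℝ}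

/-- The subsolution that touches a mixture from below at a reset. -/
lemma IsExtremalPair.exists_touching (h : IsExtremalPair H s f g b) (hmix : IsMix V c τ g f m)
    (hreset : ∃ ρ > 0, ∀ᵐ x, x ∈ Ioo (r - ρ) (r + ρ) → f x = g x) (hbK : b ≤ K) :
    ∃ w, IsObstacleSub H s (prim m) 0 K w ∧ w r = prim m r := by
  classical
  obtain ⟨ρ, hρ, heq⟩ := hreset
  -- The greatest derivative before `r` and the least one after it: among slopes between `f` and
  -- `g`, this primitive falls below any other on both sides of `r`. Near `r` the two agree, so no
  -- kink arises.
  let k : ℝ → ℝ := (Iio r).piecewise g f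
  have hkl : ∀ x, x < r → k x = g x := fun x hx => piecewise_eq_of_mem _ _ _ hx
  have hkr : ∀ x, r ≤ x → k x = f x := fun x hx => piecewise_eq_of_notMem _ _ _ (not_lt.2 hx)
  have hkb : ∀ x, |k x| ≤ b := by
    intro x
    rcases lt_or_ge x r with hx | hx
    · rw [hkl x hx, abs_of_nonneg ((h.nonneg x).trans (h.le x))]; exact h.bound x
    · rw [hkr x hx, abs_of_nonneg (h.nonneg x)]; exact (h.le x).trans (h.bound x)
  have hk : MemLp k ⊤ volume := memLp_top_of_abs_le
    (h.upper.memLp.aestronglyMeasurable.restrict.piecewise measurableSet_Iio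
      h.lower.memLp.aestronglyMeasurable.restrict) hkb
  have hkg : ∀ᵐ x, x ∈ Ioo (r - ρ) (r + ρ) → k x = g x := by
    filter_upwards [heq] with x hx hI
    rcases lt_or_ge x r with h1 | h1
    · exact hkl x h1
    · rw [hkr x h1, hx hI]
  have hsub : ∀ y, SubAt H (s y) (prim k) y := by
    intro y
    rcases lt_trichotomy y r with hy | rfl | hy
    · refine (h.upper.sub y).of_ge ((prim_eventually_eq_of_ae hk h.upper.memLp (r := r - y)
        (by linarith) (Eventually.of_forall fun x hx => hkl x (by linarith [hx.2]))).mono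
          fun x hx => hx.ge)
    · exact (h.upper.sub y).of_ge ((prim_eventually_eq_of_ae hk h.upper.memLp hρ hkg).mono
        fun x hx => hx.ge)
    · refine (h.lower.sub y).of_ge ((prim_eventually_eq_of_ae hk h.lower.memLp (r := y - r)
        (by linarith) (Eventually.of_forall fun x hx => hkr x (by linarith [hx.1]))).mono
          fun x hx => hx.ge)
  have hle := hmix.le_left (Eventually.of_forall h.le)
  refine ⟨fun x => prim k x + (prim m r - prim k r), ⟨fun x y => ?_, fun x => ?_, fun y => ?_⟩,
    by ring⟩
  · rw [add_sub_add_right_eq_sub]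
    exact (abs_prim_sub_le hk hkb x y).trans (by gcongr)
  · rcases le_total x r with hx | hx
    · have := prim_sub_le_of_le hmix.mem hk hx (by
        filter_upwards [hle] with t ht hI
        rw [hkl t hI.2]; exact ht.2)
      linarith
    · have := prim_sub_le_of_le hk hmix.mem hx (by
        filter_upwards [hle] with t ht hI
        rw [hkr t hI.1.le]; exact ht.1)
      linarith
  · rw [zero_mul, sub_zero]
    exact (hsub y).congr (Eventually.of_forall fun x => rfl)

end Touching

section Exact
variable {P : Measure BUC} {mbar c τ C μ q : ℝ} {H : ℝ → ℝ} {L : ℕ} {p : ℕ → ℝ}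

/-- Functions that meet, up to a constant, at points tending to `+∞` have the same asymptotic slope.
-/
lemma HasSlope.eq_of_frequently {u w : ℝ → ℝ} {a b : ℝ} (hu : HasSlope u a) (hw : HasSlope w b)
    {k : ℝ} (h : ∀ x, ∃ y, x < y ∧ u y + k = w y) : a = b := by
  refine eq_of_abs_sub_le_all fun ε hε => ?_
  obtain ⟨D, hD⟩ := hu (ε / 4) (by positivity)
  obtain ⟨E, hE⟩ := hw (ε / 4) (by positivity)
  obtain ⟨y, hy, e⟩ := h (max 1 (2 * (|D| + |E| + |k|) / ε))
  have hy1 : 1 < y := (le_max_left _ _).trans_lt hy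
  have hy2 : 2 * (|D| + |E| + |k|) < y * ε := by
    rw [← div_lt_iff₀ hε]; exact (le_max_right _ _).trans_lt hy
  have h1 := abs_le.1 (hD y)
  have h2 := abs_le.1 (hE y)
  rw [abs_of_pos (by linarith : 0 < y)] at h1 h2
  have h3 := le_abs_self D
  have h4 := le_abs_self E
  have h5 := abs_le.1 (le_refl |k|)
  have hy0 : 0 < y := by linarith
  rw [abs_le]
  constructor
  · by_contra! hlt
    nlinarith [mul_lt_mul_of_pos_right hlt hy0]
  · by_contra! hlt
    nlinarith [mul_lt_mul_of_pos_right hlt hy0]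

lemma IsGenerator.solDeriv_field {F : BUC → ℝ} {f : BUC → ℝ → ℝ} (hF : IsGenerator P C F f)
    (hf : ∀ᵐ V ∂P, SolDeriv H (fun y => μ - V.1 y) (f V)) :
    ∀ᵐ V ∂P, SolDeriv H (fun y => μ - V.1 y) fun y => F (BUC.translate y V) := by
  filter_upwards [hF.ae_eq, hf] with V h1 h2
  exact h2.congr_ae h1.symm

variable [IsProbabilityMeasure P]

/-- Between the extremal means, every slope is the mean of a stationary solution derivative. -/
theorem IsStrictSetting.exists_exact_field (h : IsStrictSetting P mbar H L p) (h0 : 0 ≤ μ)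
    (hq : q ∈ Icc (∫ V, lowerDerivative H p L mbar μ V 0 ∂P)
      (∫ V, upperDerivative H p L mbar μ V 0 ∂P)) :
    ∃ (F : BUC → ℝ) (C : ℝ), Measurable F ∧ (∀ V, |F V| ≤ C) ∧ ∫ V, F V ∂P = q ∧
      ∀ᵐ V ∂P, SolDeriv H (fun y => μ - V.1 y) fun y => F (BUC.translate y V) := by
  obtain ⟨F, hF⟩ := h.exists_generator_upper h0
  obtain ⟨G, hG⟩ := h.exists_generator_lower h0
  have hex := h.ae_extremal h0
  rcases hq.1.eq_or_lt with e | h1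
  · exact ⟨G, _, hG.measurable, hG.bound, by rw [← e, hG.integral_eq],
      hG.solDeriv_field (hex.mono fun V hV => hV.lower)⟩
  rcases hq.2.eq_or_lt with e | h2
  · exact ⟨F, _, hF.measurable, hF.bound, by rw [e, hF.integral_eq],
      hF.solDeriv_field (hex.mono fun V hV => hV.upper)⟩
  obtain ⟨c, hc, hc1, hc0⟩ := h.exists_regular_level h0
  rw [hG.integral_eq] at h1
  rw [hF.integral_eq] at h2
  obtain ⟨τ, hτ, e⟩ := h.law.exists_mixGen_mean h.levels hF.measurable hG.measurable hF.bound
    hG.bound hc (q := q) (Or.inl ⟨h1, h2⟩)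
  have hM := measurable_mixGen (c := c) hF.measurable hG.measurable τ
  have hMb := abs_mixGen_le (c := c) hF.bound hG.bound τ
  -- `K` must dominate the slopes of all subsolutions, as Perron's method requires, and also those
  -- of the touching functions, which are at most `levelBound H mbar μ`.
  obtain ⟨R, hR0, hR⟩ := exists_bound_of_coercive h.ham.coercive (μ + mbar)
  set K := max R (levelBound H mbar μ) with hK
  set M := mixGen c τ F G with hMdef
  have hHc := h.ham.continuous
  have htouch : ∀ᵐ V ∂P, ∀ r, V.1 r = c → ∃ w, IsObstacleSub H (fun y => μ - V.1 y)
      (fieldPrim M V) 0 K w ∧ w r = fieldPrim M V r := by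
    filter_upwards [hF.ae_isMix hG hτ, hex, h.ae_mix_reset h0 hc1 hc0] with V hmix hV hres r hr
    exact hV.exists_touching hmix (hres r hr) (le_max_right _ _)
  have hne : ∀ᵐ V ∂P, ∃ w, IsObstacleSub H (fun y => μ - V.1 y) (fieldPrim M V) 0 K w := by
    filter_upwards [htouch, h.ae_oscillates] with V hV hosc
    obtain ⟨r, -, hr⟩ := hosc.top c hc 0
    obtain ⟨w, hw, -⟩ := hV r hr
    exact ⟨w, hw⟩
  obtain ⟨E, hE, hEb, hEq⟩ := h.law.exists_generator_fieldSup hHc hM hMb hne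
  refine ⟨E, K, hE, hEb, ?_, ?_⟩
  -- The greatest subsolution touches the primitive of the mixture at each visit to `c`, and there
  -- are visits arbitrarily far to the right; hence its slope is that of the mixture, namely `q`.
  · obtain ⟨V, k1, k2, k3, k4, k5⟩ := ((h.law.ae_hasSlope hE hEb).and ((h.law.ae_hasSlope hM hMb).and
      (hEq.and (htouch.and h.ae_oscillates)))).exists
    rw [← e]
    refine k1.eq_of_frequently k2 (k := fieldSup H μ K M V 0) fun x => ?_
    obtain ⟨y, hy, hyc⟩ := k5.top c hc x
    obtain ⟨w, hw, hwy⟩ := k4 y hyc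
    refine ⟨y, hy, ?_⟩
    rw [← k3 y]
    exact le_antisymm ((isObstacleSub_obstacleSup hHc (continuous_const.sub V.continuous_coe)
      le_rfl hw).le y) (hwy ▸ hw.le_sup y)
  · filter_upwards [hEq, hne, h.ae_superAt_mix h0 hc1 hc0 hF hG hτ, h.law.ae_bounds]
      with V k1 ⟨w, hw⟩ k3 k4
    have hs : Continuous fun y => μ - V.1 y := continuous_const.sub V.continuous_coe
    have hu := isObstacleSub_obstacleSup hHc hs le_rfl hw
    have hback : ∀ x, prim (fun y => E (BUC.translate y V)) x =
        fieldSup H μ K M V x + -fieldSup H μ K M V 0 := fun x => by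
      have := k1 x
      unfold fieldPrim at this
      linarith
    refine ⟨memLp_field hE hEb V, fun y => ?_, fun y => ?_⟩
    · have := hu.sub y
      rw [zero_mul, sub_zero] at this
      exact this.congr (Eventually.of_forall hback)
    · have := superAt_obstacleSup hHc hs (continuous_prim (memLp_field hM hMb V)) le_rfl hw
        (fun y q r _ _ hq => (hR q (by linarith [k4.1 y])).trans (le_max_left _ _))
        (y := y) (by rw [zero_mul, sub_zero]; exact k3 y)
      rw [zero_mul, sub_zero] at this
      exact this.congr (Eventually.of_forall hback)

end Exact

/-! ### The levels fill the half-lines of slopes -/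

lemma IsNormalizedHamiltonian.le_mul_abs {H : ℝ → ℝ} (hH : IsNormalizedHamiltonian H) {K : NNReal}
    (hK : LipschitzWith K H) (q : ℝ) : H q ≤ K * |q| := by
  have := hK.dist_le_mul q 0
  rw [hH.zero, Real.dist_eq, Real.dist_eq, sub_zero, sub_zero] at this
  exact (le_abs_self _).trans this

/-- Since `H q ≤ K |q|`, a nondecreasing solution with right-hand side at least `μ` has slope at
least `μ / K`. This bounds the levels that can occur for a given mean slope. -/
lemma IsMonoSol.le_mul_sub {H s u : ℝ → ℝ} (hH : IsNormalizedHamiltonian H) {K : NNReal}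
    (hK : LipschitzWith K H) (hu : IsMonoSol H s u) {μ : ℝ} (hs : ∀ y, μ ≤ s y) :
    μ ≤ K * (u 1 - u 0) := by
  have hK1 : (0 : ℝ) < K + 1 := by positivity
  -- A constant larger than `K` is used to avoid dividing by zero.
  have key : ∀ K' > (K : ℝ), μ ≤ K' * (u 1 - u 0) := by
    intro K' hK'
    have hK0 : 0 < K' := K.2.trans_lt hK'
    have := mul_le_sub_of_superAt (a := 0) (b := 1) (c := 2) (ρ := μ / K') hu.continuous.continuousOn
      one_pos one_lt_two fun y _ φ hφ hm => by
        have h0 := deriv_nonneg_of_isLocalMin_of_monotone hu.mono hφ hm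
        have h1 := hu.sup y φ hφ hm
        have h2 := hH.le_mul_abs hK (deriv φ y)
        rw [abs_of_nonneg h0] at h2
        rw [div_le_iff₀ hK0]
        nlinarith [hs y]
    rw [sub_zero, mul_one, div_le_iff₀ hK0] at this
    linarith
  have hlim : Tendsto (fun K' : ℝ => K' * (u 1 - u 0)) (𝓝[>] (K : ℝ)) (𝓝 (K * (u 1 - u 0))) :=
    (Continuous.tendsto (by fun_prop) _).mono_left nhdsWithin_le_nhds
  exact ge_of_tendsto hlim (eventually_mem_nhdsWithin.mono key)

/-! ### Semicontinuity of the extremal means in the level -/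

section Semicontinuity
variable {H : ℝ → ℝ} {μ B y a : ℝ} {ν : ℕ → ℝ} {V : BUC} {u : ℕ → ℝ → ℝ}

/-- Upper semicontinuity in the level of the greatest increment of a monotone solution. -/
lemma eventually_le_of_isMonoSol (hH : Continuous H) (hν : Tendsto ν atTop (𝓝 μ))
    (hu : ∀ n, IsMonoSol H (fun x => ν n - V.1 x) (u n))
    (hB : ∀ n x z, |u n x - u n z| ≤ B * |x - z|) (hu0 : ∀ n, u n 0 = 0)
    (ha : ∀ v, IsMonoSol H (fun x => μ - V.1 x) v → v 0 = 0 → v y ≤ a) {ε : ℝ} (hε : 0 < ε) :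
    ∀ᶠ n in atTop, u n y ≤ a + ε := by
  by_contra hcon
  rw [not_eventually] at hcon
  -- The change of level is absorbed into the potential, so that closedness at the fixed level `μ`
  -- applies.
  let φ : ℕ → C(ℝ, ℝ) := fun n => BUC.toC V + ContinuousMap.const ℝ (μ - ν n)
  have hφ : Tendsto φ atTop (𝓝 (BUC.toC V)) := by
    have h1 : Tendsto (fun n => μ - ν n) atTop (𝓝 0) := by simpa using hν.const_sub μ
    have h2 : Tendsto (fun n => ContinuousMap.const ℝ (μ - ν n)) atTop
        (𝓝 (ContinuousMap.const ℝ (0 : ℝ))) := (ContinuousMap.continuous_const'.tendsto _).comp h1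
    have h3 := h2.const_add (BUC.toC V)
    rwa [show BUC.toC V + ContinuousMap.const ℝ (0 : ℝ) = BUC.toC V by ext; simp] at h3
  have hcl := isClosed_setOf_isMonoSol (H := H) (μ := μ) (B := B) (y := y) hH (a + ε)
  have hmem := hcl.closure_subset (mem_closure_of_frequently_of_tendsto (hcon.mono fun n hn =>
    ⟨u n, by
      convert hu n using 2 with x
      simp only [φ, BUC.toC, ContinuousMap.add_apply, ContinuousMap.coe_mk,
        ContinuousMap.const_apply]
      ring, hB n, hu0 n, (not_le.1 hn).le⟩) hφ)
  obtain ⟨v, hv, -, hv0, hva⟩ := hmem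
  linarith [ha v hv hv0]

/-- A reversed Fatou lemma: `max (f n) g` converges to `g` boundedly and dominates `f n`. -/
lemma le_integral_of_eventually_le {Ω : Type*} [MeasurableSpace Ω] {P : Measure Ω}
    [IsProbabilityMeasure P] {f : ℕ → Ω → ℝ} {g : Ω → ℝ} (hf : ∀ n, Measurable (f n))
    (hg : Measurable g) (hfB : ∀ n ω, |f n ω| ≤ B) (hgB : ∀ ω, |g ω| ≤ B)
    (h : ∀ᵐ ω ∂P, ∀ ε > 0, ∀ᶠ n in atTop, f n ω ≤ g ω + ε) {q : ℝ} (hq : ∀ n, q ≤ ∫ ω, f n ω ∂P) :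
    q ≤ ∫ ω, g ω ∂P := by
  have hmax : ∀ n ω, |max (f n ω) (g ω)| ≤ B := fun n ω =>
    abs_max_le_max_abs_abs.trans (max_le (hfB n ω) (hgB ω))
  have hlim : Tendsto (fun n => ∫ ω, max (f n ω) (g ω) ∂P) atTop (𝓝 (∫ ω, g ω ∂P)) := by
    refine tendsto_integral_filter_of_dominated_convergence (fun _ => B)
      (Eventually.of_forall fun n => ((hf n).max hg).aestronglyMeasurable)
      (Eventually.of_forall fun n => Eventually.of_forall (hmax n)) (integrable_const B) ?_
    filter_upwards [h] with ω hω
    refine tendsto_order.2 ⟨fun b hb => Eventually.of_forall fun n => hb.trans_le (le_max_right _ _),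
      fun b hb => ?_⟩
    filter_upwards [hω ((b - g ω) / 2) (by linarith)] with n hn
    exact max_lt (by linarith) hb
  refine ge_of_tendsto hlim (Eventually.of_forall fun n => (hq n).trans ?_)
  exact integral_mono (Integrable.of_bound (hf n).aestronglyMeasurable B (Eventually.of_forall (hfB n)))
    (Integrable.of_bound ((hf n).max hg).aestronglyMeasurable B (Eventually.of_forall (hmax n)))
    fun ω => le_max_left _ _

variable {P : Measure BUC} [IsProbabilityMeasure P] {mbar q : ℝ} {F : ℕ → BUC → ℝ} {G : BUC → ℝ}

/-- With `y = 1` this yields upper semicontinuity of the upper mean; with `y = -1`, where the least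
derivative has the greatest primitive, lower semicontinuity of the lower mean. -/
lemma IsPotentialLaw.le_mul_mean_of_tendsto (hP : IsPotentialLaw P mbar) (hH : Continuous H)
    (hF : ∀ n, Measurable (F n)) (hFB : ∀ n V, |F n V| ≤ B) (hG : Measurable G)
    (hGB : ∀ V, |G V| ≤ B) (hν : Tendsto ν atTop (𝓝 μ))
    (hsol : ∀ᵐ V ∂P, ∀ n, IsMonoSol H (fun x => ν n - V.1 x) (fieldPrim (F n) V))
    (hmax : ∀ᵐ V ∂P, ∀ v, IsMonoSol H (fun x => μ - V.1 x) v → v 0 = 0 → v y ≤ fieldPrim G V y)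
    (hq : ∀ n, q ≤ y * ∫ V, F n V ∂P) : q ≤ y * ∫ V, G V ∂P := by
  have hb : ∀ {E : BUC → ℝ}, Measurable E → (∀ V, |E V| ≤ B) → ∀ V, |fieldPrim E V y| ≤ B * |y| :=
    fun hE hEB V => by simpa [fieldPrim_zero] using abs_fieldPrim_sub_le hE hEB V y 0
  rw [← integral_fieldPrim hP hG hGB]
  refine le_integral_of_eventually_le (f := fun n V => fieldPrim (F n) V y)
    (fun n => measurable_fieldPrim (hF n) y) (measurable_fieldPrim hG y)
    (fun n => hb (hF n) (hFB n)) (hb hG hGB) ?_ fun n => ?_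
  · filter_upwards [hsol, hmax] with V h1 h2 ε hε
    exact eventually_le_of_isMonoSol hH hν h1
      (fun n x z => abs_fieldPrim_sub_le (hF n) (hFB n) V x z) (fun n => fieldPrim_zero V) h2 hε
  · rw [integral_fieldPrim hP (hF n) (hFB n)]
    exact hq n

end Semicontinuity

lemma IsNormalizedHamiltonian.levelBound_mono {H : ℝ → ℝ} (hH : IsNormalizedHamiltonian H)
    {mbar μ ν : ℝ} (h0 : 0 ≤ μ + mbar) (h : μ ≤ ν) : levelBound H mbar μ ≤ levelBound H mbar ν :=
  csSup_le ⟨0, le_rfl, by rwa [hH.zero]⟩ fun _ hq => hH.le_levelBound hq.1 (by linarith [hq.2])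

section Levels
variable {P : Measure BUC} [IsProbabilityMeasure P] {mbar μ q : ℝ} {H : ℝ → ℝ} {L : ℕ} {p : ℕ → ℝ}

namespace IsStrictSetting

lemma integral_lower_le_upper (h : IsStrictSetting P mbar H L p) (h0 : 0 ≤ μ) :
    ∫ V, lowerDerivative H p L mbar μ V 0 ∂P ≤ ∫ V, upperDerivative H p L mbar μ V 0 ∂P := by
  obtain ⟨F, hF⟩ := h.exists_generator_upper h0
  obtain ⟨G, hG⟩ := h.exists_generator_lower h0
  exact integral_mono_ae hG.integrable hF.integrable ((h.ae_extremal h0).mono fun V hV => hV.le 0)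

lemma integral_lower_nonneg (h : IsStrictSetting P mbar H L p) (h0 : 0 ≤ μ) :
    0 ≤ ∫ V, lowerDerivative H p L mbar μ V 0 ∂P :=
  integral_nonneg_of_ae ((h.ae_extremal h0).mono fun _ hV => hV.nonneg 0)

lemma integral_upper_le_lower (h : IsStrictSetting P mbar H L p) (h0 : 0 ≤ μ) {ν : ℝ}
    (hμν : μ < ν) : ∫ V, upperDerivative H p L mbar μ V 0 ∂P ≤
      ∫ V, lowerDerivative H p L mbar ν V 0 ∂P := by
  have h1 := h0.trans hμν.le
  obtain ⟨F, hF⟩ := h.exists_generator_upper h0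
  obtain ⟨G, hG⟩ := h.exists_generator_lower h1
  rw [hF.integral_eq, hG.integral_eq, ← one_mul (∫ V, F V ∂P), ← one_mul (∫ V, G V ∂P),
    ← integral_fieldPrim h.law hF.measurable hF.bound,
    ← integral_fieldPrim h.law hG.measurable hG.bound]
  have hint : ∀ {E : BUC → ℝ} {C : ℝ}, Measurable E → (∀ V, |E V| ≤ C) →
      Integrable (fun V => fieldPrim E V 1) P := fun {E C} hE hC =>
    Integrable.of_bound (measurable_fieldPrim hE 1).aestronglyMeasurable C
      (Eventually.of_forall fun V => by
        simpa [fieldPrim_zero] using abs_fieldPrim_sub_le hE hC V 1 0)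
  refine integral_mono_ae (hint hF.measurable hF.bound) (hint hG.measurable hG.bound) ?_
  filter_upwards [h.ae_extremal h0, h.ae_extremal h1, h.ae_oscillates, hF.prim_eq, hG.prim_eq]
    with V k1 k2 k3 k4 k5
  have := antitone_upper_sub_lower h.bumps h.ham h.strict h.law.mbar_pos k3 h0 hμν
    (k1.upper.isMonoSol fun y => (k1.nonneg y).trans (k1.le y)) (k2.lower.isMonoSol k2.nonneg)
    (zero_le_one (α := ℝ))
  simp only [prim_zero, k4, k5] at this
  linarith

lemma le_mul_integral_lower (h : IsStrictSetting P mbar H L p) (h0 : 0 ≤ μ) {K : NNReal}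
    (hK : LipschitzWith K H) : μ ≤ K * ∫ V, lowerDerivative H p L mbar μ V 0 ∂P := by
  obtain ⟨G, hG⟩ := h.exists_generator_lower h0
  rw [hG.integral_eq, ← one_mul (∫ V, G V ∂P), ← integral_fieldPrim h.law hG.measurable hG.bound,
    ← integral_const_mul]
  have hint : Integrable (fun V => fieldPrim G V 1) P :=
    Integrable.of_bound (measurable_fieldPrim hG.measurable 1).aestronglyMeasurable
      (levelBound H mbar μ) (Eventually.of_forall fun V => by
        simpa [fieldPrim_zero] using abs_fieldPrim_sub_le hG.measurable hG.bound V 1 0)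
  have := integral_mono_ae (integrable_const μ) (hint.const_mul (K : ℝ)) (by
    filter_upwards [h.ae_extremal h0, hG.prim_eq, h.law.ae_bounds] with V k1 k2 k3
    have := (k1.lower.isMonoSol k1.nonneg).le_mul_sub h.ham hK (μ := μ)
      fun y => by linarith [k3.2.1 y]
    rwa [prim_zero, sub_zero, k2] at this)
  simpa using this

lemma integral_lower_le_of_tendsto (h : IsStrictSetting P mbar H L p) (h0 : 0 ≤ μ) {ν : ℕ → ℝ}
    {M : ℝ} (hν0 : ∀ n, 0 ≤ ν n) (hνM : ∀ n, ν n ≤ M) (hν : Tendsto ν atTop (𝓝 μ))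
    (hq : ∀ n, ∫ V, lowerDerivative H p L mbar (ν n) V 0 ∂P ≤ q) :
    ∫ V, lowerDerivative H p L mbar μ V 0 ∂P ≤ q := by
  have hm := h.law.mbar_pos
  choose F hF using fun n => h.exists_generator_lower (hν0 n)
  obtain ⟨G, hG⟩ := h.exists_generator_lower h0
  have hμM : μ ≤ M := le_of_tendsto hν (Eventually.of_forall hνM)
  have hsol : ∀ᵐ V ∂P, ∀ n, IsMonoSol H (fun x => ν n - V.1 x) (fieldPrim (F n) V) := by
    refine ae_all_iff.2 fun n => ?_
    filter_upwards [h.ae_extremal (hν0 n), (hF n).prim_eq] with V h1 h2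
    rw [← h2]
    exact h1.lower.isMonoSol h1.nonneg
  have := h.law.le_mul_mean_of_tendsto (y := -1) (q := -q) (B := levelBound H mbar M)
    h.ham.continuous (fun n => (hF n).measurable) (fun n V => ((hF n).bound V).trans
      (h.ham.levelBound_mono (by linarith [hν0 n]) (hνM n))) hG.measurable (fun V => (hG.bound V).trans
      (h.ham.levelBound_mono (by linarith) hμM)) hν hsol (by
      filter_upwards [h.ae_extremal h0, hG.prim_eq] with V h1 h2 v hv hv0
      have := h1.lower_sub v hv (by norm_num : (-1 : ℝ) ≤ 0)
      simp only [prim_zero, hv0, h2] at this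
      linarith) fun n => by
      have := hq n
      rw [(hF n).integral_eq] at this
      linarith
  rw [hG.integral_eq]
  linarith

lemma le_integral_upper_of_tendsto (h : IsStrictSetting P mbar H L p) (h0 : 0 ≤ μ) {ν : ℕ → ℝ}
    {M : ℝ} (hν0 : ∀ n, 0 ≤ ν n) (hνM : ∀ n, ν n ≤ M) (hν : Tendsto ν atTop (𝓝 μ))
    (hq : ∀ n, q ≤ ∫ V, upperDerivative H p L mbar (ν n) V 0 ∂P) :
    q ≤ ∫ V, upperDerivative H p L mbar μ V 0 ∂P := by
  have hm := h.law.mbar_pos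
  choose F hF using fun n => h.exists_generator_upper (hν0 n)
  obtain ⟨G, hG⟩ := h.exists_generator_upper h0
  have hμM : μ ≤ M := le_of_tendsto hν (Eventually.of_forall hνM)
  have hsol : ∀ᵐ V ∂P, ∀ n, IsMonoSol H (fun x => ν n - V.1 x) (fieldPrim (F n) V) := by
    refine ae_all_iff.2 fun n => ?_
    filter_upwards [h.ae_extremal (hν0 n), (hF n).prim_eq] with V h1 h2
    rw [← h2]
    exact h1.upper.isMonoSol fun y => (h1.nonneg y).trans (h1.le y)
  have := h.law.le_mul_mean_of_tendsto (y := 1) (q := q) (B := levelBound H mbar M)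
    h.ham.continuous (fun n => (hF n).measurable) (fun n V => ((hF n).bound V).trans
      (h.ham.levelBound_mono (by linarith [hν0 n]) (hνM n))) hG.measurable (fun V => (hG.bound V).trans
      (h.ham.levelBound_mono (by linarith) hμM)) hν hsol (by
      filter_upwards [h.ae_extremal h0, hG.prim_eq] with V h1 h2 v hv hv0
      have := h1.sub_upper v hv (zero_le_one (α := ℝ))
      simp only [prim_zero, hv0, h2] at this
      linarith) fun n => by
      have := hq n
      rw [(hF n).integral_eq] at this
      linarith
  rw [hG.integral_eq]
  linarith

/-- The intervals between the extremal means cover the slopes to the right of the flat piece. -/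
theorem exists_level_right (h : IsStrictSetting P mbar H L p)
    (hq : ∫ V, lowerDerivative H p L mbar 0 V 0 ∂P ≤ q) :
    ∃ μ, 0 ≤ μ ∧ q ∈ Icc (∫ V, lowerDerivative H p L mbar μ V 0 ∂P)
      (∫ V, upperDerivative H p L mbar μ V 0 ∂P) := by
  obtain ⟨K, hK⟩ := h.ham.lipschitz
  -- The level sought is the supremum of those whose lower mean does not exceed `q`; lower
  -- semicontinuity shows that the supremum itself belongs to `A`.
  set A : Set ℝ := {μ | 0 ≤ μ ∧ ∫ V, lowerDerivative H p L mbar μ V 0 ∂P ≤ q} with hA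
  have hne : A.Nonempty := ⟨0, le_rfl, hq⟩
  have hbdd : BddAbove A := ⟨K * q, fun μ hμ => (h.le_mul_integral_lower hμ.1 hK).trans
    (mul_le_mul_of_nonneg_left hμ.2 K.2)⟩
  obtain ⟨ν, -, hν, hνA⟩ := exists_seq_tendsto_sSup hne hbdd
  have h0 : 0 ≤ sSup A := le_csSup hbdd ⟨le_rfl, hq⟩
  refine ⟨sSup A, h0, h.integral_lower_le_of_tendsto h0 (fun n => (hνA n).1)
    (fun n => le_csSup hbdd (hνA n)) hν fun n => (hνA n).2, ?_⟩
  have hν' : Tendsto (fun n : ℕ => sSup A + 1 / ((n : ℝ) + 1)) atTop (𝓝 (sSup A)) := by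
    simpa using tendsto_one_div_add_atTop_nhds_zero_nat.const_add (sSup A)
  have hpos : ∀ n : ℕ, 0 < 1 / ((n : ℝ) + 1) := fun n => by positivity
  refine h.le_integral_upper_of_tendsto h0 (M := sSup A + 1) (fun n => by linarith [hpos n])
    (fun n => ?_) hν' fun n => ?_
  · have : 1 / ((n : ℝ) + 1) ≤ 1 := by
      rw [div_le_one (by positivity)]; linarith [Nat.cast_nonneg (α := ℝ) n]
    linarith
  -- Levels above the supremum are not in `A`, so their lower mean, and a fortiori their upper mean,
  -- exceeds `q`; this passes to the supremum by upper semicontinuity.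
  · have h1 : 0 ≤ sSup A + 1 / ((n : ℝ) + 1) := by linarith [hpos n]
    refine le_trans ?_ (h.integral_lower_le_upper h1)
    by_contra! hlt
    have := le_csSup hbdd (show sSup A + 1 / ((n : ℝ) + 1) ∈ A from ⟨h1, hlt.le⟩)
    linarith [hpos n]

end IsStrictSetting

lemma IsPotentialLaw.continuousOn_integral_leftInv (hP : IsPotentialLaw P mbar)
    (hH : IsNormalizedHamiltonian H) (hleft : StrictAntiOn H (Iic 0)) (N : ℝ) :
    ContinuousOn (fun μ => ∫ V : BUC, leftInv H (μ - V.1 0) ∂P) (Icc 0 N) := by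
  refine continuousOn_of_dominated (bound := fun _ => -leftInv H (N + mbar)) (fun μ hμ => ?_)
    (fun μ hμ => ?_) (integrable_const _) ?_
  · obtain ⟨F, hF⟩ := hP.exists_generator_left hH hleft hμ.1
    exact hF.integrable.aestronglyMeasurable
  · filter_upwards [hP.ae_bounds] with V hV
    have h1 : 0 ≤ μ - V.1 0 := by linarith [hV.2.1 0, hμ.1]
    have h2 : μ - V.1 0 ≤ N + mbar := by linarith [hV.1 0, hμ.2]
    rw [Real.norm_eq_abs, abs_of_nonpos (leftInv_spec hH h1).1]
    exact neg_le_neg ((strictAntiOn_leftInv hH hleft).antitoneOn h1 (h1.trans h2) h2)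
  · filter_upwards [hP.ae_bounds] with V hV
    refine (continuousOn_leftInv hH hleft).comp (by fun_prop) fun μ hμ => ?_
    have := hV.2.1 0
    have := hμ.1
    change 0 ≤ μ - V.1 0
    linarith

lemma IsPotentialLaw.integral_leftInv_antitone (hP : IsPotentialLaw P mbar)
    (hH : IsNormalizedHamiltonian H) (hleft : StrictAntiOn H (Iic 0)) (h0 : 0 ≤ μ) {ν : ℝ}
    (hμν : μ ≤ ν) : ∫ V : BUC, leftInv H (ν - V.1 0) ∂P ≤ ∫ V : BUC, leftInv H (μ - V.1 0) ∂P := by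
  obtain ⟨F, hF⟩ := hP.exists_generator_left hH hleft h0
  obtain ⟨G, hG⟩ := hP.exists_generator_left hH hleft (h0.trans hμν)
  refine integral_mono_ae hG.integrable hF.integrable ?_
  filter_upwards [hP.ae_bounds] with V hV
  have h1 : 0 ≤ μ - V.1 0 := by linarith [hV.2.1 0]
  exact (strictAntiOn_leftInv hH hleft).antitoneOn h1 (by change 0 ≤ ν - V.1 0; linarith)
    (by linarith)

theorem IsPotentialLaw.exists_level_left (hP : IsPotentialLaw P mbar)
    (hH : IsNormalizedHamiltonian H) (hleft : StrictAntiOn H (Iic 0))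
    (hq : q ≤ ∫ V : BUC, leftInv H (-V.1 0) ∂P) :
    ∃ μ, 0 ≤ μ ∧ q = ∫ V : BUC, leftInv H (μ - V.1 0) ∂P := by
  obtain ⟨K, hK⟩ := hH.lipschitz
  -- Since `H r ≤ K |r|`, at this level `leftInv H (N - V)` is at most `-|q|` for almost every `V`.
  set N : ℝ := (K + 1) * |q| with hN
  have hN0 : 0 ≤ N := by positivity
  have hfar : ∫ V : BUC, leftInv H (N - V.1 0) ∂P ≤ q := by
    obtain ⟨F, hF⟩ := hP.exists_generator_left hH hleft hN0
    have := integral_mono_ae hF.integrable (integrable_const (-|q|)) (by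
      filter_upwards [hP.ae_bounds] with V hV
      have h1 : 0 ≤ N - V.1 0 := by linarith [hV.2.1 0]
      obtain ⟨k1, k2⟩ := leftInv_spec hH h1
      have k3 := hH.le_mul_abs hK (leftInv H (N - V.1 0))
      rw [k2, abs_of_nonpos k1] at k3
      by_contra! hlt
      have h2 : 0 ≤ -leftInv H (N - V.1 0) := by linarith
      have h3 : (K : ℝ) * -leftInv H (N - V.1 0) ≤ (K + 1) * -leftInv H (N - V.1 0) := by
        linarith
      have h4 : ((K : ℝ) + 1) * -leftInv H (N - V.1 0) < (K + 1) * |q| :=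
        mul_lt_mul_of_pos_left (by linarith) (by positivity)
      linarith [hV.2.1 0])
    simp only [integral_const, probReal_univ, one_smul] at this
    linarith [neg_abs_le q]
  obtain ⟨μ, hμ, e⟩ := intermediate_value_Icc' hN0
    (hP.continuousOn_integral_leftInv hH hleft N) ⟨hfar, by simpa using hq⟩
  exact ⟨μ, hμ.1, e.symm⟩

end Levels

/-! ### The effective Hamiltonian under the strict oscillation condition -/

lemma quasiconvexOn_of_monotoneOn_of_antitoneOn {f : ℝ → ℝ} (h1 : MonotoneOn f (Ici 0))
    (h2 : AntitoneOn f (Iic 0)) : QuasiconvexOn ℝ univ f := by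
  intro r
  refine OrdConnected.convex ⟨?_⟩
  rintro x ⟨-, hx⟩ y ⟨-, hy⟩ z ⟨hxz, hzy⟩
  refine ⟨mem_univ z, ?_⟩
  rcases le_total 0 z with hz | hz
  · exact (h1 hz (hz.trans hzy) hzy).trans hy
  · exact (h2 (hxz.trans hz) hz hxz).trans hx

section Strict
variable {P : Measure BUC} {mbar : ℝ} {H Hbar : ℝ → ℝ} {L : ℕ} {p : ℕ → ℝ}

namespace IsStrictSetting

lemma integral_leftInv_nonpos (h : IsStrictSetting P mbar H L p) :
    ∫ V : BUC, leftInv H (-V.1 0) ∂P ≤ 0 := by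
  refine integral_nonpos_of_ae ?_
  filter_upwards [h.law.ae_bounds] with V hV
  exact (leftInv_spec h.ham (by linarith [hV.2.1 0] : 0 ≤ -V.1 0)).1

variable [IsProbabilityMeasure P]

/-- The left branch, the flat piece and the right levels together cover the slope axis. -/
theorem exists_homogenizable (h : IsStrictSetting P mbar H L p) (q : ℝ) :
    ∃ μ, 0 ≤ μ ∧ IsRegularlyHomogenizableAt P mbar H q μ := by
  rcases le_total q (∫ V, leftInv H (-V.1 0) ∂P) with h1 | h1
  · obtain ⟨μ, h0, e⟩ := h.law.exists_level_left h.ham h.left h1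
    exact ⟨μ, h0, h.homogenizable_left h0 e⟩
  rcases le_total q (∫ V, lowerDerivative H p L mbar 0 V 0 ∂P) with h2 | h2
  · exact ⟨0, le_rfl, h.homogenizable_flat h1 h2⟩
  · obtain ⟨μ, h0, hq⟩ := h.exists_level_right h2
    exact ⟨μ, h0, h.homogenizable_right h0 hq⟩

variable {q μ : ℝ}

/-- Some level's interval contains `q`, and by uniqueness of the effective value every level whose
interval contains `q` equals `Hbar q`. -/
lemma effective_eq_iff_right (h : IsStrictSetting P mbar H L p)
    (hbar : ∀ q, IsRegularlyHomogenizableAt P mbar H q (Hbar q))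
    (hq : ∫ V, lowerDerivative H p L mbar 0 V 0 ∂P ≤ q) (h0 : 0 ≤ μ) :
    Hbar q = μ ↔ q ∈ Icc (∫ V, lowerDerivative H p L mbar μ V 0 ∂P)
      (∫ V, upperDerivative H p L mbar μ V 0 ∂P) := by
  constructor
  · rintro rfl
    obtain ⟨ν, hν, hqν⟩ := h.exists_level_right hq
    rwa [(hbar q).unique (h.homogenizable_right hν hqν)]
  · exact fun hI => (hbar q).unique (h.homogenizable_right h0 hI)

lemma effective_eq_iff_left (h : IsStrictSetting P mbar H L p)
    (hbar : ∀ q, IsRegularlyHomogenizableAt P mbar H q (Hbar q))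
    (hq : q ≤ ∫ V : BUC, leftInv H (-V.1 0) ∂P) (h0 : 0 ≤ μ) :
    Hbar q = μ ↔ q = ∫ V : BUC, leftInv H (μ - V.1 0) ∂P := by
  constructor
  · rintro rfl
    obtain ⟨ν, hν, hqν⟩ := h.law.exists_level_left h.ham h.left hq
    rwa [(hbar q).unique (h.homogenizable_left hν hqν)]
  · exact fun hI => (hbar q).unique (h.homogenizable_left h0 hI)

lemma effective_flat (h : IsStrictSetting P mbar H L p)
    (hbar : ∀ q, IsRegularlyHomogenizableAt P mbar H q (Hbar q))
    (h1 : ∫ V : BUC, leftInv H (-V.1 0) ∂P ≤ q)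
    (h2 : q ≤ ∫ V, lowerDerivative H p L mbar 0 V 0 ∂P) : Hbar q = 0 :=
  (hbar q).unique (h.homogenizable_flat h1 h2)

lemma effective_nonneg (h : IsStrictSetting P mbar H L p)
    (hbar : ∀ q, IsRegularlyHomogenizableAt P mbar H q (Hbar q)) (q : ℝ) : 0 ≤ Hbar q := by
  obtain ⟨μ, h0, hμ⟩ := h.exists_homogenizable q
  rwa [(hbar q).unique hμ]

lemma monotoneOn_effective (h : IsStrictSetting P mbar H L p)
    (hbar : ∀ q, IsRegularlyHomogenizableAt P mbar H q (Hbar q)) : MonotoneOn Hbar (Ici 0) := by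
  intro q hq q' hq' hqq
  rcases le_total q (∫ V, lowerDerivative H p L mbar 0 V 0 ∂P) with h1 | h1
  · rw [h.effective_flat hbar (h.integral_leftInv_nonpos.trans hq) h1]
    exact h.effective_nonneg hbar q'
  by_contra! hlt
  have h2 := (h.effective_eq_iff_right hbar h1 (h.effective_nonneg hbar q)).1 rfl
  have h3 := (h.effective_eq_iff_right hbar (h1.trans hqq) (h.effective_nonneg hbar q')).1 rfl
  -- A drop in level would place the interval containing `q'` to the left of the one containing `q`,
  -- which forces `q = q'`.
  have h4 := h.integral_upper_le_lower (h.effective_nonneg hbar q') hlt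
  have : q = q' := le_antisymm hqq (h3.2.trans (h4.trans h2.1))
  exact hlt.ne (by rw [this])

lemma antitoneOn_effective (h : IsStrictSetting P mbar H L p)
    (hbar : ∀ q, IsRegularlyHomogenizableAt P mbar H q (Hbar q)) : AntitoneOn Hbar (Iic 0) := by
  intro q hq q' hq' hqq
  rcases le_total (∫ V, leftInv H (-V.1 0) ∂P) q' with h1 | h1
  · rw [h.effective_flat hbar h1 (le_trans hq' (h.integral_lower_nonneg le_rfl))]
    exact h.effective_nonneg hbar q
  by_contra! hlt
  have h2 := (h.effective_eq_iff_left hbar (hqq.trans h1) (h.effective_nonneg hbar q)).1 rfl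
  have h3 := (h.effective_eq_iff_left hbar h1 (h.effective_nonneg hbar q')).1 rfl
  have h4 := h.law.integral_leftInv_antitone h.ham h.left (h.effective_nonneg hbar q) hlt.le
  rw [← h2, ← h3] at h4
  have : q = q' := le_antisymm hqq h4
  exact hlt.ne (by rw [this])

lemma isAdmissibleField_lower (h : IsStrictSetting P mbar H L p) (h0 : 0 ≤ μ) :
    IsAdmissibleField P H p L mbar μ (lowerDerivative H p L mbar μ) := by
  obtain ⟨F, hF⟩ := h.exists_generator_lower h0
  refine ⟨isStationaryField_lowerDerivative, hF.integrable, ?_, fun hμ => ?_⟩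
  · filter_upwards [h.ae_extremal h0] with V hV
    exact isSolutionDerivative_iff.2 hV.lower
  · filter_upwards [h.ae_oscillates] with V hV
    exact ((isExtremalPair_level h.bumps h.ham h.strict h.law.mbar_pos hV h0).2 hμ).1

lemma isAdmissibleField_upper (h : IsStrictSetting P mbar H L p) (h0 : 0 ≤ μ) :
    IsAdmissibleField P H p L mbar μ (upperDerivative H p L mbar μ) := by
  obtain ⟨F, hF⟩ := h.exists_generator_upper h0
  refine ⟨isStationaryField_upperDerivative, hF.integrable, ?_, fun hμ => ?_⟩
  · filter_upwards [h.ae_extremal h0] with V hV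
    exact isSolutionDerivative_iff.2 hV.upper
  · filter_upwards [h.ae_oscillates] with V hV
    exact ((isExtremalPair_level h.bumps h.ham h.strict h.law.mbar_pos hV h0).2 hμ).2

lemma exists_stationary_derivative (h : IsStrictSetting P mbar H L p) (h0 : 0 ≤ μ)
    (hq : q ∈ Icc (∫ V, lowerDerivative H p L mbar μ V 0 ∂P)
      (∫ V, upperDerivative H p L mbar μ V 0 ∂P)) :
    ∃ f : BUC → ℝ → ℝ, Measurable (Function.uncurry f) ∧ IsStationaryField f ∧
      (∀ᵐ V ∂P, IsSolutionDerivative H V.1 μ (f V)) ∧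
      Integrable (fun V => f V 0) P ∧ ∫ V, f V 0 ∂P = q := by
  obtain ⟨F, C, hF, hC, hFq, hsol⟩ := h.exists_exact_field h0 hq
  refine ⟨fun V y => F (BUC.translate y V), measurable_field hF, isStationaryField_generated F,
    hsol.mono fun V hV => isSolutionDerivative_iff.2 hV, ?_, ?_⟩
  · simp_rw [BUC.translate_zero]
    exact Integrable.of_bound hF.aestronglyMeasurable C (Eventually.of_forall hC)
  · simp_rw [BUC.translate_zero]
    exact hFq

end IsStrictSetting

lemma IsPotentialLaw.integrable_leftInv [IsProbabilityMeasure P] (hP : IsPotentialLaw P mbar)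
    (hH : IsNormalizedHamiltonian H) (hleft : StrictAntiOn H (Iic 0)) {μ : ℝ} (h0 : 0 ≤ μ) :
    Integrable (fun V : BUC => leftInv H (μ - V.1 0)) P := by
  obtain ⟨F, hF⟩ := hP.exists_generator_left hH hleft h0
  exact hF.integrable

end Strict

/-! ### The borderline oscillation condition -/

section Borderline
variable {P : Measure BUC} {mbar t q lam : ℝ} {H : ℝ → ℝ} {L : ℕ} {p : ℕ → ℝ} {v w : ℝ → ℝ}

lemma IsNormalizedHamiltonian.const_mul (hH : IsNormalizedHamiltonian H) (ht : 0 < t) :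
    IsNormalizedHamiltonian fun q => t * H q := by
  obtain ⟨K, hK⟩ := hH.lipschitz
  refine ⟨⟨t.toNNReal * K, LipschitzWith.of_dist_le_mul fun x y => ?_⟩,
    fun q => mul_nonneg ht.le (hH.nonneg q), by rw [hH.zero, mul_zero],
    hH.coercive.const_mul_atTop ht⟩
  have := mul_le_mul_of_nonneg_left (hK.dist_le_mul x y) ht.le
  rw [Real.dist_eq, ← mul_sub, abs_mul, abs_of_pos ht, NNReal.coe_mul, Real.coe_toNNReal t ht.le,
    mul_assoc]
  exact this

lemma HasBumps.const_mul (hb : HasBumps H L p) (ht : 0 < t) : HasBumps (fun q => t * H q) L p :=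
  ⟨hb.decreasing, hb.last, fun _ ha _ hb' hab => mul_lt_mul_of_pos_left (hb.mono_outer ha hb' hab) ht,
    fun k h1 h2 _ ha _ hb' hab => mul_lt_mul_of_pos_left (hb.mono_inner k h1 h2 ha hb' hab) ht,
    fun k h1 h2 _ ha _ hb' hab => mul_lt_mul_of_pos_left (hb.anti_inner k h1 h2 ha hb' hab) ht,
    fun i h1 h2 => mul_pos ht (hb.values_pos i h1 h2),
    fun _ hi _ hj e => hb.values_distinct hi hj (mul_left_cancel₀ ht.ne' e)⟩

/-- Shrinking the Hamiltonian makes the oscillation condition strict. -/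
lemma isStrictSetting_const_mul (hP : IsPotentialLaw P mbar) (hV : ∀ᵐ V ∂P, HasDiscreteLevels V.1)
    (hH : IsNormalizedHamiltonian H) (hb : HasBumps H L p) (hleft : StrictAntiOn H (Iic 0))
    (hosc : ∀ i j, 1 ≤ i → i ≤ L → 1 ≤ j → j ≤ L → maxValue H p i - minValue H p j ≤ mbar)
    (ht : t ∈ Ioo 0 1) : IsStrictSetting P mbar (fun q => t * H q) L p := by
  refine ⟨hP, hV, hH.const_mul ht.1, hb.const_mul ht.1,
    fun _ hx _ hy hxy => mul_lt_mul_of_pos_left (hleft hx hy hxy) ht.1, fun i j h1 h2 h3 h4 => ?_⟩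
  have := mul_le_mul_of_nonneg_left (hosc i j h1 h2 h3 h4) ht.1.le
  have h5 : t * mbar < mbar := mul_lt_of_lt_one_left hP.mbar_pos ht.2
  simp only [maxValue, minValue] at this ⊢
  linarith

/-- Stability of the cell problem when the Hamiltonian is shrunk. -/
lemma abs_sub_le_of_isCellSolution (hH : IsNormalizedHamiltonian H) {V : BUC}
    (hV : ∀ y, -mbar ≤ V.1 y ∧ V.1 y ≤ 0) (hlam : 0 < lam) (ht : t ∈ Icc (1 / 2) 1)
    (hv : IsCellSolution H V.1 q lam v) (hw : IsCellSolution (fun q => t * H q) V.1 q lam w)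
    (y : ℝ) : |lam * v y - lam * w y| ≤ (1 - t) * (H q + 2 * mbar) := by
  have ht0 : 0 < t := by linarith [ht.1]
  obtain ⟨K, hK⟩ := hH.lipschitz
  obtain ⟨K', hK'⟩ := (hH.const_mul ht0).lipschitz
  have hKq := lipschitzWith_comp_const_add hK q
  have hKq' := lipschitzWith_comp_const_add hK' q
  obtain ⟨⟨C, hC⟩, hvc, hvs, hvS⟩ := isCellSolution_iff.1 hv
  obtain ⟨⟨C', hC'⟩, hwc, hws, hwS⟩ := isCellSolution_iff.1 hw
  have hg : Continuous fun y => -V.1 y := V.continuous_coe.neg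
  have hHq := hH.nonneg q
  -- The constant `-(t * H q) / lam` is a subsolution. This lower bound on `w` limits `H` at the
  -- test slopes of `w`, which is what makes the error of order `1 - t`.
  have hconst : ∀ x, -(t * H q) ≤ lam * w x := by
    intro x
    have := discounted_comparison hKq' hlam (g := fun y => -V.1 y) hg continuous_const hwc
      (v₁ := fun _ => -(t * H q) / lam) (fun y => by
        refine subAt_of_differentiableAt (differentiableAt_const _) ?_
        rw [deriv_const, add_zero, mul_div_cancel₀ _ hlam.ne']
        linarith [(hV y).2]) hwS ⟨-(t * H q) / lam + C', fun y => by
          linarith [(abs_le.1 (hC' y)).1]⟩ x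
    rw [div_le_iff₀ hlam] at this
    linarith
  set B := H q + 2 * mbar with hB
  have h1 : v y ≤ w y := discounted_comparison hKq hlam (g := fun y => -V.1 y) hg hvc hwc hvs
    (fun y => (hwS y).imp fun r hr => hr.trans
      (mul_le_of_le_one_left (hH.nonneg _) ht.2)) ⟨C + C', fun y => by
        linarith [(abs_le.1 (hC y)).2, (abs_le.1 (hC' y)).1]⟩ y
  have h2 : w y + -((1 - t) * B / lam) ≤ v y := by
    refine discounted_comparison hKq hlam (g := fun y => -V.1 y) hg (by fun_prop) hvc
      (v₁ := fun y => w y + -((1 - t) * B / lam)) (fun y => ?_) hvS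
      ⟨C' + -((1 - t) * B / lam) + C, fun y => by
        linarith [(abs_le.1 (hC' y)).2, (abs_le.1 (hC y)).1]⟩ y
    refine SubAt.congr (k := -((1 - t) * B / lam)) ?_ (Eventually.of_forall fun x => rfl)
    refine (hws y).imp fun r hr => ?_
    have e : lam * (w y + -((1 - t) * B / lam)) = lam * w y - (1 - t) * B := by
      field_simp
      ring
    rw [e]
    have k1 := hconst y
    have k2 := (hV y).1
    have k3 := hH.nonneg (q + r)
    have k4 : H (q + r) ≤ B := by
      -- Dividing by `t ≥ 1 / 2` turns `mbar` into at most `2 * mbar`, whence the constant `B`.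
      have : t * H (q + r) ≤ t * H q + mbar := by linarith
      have k5 : mbar ≤ t * (2 * mbar) := by nlinarith [ht.1, (hV y).2]
      have : t * H (q + r) ≤ t * B := by rw [hB]; linarith
      exact le_of_mul_le_mul_left this ht0
    have k6 : (1 - t) * H (q + r) ≤ (1 - t) * B :=
      mul_le_mul_of_nonneg_left k4 (by linarith [ht.2])
    linarith
  have h3 := mul_le_mul_of_nonneg_left h1 hlam.le
  have h4 := mul_le_mul_of_nonneg_left h2 hlam.le
  have e : lam * (w y + -((1 - t) * B / lam)) = lam * w y - (1 - t) * B := by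
    field_simp
    ring
  have h5 : 0 ≤ (1 - t) * B := by linarith
  rw [abs_le]
  constructor <;> linarith

variable [IsProbabilityMeasure P]

lemma abs_sub_le_of_homogenizable (hH : IsNormalizedHamiltonian H) {s h k : ℝ}
    (hs : s ∈ Icc (1 / 2) 1) (ht : t ∈ Icc (1 / 2) 1)
    (h₁ : IsRegularlyHomogenizableAt P mbar (fun q => s * H q) q h)
    (h₂ : IsRegularlyHomogenizableAt P mbar (fun q => t * H q) q k) :
    |h - k| ≤ ((1 - s) + (1 - t)) * (H q + 2 * mbar) := by
  obtain ⟨V, ⟨k1, k2⟩, k3⟩ := (((h₁.limit 1 one_pos).and (h₂.limit 1 one_pos)).and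
    h₁.law.ae_bounds).exists
  refine le_of_forall_pos_le_add fun ε hε => ?_
  obtain ⟨lam, ⟨k4, k5⟩, k6⟩ := (((k1 (ε / 2) (by positivity)).and
    (k2 (ε / 2) (by positivity))).and self_mem_nhdsWithin).exists
  have hlam : 0 < lam := k6
  obtain ⟨v, hv, -⟩ := existsUnique_isCellSolution hH V q hlam
  obtain ⟨w₁, hw₁, -⟩ := h₁.wellposed V lam hlam
  obtain ⟨w₂, hw₂, -⟩ := h₂.wellposed V lam hlam
  have hV : ∀ y, -mbar ≤ V.1 y ∧ V.1 y ≤ 0 := fun y => ⟨k3.1 y, k3.2.1 y⟩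
  have e0 : |(0 : ℝ)| ≤ 1 / lam := by rw [abs_zero]; positivity
  have e1 := abs_le.1 (k4 w₁ hw₁ 0 e0)
  have e2 := abs_le.1 (k5 w₂ hw₂ 0 e0)
  have e3 := abs_le.1 (abs_sub_le_of_isCellSolution hH hV hlam hs hv hw₁ 0)
  have e4 := abs_le.1 (abs_sub_le_of_isCellSolution hH hV hlam ht hv hw₂ 0)
  rw [abs_le]
  constructor <;> linarith

/-- Homogenization passes to the limit along shrunk Hamiltonians. -/
theorem exists_homogenizable_limit (hP : IsPotentialLaw P mbar) (hH : IsNormalizedHamiltonian H)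
    {t : ℕ → ℝ} (ht : ∀ n, t n ∈ Icc (1 / 2) 1) (hlim : Tendsto t atTop (𝓝 1)) {h : ℕ → ℝ}
    (hh : ∀ n, IsRegularlyHomogenizableAt P mbar (fun q => t n * H q) q (h n)) :
    ∃ k, Tendsto h atTop (𝓝 k) ∧ IsRegularlyHomogenizableAt P mbar H q k := by
  set B := H q + 2 * mbar with hB
  have hB0 : 0 ≤ B := by linarith [hH.nonneg q, hP.mbar_pos]
  have hsm : Tendsto (fun n => (1 - t n) * B) atTop (𝓝 0) := by
    have := (hlim.const_sub 1).mul_const B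
    simpa using this
  have hdist : ∀ n m, |h n - h m| ≤ (1 - t n) * B + (1 - t m) * B := fun n m => by
    have := abs_sub_le_of_homogenizable hH (ht n) (ht m) (hh n) (hh m)
    linarith
  -- The effective values for two shrinking factors are close because both discounted solutions are
  -- close to the one for `H` itself.
  have hcau : CauchySeq h := by
    refine Metric.cauchySeq_iff.2 fun ε hε => ?_
    obtain ⟨N, hN⟩ := eventually_atTop.1 (hsm.eventually_lt_const (half_pos hε))
    refine ⟨N, fun m hm n hn => ?_⟩
    rw [Real.dist_eq]
    linarith [hdist m n, hN m hm, hN n hn]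
  obtain ⟨k, hk⟩ := cauchySeq_tendsto_of_complete hcau
  refine ⟨k, hk, hP, hH.continuous, hH.coercive,
    fun V lam hlam => existsUnique_isCellSolution hH V q hlam, fun R hR => ?_⟩
  filter_upwards [ae_all_iff.2 fun n => (hh n).limit R hR, hP.ae_bounds] with V h1 h2 ε hε
  have hV : ∀ y, -mbar ≤ V.1 y ∧ V.1 y ≤ 0 := fun y => ⟨h2.1 y, h2.2.1 y⟩
  have e1 : ∀ᶠ n in atTop, |h n - k| < ε / 3 := by
    have := Metric.tendsto_nhds.1 hk (ε / 3) (by positivity)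
    simpa [Real.dist_eq] using this
  obtain ⟨n, hn1, hn2⟩ := ((hsm.eventually_lt_const (show (0 : ℝ) < ε / 3 by positivity)).and
    e1).exists
  filter_upwards [h1 n (ε / 3) (by positivity), self_mem_nhdsWithin] with lam h3 h4 v hv y hy
  have hlam : 0 < lam := h4
  obtain ⟨w, hw, -⟩ := (hh n).wellposed V lam hlam
  have e2 := abs_le.1 (h3 w hw y hy)
  have e3 := abs_le.1 (abs_sub_le_of_isCellSolution hH hV hlam (ht n) hv hw y)
  have e4 := abs_lt.1 hn2
  rw [abs_le]
  constructor <;> linarith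

end Borderline

end

/-! ### Assembling the theorem -/

theorem theorem3 (P : Measure BUC) [IsProbabilityMeasure P] (mbar : ℝ)
    (hP : IsPotentialLaw P mbar) (hV : ∀ᵐ V ∂P, HasDiscreteLevels V.1)
    (H : ℝ → ℝ) (L : ℕ) (p : ℕ → ℝ)
    (hH : IsNormalizedHamiltonian H) (hbumps : HasBumps H L p)
    (hleft : StrictAntiOn H (Iic 0))
    (hosc : ∀ i j, 1 ≤ i → i ≤ L → 1 ≤ j → j ≤ L → maxValue H p i - minValue H p j ≤ mbar) :
    ∃ Hbar : ℝ → ℝ,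
      -- regular homogenization, with effective Hamiltonian `Hbar`
      (∀ q, IsRegularlyHomogenizableAt P mbar H q (Hbar q)) ∧
      -- nonnegativity and quasiconvexity
      (∀ q, 0 ≤ Hbar q) ∧ QuasiconvexOn ℝ univ Hbar ∧
      MonotoneOn Hbar (Ici 0) ∧ AntitoneOn Hbar (Iic 0) ∧
      -- the level sets of `Hbar`, when the oscillation bound is strict
      ((∀ i j, 1 ≤ i → i ≤ L → 1 ≤ j → j ≤ L → maxValue H p i - minValue H p j < mbar) →
        -- the extremal stationary derivatives
        (∀ μ, 0 ≤ μ →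
          IsAdmissibleField P H p L mbar μ (lowerDerivative H p L mbar μ) ∧
          IsAdmissibleField P H p L mbar μ (upperDerivative H p L mbar μ)) ∧
        -- the right part
        (∀ q, ∫ V, lowerDerivative H p L mbar 0 V 0 ∂P ≤ q →
          (∀ μ, 0 ≤ μ → (Hbar q = μ ↔
            q ∈ Icc (∫ V, lowerDerivative H p L mbar μ V 0 ∂P)
              (∫ V, upperDerivative H p L mbar μ V 0 ∂P))) ∧
          ∃ f : BUC → ℝ → ℝ, Measurable (Function.uncurry f) ∧ IsStationaryField f ∧
            (∀ᵐ V ∂P, IsSolutionDerivative H V.1 (Hbar q) (f V)) ∧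
            Integrable (fun V => f V 0) P ∧ ∫ V, f V 0 ∂P = q) ∧
        -- the flat piece at the minimum
        (∀ q, ∫ V, leftInv H (-V.1 0) ∂P ≤ q →
          q ≤ ∫ V, lowerDerivative H p L mbar 0 V 0 ∂P → Hbar q = 0) ∧
        -- the left part
        (∀ μ, 0 ≤ μ → Integrable (fun V : BUC => leftInv H (μ - V.1 0)) P ∧
          ∀ᵐ V ∂P, IsSolutionDerivative H V.1 μ (fun y => leftInv H (μ - V.1 y))) ∧
        (∀ q, q ≤ ∫ V, leftInv H (-V.1 0) ∂P →
          ∀ μ, 0 ≤ μ → (Hbar q = μ ↔ q = ∫ V, leftInv H (μ - V.1 0) ∂P))) := by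
  -- Under the strict bound everything is available directly. In the borderline case the statements
  -- about level sets are vacuous, and only homogenization and the shape of `Hbar` have to pass to
  -- the limit.
  by_cases hstrict : ∀ i j, 1 ≤ i → i ≤ L → 1 ≤ j → j ≤ L →
      maxValue H p i - minValue H p j < mbar
  · have h : IsStrictSetting P mbar H L p := ⟨hP, hV, hH, hbumps, hleft, hstrict⟩
    choose Hbar h0 hbar using h.exists_homogenizable
    have hmono := h.monotoneOn_effective hbar
    have hanti := h.antitoneOn_effective hbar
    refine ⟨Hbar, hbar, h0, quasiconvexOn_of_monotoneOn_of_antitoneOn hmono hanti, hmono, hanti,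
      fun _ => ⟨fun μ hμ => ⟨h.isAdmissibleField_lower hμ, h.isAdmissibleField_upper hμ⟩,
        fun q hq => ⟨fun μ hμ => h.effective_eq_iff_right hbar hq hμ,
          h.exists_stationary_derivative (h0 q) ((h.effective_eq_iff_right hbar hq (h0 q)).1 rfl)⟩,
        fun q h1 h2 => h.effective_flat hbar h1 h2,
        fun μ hμ => ⟨hP.integrable_leftInv hH hleft hμ, ?_⟩,
        fun q hq μ hμ => h.effective_eq_iff_left hbar hq hμ⟩⟩
    filter_upwards [hP.ae_solDeriv_left hH hleft hμ] with V hV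
    exact isSolutionDerivative_iff.2 hV.2.2
  -- The shrinking factors `1 - 1 / (n + 2)` start at `1 / 2`, the least value allowed by the
  -- stability estimate, and stay below `1`.
  · have hpos : ∀ n : ℕ, 0 < 1 / ((n : ℝ) + 2) := fun n => by positivity
    have hle : ∀ n : ℕ, 1 / ((n : ℝ) + 2) ≤ 1 / 2 := fun n => by
      gcongr
      linarith [Nat.cast_nonneg (α := ℝ) n]
    have hlim : Tendsto (fun n : ℕ => 1 - 1 / ((n : ℝ) + 2)) atTop (𝓝 1) := by
      have h1 : Tendsto (fun n : ℕ => (n : ℝ) + 2) atTop atTop :=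
        tendsto_atTop_add_const_right _ _ tendsto_natCast_atTop_atTop
      have := (h1.inv_tendsto_atTop).const_sub 1
      simpa using this
    have h : ∀ n : ℕ, IsStrictSetting P mbar (fun q => (1 - 1 / ((n : ℝ) + 2)) * H q) L p :=
      fun n => isStrictSetting_const_mul hP hV hH hbumps hleft hosc
        ⟨by linarith [hle n], by linarith [hpos n]⟩
    choose G hG0 hG using fun n => (h n).exists_homogenizable
    choose Hbar htend hbar using fun q => exists_homogenizable_limit (q := q) hP hH
      (t := fun n : ℕ => 1 - 1 / ((n : ℝ) + 2))
      (fun n => ⟨by linarith [hle n], by linarith [hpos n]⟩) hlim fun n => hG n q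
    have hmono : MonotoneOn Hbar (Ici 0) := fun x hx y hy hxy =>
      le_of_tendsto_of_tendsto' (htend x) (htend y)
        fun n => (h n).monotoneOn_effective (hG n) hx hy hxy
    have hanti : AntitoneOn Hbar (Iic 0) := fun x hx y hy hxy =>
      le_of_tendsto_of_tendsto' (htend y) (htend x)
        fun n => (h n).antitoneOn_effective (hG n) hx hy hxy
    exact ⟨Hbar, hbar, fun q => ge_of_tendsto' (htend q) fun n => hG0 n q,
      quasiconvexOn_of_monotoneOn_of_antitoneOn hmono hanti, hmono, hanti,
      fun hs => absurd hs hstrict⟩
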